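/- Let $p,q\ge 0$ be integers, $n=p+q\ge 3$, and let $\eta$ be the flat metric of signature $(p,q)$ on $\mathbb{R}^n$, i.e. $\eta=\mathrm{diag}(1,\dots,1,-1,\dots,-1)$ in the cartesian coordinates $x^i$. Let $\mathfrak{cf}$ be the Lie algebra of (smooth) conformal Killing vector fields of $(\mathbb{R}^n,\eta)$. For $\delta\in\mathbb{R}$ let $\mathcal{S}^\delta$ be the space of functions on $T^*\mathbb{R}^n$ that are polynomial in the fibre coordinates $p_i$ with smooth coefficients in $x$, on which a vector field $X=X^i\partial_i$ acts by $$L^\delta_X=X^i\partial_i-p_j(\partial_iX^j)\partial_{p_i}+\delta\,(\partial_iX^i).$$ Put $R=\eta^{ij}p_ip_j$, $T=\eta_{ij}\partial_{p_i}\partial_{p_j}$, $G=\eta^{ij}p_i\partial_j$, $D=\partial_i\partial_{p_i}$, $L=\eta^{ij}\partial_i\partial_j$. For integers $k\ge 2s\ge 0$ let $\mathcal{S}^\delta_{k,s}\subset\mathcal{S}^\delta$ be the $\mathfrak{cf}$-submodule of symbols homogeneous of degree $k$ in $p$ of the form $R^sQ$ with $TQ=0$. Let $G_0$, $D_0$,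 $L_0$ be the operators induced by $G$, $D$, $L$ on $\ker T$; explicitly $D_0=D|_{\ker T}$, $L_0=L|_{\ker T}$, and $G_0$ is the trace-free part of $G$, that is $G_0=G-\frac{1}{n+2k-2}RD$ on $\mathcal{S}^\delta_{k,0}$. For integers $k\ge 2s\ge0$, $k'\ge 2s'\ge0$ and $\delta,\delta'\in\mathbb{R}$ let $\mathcal{D}_{\mathfrak{cf}}(\mathcal{S}^\delta_{k,s},\mathcal{S}^{\delta'}_{k',s'})$ be the real vector space of the conformally invariant differential operators, that is, of the linear differential operators $A:\mathcal{S}^\delta_{k,s}\to\mathcal{S}^{\delta'}_{k',s'}$ such that $L^{\delta'}_XA=AL^\delta_X$ for all $X\in\mathfrak{cf}$ and, if $n=3$, such that $A$ moreover commutes with the action of the reflections $x^i\mapsto -x^i$ $(i=1,2,3)$. **Theorem.** There are real numbers $a^{m,\ell}_i$ (depending only on $p,q$ and on the integers $m,\ell,i\geq 0$), with $a^{m,\ell}_0=1$, such that, writing $$\mathcal{L}_\ell=\sum_{i=0}^{\ell}a^{m,\ell}_i\,G_0^iL_0^{\ell-i}D_0^i\qquad\text{on }\mathcal{S}_{m,0},\quad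 m=k-2s,$$ the following holds for all such $k,s,k',s',\delta,\delta'$. Put $j=\frac n2(\delta'-\delta)$. The space $\mathcal{D}_{\mathfrak{cf}}(\mathcal{S}^\delta_{k,s},\mathcal{S}^{\delta'}_{k',s'})$ has dimension $0$ or $1$. It is non-zero if and only if $j$ is an integer and one of the following four conditions holds, and in each of these cases it is the line spanned by the indicated (non-zero) operator: * $R^{s'}T^s$, if $s'-s=j$ and $k-k'=-2j$ ($\delta$ arbitrary); * $R^{s'}D^dT^s$ with $d\ge1$ an integer, if $s'-s=j$, $k-k'=d-2j$ and $\delta=1+\frac{2(k-s)-d-1}{n}$; * $R^{s'}G_0^gT^s$ with $g\ge1$ an integer, if $g+s'-s=j$, $k-k'=s-s'-j$ and $\delta=\frac{2s+1-g}{n}$; * $R^{s'}\mathcal{L}_\ell T^s$ with $\ell\ge1$ an integer, if $\ell+s'-s=j$, $k-k'=2(\ell-j)$ and $\delta=\frac12+\frac{k-\ell}{n}$. -/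

import Mathlib

open scoped ContDiff
open MvPolynomial

namespace ConfSymbols

noncomputable section

/-- The smooth real functions on `ℝⁿ` as a subalgebra of all functions. -/
def smoothSubalgebra (n : ℕ) : Subalgebra ℝ ((Fin n → ℝ) → ℝ) where
  carrier := {f | ContDiff ℝ ∞ f}
  mul_mem' {f g} (hf : ContDiff ℝ ∞ f) (hg : ContDiff ℝ ∞ g) :=
    show ContDiff ℝ ∞ (fun x => f x * g x) from hf.mul hg
  add_mem' {f g} (hf : ContDiff ℝ ∞ f) (hg : ContDiff ℝ ∞ g) :=
    show ContDiff ℝ ∞ (fun x => f x + g x) from hf.add hg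
  algebraMap_mem' c := show ContDiff ℝ ∞ (fun _ => c) from contDiff_const

/-- The algebra `C^∞(ℝⁿ)` of smooth real functions on `ℝⁿ`. -/
def Smooth (n : ℕ) : Type := smoothSubalgebra n

instance (n : ℕ) : CommRing (Smooth n) := inferInstanceAs (CommRing (smoothSubalgebra n))

instance (n : ℕ) : Algebra ℝ (Smooth n) := inferInstanceAs (Algebra ℝ (smoothSubalgebra n))

/-- The partial derivative `∂/∂xⁱ` on `C^∞(ℝⁿ)`. -/
def partialX {n : ℕ} (i : Fin n) : Derivation ℝ (Smooth n) (Smooth n) :=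
  Derivation.mk'
    { toFun := fun f => ⟨fun x => fderiv ℝ f.1 x (Pi.single i 1), by
        have hf : ContDiff ℝ ∞ f.1 := f.2
        exact (hf.fderiv_right (m := ∞) (by simp)).clm_apply contDiff_const⟩
      map_add' := fun f g => by
        have hf : ContDiff ℝ ∞ f.1 := f.2
        have hg : ContDiff ℝ ∞ g.1 := g.2
        refine Subtype.ext (funext fun x => ?_)
        have := fderiv_add (hf.differentiable (by simp) x) (hg.differentiable (by simp) x)
        change fderiv ℝ (f.1 + g.1) x _ = _
        rw [this]; rfl
      map_smul' := fun c f => by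
        have hf : ContDiff ℝ ∞ f.1 := f.2
        refine Subtype.ext (funext fun x => ?_)
        have := fderiv_const_smul (hf.differentiable (by simp) x) c
        change fderiv ℝ (c • f.1) x _ = _
        rw [this]; rfl }
    (fun f g => by
        have hf : ContDiff ℝ ∞ f.1 := f.2
        have hg : ContDiff ℝ ∞ g.1 := g.2
        refine Subtype.ext (funext fun x => ?_)
        have := fderiv_mul (hf.differentiable (by simp) x) (hg.differentiable (by simp) x)
        change fderiv ℝ (f.1 * g.1) x _ = _
        rw [this]; rfl)

/-- Symbols: functions on `T*ℝⁿ` that are polynomial in the fibre coordinates `p_i`, i.e.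
polynomials in the variables `p_i = X i` with coefficients in `C^∞(ℝⁿ)`. -/
abbrev Symbol (n : ℕ) : Type := MvPolynomial (Fin n) (Smooth n)

/-- `∂/∂xⁱ` on symbols, acting on the coefficients. -/
def dx {n : ℕ} (i : Fin n) : Module.End ℝ (Symbol n) where
  toFun P := AddMonoidAlgebra.map (partialX i : Smooth n →ₗ[ℝ] Smooth n).toAddMonoidHom P
  map_add' P Q := AddMonoidAlgebra.map_add _ P Q
  map_smul' c P := by
    apply AddMonoidAlgebra.ext
    apply Finsupp.ext
    intro m
    exact (partialX i).map_smul c (P.coeff m)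

/-- `∂/∂p_i` on symbols. -/
def dp {n : ℕ} (i : Fin n) : Module.End ℝ (Symbol n) :=
  (pderiv i : Derivation (Smooth n) (Symbol n) (Symbol n)).toLinearMap.restrictScalars ℝ

theorem coeff_dx {n : ℕ} (i : Fin n) (P : Symbol n) (m : Fin n →₀ ℕ) :
    (dx i P).coeff m = partialX i (P.coeff m) := rfl

theorem dx_monomial {n : ℕ} (i : Fin n) (m : Fin n →₀ ℕ) (f : Smooth n) :
    dx i (monomial m f) = monomial m (partialX i f) := by
  ext1 m'
  rw [coeff_dx, MvPolynomial.coeff_monomial, MvPolynomial.coeff_monomial]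
  split_ifs <;> simp

theorem dx_mul {n : ℕ} (i : Fin n) (P Q : Symbol n) :
    dx i (P * Q) = P * dx i Q + dx i P * Q := by
  induction P using MvPolynomial.induction_on' with
  | add P₁ P₂ h₁ h₂ => rw [add_mul, map_add, h₁, h₂, map_add]; ring
  | monomial m f =>
    induction Q using MvPolynomial.induction_on' with
    | add Q₁ Q₂ h₁ h₂ => rw [mul_add, map_add, h₁, h₂, map_add]; ring
    | monomial m' g =>
      simp only [dx_monomial, monomial_mul, Derivation.leibniz, smul_eq_mul]
      rw [← map_add, mul_comm g]

theorem dx_one {n : ℕ} (i : Fin n) : dx i (1 : Symbol n) = 0 := by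
  have : (1 : Symbol n) = monomial 0 1 := rfl
  rw [this, dx_monomial]; simp

theorem dx_X {n : ℕ} (i j : Fin n) : dx i (X j : Symbol n) = 0 := by
  rw [X, dx_monomial]; simp

theorem dp_mul {n : ℕ} (i : Fin n) (P Q : Symbol n) :
    dp i (P * Q) = P * dp i Q + dp i P * Q := by
  simp [dp, Derivation.leibniz, mul_comm]

theorem dp_X {n : ℕ} (i j : Fin n) : dp i (X j : Symbol n) = if j = i then 1 else 0 := by
  simp [dp, pderiv_X, Pi.single_apply, eq_comm]

theorem dp_smul {n : ℕ} (i : Fin n) (f : Smooth n) (P : Symbol n) :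
    dp i (f • P) = f • dp i P := by
  simp [dp]

theorem dp_dp_comm {n : ℕ} (i j : Fin n) (P : Symbol n) : dp i (dp j P) = dp j (dp i P) := by
  induction P using MvPolynomial.induction_on with
  | C f => simp [dp]
  | add P Q hP hQ => simp only [map_add, hP, hQ]
  | mul_X P a h =>
    simp only [dp_mul, map_add, dp_X, h]
    split_ifs <;> simp [dp]
    ring

theorem dp_dx_comm {n : ℕ} (i j : Fin n) (P : Symbol n) : dp i (dx j P) = dx j (dp i P) := by
  induction P using MvPolynomial.induction_on with
  | C f =>
    have h0 : ∀ g : Smooth n, dp i (C g) = 0 := fun g => by simp [dp]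
    have h1 : dx j (C f) = C (partialX j f) := dx_monomial j 0 f
    rw [h1, h0, h0, map_zero]
  | add P Q hP hQ => simp only [map_add, hP, hQ]
  | mul_X P a h =>
    simp only [dp_mul, dx_mul, dx_X, map_add, dp_X, h]
    split_ifs <;> simp [dx_one]

theorem dx_isHomogeneous {n k : ℕ} (i : Fin n) {P : Symbol n} (h : P.IsHomogeneous k) :
    (dx i P).IsHomogeneous k := by
  intro m hm
  apply h
  intro h0
  apply hm
  rw [coeff_dx, h0, map_zero]

theorem X_mul_dp_isHomogeneous {n k : ℕ} (i j : Fin n) {P : Symbol n} (h : P.IsHomogeneous k) :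
    (X j * dp i P).IsHomogeneous k := by
  rcases Nat.eq_zero_or_pos k with rfl | hk
  · rw [totalDegree_eq_zero_iff_eq_C.mp (Nat.le_zero.mp h.totalDegree_le)]
    simp [dp, isHomogeneous_zero]
  · have := (isHomogeneous_X (Smooth n) j).mul (h.pderiv (i := i))
    rwa [Nat.add_sub_cancel' hk] at this

/-- The divergence `∂_i Xⁱ` of a vector field `X = Xⁱ ∂_i` on `ℝⁿ`. -/
def divergence {n : ℕ} (V : Fin n → Smooth n) : Smooth n := ∑ i, partialX i (V i)

/-- The action `L_X^δ = Xⁱ ∂_i - p_j (∂_i Xʲ) ∂_{p_i} + δ Div(X)` of a vector field on the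
module of symbols of weight `δ`. -/
def lieDer {n : ℕ} (δ : ℝ) (V : Fin n → Smooth n) : Module.End ℝ (Symbol n) where
  toFun P := ∑ i, V i • dx i P - ∑ i, ∑ j, partialX i (V j) • (X j * dp i P)
    + δ • (divergence V • P)
  map_add' P Q := by
    simp only [map_add, mul_add, smul_add, Finset.sum_add_distrib]; abel
  map_smul' c P := by
    simp only [map_smul, mul_smul_comm, smul_comm _ c, ← Finset.smul_sum, RingHom.id_apply]
    rw [smul_add, smul_sub]

/-- The diagonal entries of the flat metric `η = diag(1,…,1,-1,…,-1)` of signature `(p,q)`.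
Since they are `±1`, the inverse metric has the same entries. -/
def sgn (p q : ℕ) (i : Fin (p + q)) : ℝ := if (i : ℕ) < p then 1 else -1

/-- `V` is a conformal Killing vector field of `(ℝⁿ, η)`: the Lie derivative of `η` along `V` is
a multiple `f η` of `η`. -/
def IsConformalKilling (p q : ℕ) (V : Fin (p + q) → Smooth (p + q)) : Prop :=
  ∃ f : Smooth (p + q), ∀ i j,
    sgn p q j • partialX i (V j) + sgn p q i • partialX j (V i) =
      if i = j then sgn p q i • f else 0

/-- `R = η^{ij} p_i p_j`. -/
def metricR (p q : ℕ) : Symbol (p + q) := ∑ i, sgn p q i • X i ^ 2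

/-- Multiplication by `R`. -/
def opR (p q : ℕ) : Module.End ℝ (Symbol (p + q)) := LinearMap.mulLeft ℝ (metricR p q)

/-- The trace `T = η_{ij} ∂_{p_i} ∂_{p_j}`. -/
def opT (p q : ℕ) : Module.End ℝ (Symbol (p + q)) := ∑ i, sgn p q i • (dp i * dp i)

/-- The gradient `G = η^{ij} p_i ∂_j`. -/
def opG (p q : ℕ) : Module.End ℝ (Symbol (p + q)) :=
  ∑ i, sgn p q i • (LinearMap.mulLeft ℝ (X i) * dx i)

/-- The divergence `D = ∂_i ∂_{p_i}`. -/
def opD (p q : ℕ) : Module.End ℝ (Symbol (p + q)) := ∑ i, dx i * dp i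

/-- The Laplacian `L = η^{ij} ∂_i ∂_j`. -/
def opL (p q : ℕ) : Module.End ℝ (Symbol (p + q)) := ∑ i, sgn p q i • (dx i * dx i)

theorem sgn_mul_self (p q : ℕ) (i : Fin (p + q)) : sgn p q i * sgn p q i = 1 := by
  unfold sgn; split_ifs <;> norm_num

theorem lieDer_apply {n : ℕ} (δ : ℝ) (V : Fin n → Smooth n) (P : Symbol n) :
    lieDer δ V P = ∑ i, V i • dx i P - ∑ i, ∑ j, partialX i (V j) • (X j * dp i P)
      + δ • (divergence V • P) := rfl

theorem opT_apply (p q : ℕ) (P : Symbol (p + q)) :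
    opT p q P = ∑ i, sgn p q i • dp i (dp i P) := by
  simp [opT]

theorem lieDer_mul {n : ℕ} (δ : ℝ) (V : Fin n → Smooth n) (P Q : Symbol n) :
    lieDer δ V (P * Q) = P * lieDer δ V Q + lieDer 0 V P * Q := by
  simp only [lieDer_apply, dx_mul, dp_mul, smul_add, mul_add, Finset.sum_add_distrib, zero_smul,
    add_zero, mul_sub, sub_mul, Finset.mul_sum, Finset.sum_mul, mul_smul_comm, smul_mul_assoc,
    mul_left_comm (X _ : Symbol n) P, mul_assoc]
  abel

theorem sum_symm {n : ℕ} (W : Fin n → Fin n → Smooth n) (g : Fin n → Smooth n)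
    (hW : ∀ i j, W i j + W j i = if i = j then g i else 0) (Z : Fin n → Fin n → Symbol n)
    (hZ : ∀ i j, Z i j = Z j i) :
    ∑ i, ∑ j, W i j • ((2 : ℝ) • Z i j) = ∑ i, g i • Z i i := by
  have h1 : ∑ i, ∑ j, W i j • Z i j = ∑ i, ∑ j, W j i • Z i j := by
    rw [Finset.sum_comm]
    exact Finset.sum_congr rfl fun i _ => Finset.sum_congr rfl fun j _ => by rw [hZ]
  have h2 : ∑ i, ∑ j, (W i j + W j i) • Z i j = ∑ i, g i • Z i i := by
    refine Finset.sum_congr rfl fun i _ => ?_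
    simp [hW, ite_smul]
  rw [← h2]
  simp only [add_smul, Finset.sum_add_distrib, ← h1]
  simp only [two_smul, smul_add, Finset.sum_add_distrib]

theorem lieDer_metricR {p q : ℕ} {V : Fin (p + q) → Smooth (p + q)} {f : Smooth (p + q)}
    (hV : ∀ i j, sgn p q j • partialX i (V j) + sgn p q i • partialX j (V i) =
      if i = j then sgn p q i • f else 0) :
    lieDer 0 V (metricR p q) = -(f • metricR p q) := by
  have hdx : ∀ i, dx i (metricR p q) = 0 := fun i => by
    simp [metricR, pow_two, dx_mul, dx_X]
  have hdp : ∀ i, dp i (metricR p q) = sgn p q i • ((2 : ℝ) • X i) := fun i => by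
    simp only [metricR, pow_two, map_sum, map_smul, dp_mul, dp_X, mul_ite, mul_one, mul_zero,
      ite_mul, one_mul, zero_mul, ← two_smul ℝ (ite _ _ _ : Symbol (p + q))]
    simp
  have key := sum_symm (fun i j => sgn p q i • partialX i (V j)) (fun i => sgn p q i • f)
    (fun i j => by
      have h := congrArg (fun w => (sgn p q i * sgn p q j) • w) (hV i j)
      simp only [smul_add, smul_smul] at h
      rw [mul_assoc, sgn_mul_self, mul_one, mul_right_comm, sgn_mul_self, one_mul] at h
      rw [h]
      split_ifs with hij
      · subst hij; rw [sgn_mul_self, one_smul]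
      · rw [smul_zero]) (fun i j => X j * X i) (fun i j => mul_comm _ _)
  have e : ∀ i j, partialX i (V j) • (X j * dp i (metricR p q)) =
      (sgn p q i • partialX i (V j)) • ((2 : ℝ) • (X j * X i : Symbol (p + q))) := fun i j => by
    rw [hdp, mul_smul_comm, mul_smul_comm, smul_assoc, smul_comm (partialX i (V j))]
  simp only [lieDer_apply, hdx, e, smul_zero, Finset.sum_const_zero, zero_sub, zero_smul, add_zero]
  rw [key, metricR, Finset.smul_sum]
  simp only [pow_two, smul_assoc, smul_comm f]

theorem opT_lieDer {p q : ℕ} {V : Fin (p + q) → Smooth (p + q)} {f : Smooth (p + q)}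
    (hV : ∀ i j, sgn p q j • partialX i (V j) + sgn p q i • partialX j (V i) =
      if i = j then sgn p q i • f else 0) (δ : ℝ) (Q : Symbol (p + q)) :
    opT p q (lieDer δ V Q) = lieDer δ V (opT p q Q) - f • opT p q Q := by
  have h1 : ∀ a, dp a (lieDer δ V Q) =
      lieDer δ V (dp a Q) - ∑ i, partialX i (V a) • dp i Q := fun a => by
    simp only [lieDer_apply, map_add, map_sub, map_sum, map_smul, dp_smul, dp_mul, dp_X,
      dp_dx_comm, dp_dp_comm a, smul_add, Finset.sum_add_distrib, ite_mul, one_mul, zero_mul,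
      smul_ite, smul_zero, Finset.sum_ite_eq', Finset.mem_univ, if_true]
    abel
  have h2 : ∀ a, dp a (dp a (lieDer δ V Q)) = lieDer δ V (dp a (dp a Q))
      - ∑ i, partialX i (V a) • ((2 : ℝ) • dp a (dp i Q)) := fun a => by
    have h1' : dp a (lieDer δ V (dp a Q)) =
        lieDer δ V (dp a (dp a Q)) - ∑ i, partialX i (V a) • dp i (dp a Q) := by
      simp only [lieDer_apply, map_add, map_sub, map_sum, map_smul, dp_smul, dp_mul, dp_X,
        dp_dx_comm, dp_dp_comm a, smul_add, Finset.sum_add_distrib, ite_mul, one_mul, zero_mul,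
        smul_ite, smul_zero, Finset.sum_ite_eq', Finset.mem_univ, if_true]
      abel
    rw [h1, map_sub, h1', map_sum]
    simp only [dp_smul, two_smul, smul_add, Finset.sum_add_distrib, dp_dp_comm _ a]
    abel
  have key := sum_symm (fun i j => sgn p q i • partialX j (V i)) (fun i => sgn p q i • f)
    (fun i j => (add_comm _ _).trans (hV i j)) (fun i j => dp i (dp j Q)) (fun i j => dp_dp_comm _ _ _)
  rw [opT_apply, opT_apply, map_sum, Finset.smul_sum]
  simp only [h2, smul_sub, Finset.sum_sub_distrib, map_smul]
  congr 1
  simp only [smul_assoc] at key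
  simp only [Finset.smul_sum, smul_comm f]
  exact key

/-- The submodule `S_{k,s}`: homogeneous symbols of degree `k` of the form `R^s Q`, `T Q = 0`. -/
def sym (p q k s : ℕ) : Submodule (Smooth (p + q)) (Symbol (p + q)) where
  carrier := {P | P.IsHomogeneous k ∧ ∃ Q, opT p q Q = 0 ∧ P = metricR p q ^ s * Q}
  zero_mem' := ⟨isHomogeneous_zero _ _ _, 0, map_zero _, by simp⟩
  add_mem' := by
    rintro _ _ ⟨h₁, Q₁, hQ₁, rfl⟩ ⟨h₂, Q₂, hQ₂, rfl⟩
    exact ⟨h₁.add h₂, Q₁ + Q₂, by rw [map_add, hQ₁, hQ₂, add_zero], by rw [mul_add]⟩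
  smul_mem' := by
    rintro f _ ⟨h, Q, hQ, rfl⟩
    refine ⟨(homogeneousSubmodule _ _ k).smul_mem f h, f • Q, ?_, by rw [mul_smul_comm]⟩
    rw [opT_apply] at hQ ⊢
    simp only [dp_smul, smul_comm _ f, ← Finset.smul_sum, hQ, smul_zero]

theorem lieDer_mem_sym {p q k s : ℕ} {V : Fin (p + q) → Smooth (p + q)}
    (hV : IsConformalKilling p q V) (δ : ℝ) {P : Symbol (p + q)} (hP : P ∈ sym p q k s) :
    lieDer δ V P ∈ sym p q k s := by
  obtain ⟨f, hf⟩ := hV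
  obtain ⟨h, Q, hQ, rfl⟩ := hP
  have hpow : ∀ t : ℕ, lieDer 0 V (metricR p q ^ t) = -((t : ℝ) • f • metricR p q ^ t) := by
    intro t
    induction t with
    | zero =>
      have h2 : ∀ i, dp i (1 : Symbol (p + q)) = 0 := fun i => by simp [dp]
      simp [lieDer_apply, dx_one, h2]
    | succ t ih =>
      rw [pow_succ, lieDer_mul, ih, lieDer_metricR hf]
      push_cast
      simp only [mul_neg, neg_mul, smul_mul_assoc, mul_smul_comm, add_smul, one_smul]
      abel
  have hom : ∀ P : Symbol (p + q), P.IsHomogeneous k → (lieDer δ V P).IsHomogeneous k := by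
    intro P hP
    have hs := fun (g : Smooth (p + q)) (P' : Symbol (p + q)) (h' : P'.IsHomogeneous k) =>
      (homogeneousSubmodule (Fin (p + q)) (Smooth (p + q)) k).smul_mem g h'
    rw [lieDer_apply]
    refine IsHomogeneous.add (IsHomogeneous.sub ?_ ?_) ?_
    · exact IsHomogeneous.sum _ _ _ fun i _ => hs _ _ (dx_isHomogeneous i hP)
    · exact IsHomogeneous.sum _ _ _ fun i _ => IsHomogeneous.sum _ _ _ fun j _ =>
        hs _ _ (X_mul_dp_isHomogeneous i j hP)
    · rw [← smul_assoc]
      exact hs _ _ hP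
  refine ⟨hom _ h, lieDer δ V Q - (s : ℝ) • f • Q, ?_, ?_⟩
  · have hfQ : opT p q (f • Q) = 0 := by
      have := hQ
      rw [opT_apply] at this ⊢
      simp only [dp_smul, smul_comm _ f, ← Finset.smul_sum, this, smul_zero]
    rw [map_sub, map_smul, hfQ, opT_lieDer hf, hQ]; simp
  · rw [lieDer_mul, hpow, mul_sub, neg_mul, mul_smul_comm, mul_smul_comm, smul_mul_assoc,
      smul_mul_assoc, sub_eq_add_neg]

/-- The action of a conformal Killing vector field on `S^δ_{k,s}`. -/
def lieSym {p q : ℕ} (k s : ℕ) (δ : ℝ) {V : Fin (p + q) → Smooth (p + q)}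
    (hV : IsConformalKilling p q V) : sym p q k s →ₗ[ℝ] sym p q k s where
  toFun P := ⟨lieDer δ V P, lieDer_mem_sym hV δ P.2⟩
  map_add' P Q := Subtype.ext (map_add (lieDer δ V) (P : Symbol (p + q)) Q)
  map_smul' c P := Subtype.ext (map_smul (lieDer δ V) c (P : Symbol (p + q)))

/-- The commutator `[A, f]` of an operator with the multiplication by a function. -/
def commFun {n : ℕ} {M N : Submodule (Smooth n) (Symbol n)} (A : M →ₗ[ℝ] N) (f : Smooth n) :
    M →ₗ[ℝ] N :=
  A ∘ₗ Algebra.lsmul ℝ ℝ M f - Algebra.lsmul ℝ ℝ N f ∘ₗ A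

/-- `A` is a differential operator of order at most `r`: all the iterated commutators
`[…[A, f₀], …, f_r]` with functions vanish. -/
def IsDiffOp {n : ℕ} {M N : Submodule (Smooth n) (Symbol n)} : ℕ → (M →ₗ[ℝ] N) → Prop
  | 0, A => ∀ f, commFun A f = 0
  | r + 1, A => ∀ f, IsDiffOp r (commFun A f)

theorem commFun_zero {n : ℕ} {M N : Submodule (Smooth n) (Symbol n)} (f : Smooth n) :
    commFun (0 : M →ₗ[ℝ] N) f = 0 := by
  refine LinearMap.ext fun P => ?_
  change (0 : N) - f • (0 : N) = 0
  rw [smul_zero, sub_zero]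

theorem commFun_add {n : ℕ} {M N : Submodule (Smooth n) (Symbol n)} (A B : M →ₗ[ℝ] N)
    (f : Smooth n) : commFun (A + B) f = commFun A f + commFun B f := by
  simp only [commFun, LinearMap.add_comp, LinearMap.comp_add]; abel

theorem commFun_smul {n : ℕ} {M N : Submodule (Smooth n) (Symbol n)} (c : ℝ) (A : M →ₗ[ℝ] N)
    (f : Smooth n) : commFun (c • A) f = c • commFun A f := by
  refine LinearMap.ext fun P => ?_
  change c • A (f • P) - f • (c • A P) = c • (A (f • P) - f • A P)
  rw [smul_sub, smul_comm f c]

theorem isDiffOp_zero {n : ℕ} {M N : Submodule (Smooth n) (Symbol n)} (r : ℕ) :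
    IsDiffOp r (0 : M →ₗ[ℝ] N) := by
  induction r with
  | zero => exact commFun_zero
  | succ r ih => intro f; rw [commFun_zero]; exact ih

theorem IsDiffOp.succ {n : ℕ} {M N : Submodule (Smooth n) (Symbol n)} {r : ℕ} {A : M →ₗ[ℝ] N}
    (h : IsDiffOp r A) : IsDiffOp (r + 1) A := by
  induction r generalizing A with
  | zero => intro f; rw [h f]; exact isDiffOp_zero 0
  | succ r ih => intro f; exact ih (h f)

theorem IsDiffOp.mono {n : ℕ} {M N : Submodule (Smooth n) (Symbol n)} {r t : ℕ} (hrt : r ≤ t)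
    {A : M →ₗ[ℝ] N} (h : IsDiffOp r A) : IsDiffOp t A := by
  induction hrt with
  | refl => exact h
  | step _ ih => exact ih.succ

theorem IsDiffOp.add {n : ℕ} {M N : Submodule (Smooth n) (Symbol n)} {r : ℕ} {A B : M →ₗ[ℝ] N}
    (hA : IsDiffOp r A) (hB : IsDiffOp r B) : IsDiffOp r (A + B) := by
  induction r generalizing A B with
  | zero => intro f; rw [commFun_add, hA f, hB f, add_zero]
  | succ r ih => intro f; rw [commFun_add]; exact ih (hA f) (hB f)

theorem IsDiffOp.smul {n : ℕ} {M N : Submodule (Smooth n) (Symbol n)} {r : ℕ} (c : ℝ)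
    {A : M →ₗ[ℝ] N} (hA : IsDiffOp r A) : IsDiffOp r (c • A) := by
  induction r generalizing A with
  | zero => intro f; rw [commFun_smul, hA f, smul_zero]
  | succ r ih => intro f; rw [commFun_smul]; exact ih (hA f)

/-- The space `D_cf(S^δ_{k,s}, S^{δ'}_{k',s'})` of conformally invariant differential operators:
those intertwining the actions of all the conformal Killing vector fields. -/
def confInv (p q k s k' s' : ℕ) (δ δ' : ℝ) :
    Submodule ℝ (sym p q k s →ₗ[ℝ] sym p q k' s') where
  carrier := {A | (∃ r, IsDiffOp r A) ∧
    ∀ (V : Fin (p + q) → Smooth (p + q)) (hV : IsConformalKilling p q V),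
      A ∘ₗ lieSym k s δ hV = lieSym k' s' δ' hV ∘ₗ A}
  zero_mem' := ⟨⟨0, isDiffOp_zero 0⟩, fun V hV => by
    rw [LinearMap.zero_comp, LinearMap.comp_zero]⟩
  add_mem' := by
    rintro A B ⟨⟨r, hA⟩, hA'⟩ ⟨⟨t, hB⟩, hB'⟩
    refine ⟨⟨max r t, (hA.mono (le_max_left r t)).add (hB.mono (le_max_right r t))⟩, ?_⟩
    intro V hV
    rw [LinearMap.add_comp, LinearMap.comp_add, hA' V hV, hB' V hV]
  smul_mem' := by
    rintro c A ⟨⟨r, hA⟩, hA'⟩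
    refine ⟨⟨r, hA.smul c⟩, ?_⟩
    intro V hV
    rw [LinearMap.smul_comp, LinearMap.comp_smul, hA' V hV]

/-- The reflection `xⁱ ↦ -xⁱ` of `ℝⁿ`, an isometry of `η`. -/
def reflPt {n : ℕ} (i : Fin n) (x : Fin n → ℝ) : Fin n → ℝ := fun j => if j = i then -x j else x j

/-- Pull-back of functions by the reflection `xⁱ ↦ -xⁱ`. -/
def reflFun {n : ℕ} (i : Fin n) : Smooth n →ₐ[ℝ] Smooth n where
  toFun f := ⟨fun x => f.1 (reflPt i x), by
    have hf : ContDiff ℝ ∞ f.1 := f.2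
    refine hf.comp (contDiff_pi.mpr fun j => ?_)
    unfold reflPt
    split_ifs
    · exact (contDiff_apply ℝ ℝ j).neg
    · exact contDiff_apply ℝ ℝ j⟩
  map_one' := rfl
  map_mul' _ _ := rfl
  map_zero' := rfl
  map_add' _ _ := rfl
  commutes' _ := rfl

/-- Pull-back of symbols by the lift `(xⁱ, p_i) ↦ (-xⁱ, -p_i)` of a reflection to `T*ℝⁿ`. Its
Jacobian is `±1`, so that it acts in this way for every weight `δ`. -/
def refl {n : ℕ} (i : Fin n) : Module.End ℝ (Symbol n) where
  toFun P := eval₂Hom (C.comp (reflFun i).toRingHom) (fun j => if j = i then -X j else X j) P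
  map_add' := map_add _
  map_smul' c P := by
    rw [RingHom.id_apply, ← smul_one_smul (Smooth n) c P, smul_eq_C_mul, map_mul,
      ← smul_one_smul (Smooth n) c (eval₂Hom _ _ P), smul_eq_C_mul]
    congr 1
    simp [map_smul]

theorem refl_mul {n : ℕ} (i : Fin n) (P Q : Symbol n) : refl i (P * Q) = refl i P * refl i Q :=
  map_mul (eval₂Hom _ _) P Q

theorem refl_X {n : ℕ} (i j : Fin n) : refl i (X j) = if j = i then -X j else X j :=
  eval₂Hom_X' _ _ _

theorem refl_metricR (p q : ℕ) (i : Fin (p + q)) (s : ℕ) :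
    refl i (metricR p q ^ s) = metricR p q ^ s := by
  have h : refl i (metricR p q) = metricR p q := by
    simp only [metricR, map_sum, map_smul, pow_two, refl_mul, refl_X]
    refine Finset.sum_congr rfl fun j _ => ?_
    split_ifs <;> simp
  induction s with
  | zero => exact map_one (eval₂Hom _ _)
  | succ s ih => rw [pow_succ, refl_mul, ih, h]

theorem dp_refl {n : ℕ} (a i : Fin n) (P : Symbol n) :
    dp a (refl i P) = (if a = i then (-1 : ℝ) else 1) • refl i (dp a P) := by
  induction P using MvPolynomial.induction_on with
  | C f =>
    have h0 : ∀ g : Smooth n, dp a (C g) = 0 := fun g => by simp [dp]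
    have h1 : refl i (C f) = C (reflFun i f) := eval₂Hom_C _ _ _
    rw [h1, h0, h0, map_zero, smul_zero]
  | add P Q hP hQ => simp only [map_add, hP, hQ, smul_add]
  | mul_X P b h =>
    have h1 : refl i (1 : Symbol n) = 1 := map_one (eval₂Hom _ _)
    simp only [refl_mul, dp_mul, map_add, h, refl_X, dp_X, smul_add]
    congr 1
    · by_cases hba : b = a
      · subst hba
        by_cases hbi : b = i <;> simp [hbi, dp_X, h1]
      · by_cases hbi : b = i
        · subst hbi
          simp [dp_X, hba]
        · simp [hbi, dp_X, hba]
    · rw [smul_mul_assoc]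

theorem refl_mem_sym {p q k s : ℕ} (i : Fin (p + q)) {P : Symbol (p + q)}
    (hP : P ∈ sym p q k s) : refl i P ∈ sym p q k s := by
  obtain ⟨h, Q, hQ, rfl⟩ := hP
  refine ⟨?_, refl i Q, ?_, by rw [refl_mul, refl_metricR]⟩
  · have := h.eval₂ (C.comp (reflFun i).toRingHom)
      (fun j => if j = i then -X j else X j : Fin (p + q) → Symbol (p + q)) (n := 1)
      (fun f => isHomogeneous_C _ _) (fun j => by
        split_ifs
        · exact (isHomogeneous_X _ j).neg
        · exact isHomogeneous_X _ j)
    rwa [one_mul] at this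
  · have : opT p q (refl i Q) = refl i (opT p q Q) := by
      simp only [opT_apply, map_sum, map_smul, dp_refl]
      refine Finset.sum_congr rfl fun a _ => ?_
      split_ifs <;> simp
    rw [this, hQ, map_zero]

/-- The action of a reflection on `S_{k,s}`. -/
def reflSym (p q k s : ℕ) (i : Fin (p + q)) : sym p q k s →ₗ[ℝ] sym p q k s where
  toFun P := ⟨refl i P, refl_mem_sym i P.2⟩
  map_add' P Q := Subtype.ext (map_add (refl i) (P : Symbol (p + q)) Q)
  map_smul' c P := Subtype.ext (map_smul (refl i) c (P : Symbol (p + q)))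

/-- The operators `S_{k,s} → S_{k',s'}` that are invariant under the reflections `xⁱ ↦ -xⁱ`. -/
def reflInv (p q k s k' s' : ℕ) : Submodule ℝ (sym p q k s →ₗ[ℝ] sym p q k' s') where
  carrier := {A | ∀ i, A ∘ₗ reflSym p q k s i = reflSym p q k' s' i ∘ₗ A}
  zero_mem' i := by rw [LinearMap.zero_comp, LinearMap.comp_zero]
  add_mem' {A B} hA hB i := by rw [LinearMap.add_comp, LinearMap.comp_add, hA i, hB i]
  smul_mem' c A hA i := by rw [LinearMap.smul_comp, LinearMap.comp_smul, hA i]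

/-- The operator `G₀ = π₀ G` on trace-free symbols of degree `k`. On such symbols `T G = 2 D` and
`T R D = 2 (n + 2k - 2) D`, so that this is the trace-free part of `G`, the difference being a
multiple of `R`. -/
def opG₀ (p q k : ℕ) : Module.End ℝ (Symbol (p + q)) :=
  opG p q - ((p : ℝ) + q + 2 * k - 2)⁻¹ • (opR p q * opD p q)

theorem dp_metricR (p q : ℕ) (i : Fin (p + q)) :
    dp i (metricR p q) = sgn p q i • ((2 : ℝ) • X i) := by
  simp only [metricR, pow_two, map_sum, map_smul, dp_mul, dp_X, mul_ite, mul_one, mul_zero,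
    ite_mul, one_mul, zero_mul, ← two_smul ℝ (ite _ _ _ : Symbol (p + q))]
  simp

theorem opT_opR {p q m : ℕ} {Q : Symbol (p + q)} (h : Q.IsHomogeneous m) (hQ : opT p q Q = 0) :
    opT p q (opR p q Q) = (4 * (m : ℝ) + 2 * (p + q)) • Q := by
  have h1 : ∀ i, sgn p q i • dp i (dp i (metricR p q * Q)) =
      metricR p q * (sgn p q i • dp i (dp i Q)) + (4 : ℝ) • (X i * dp i Q) + (2 : ℝ) • Q := by
    intro i
    simp only [dp_mul, map_add, dp_metricR, smul_mul_assoc, map_smul, dp_X, if_true, one_mul,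
      smul_add, smul_smul, ← mul_assoc, sgn_mul_self, mul_smul_comm]
    module
  have h2 : ∑ i, X i * dp i Q = (m : ℝ) • Q := by
    rw [Nat.cast_smul_eq_nsmul]
    exact h.sum_X_mul_pderiv
  rw [opT_apply] at hQ
  rw [opT_apply]
  change ∑ i, sgn p q i • dp i (dp i (metricR p q * Q)) = _
  simp only [h1, Finset.sum_add_distrib, ← Finset.mul_sum, ← Finset.smul_sum, hQ, h2]
  rw [Finset.sum_const, Finset.card_univ, Fintype.card_fin, ← Nat.cast_smul_eq_nsmul ℝ, mul_zero,
    zero_add, smul_smul, smul_smul, ← add_smul]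
  congr 1
  push_cast
  ring

theorem opT_opG (p q : ℕ) (P : Symbol (p + q)) (hP : opT p q P = 0) :
    opT p q (opG p q P) = (2 : ℝ) • opD p q P := by
  have h1 : ∀ a i, dp a (dp a (X i * dx i P)) =
      X i * dx i (dp a (dp a P)) + (2 : ℝ) • (if i = a then dx i (dp a P) else 0) := by
    intro a i
    simp only [dp_mul, dp_X, map_add, dp_dx_comm]
    split_ifs
    · have h0 : dp a (1 : Symbol (p + q)) = 0 := by simp [dp]
      rw [one_mul, h0, two_smul]; ring
    · simp
  have hG : opG p q P = ∑ i, sgn p q i • (X i * dx i P) := by simp [opG]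
  have hD : opD p q P = ∑ i, dx i (dp i P) := by simp [opD]
  have h2 : ∀ i, ∑ a, sgn p q a • (X i * dx i (dp a (dp a P))) = 0 := fun i => by
    rw [opT_apply] at hP
    have h3 := congrArg (fun Z => X i * dx i Z) hP
    simpa only [map_sum, map_smul, Finset.mul_sum, mul_smul_comm, map_zero, mul_zero] using h3
  rw [hG, hD, map_sum, Finset.smul_sum]
  refine Finset.sum_congr rfl fun i _ => ?_
  rw [map_smul, opT_apply]
  simp only [h1, smul_add, Finset.sum_add_distrib, h2, zero_add]
  simp only [smul_ite, smul_zero, Finset.sum_ite_eq, Finset.mem_univ, if_true]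
  rw [smul_smul, sgn_mul_self, one_smul]

theorem opT_opD (p q : ℕ) (P : Symbol (p + q)) : opT p q (opD p q P) = opD p q (opT p q P) := by
  simp only [opD, LinearMap.sum_apply, Module.End.mul_apply, opT_apply, map_sum, map_smul,
    dp_dx_comm, Finset.smul_sum]
  rw [Finset.sum_comm]
  refine Finset.sum_congr rfl fun i _ => Finset.sum_congr rfl fun a _ => ?_
  simp only [dp_dp_comm _ i]

theorem opD_isHomogeneous {p q k : ℕ} {P : Symbol (p + q)} (h : P.IsHomogeneous k) :
    (opD p q P).IsHomogeneous (k - 1) := by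
  simp only [opD, LinearMap.sum_apply, Module.End.mul_apply]
  exact IsHomogeneous.sum _ _ _ fun i _ => dx_isHomogeneous i h.pderiv

/-- `G₀ P` is trace-free for `P` trace-free of degree `k`. -/
theorem opT_opG₀ {p q k : ℕ} (hn : 3 ≤ p + q) {P : Symbol (p + q)} (h : P.IsHomogeneous k)
    (hP : opT p q P = 0) : opT p q (opG₀ p q k P) = 0 := by
  have hD : opT p q (opD p q P) = 0 := by rw [opT_opD, hP, map_zero]
  have hR := opT_opR (opD_isHomogeneous h) hD
  have e : opG₀ p q k P = opG p q P
      - ((p : ℝ) + q + 2 * k - 2)⁻¹ • opR p q (opD p q P) := rfl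
  rw [e, map_sub, map_smul, hR, opT_opG p q P hP]
  rcases Nat.eq_zero_or_pos k with rfl | hk
  · have h0 : opD p q P = 0 := by
      rw [totalDegree_eq_zero_iff_eq_C.mp (Nat.le_zero.mp h.totalDegree_le)]
      simp [opD, dp]
    simp [h0]
  · have hn' : (3 : ℝ) ≤ p + q := by exact_mod_cast hn
    have hk' : (1 : ℝ) ≤ k := by exact_mod_cast hk
    rw [smul_smul, ← sub_smul, Nat.cast_sub hk]
    have hne : (p : ℝ) + q + 2 * k - 2 ≠ 0 := by linarith
    have : (2 : ℝ) - ((p : ℝ) + q + 2 * k - 2)⁻¹ * (4 * ((k : ℝ) - (1 : ℕ)) + 2 * (p + q)) = 0 := by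
      push_cast
      field_simp
      ring
    rw [this, zero_smul]

/-- The power `G₀^g : S_{k,0} → S_{k+g,0}`. -/
def opG₀pow (p q k : ℕ) : ℕ → Module.End ℝ (Symbol (p + q))
  | 0 => 1
  | g + 1 => opG₀ p q (k + g) * opG₀pow p q k g

/-- The operator `∑_{i ≤ ℓ} a_i G₀^i L^{ℓ-i} D^i` on `S_{k,0}`. Since `L` and `D` commute with
`T`, they preserve trace-free symbols and `L₀`, `D₀` are just their restrictions. Terms with
`i > k` vanish. -/
def opCalL (p q : ℕ) (a : ℕ → ℝ) (k ℓ : ℕ) : Module.End ℝ (Symbol (p + q)) :=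
  ∑ i ∈ Finset.range (ℓ + 1), a i • (opG₀pow p q (k - i) i * opL p q ^ (ℓ - i) * opD p q ^ i)

/-- `W` is a line, generated by the operator `R^{s'} B T^s`. -/
def IsSpannedBy {p q k s k' s' : ℕ} (W : Submodule ℝ (sym p q k s →ₗ[ℝ] sym p q k' s'))
    (B : Module.End ℝ (Symbol (p + q))) : Prop :=
  ∃ A : sym p q k s →ₗ[ℝ] sym p q k' s', A ≠ 0 ∧
    (∀ P, (A P : Symbol (p + q)) = (opR p q ^ s' * B * opT p q ^ s) P) ∧
    W = Submodule.span ℝ {A}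

/-- The parameters for which the algebraic operator `R^{s'} T^s` occurs. -/
def CaseId (k s k' s' : ℕ) (j : ℤ) : Prop :=
  (s' : ℤ) - s = j ∧ (k : ℤ) - k' = -2 * j

/-- The parameters for which `R^{s'} D^d T^s` occurs in dimension `n`. -/
def CaseD (n k s k' s' : ℕ) (δ : ℝ) (j : ℤ) (d : ℕ) : Prop :=
  1 ≤ d ∧ (s' : ℤ) - s = j ∧ (k : ℤ) - k' = d - 2 * j ∧
    δ = 1 + (2 * ((k : ℝ) - s) - d - 1) / n

/-- The parameters for which `R^{s'} G₀^g T^s` occurs in dimension `n`. -/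
def CaseG (n k s k' s' : ℕ) (δ : ℝ) (j : ℤ) (g : ℕ) : Prop :=
  1 ≤ g ∧ (g : ℤ) + s' - s = j ∧ (k : ℤ) - k' = s - s' - j ∧
    δ = (2 * (s : ℝ) + 1 - g) / n

/-- The parameters for which `R^{s'} 𝓛_ℓ T^s` occurs in dimension `n`. -/
def CaseL (n k s k' s' : ℕ) (δ : ℝ) (j : ℤ) (l : ℕ) : Prop :=
  1 ≤ l ∧ (l : ℤ) + s' - s = j ∧ (k : ℤ) - k' = 2 * (l - j) ∧
    δ = 1 / 2 + ((k : ℝ) - l) / n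

end

end ConfSymbols

/-! Multiplication by `R^s` identifies the trace-free symbols of degree `k - 2s` and weight `δ -
2s/n` with `S_{k,s}` in weight `δ`, and `T^s R^s` is a non-zero scalar on trace-free symbols. Hence
it suffices to find the invariant operators from trace-free symbols of degree `m` to trace-free
symbols of degree `m'` (`conjEquiv_mem_iff`, `isSpannedBy_of_isInvariant`).

Existence is a computation of commutators. Since `n ≥ 3`, the conformal factor `f` of a conformal
Killing field has zero Hessian (`KillingEq.hessian_eq_zero`), so the commutators of `D`, `G₀`, `L`
with the Lie derivative involve only the constant gradient of `f`, and under powers their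
coefficients simply add up (`KillingEq.opD_pow_lieDer`, `KillingEq.opG₀pow_lieDer`,
`KillingEq.opL_pow_lieDer`). For `D^d` and `G₀^g` the accumulated coefficient vanishes at the stated
weight. For `𝓛_ℓ` at its weight, the errors of the `i`-th summand are multiples of `errA - errB`
with indices `i - 1` and `i`, and the recursion for the `a_i` cancels them between neighbouring
summands (`KillingEq.calL_lieDer`). Test symbols built from null vectors show that the operators are
not zero.

For uniqueness, an operator of finite order commuting with translations is determined by its jet at
the origin, a bilinear map `Φ(g(x), h(p))` on polynomials, with `h` harmonic. The conformal fields
vanishing at the origin make `Φ` equivariant under rotations, homogeneous in `g` of a degree `N`,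
and subject to one identity for each special conformal field. Complexification removes the signature
and provides light-cone coordinates `u`, `v` (`LightFrame.exists_intertwiner`). Modulo multiples of
the quadratic form, polynomials of degree `m` are generated by `X_v^m` under shears
(`mem_of_shear`), so `Φ` is determined by the functional `top`, the coefficient of `X_v^{m'}` in
`Φ(g, X_v^m)` (`Intertwiner.eq_zero_of_top`). Rotations of the transversal directions reduce `top`
to its values on monomials `X_u^a X_v^b X_w^r`; the torus and the Euler field fix `a - b` and `a + b
+ r`; the special conformal fields give recurrences in `a`, `b`, `r`.

The recurrences carry every non-zero value of `top` to a single critical monomial with `min(a, b) =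
0` (`Intertwiner.critical`), so the space of operators has dimension at most one. At the critical
monomial a recurrence reads scalar times value equals zero; the vanishing of the scalar is the
condition on the weight (`Intertwiner.classification`). The exponent `r` is even, by rotations if `n
≥ 4` and by the reflections if `n = 3`. -/

namespace ConfSymbols

set_option linter.unusedSectionVars false
set_option linter.unusedSimpArgs false

noncomputable section

/-! ### Smooth functions, Hadamard's lemma and coefficientwise operations on symbols -/

open MeasureTheory in
theorem contDiff_parametric_integral {E : Type} [NormedAddCommGroup E] [NormedSpace ℝ E]
    [FiniteDimensional ℝ E] (k : ℕ) : ∀ {F : Type} [NormedAddCommGroup F] [NormedSpace ℝ F]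
    [CompleteSpace F] {h : E × ℝ → F}, ContDiff ℝ ∞ h →
    ContDiff ℝ k fun x => ∫ t in (0 : ℝ)..1, h (x, t) := by
  induction k with
  | zero =>
    intro F _ _ _ h hh
    exact contDiff_zero.mpr
      (intervalIntegral.continuous_parametric_intervalIntegral_of_continuous'
        (f := fun x t => h (x, t)) (by exact hh.continuous) 0 1)
  | succ k ih =>
    intro F _ _ _ h hh
    have hd : ∀ x t, HasFDerivAt (fun x => h (x, t))
        ((fderiv ℝ h (x, t)).comp (ContinuousLinearMap.inl ℝ E ℝ)) x := fun x t =>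
      ((hh.differentiable (by simp) (x, t)).hasFDerivAt).comp x (hasFDerivAt_prodMk_left x t)
    have hs : ContDiff ℝ ∞ fun y : E × ℝ =>
        (fderiv ℝ h y).comp (ContinuousLinearMap.inl ℝ E ℝ) :=
      (hh.fderiv_right (m := ∞) (by simp)).clm_comp contDiff_const
    rw [show ((k + 1 : ℕ) : WithTop ℕ∞) = (k : WithTop ℕ∞) + 1 by simp,
      contDiff_succ_iff_hasFDerivAt]
    -- The derivative of the integral is the integral of the partial derivative, which is of the
    -- same kind with values in `E →L[ℝ] F`. This is why `F` is quantified inside the induction. The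
    -- dominating constant comes from compactness of the unit ball times `[0,1]`.
    refine ⟨_, ih hs, fun x => ?_⟩
    have hK : IsCompact (Metric.closedBall x 1 ×ˢ Set.Icc (0 : ℝ) 1) :=
      (isCompact_closedBall x 1).prod isCompact_Icc
    obtain ⟨B, hB⟩ := hK.exists_bound_of_continuousOn hs.continuous.continuousOn
    refine intervalIntegral.hasFDerivAt_integral_of_dominated_of_fderiv_le (μ := volume)
      (F := fun x t => h (x, t))
      (F' := fun x t => (fderiv ℝ h (x, t)).comp (ContinuousLinearMap.inl ℝ E ℝ))
      (bound := fun _ => B) (s := Metric.ball x 1) (Metric.ball_mem_nhds x one_pos) ?_ ?_ ?_ ?_ ?_ ?_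
    · exact Filter.Eventually.of_forall fun y =>
        (hh.continuous.comp (by fun_prop)).aestronglyMeasurable
    · exact (hh.continuous.comp (by fun_prop)).intervalIntegrable _ _
    · exact (hs.continuous.comp (by fun_prop : Continuous fun t : ℝ => (x, t))).aestronglyMeasurable
    · refine Filter.Eventually.of_forall fun t ht y hy => hB (y, t) ⟨?_, ?_⟩
      · exact Metric.ball_subset_closedBall hy
      · rw [Set.uIoc_of_le zero_le_one] at ht; exact ⟨ht.1.le, ht.2⟩
    · exact intervalIntegrable_const
    · exact Filter.Eventually.of_forall fun t _ y _ => hd y t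

theorem partialX_apply {n : ℕ} (i : Fin n) (f : Smooth n) (x : Fin n → ℝ) :
    (partialX i f).1 x = fderiv ℝ f.1 x (Pi.single i 1) := rfl

theorem smooth_contDiff {n : ℕ} (f : Smooth n) : ContDiff ℝ ∞ f.1 := f.2

theorem smooth_ext {n : ℕ} {f g : Smooth n} (h : ∀ x, f.1 x = g.1 x) : f = g :=
  Subtype.ext (funext h)

theorem hadamard_integrand_contDiff {n : ℕ} (c : Fin n → ℝ) (f : Smooth n) :
    ContDiff ℝ ∞ fun y : (Fin n → ℝ) × ℝ => f.1 (c + y.2 • (y.1 - c)) :=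
  (smooth_contDiff f).comp
    (contDiff_const.add (contDiff_snd.smul (contDiff_fst.sub contDiff_const)))

/-- The coefficient `∫₀¹ (∂ᵢ f) (c + t (x - c)) dt` of `xᵢ - cᵢ` in Hadamard's lemma. -/
def hadamard {n : ℕ} (c : Fin n → ℝ) (i : Fin n) : Smooth n →ₗ[ℝ] Smooth n where
  toFun f := ⟨fun x => ∫ t in (0 : ℝ)..1, (partialX i f).1 (c + t • (x - c)),
    contDiff_infty.mpr fun k =>
      contDiff_parametric_integral k (hadamard_integrand_contDiff c (partialX i f))⟩
  map_add' f g := smooth_ext fun x => by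
    have hc : ∀ f : Smooth n, Continuous fun t : ℝ => f.1 (c + t • (x - c)) := fun f =>
      (smooth_contDiff f).continuous.comp (by fun_prop)
    rw [map_add]
    exact intervalIntegral.integral_add ((hc _).intervalIntegrable _ _)
      ((hc _).intervalIntegrable _ _)
  map_smul' a f := smooth_ext fun x => by
    rw [(partialX i).map_smul]
    exact intervalIntegral.integral_const_mul _ _

/-- The coordinate function `xᵢ`. -/
def coord {n : ℕ} (i : Fin n) : Smooth n := ⟨fun x => x i, show ContDiff ℝ ∞ _ from contDiff_apply ℝ ℝ i⟩

/-- Evaluation of smooth functions at a point. -/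
def evAt {n : ℕ} (c : Fin n → ℝ) : Smooth n →ₐ[ℝ] ℝ where
  toFun f := f.1 c
  map_one' := rfl
  map_mul' _ _ := rfl
  map_zero' := rfl
  map_add' _ _ := rfl
  commutes' _ := rfl

/-- Fundamental theorem of calculus on the segment from `c` to `x`. The coefficients depend linearly
on `f`, so that the formula can be applied to all the coefficients of a symbol at once. -/
theorem hadamard_eq {n : ℕ} (c : Fin n → ℝ) (f : Smooth n) :
    f = algebraMap ℝ _ (evAt c f) +
      ∑ i, (coord i - algebraMap ℝ _ (c i)) * hadamard c i f := by
  have hval : ∀ (x : Fin n → ℝ) (s : Finset (Fin n)) (g : Fin n → Smooth n),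
      (∑ i ∈ s, g i).1 x = ∑ i ∈ s, (g i).1 x := fun x s g => map_sum (evAt x) g s
  refine smooth_ext fun x => ?_
  have hd : ∀ t ∈ Set.uIcc (0 : ℝ) 1, HasDerivAt (fun t : ℝ => f.1 (c + t • (x - c)))
      (∑ i, (x i - c i) * (partialX i f).1 (c + t • (x - c))) t := by
    intro t _
    have h1 : HasDerivAt (fun t : ℝ => c + t • (x - c)) (x - c) t := by
      simpa using ((hasDerivAt_id t).smul_const (x - c)).const_add c
    have h2 := ((smooth_contDiff f).differentiable (by simp) (c + t • (x - c))).hasFDerivAt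
    refine (h2.comp_hasDerivAt t h1).congr_deriv ?_
    rw [show fderiv ℝ f.1 (c + t • (x - c)) (x - c) =
      fderiv ℝ f.1 (c + t • (x - c)) (∑ i, Pi.single i ((x - c) i)) by
        rw [Finset.univ_sum_single], map_sum]
    refine Finset.sum_congr rfl fun i _ => ?_
    symm
    rw [partialX_apply, show (Pi.single i ((x - c) i) : Fin n → ℝ) =
      (x i - c i) • Pi.single i 1 by rw [← Pi.single_smul]; simp, map_smul, smul_eq_mul]
  have hc : ∀ f : Smooth n, Continuous fun t : ℝ => f.1 (c + t • (x - c)) := fun f =>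
    (smooth_contDiff f).continuous.comp (by fun_prop)
  have hi := intervalIntegral.integral_eq_sub_of_hasDerivAt hd (Continuous.intervalIntegrable
    (continuous_finsetSum _ fun i _ => continuous_const.mul (hc _)) _ _)
  rw [intervalIntegral.integral_finsetSum (f := fun i t => (x i - c i) *
      (partialX i f).1 (c + t • (x - c)))
    (fun i _ => (continuous_const.mul (hc _)).intervalIntegrable _ _)] at hi
  simp only [one_smul, zero_smul, add_zero, add_sub_cancel] at hi
  have : f.1 x = f.1 c + ∑ i, (x i - c i) * (hadamard c i f).1 x := by
    rw [← sub_eq_iff_eq_add', ← hi]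
    exact Finset.sum_congr rfl fun i _ => intervalIntegral.integral_const_mul _ _
  rw [this]
  exact congrArg (f.1 c + ·) (hval x Finset.univ
    fun i => (coord i - algebraMap ℝ _ (c i)) * hadamard c i f).symm

theorem partialX_comm {n : ℕ} (i j : Fin n) (f : Smooth n) :
    partialX i (partialX j f) = partialX j (partialX i f) := by
  refine smooth_ext fun x => ?_
  have hf := smooth_contDiff f
  have hd : DifferentiableAt ℝ (fderiv ℝ f.1) x :=
    (hf.fderiv_right (m := ∞) (by simp)).differentiable (by simp) x
  have key : ∀ a b : Fin n, (partialX a (partialX b f)).1 x =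
      fderiv ℝ (fderiv ℝ f.1) x (Pi.single a 1) (Pi.single b 1) := by
    intro a b
    change fderiv ℝ (fun y => fderiv ℝ f.1 y (Pi.single b 1)) x (Pi.single a 1) = _
    rw [fderiv_clm_apply hd (differentiableAt_const _)]
    simp
  rw [key, key]
  exact (hf.contDiffAt.isSymmSndFDerivAt (by simpa using ENat.LEInfty.out)).eq _ _

theorem partialX_coord {n : ℕ} (i j : Fin n) :
    partialX i (coord j : Smooth n) = if j = i then 1 else 0 := by
  refine smooth_ext fun x => ?_
  have : (partialX i (coord j : Smooth n)).1 x = (Pi.single i 1 : Fin n → ℝ) j := by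
    change fderiv ℝ (ContinuousLinearMap.proj (R := ℝ) (φ := fun _ : Fin n => ℝ) j) x
      (Pi.single i 1) = _
    rw [ContinuousLinearMap.fderiv]; rfl
  rw [this, Pi.single_apply]
  split_ifs <;> rfl

/-- Hadamard's coefficients are integrals of the partial derivatives, so only the constant term
survives. -/
theorem eq_algebraMap_of_partialX_eq_zero {n : ℕ} (f : Smooth n) (h : ∀ i, partialX i f = 0) :
    f = algebraMap ℝ _ (evAt 0 f) := by
  have := hadamard_eq 0 f
  have h0 : ∀ i, hadamard (0 : Fin n → ℝ) i f = 0 := fun i => smooth_ext fun x => by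
    change ∫ t in (0 : ℝ)..1, (partialX i f).1 _ = 0
    rw [h i]
    exact intervalIntegral.integral_zero
  simpa only [h0, mul_zero, Finset.sum_const_zero, add_zero] using this

/-- A real linear map of functions, applied to the coefficients of a symbol. -/
def mapCoeff {n : ℕ} (u : Smooth n →ₗ[ℝ] Smooth n) : Module.End ℝ (Symbol n) where
  toFun P := AddMonoidAlgebra.map u.toAddMonoidHom P
  map_add' P Q := AddMonoidAlgebra.map_add _ P Q
  map_smul' c P := by
    apply AddMonoidAlgebra.ext
    apply Finsupp.ext
    intro m
    exact u.map_smul c (P.coeff m)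

theorem coeff_mapCoeff {n : ℕ} (u : Smooth n →ₗ[ℝ] Smooth n) (P : Symbol n) (m : Fin n →₀ ℕ) :
    (mapCoeff u P).coeff m = u (P.coeff m) := rfl

theorem mapCoeff_monomial {n : ℕ} (u : Smooth n →ₗ[ℝ] Smooth n) (m : Fin n →₀ ℕ) (f : Smooth n) :
    mapCoeff u (monomial m f) = monomial m (u f) := by
  ext1 m'
  rw [coeff_mapCoeff, MvPolynomial.coeff_monomial, MvPolynomial.coeff_monomial]
  split_ifs <;> simp

theorem dp_mapCoeff {n : ℕ} (u : Smooth n →ₗ[ℝ] Smooth n) (i : Fin n) (P : Symbol n) :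
    dp i (mapCoeff u P) = mapCoeff u (dp i P) := by
  induction P using MvPolynomial.induction_on' with
  | add P Q hP hQ => simp only [map_add, hP, hQ]
  | monomial m f =>
    have h : ∀ g : Smooth n, dp i (monomial m g) = monomial (m - Finsupp.single i 1) (g * m i) :=
      fun g => pderiv_monomial
    rw [mapCoeff_monomial, h, h, mapCoeff_monomial]
    congr 1
    rw [mul_comm, mul_comm f, ← nsmul_eq_mul, ← nsmul_eq_mul, map_nsmul]

/-- Homogeneity and `T` concern the fibre variables only and have constant coefficients.
Consequently Taylor expansion in `x` can be carried out inside the trace-free symbols. -/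
theorem mapCoeff_mem_sym_zero {p q m : ℕ} (u : Smooth (p + q) →ₗ[ℝ] Smooth (p + q))
    {P : Symbol (p + q)} (hP : P ∈ sym p q m 0) : mapCoeff u P ∈ sym p q m 0 := by
  obtain ⟨h, Q, hQ, rfl⟩ := hP
  rw [pow_zero, one_mul] at h ⊢
  refine ⟨fun d hd => h fun h0 => hd (by rw [coeff_mapCoeff, h0, map_zero]), mapCoeff u Q, ?_,
    by rw [pow_zero, one_mul]⟩
  have := congrArg (mapCoeff u) hQ
  rw [opT_apply, map_sum, map_zero] at this
  rw [opT_apply, ← this]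
  simp only [dp_mapCoeff, map_smul]

/-- Evaluation of the coefficients of a symbol at a point. -/
def evSym {n : ℕ} (c : Fin n → ℝ) : Symbol n →ₐ[ℝ] MvPolynomial (Fin n) ℝ :=
  mapAlgHom (evAt c)

/-- The symbols with constant coefficients. -/
def constSym {n : ℕ} : MvPolynomial (Fin n) ℝ →ₐ[ℝ] Symbol n :=
  mapAlgHom (Algebra.ofId ℝ (Smooth n))

theorem coeff_evSym {n : ℕ} (c : Fin n → ℝ) (P : Symbol n) (m : Fin n →₀ ℕ) :
    (evSym c P).coeff m = evAt c (P.coeff m) := coeff_map _ _ _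

theorem coeff_constSym {n : ℕ} (P : MvPolynomial (Fin n) ℝ) (m : Fin n →₀ ℕ) :
    (constSym P).coeff m = algebraMap ℝ (Smooth n) (P.coeff m) := coeff_map _ _ _

theorem evSym_smul {n : ℕ} (c : Fin n → ℝ) (f : Smooth n) (P : Symbol n) :
    evSym c (f • P) = evAt c f • evSym c P := by
  ext1 m; simp [coeff_evSym]

theorem symbol_eq_zero_of_evSym {n : ℕ} {P : Symbol n} (h : ∀ c, evSym c P = 0) : P = 0 := by
  ext1 m
  refine smooth_ext fun x => ?_
  have := congrArg (fun Q => Q.coeff m) (h x)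
  rwa [coeff_evSym] at this

theorem symbol_hadamard {n : ℕ} (c : Fin n → ℝ) (P : Symbol n) :
    P = constSym (evSym c P) +
      ∑ i, (coord i - algebraMap ℝ (Smooth n) (c i)) • mapCoeff (hadamard c i) P := by
  ext1 m
  conv_lhs => rw [hadamard_eq c (P.coeff m)]
  simp [coeff_constSym, coeff_evSym, coeff_sum, coeff_mapCoeff, coeff_smul]

/-! ### Locality of differential operators -/

section Locality

variable {n : ℕ} {M N : Submodule (Smooth n) (Symbol n)}

/-- `I_c^r M`, where `I_c` is the ideal of the functions vanishing at `c`. -/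
def vanishing (c : Fin n → ℝ) (M : Submodule (Smooth n) (Symbol n)) : ℕ → Submodule ℝ M
  | 0 => ⊤
  | r + 1 => Submodule.span ℝ {Q | ∃ f : Smooth n, evAt c f = 0 ∧ ∃ P ∈ vanishing c M r, Q = f • P}

/-- In `A (f P) = f A P + [A, f] P` the first term vanishes at `c` with `f`, and the second costs
one factor vanishing at `c` but also one order. After `r` steps one factor is left for an operator
that is linear over functions. -/
theorem IsDiffOp.evSym_eq_zero (c : Fin n → ℝ) {r : ℕ} {A : M →ₗ[ℝ] N} (hA : IsDiffOp r A)
    {P : M} (hP : P ∈ vanishing c M (r + 1)) : evSym c (A P : Symbol n) = 0 := by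
  induction r generalizing A P with
  | zero =>
    induction hP using Submodule.span_induction with
    | mem Q hQ =>
      obtain ⟨f, hf, P, -, rfl⟩ := hQ
      have h := LinearMap.congr_fun (hA f) P
      have h' : A (f • P) = f • A P := sub_eq_zero.mp h
      rw [h', Submodule.coe_smul, evSym_smul, hf, zero_smul]
    | zero => simp
    | add Q₁ Q₂ _ _ h₁ h₂ => rw [map_add, Submodule.coe_add, map_add, h₁, h₂, add_zero]
    | smul a Q _ h =>
      rw [map_smul]
      exact (map_smul (evSym c) a _).trans (by rw [h, smul_zero])
  | succ r ih =>
    induction hP using Submodule.span_induction with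
    | mem Q hQ =>
      obtain ⟨f, hf, P, hP, rfl⟩ := hQ
      have h' : A (f • P) = f • A P + commFun A f P := (add_sub_cancel (f • A P) _).symm
      rw [h', Submodule.coe_add, map_add, ih (hA f) hP, Submodule.coe_smul, evSym_smul, hf,
        zero_smul, add_zero]
    | zero => simp
    | add Q₁ Q₂ _ _ h₁ h₂ => rw [map_add, Submodule.coe_add, map_add, h₁, h₂, add_zero]
    | smul a Q _ h =>
      rw [map_smul]
      exact (map_smul (evSym c) a _).trans (by rw [h, smul_zero])

end Locality

/-- The monomial functions `x^α`. -/
def monoFun {n : ℕ} (α : Fin n → ℕ) : Smooth n := ∏ i, coord i ^ α i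

theorem monoFun_zero {n : ℕ} : (monoFun 0 : Smooth n) = 1 := by simp [monoFun]

theorem coord_mul_monoFun {n : ℕ} (i : Fin n) (α : Fin n → ℕ) :
    coord i * monoFun α = monoFun (α + Pi.single i 1) := by
  simp only [monoFun, Pi.add_apply, pow_add, Finset.prod_mul_distrib]
  rw [mul_comm]
  congr 1
  rw [Finset.prod_eq_single i (fun j _ h => by simp [h]) (by simp)]
  simp

theorem partialX_monoFun {n : ℕ} (i : Fin n) (α : Fin n → ℕ) :
    partialX i (monoFun α) = (α i : ℝ) • monoFun (α - Pi.single i 1) := by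
  have h : monoFun α = coord i ^ α i * ∏ j ∈ Finset.univ.erase i, coord j ^ α j := by
    rw [monoFun, ← Finset.mul_prod_erase Finset.univ (fun j => coord j ^ α j) (Finset.mem_univ i)]
  have h2 : (monoFun (α - Pi.single i 1) : Smooth n) =
      coord i ^ (α i - 1) * ∏ j ∈ Finset.univ.erase i, coord j ^ α j := by
    rw [monoFun, ← Finset.mul_prod_erase Finset.univ _ (Finset.mem_univ i)]
    congr 1
    · simp
    · refine Finset.prod_congr rfl fun j hj => ?_
      simp [Finset.ne_of_mem_erase hj]
  have h3 : partialX i (∏ j ∈ Finset.univ.erase i, (coord j : Smooth n) ^ α j) = 0 := by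
    refine Finset.prod_induction _ (fun g : Smooth n => partialX i g = 0) ?_ ?_ ?_
    · intro a b ha hb
      rw [Derivation.leibniz, ha, hb, smul_zero, smul_zero, add_zero]
    · exact Derivation.map_one_eq_zero _
    · intro j hj
      rw [Derivation.leibniz_pow, partialX_coord, if_neg (Finset.ne_of_mem_erase hj)]
      simp
  rw [h, Derivation.leibniz, h3, Derivation.leibniz_pow, partialX_coord, if_pos rfl, h2]
  simp only [smul_eq_mul, mul_zero, zero_add, mul_one]
  rw [Nat.cast_smul_eq_nsmul, nsmul_eq_mul, nsmul_eq_mul]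
  ring

/-! ### Translation invariant operators are determined at the origin on polynomial symbols -/

section Determination

variable {p q m m' : ℕ}

theorem constSym_evSym_mem (c : Fin (p + q) → ℝ) {P : Symbol (p + q)} (hP : P ∈ sym p q m 0) :
    constSym (evSym c P) ∈ sym p q m 0 := by
  have := mapCoeff_mem_sym_zero ((Algebra.linearMap ℝ (Smooth (p + q))) ∘ₗ (evAt c).toLinearMap) hP
  convert this using 1
  ext1 d
  rw [coeff_constSym, coeff_evSym]
  rfl

/-- The trace-free symbols with polynomial coefficients. -/
def polySym (p q m : ℕ) : Submodule ℝ (sym p q m 0) :=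
  Submodule.span ℝ {Z | ∃ (α : Fin (p + q) → ℕ) (h : MvPolynomial (Fin (p + q)) ℝ),
    constSym h ∈ sym p q m 0 ∧ (Z : Symbol (p + q)) = monoFun α • constSym h}

theorem coord_smul_mem_polySym (i : Fin (p + q)) (a : ℝ) {Z : sym p q m 0}
    (hZ : Z ∈ polySym p q m) :
    (coord i - algebraMap ℝ (Smooth (p + q)) a) • Z ∈ polySym p q m := by
  rw [sub_smul (M := sym p q m 0) (coord i) (algebraMap ℝ (Smooth (p + q)) a) Z,
    algebraMap_smul]
  refine sub_mem ?_ (Submodule.smul_mem _ _ hZ)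
  induction hZ using Submodule.span_induction with
  | mem Q hQ =>
    obtain ⟨α, h, hh, hQ⟩ := hQ
    refine Submodule.subset_span ⟨α + Pi.single i 1, h, hh, ?_⟩
    rw [Submodule.coe_smul, hQ, smul_smul, coord_mul_monoFun]
  | zero => simp
  | add Q₁ Q₂ _ _ h₁ h₂ => rw [smul_add]; exact add_mem h₁ h₂
  | smul b Q _ h => rw [smul_comm]; exact Submodule.smul_mem _ _ h

/-- Taylor's theorem with remainder, obtained by applying Hadamard's lemma again to the coefficients
it produces. -/
theorem exists_polySym_add_vanishing (c : Fin (p + q) → ℝ) (r : ℕ) (P : sym p q m 0) :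
    ∃ Z ∈ polySym p q m, P - Z ∈ vanishing c (sym p q m 0) r := by
  induction r generalizing P with
  | zero => exact ⟨0, zero_mem _, trivial⟩
  | succ r ih =>
    choose Z hZ hZ' using fun i =>
      ih (⟨_, mapCoeff_mem_sym_zero (hadamard c i) P.2⟩ : sym p q m 0)
    have h0 : (⟨_, constSym_evSym_mem c P.2⟩ : sym p q m 0) ∈ polySym p q m :=
      Submodule.subset_span ⟨0, evSym c P, constSym_evSym_mem c P.2,
        by rw [monoFun_zero, one_smul]⟩
    refine ⟨⟨_, constSym_evSym_mem c P.2⟩ +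
      ∑ i, (coord i - algebraMap ℝ (Smooth (p + q)) (c i)) • Z i,
      add_mem h0 (sum_mem fun i _ => coord_smul_mem_polySym i _ (hZ i)), ?_⟩
    have : P - (⟨_, constSym_evSym_mem c P.2⟩ +
        ∑ i, (coord i - algebraMap ℝ (Smooth (p + q)) (c i)) • Z i) =
        ∑ i, (coord i - algebraMap ℝ (Smooth (p + q)) (c i)) •
          ((⟨_, mapCoeff_mem_sym_zero (hadamard c i) P.2⟩ : sym p q m 0) - Z i) := by
      simp only [smul_sub, Finset.sum_sub_distrib, ← sub_sub]
      congr 1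
      refine Subtype.ext ?_
      rw [Submodule.coe_sub, sub_eq_iff_eq_add']
      conv_lhs => rw [symbol_hadamard c (P : Symbol (p + q))]
      simp
    rw [this]
    refine sum_mem fun i _ => Submodule.subset_span ⟨_, ?_, _, hZ' i, rfl⟩
    simp [evAt, coord]
    exact sub_self _

theorem eq_constSym_of_dx_eq_zero {n : ℕ} {P : Symbol n} (h : ∀ i, dx i P = 0) :
    P = constSym (evSym 0 P) := by
  ext1 d
  rw [coeff_constSym, coeff_evSym]
  refine eq_algebraMap_of_partialX_eq_zero _ fun i => ?_
  rw [← coeff_dx, h i, coeff_zero]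

theorem dx_smul_constSym {n : ℕ} (i : Fin n) (f : Smooth n) (h : MvPolynomial (Fin n) ℝ) :
    dx i (f • constSym h) = partialX i f • constSym h := by
  ext1 d
  rw [coeff_dx, coeff_smul, coeff_smul, coeff_constSym, smul_eq_mul, smul_eq_mul,
    Derivation.leibniz, Derivation.map_algebraMap, smul_zero, zero_add, smul_eq_mul, mul_comm]

/-- A translation invariant differential operator is determined by its values at the origin on
symbols with polynomial coefficients. -/
theorem diffOp_eq_zero {A : sym p q m 0 →ₗ[ℝ] sym p q m' 0} {r : ℕ} (hA : IsDiffOp r A)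
    (htr : ∀ i (P Q : sym p q m 0), (Q : Symbol (p + q)) = dx i (P : Symbol (p + q)) →
      (A Q : Symbol (p + q)) = dx i (A P : Symbol (p + q)))
    (h0 : ∀ (α : Fin (p + q) → ℕ) h (Z : sym p q m 0), constSym h ∈ sym p q m 0 →
      (Z : Symbol (p + q)) = monoFun α • constSym h →
      evSym 0 (A Z : Symbol (p + q)) = 0) : A = 0 := by
  -- Induction on the degree in `x`. By translation invariance the derivatives of `A Z` are values
  -- of `A` on monomials of lower degree, hence zero; so `A Z` has constant coefficients and is
  -- known from its value at the origin.
  have hmono : ∀ (d : ℕ) (α : Fin (p + q) → ℕ) h (Z : sym p q m 0), constSym h ∈ sym p q m 0 →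
      ∑ i, α i = d → (Z : Symbol (p + q)) = monoFun α • constSym h → A Z = 0 := by
    intro d
    induction d using Nat.strong_induction_on with
    | _ d ih =>
      intro α h Z hh hα hZ
      have hd : ∀ i, dx i (A Z : Symbol (p + q)) = 0 := by
        intro i
        let Z' : sym p q m 0 := monoFun (α - Pi.single i 1) • ⟨_, hh⟩
        have hZ' : (((α i : ℝ) • Z' : sym p q m 0) : Symbol (p + q)) = dx i (Z : Symbol (p + q)) := by
          rw [hZ, dx_smul_constSym, partialX_monoFun, smul_assoc]; rfl
        rw [← htr i Z _ hZ', map_smul]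
        rcases Nat.eq_zero_or_pos (α i) with h1 | h1
        · rw [h1, Nat.cast_zero, zero_smul]; rfl
        · have hlt : ∑ j, (α - Pi.single i 1 : Fin (p + q) → ℕ) j < d := by
            rw [← hα]
            refine Finset.sum_lt_sum (fun j _ => Nat.sub_le _ _) ⟨i, Finset.mem_univ i, ?_⟩
            simp; omega
          rw [ih _ hlt (α - Pi.single i 1) h Z' hh rfl rfl, smul_zero]; rfl
      refine Subtype.ext ?_
      rw [eq_constSym_of_dx_eq_zero hd, h0 α h Z hh hZ, map_zero]; rfl
  have hpoly : ∀ Z ∈ polySym p q m, A Z = 0 := by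
    intro Z hZ
    induction hZ using Submodule.span_induction with
    | mem Q hQ =>
      obtain ⟨α, h, hh, hQ⟩ := hQ
      exact hmono _ α h Q hh rfl hQ
    | zero => exact map_zero A
    | add Q₁ Q₂ _ _ h₁ h₂ => rw [map_add, h₁, h₂, add_zero]
    | smul b Q _ h => rw [map_smul, h, smul_zero]
  -- At each point `c`, an operator of order `r` does not see the remainder of the Taylor
  -- polynomial, which lies in `I_c^{r+1}`.
  refine LinearMap.ext fun P => Subtype.ext (symbol_eq_zero_of_evSym fun c => ?_)
  obtain ⟨Z, hZ, hPZ⟩ := exists_polySym_add_vanishing c (r + 1) P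
  have := hA.evSym_eq_zero c hPZ
  rwa [map_sub, hpoly Z hZ, sub_zero] at this

end Determination

/-! ### Conformal Killing fields -/

section Killing

variable {p q : ℕ} {V : Fin (p + q) → Smooth (p + q)} {f : Smooth (p + q)}

/-- The conformal Killing equation with conformal factor `f`. -/
def KillingEq (p q : ℕ) (V : Fin (p + q) → Smooth (p + q)) (f : Smooth (p + q)) : Prop :=
  ∀ i j, sgn p q j • partialX i (V j) + sgn p q i • partialX j (V i) =
      if i = j then sgn p q i • f else 0

theorem sgn_smul_sgn_smul {M : Type*} [AddCommGroup M] [Module ℝ M] (i : Fin (p + q)) (x : M) :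
    sgn p q i • sgn p q i • x = x := by
  rw [smul_smul, sgn_mul_self, one_smul]

theorem KillingEq.partialX_self (hV : KillingEq p q V f) (i : Fin (p + q)) :
    partialX i (V i) = (1 / 2 : ℝ) • f := by
  have h := congrArg (fun g => (1 / 2 : ℝ) • sgn p q i • g) (hV i i)
  simp only [if_true, sgn_smul_sgn_smul, smul_add] at h
  rw [← h, ← add_smul]; norm_num

theorem KillingEq.divergence_eq (hV : KillingEq p q V f) :
    divergence V = (((p + q : ℕ) : ℝ) / 2) • f := by
  rw [divergence, Finset.sum_congr rfl fun i _ => hV.partialX_self i]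
  rw [Finset.sum_const, Finset.card_univ, Fintype.card_fin, ← Nat.cast_smul_eq_nsmul ℝ, smul_smul]
  congr 1; ring

/-- As for the Christoffel symbols: of the three cyclic permutations of the differentiated Killing
equation, the sum of two minus the third isolates one second derivative of the lowered field. -/
theorem KillingEq.partialX_partialX (hV : KillingEq p q V f) (k i j : Fin (p + q)) :
    partialX k (partialX i (V j)) = (1 / 2 : ℝ) • ((if i = j then partialX k f else 0) +
      (if k = j then partialX i f else 0) -
      if k = i then (sgn p q k * sgn p q j) • partialX j f else 0) := by
  have hD : ∀ a b c, sgn p q c • partialX a (partialX b (V c)) +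
      sgn p q b • partialX a (partialX c (V b)) = if b = c then sgn p q b • partialX a f else 0 := by
    intro a b c
    have := congrArg (partialX a) (hV b c)
    rw [map_add, (partialX a).map_smul, (partialX a).map_smul] at this
    rw [this]
    split_ifs
    · exact (partialX a).map_smul _ _
    · exact map_zero _
  have h1 := hD k i j
  have h2 := hD i j k
  have h3 := hD j k i
  rw [partialX_comm i j, partialX_comm i k] at h2
  rw [partialX_comm j k, ] at h3
  have h4 : sgn p q j • partialX k (partialX i (V j)) = (1 / 2 : ℝ) •
      ((if i = j then sgn p q i • partialX k f else 0) +
      (if j = k then sgn p q j • partialX i f else 0) -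
      if k = i then sgn p q k • partialX j f else 0) := by
    rw [← h1, ← h2, ← h3]
    module
  have h5 := congrArg (fun g => sgn p q j • g) h4
  simp only [sgn_smul_sgn_smul] at h5
  rw [h5, smul_comm]
  congr 1
  rw [smul_sub, smul_add]
  congr 1
  · congr 1
    · by_cases h : i = j
      · subst h; simp only [if_true, sgn_smul_sgn_smul]
      · simp only [if_neg h, smul_zero]
    · by_cases h : k = j
      · subst h; simp only [if_true, sgn_smul_sgn_smul]
      · simp only [if_neg h, if_neg (Ne.symm h), smul_zero]
  · split_ifs
    · rw [smul_smul, mul_comm]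
    · rw [smul_zero]

/-- The integrability condition for the second derivatives of `V`: third derivatives commute. Here
the dimension matters, because three distinct indices are needed. -/
theorem KillingEq.hessian_eq_zero (hV : KillingEq p q V f) (hn : 3 ≤ p + q) (i j : Fin (p + q)) :
    partialX i (partialX j f) = 0 := by
  have hD : ∀ l k i j : Fin (p + q), partialX l (partialX k (partialX i (V j))) = (1 / 2 : ℝ) •
      ((if i = j then partialX l (partialX k f) else 0) +
      (if k = j then partialX l (partialX i f) else 0) -
      if k = i then (sgn p q k * sgn p q j) • partialX l (partialX j f) else 0) := by
    intro l k i j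
    rw [hV.partialX_partialX, (partialX l).map_smul, map_sub, map_add]
    congr 3
    · split_ifs <;> simp
    · split_ifs <;> simp
    · split_ifs
      · exact (partialX l).map_smul _ _
      · simp
  -- Exchange of `∂_l` and `∂_k` in the third derivatives of the component `V k`. For `l ≠ i` this
  -- already gives the mixed derivatives of `f`.
  have key : ∀ l k i : Fin (p + q), k ≠ l → k ≠ i → partialX l (partialX i f) =
      - if l = i then (sgn p q l * sgn p q k) • partialX k (partialX k f) else 0 := by
    intro l k i hkl hki
    have h1 := hD l k i k
    rw [partialX_comm l k, hD k l i k] at h1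
    simp only [if_neg (Ne.symm hki), if_neg hki, if_neg (Ne.symm hkl), if_true, zero_add,
      sub_zero, zero_sub] at h1
    exact (smul_right_injective _ (by norm_num : (1 / 2 : ℝ) ≠ 0) h1).symm
  have hex : ∀ a b : Fin (p + q), ∃ c, c ≠ a ∧ c ≠ b := by
    intro a b
    by_contra! h
    have : (Finset.univ : Finset (Fin (p + q))) ⊆ {a, b} := by
      intro c _
      by_cases hc : c = a
      · simp [hc]
      · simp [h c hc]
    have h2 := (Finset.card_le_card this).trans Finset.card_le_two
    rw [Finset.card_univ, Fintype.card_fin] at h2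
    omega
  by_cases hij : i = j
  · subst hij
    obtain ⟨k, hk, -⟩ := hex i i
    obtain ⟨l, hl, hl'⟩ := hex i k
    -- Each step around the triangle `i → k → l → i` changes the sign of the normalized second
    -- derivative; three changes give `∂_i² f = -∂_i² f`.
    have h1 := key i k i hk hk
    have h2 := key k l k hl' hl'
    have h3 := key l i l hl.symm hl.symm
    simp only [if_true] at h1 h2 h3
    rw [h3, smul_neg, neg_neg, smul_smul] at h2
    rw [h2, smul_smul] at h1
    have e : sgn p q i * sgn p q k * (sgn p q k * sgn p q l * (sgn p q l * sgn p q i)) = 1 := by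
      have a := sgn_mul_self p q i
      have b := sgn_mul_self p q k
      have c := sgn_mul_self p q l
      linear_combination (sgn p q k * sgn p q k * (sgn p q l * sgn p q l)) * a +
        (sgn p q l * sgn p q l) * b + c
    rw [e, one_smul] at h1
    have h4 : (2 : ℝ) • partialX i (partialX i f) = 0 := by
      rw [two_smul]; nth_rewrite 1 [h1]; exact neg_add_cancel _
    exact (smul_eq_zero.mp h4).resolve_left two_ne_zero
  · obtain ⟨k, hk, hk'⟩ := hex i j
    rw [key i k j hk hk', if_neg hij, neg_zero]

end Killing

/-! ### Commutators of `D`, `G`, `L` with conformal fields -/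

section Commutators

variable {p q : ℕ}

theorem dx_smul {n : ℕ} (i : Fin n) (g : Smooth n) (P : Symbol n) :
    dx i (g • P) = g • dx i P + partialX i g • P := by
  ext1 d
  simp only [coeff_dx, coeff_add, coeff_smul, smul_eq_mul, Derivation.leibniz]
  ring

theorem dx_comm {n : ℕ} (i j : Fin n) (P : Symbol n) : dx i (dx j P) = dx j (dx i P) := by
  ext1 d
  simp only [coeff_dx]
  exact partialX_comm _ _ _

/-- The Euler operator `p_i ∂_{p_i}`. -/
def eulerP {n : ℕ} : Module.End ℝ (Symbol n) := ∑ i, LinearMap.mulLeft ℝ (X i) * dp i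

theorem eulerP_apply {n : ℕ} (P : Symbol n) : eulerP P = ∑ i, X i * dp i P := by
  simp [eulerP]

/-- The derivation `(∂_i f) ∂_{p_i}`. -/
def gradP {n : ℕ} (f : Smooth n) : Module.End ℝ (Symbol n) where
  toFun P := ∑ i, partialX i f • dp i P
  map_add' P Q := by simp [Finset.sum_add_distrib]
  map_smul' c P := by simp [Finset.smul_sum, smul_comm c]

/-- The operator `η^{ij} (∂_i f) ∂_j`. -/
def gradX (p q : ℕ) (f : Smooth (p + q)) : Module.End ℝ (Symbol (p + q)) where
  toFun P := ∑ i, sgn p q i • partialX i f • dx i P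
  map_add' P Q := by simp [Finset.sum_add_distrib]
  map_smul' c P := by simp [Finset.smul_sum, smul_comm c]

/-- The symbol `η^{ij} (∂_i f) p_j`. -/
def gradSym (p q : ℕ) (f : Smooth (p + q)) : Symbol (p + q) :=
  ∑ i, sgn p q i • partialX i f • X i

theorem gradP_apply {n : ℕ} (f : Smooth n) (P : Symbol n) :
    gradP f P = ∑ i, partialX i f • dp i P := rfl

theorem gradX_apply (f : Smooth (p + q)) (P : Symbol (p + q)) :
    gradX p q f P = ∑ i, sgn p q i • partialX i f • dx i P := rfl

variable {V : Fin (p + q) → Smooth (p + q)} {f : Smooth (p + q)}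

/-- Source of all the commutators below. The terms beyond the Lie derivative of `∂_a P` come from
differentiating `V`, its Jacobian and its divergence; the last two are expressed by the gradient of
`f`. -/
theorem KillingEq.dx_lieDer (hV : KillingEq p q V f) (δ : ℝ) (a : Fin (p + q))
    (P : Symbol (p + q)) :
    dx a (lieDer δ V P) = lieDer δ V (dx a P) + ∑ i, partialX a (V i) • dx i P
      - (1 / 2 : ℝ) • (partialX a f • eulerP P + X a * gradP f P
        - sgn p q a • (gradSym p q f * dp a P))
      + (δ * (((p + q : ℕ) : ℝ) / 2)) • partialX a f • P := by
  have h1 : ∑ i, ∑ j, partialX a (partialX i (V j)) • (X j * dp i P) =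
      (1 / 2 : ℝ) • (partialX a f • eulerP P + X a * gradP f P
        - sgn p q a • (gradSym p q f * dp a P)) := by
    simp only [hV.partialX_partialX, smul_assoc, sub_smul, add_smul, smul_sub, smul_add,
      Finset.sum_sub_distrib, Finset.sum_add_distrib, ite_smul, zero_smul, smul_ite, smul_zero,
      Finset.sum_ite_eq, Finset.mem_univ, if_true, ← Finset.smul_sum]
    congr 1
    · congr 1
      · rw [eulerP_apply, Finset.smul_sum]
      · rw [gradP_apply, Finset.mul_sum]
        simp only [mul_smul_comm]
    · rw [Finset.sum_comm]
      simp only [Finset.sum_ite_eq, Finset.mem_univ, if_true, gradSym, Finset.sum_mul,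
        Finset.smul_sum]
      refine Finset.sum_congr rfl fun j _ => ?_
      rw [mul_smul, smul_mul_assoc, smul_mul_assoc]
  have h2 : partialX a (divergence V) = (((p + q : ℕ) : ℝ) / 2) • partialX a f := by
    rw [hV.divergence_eq]; exact (partialX a).map_smul _ _
  rw [lieDer_apply, lieDer_apply, ← h1]
  simp only [map_add, map_sub, map_sum, map_smul, dx_smul, dx_mul, dx_X, zero_mul, add_zero, h2,
    dp_dx_comm, dx_comm a, Finset.sum_add_distrib, smul_add, smul_assoc, mul_smul]
  abel

theorem dp_lieDer {n : ℕ} (V : Fin n → Smooth n) (δ : ℝ) (a : Fin n) (P : Symbol n) :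
    dp a (lieDer δ V P) = lieDer δ V (dp a P) - ∑ i, partialX i (V a) • dp i P := by
  simp only [lieDer_apply, map_add, map_sub, map_sum, map_smul, dp_smul, dp_mul, dp_X,
    dp_dx_comm, dp_dp_comm a, smul_add, Finset.sum_add_distrib, ite_mul, one_mul, zero_mul,
    smul_ite, smul_zero, Finset.sum_ite_eq', Finset.mem_univ, if_true]
  abel

theorem opG_apply (P : Symbol (p + q)) : opG p q P = ∑ i, sgn p q i • (X i * dx i P) := by
  simp [opG]

theorem opD_apply (P : Symbol (p + q)) : opD p q P = ∑ i, dx i (dp i P) := by simp [opD]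

theorem opL_apply (P : Symbol (p + q)) : opL p q P = ∑ i, sgn p q i • dx i (dx i P) := by
  simp [opL]

theorem opR_apply (P : Symbol (p + q)) : opR p q P = metricR p q * P := rfl

theorem dp_eulerP {n : ℕ} (a : Fin n) (P : Symbol n) :
    dp a (eulerP P) = eulerP (dp a P) + dp a P := by
  simp only [eulerP_apply, map_sum, dp_mul, dp_X, ite_mul, one_mul, zero_mul,
    Finset.sum_add_distrib, Finset.sum_ite_eq', Finset.mem_univ, if_true, dp_dp_comm a]

theorem eulerP_dx {n : ℕ} (a : Fin n) (P : Symbol n) : eulerP (dx a P) = dx a (eulerP P) := by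
  simp only [eulerP_apply, map_sum, dx_mul, dx_X, zero_mul, add_zero, dp_dx_comm]

theorem eulerP_mul {n : ℕ} (P Q : Symbol n) : eulerP (P * Q) = P * eulerP Q + eulerP P * Q := by
  simp only [eulerP_apply, dp_mul, mul_add, Finset.sum_add_distrib, Finset.mul_sum, Finset.sum_mul,
    mul_left_comm _ P, mul_assoc]

theorem eulerP_smul {n : ℕ} (g : Smooth n) (P : Symbol n) : eulerP (g • P) = g • eulerP P := by
  simp only [eulerP_apply, dp_smul, mul_smul_comm, Finset.smul_sum]

theorem eulerP_X {n : ℕ} (i : Fin n) : eulerP (X i : Symbol n) = X i := by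
  simp [eulerP_apply, dp_X]

theorem eulerP_metricR : eulerP (metricR p q) = (2 : ℝ) • metricR p q := by
  rw [eulerP_apply]
  simp only [dp_metricR]
  simp only [metricR, Finset.smul_sum, pow_two, mul_smul_comm]
  exact Finset.sum_congr rfl fun i _ => smul_comm _ _ _

/-- Trace-free symbols with `p_i ∂_{p_i} P = κ P`. -/
def TraceFree (p q : ℕ) (κ : ℝ) (P : Symbol (p + q)) : Prop :=
  opT p q P = 0 ∧ eulerP P = κ • P

end Commutators

section Commutators

variable {p q : ℕ} {V : Fin (p + q) → Smooth (p + q)} {f : Smooth (p + q)}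

theorem TraceFree.eulerP_dp {κ : ℝ} {P : Symbol (p + q)} (hP : TraceFree p q κ P)
    (a : Fin (p + q)) : eulerP (dp a P) = (κ - 1) • dp a P := by
  have := dp_eulerP a P
  rw [hP.2, map_smul] at this
  rw [sub_smul, one_smul, this, add_sub_cancel_right]

theorem sum_X_gradP_dp (P : Symbol (p + q)) :
    ∑ a, X a * gradP f (dp a P) = ∑ i, partialX i f • eulerP (dp i P) := by
  simp only [gradP_apply, eulerP_apply, Finset.mul_sum, Finset.smul_sum, mul_smul_comm]
  rw [Finset.sum_comm]
  exact Finset.sum_congr rfl fun i _ => Finset.sum_congr rfl fun a _ => by rw [dp_dp_comm]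

/-- The contribution of `gradSym` is a multiple of `T P` and disappears; the Euler operator
contributes the degree. What remains is proportional to `gradP f P`, with a coefficient that the
weight can make zero. -/
theorem KillingEq.opD_lieDer (hV : KillingEq p q V f) (δ : ℝ) {κ : ℝ} {P : Symbol (p + q)}
    (hP : TraceFree p q κ P) :
    opD p q (lieDer δ V P) = lieDer δ V (opD p q P) +
      (((p + q : ℕ) : ℝ) / 2 * (δ - 1) - (κ - 1)) • gradP f P := by
  have h1 : ∑ a, sgn p q a • (gradSym p q f * dp a (dp a P)) = 0 := by
    simp only [← mul_smul_comm, ← Finset.mul_sum]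
    rw [← opT_apply, hP.1, mul_zero]
  have h2 : ∑ a, ∑ i, dx a (partialX i (V a) • dp i P) =
      ∑ a, ∑ i, partialX a (V i) • dx i (dp a P) +
        (((p + q : ℕ) : ℝ) / 2) • gradP f P := by
    have hi : ∀ i, ∑ a, partialX a (partialX i (V a)) = (((p + q : ℕ) : ℝ) / 2) • partialX i f := by
      intro i
      rw [← (partialX i).map_smul, ← hV.divergence_eq, divergence, map_sum]
      exact Finset.sum_congr rfl fun a _ => partialX_comm _ _ _
    have e : ∑ a, ∑ i, partialX a (partialX i (V a)) • dp i P =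
        (((p + q : ℕ) : ℝ) / 2) • gradP f P := by
      rw [Finset.sum_comm, gradP_apply, Finset.smul_sum]
      exact Finset.sum_congr rfl fun i _ => by rw [← Finset.sum_smul, hi, smul_assoc]
    rw [← e, Finset.sum_comm (f := fun a i => partialX a (V i) • dx i (dp a P)),
      ← Finset.sum_add_distrib]
    refine Finset.sum_congr rfl fun a _ => ?_
    rw [← Finset.sum_add_distrib]
    exact Finset.sum_congr rfl fun i _ => dx_smul _ _ _
  have h3 : ∑ a, partialX a f • eulerP (dp a P) = (κ - 1) • gradP f P := by
    rw [gradP_apply, Finset.smul_sum]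
    exact Finset.sum_congr rfl fun a _ => by rw [hP.eulerP_dp, smul_comm]
  have h4 : ∀ a, dx a (dp a (lieDer δ V P)) = lieDer δ V (dx a (dp a P)) +
      ∑ i, partialX a (V i) • dx i (dp a P) -
      (1 / 2 : ℝ) • (partialX a f • eulerP (dp a P) + X a * gradP f (dp a P)
        - sgn p q a • (gradSym p q f * dp a (dp a P))) +
      (δ * (((p + q : ℕ) : ℝ) / 2)) • partialX a f • dp a P -
      ∑ i, dx a (partialX i (V a) • dp i P) := fun a => by
    rw [dp_lieDer, map_sub, hV.dx_lieDer, map_sum]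
  rw [opD_apply, Finset.sum_congr rfl fun a _ => h4 a, Finset.sum_sub_distrib,
    Finset.sum_add_distrib, Finset.sum_sub_distrib, Finset.sum_add_distrib, h2, ← map_sum,
    ← opD_apply, ← Finset.smul_sum, ← Finset.smul_sum, ← gradP_apply, Finset.sum_sub_distrib,
    Finset.sum_add_distrib, h1, sum_X_gradP_dp, h3]
  module

theorem lieDer_X {n : ℕ} (V : Fin n → Smooth n) (a : Fin n) :
    lieDer 0 V (X a) = - ∑ j, partialX a (V j) • X j := by
  simp [lieDer_apply, dx_X, dp_X]

/-- Only the symmetric part of the Jacobian of `V`, with one index raised, meets a symmetric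
expression, and by the Killing equation that part is a multiple of the inverse metric. -/
theorem KillingEq.symm_sum (hV : KillingEq p q V f) (Z : Fin (p + q) → Fin (p + q) → Symbol (p + q)) :
    ∑ a, ∑ i, sgn p q a • partialX a (V i) • (Z a i + Z i a) = f • ∑ a, sgn p q a • Z a a := by
  have h : ∀ a i, sgn p q a • partialX a (V i) + sgn p q i • partialX i (V a) =
      if a = i then sgn p q a • f else 0 := by
    intro a i
    have h := congrArg (fun w => (sgn p q a * sgn p q i) • w) (hV a i)
    simp only [smul_add, smul_smul] at h
    rw [mul_assoc, sgn_mul_self, mul_one, mul_right_comm, sgn_mul_self, one_mul] at h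
    rw [h]
    split_ifs with hij
    · subst hij; rw [sgn_mul_self, one_smul]
    · rw [smul_zero]
  have h2 : ∑ a, ∑ i, sgn p q a • partialX a (V i) • Z i a =
      ∑ a, ∑ i, sgn p q i • partialX i (V a) • Z a i := Finset.sum_comm
  simp only [smul_add, Finset.sum_add_distrib, h2]
  simp only [← Finset.sum_add_distrib, ← smul_assoc, ← add_smul, h, ite_smul, zero_smul,
    Finset.sum_ite_eq, Finset.mem_univ, if_true]
  rw [Finset.smul_sum]
  exact Finset.sum_congr rfl fun a _ => by rw [smul_assoc, smul_comm]

/-- The term with `f` is the shift of weight due to the inverse metric in `G`. The two terms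
proportional to `κ` cancel, and the multiple of `R` will be removed by the trace-free projection. -/
theorem KillingEq.opG_lieDer (hV : KillingEq p q V f) (δ : ℝ) {κ : ℝ} {P : Symbol (p + q)}
    (hP : TraceFree p q κ P) :
    opG p q (lieDer δ V P) = lieDer δ V (opG p q P) + f • opG p q P +
      (((p + q : ℕ) : ℝ) / 2 * δ) • (gradSym p q f * P)
      - (1 / 2 : ℝ) • (metricR p q * gradP f P) := by
  have h1 : ∑ a, sgn p q a • (X a * lieDer δ V (dx a P)) = lieDer δ V (opG p q P) +
      ∑ a, ∑ j, sgn p q a • partialX a (V j) • (X j * dx a P) := by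
    rw [opG_apply, map_sum, ← Finset.sum_add_distrib]
    refine Finset.sum_congr rfl fun a _ => ?_
    rw [map_smul, lieDer_mul, lieDer_X, ← Finset.smul_sum, ← smul_add]
    congr 1
    simp only [neg_mul, Finset.sum_mul, smul_mul_assoc]
    abel
  have h2 := hV.symm_sum fun a i => X i * dx a P
  have h3 : ∑ a, sgn p q a • (X a * (X a * gradP f P)) = metricR p q * gradP f P := by
    simp only [metricR, Finset.sum_mul, pow_two, smul_mul_assoc, mul_assoc]
  have h4 : ∑ a, sgn p q a • (X a * sgn p q a • (gradSym p q f * dp a P)) =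
      κ • (gradSym p q f * P) := by
    rw [← mul_smul_comm, ← hP.2, eulerP_apply, Finset.mul_sum]
    refine Finset.sum_congr rfl fun a _ => ?_
    rw [mul_smul_comm, sgn_smul_sgn_smul, mul_left_comm]
  have h5 : ∑ a, sgn p q a • (X a * (partialX a f • P)) = gradSym p q f * P := by
    simp only [gradSym, Finset.sum_mul, smul_mul_assoc, mul_smul_comm]
  have h6 : ∑ a, sgn p q a • (X a * (partialX a f • eulerP P)) = κ • (gradSym p q f * P) := by
    rw [← mul_smul_comm, gradSym, Finset.sum_mul, hP.2]
    exact Finset.sum_congr rfl fun a _ => by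
      rw [smul_mul_assoc, smul_mul_assoc, mul_smul_comm]
  have h7 : ∑ a, ∑ j, sgn p q a • partialX a (V j) • (X j * dx a P) +
      ∑ a, sgn p q a • (X a * ∑ i, partialX a (V i) • dx i P) = f • opG p q P := by
    rw [opG_apply, ← h2, ← Finset.sum_add_distrib]
    refine Finset.sum_congr rfl fun a _ => ?_
    rw [Finset.mul_sum, Finset.smul_sum, ← Finset.sum_add_distrib]
    exact Finset.sum_congr rfl fun i _ => by rw [smul_add, smul_add, mul_smul_comm]
  have h8 : ∀ a, sgn p q a • (X a * dx a (lieDer δ V P)) =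
      sgn p q a • (X a * lieDer δ V (dx a P)) +
      sgn p q a • (X a * ∑ i, partialX a (V i) • dx i P) -
      (1 / 2 : ℝ) • (sgn p q a • (X a * (partialX a f • eulerP P)) +
        sgn p q a • (X a * (X a * gradP f P)) -
        sgn p q a • (X a * sgn p q a • (gradSym p q f * dp a P))) +
      (δ * (((p + q : ℕ) : ℝ) / 2)) • sgn p q a • (X a * (partialX a f • P)) := fun a => by
    rw [hV.dx_lieDer]
    simp only [mul_add, mul_sub, mul_smul_comm (_ : ℝ)]
    module
  rw [opG_apply, Finset.sum_congr rfl fun a _ => h8 a, Finset.sum_add_distrib,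
    Finset.sum_sub_distrib, Finset.sum_add_distrib, h1, ← Finset.smul_sum, ← Finset.smul_sum, h5,
    Finset.sum_sub_distrib, Finset.sum_add_distrib, h4, h3, h6, add_assoc, h7]
  module

/-- The first derivative formula is applied twice; since the Hessian of `f` is zero, the second
derivative passes through all the terms containing the gradient of `f`. -/
theorem KillingEq.opL_lieDer (hV : KillingEq p q V f) (hn : 3 ≤ p + q) (δ : ℝ) {κ : ℝ}
    {P : Symbol (p + q)} (hP : TraceFree p q κ P) :
    opL p q (lieDer δ V P) = lieDer δ V (opL p q P) + f • opL p q P +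
      (((p + q : ℕ) : ℝ) * δ - κ + 1 - ((p + q : ℕ) : ℝ) / 2) • gradX p q f P
      - opG p q (gradP f P) + gradSym p q f * opD p q P := by
  have hc := hV.hessian_eq_zero hn
  have hS : ∀ a, dx a (gradSym p q f) = 0 := fun a => by
    simp [gradSym, dx_smul, dx_X, hc]
  have hg : ∀ a (P : Symbol (p + q)), dx a (gradP f P) = gradP f (dx a P) := fun a P => by
    simp [gradP_apply, dx_smul, hc, dp_dx_comm]
  have h1 : ∀ a, sgn p q a • dx a (dx a (lieDer δ V P)) =
      sgn p q a • lieDer δ V (dx a (dx a P)) +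
      ∑ i, sgn p q a • partialX a (V i) • (dx a (dx i P) + dx i (dx a P)) +
      ∑ i, (sgn p q a • partialX a (partialX a (V i))) • dx i P +
      (δ * ((p + q : ℕ) : ℝ) - κ) • sgn p q a • partialX a f • dx a P -
      sgn p q a • (X a * dx a (gradP f P)) + gradSym p q f * dx a (dp a P) := fun a => by
    have e1 : eulerP (dx a P) = κ • dx a P := by rw [eulerP_dx, hP.2, map_smul]
    have e2 : dx a (∑ i, partialX a (V i) • dx i P) = ∑ i, partialX a (V i) • dx a (dx i P) +
        ∑ i, partialX a (partialX a (V i)) • dx i P := by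
      rw [map_sum, ← Finset.sum_add_distrib]
      exact Finset.sum_congr rfl fun i _ => dx_smul _ _ _
    rw [hV.dx_lieDer]
    simp only [map_add, map_sub, map_smul, e2, hV.dx_lieDer, dx_smul, hc, zero_smul, add_zero,
      hP.2, e1, dx_mul, dx_X, zero_mul, hS, hg, dp_dx_comm, smul_add, Finset.sum_add_distrib]
    simp only [smul_sub, smul_add, Finset.smul_sum, smul_assoc,
      smul_comm (partialX a f) κ, smul_comm _ (sgn p q a) (gradSym p q f * _), sgn_smul_sgn_smul]
    generalize partialX a f • dx a P = W
    module
  have h2 := hV.symm_sum fun a i => dx a (dx i P)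
  have h3 : ∑ a, ∑ i, (sgn p q a • partialX a (partialX a (V i))) • dx i P =
      (1 - ((p + q : ℕ) : ℝ) / 2) • gradX p q f P := by
    rw [Finset.sum_comm, gradX_apply, Finset.smul_sum]
    refine Finset.sum_congr rfl fun i _ => ?_
    rw [← Finset.sum_smul, ← smul_assoc, ← smul_assoc]
    congr 1
    simp only [hV.partialX_partialX, if_true, smul_sub, smul_add, smul_ite, smul_zero,
      Finset.sum_sub_distrib, Finset.sum_add_distrib, Finset.sum_ite_eq', Finset.mem_univ, smul_smul]
    have e : ∀ a, sgn p q a * (1 / 2 * (sgn p q a * sgn p q i)) = 1 / 2 * sgn p q i := fun a => by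
      linear_combination (1 / 2 * sgn p q i) * sgn_mul_self p q a
    simp only [e, Finset.sum_const, Finset.card_univ, Fintype.card_fin]
    rw [← Nat.cast_smul_eq_nsmul ℝ]
    module
  rw [opL_apply, Finset.sum_congr rfl fun a _ => h1 a, Finset.sum_add_distrib,
    Finset.sum_sub_distrib, Finset.sum_add_distrib, Finset.sum_add_distrib,
    Finset.sum_add_distrib, h2, h3, ← Finset.mul_sum, ← opD_apply, ← opG_apply, ← opL_apply,
    ← Finset.smul_sum, ← gradX_apply]
  have h4 : ∑ a, sgn p q a • lieDer δ V (dx a (dx a P)) = lieDer δ V (opL p q P) := by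
    rw [opL_apply, map_sum]
    exact Finset.sum_congr rfl fun a _ => (map_smul _ _ _).symm
  rw [h4]
  module

end Commutators

section Commutators

variable {p q : ℕ} {V : Fin (p + q) → Smooth (p + q)} {f : Smooth (p + q)}

theorem KillingEq.lieDer_weight (hV : KillingEq p q V f) (δ δ' : ℝ) (P : Symbol (p + q)) :
    lieDer δ' V P = lieDer δ V P + ((δ' - δ) * (((p + q : ℕ) : ℝ) / 2)) • f • P := by
  rw [lieDer_apply, lieDer_apply, hV.divergence_eq, smul_assoc]
  module

/-- The divergence is `n f / 2`, so a term `f P` in a commutator is absorbed by raising the weight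
by `2/n`, one unit of `j`. -/
theorem KillingEq.lieDer_add_two_div (hV : KillingEq p q V f) (hn : 3 ≤ p + q) (δ : ℝ)
    (P : Symbol (p + q)) :
    lieDer (δ + 2 / ((p + q : ℕ) : ℝ)) V P = lieDer δ V P + f • P := by
  have h0 : ((p + q : ℕ) : ℝ) ≠ 0 := by
    have : 0 < p + q := by omega
    positivity
  rw [hV.lieDer_weight δ, add_sub_cancel_left,
    show (2 : ℝ) / ((p + q : ℕ) : ℝ) * (((p + q : ℕ) : ℝ) / 2) = 1 by field_simp, one_smul]

theorem KillingEq.opR_lieDer (hV : KillingEq p q V f) (hn : 3 ≤ p + q) (δ : ℝ)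
    (P : Symbol (p + q)) :
    opR p q (lieDer δ V P) = lieDer (δ + 2 / ((p + q : ℕ) : ℝ)) V (opR p q P) := by
  rw [hV.lieDer_add_two_div hn, opR_apply, opR_apply, lieDer_mul, lieDer_metricR hV, neg_mul,
    smul_mul_assoc, neg_add_cancel_right]

theorem eulerP_monomial {n : ℕ} (d : Fin n →₀ ℕ) (g : Smooth n) :
    eulerP (monomial d g) = (d.degree : ℝ) • monomial d g := by
  have h : (monomial d g : Symbol n).IsHomogeneous d.degree := isHomogeneous_monomial g rfl
  rw [eulerP_apply, Nat.cast_smul_eq_nsmul]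
  exact h.sum_X_mul_pderiv

theorem coeff_eulerP {n : ℕ} (P : Symbol n) (d : Fin n →₀ ℕ) :
    (eulerP P).coeff d = (d.degree : ℝ) • P.coeff d := by
  induction P using MvPolynomial.induction_on' with
  | add P Q hP hQ => rw [map_add, coeff_add, coeff_add, hP, hQ, smul_add]
  | monomial e g =>
    rw [eulerP_monomial, coeff_smul, coeff_monomial]
    split_ifs with h
    · rw [h]
    · simp

/-- The Euler operator multiplies each coefficient by its degree, and characteristic zero separates
degrees. Working with eigenvalues in `ℝ` lets degrees drop without truncated subtraction. -/
theorem isHomogeneous_iff_eulerP {n k : ℕ} {P : Symbol n} :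
    P.IsHomogeneous k ↔ eulerP P = (k : ℝ) • P := by
  constructor
  · intro h
    rw [eulerP_apply, Nat.cast_smul_eq_nsmul]
    exact h.sum_X_mul_pderiv
  · intro h d hd
    have h1 := coeff_eulerP P d
    rw [h, coeff_smul] at h1
    have h2 : ((k : ℝ) - d.degree) • P.coeff d = 0 := by rw [sub_smul, h1, sub_self]
    have h3 := (smul_eq_zero.mp h2).resolve_right hd
    have h4 : (k : ℝ) = d.degree := sub_eq_zero.mp h3
    have h5 : Finsupp.weight (1 : Fin n → ℕ) d = d.degree := by
      rw [Finsupp.degree_eq_weight_one]; rfl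
    rw [h5]
    exact_mod_cast h4.symm

theorem traceFree_iff {k : ℕ} {P : Symbol (p + q)} :
    TraceFree p q k P ↔ P ∈ sym p q k 0 := by
  constructor
  · rintro ⟨h1, h2⟩
    exact ⟨isHomogeneous_iff_eulerP.mpr h2, P, h1, by rw [pow_zero, one_mul]⟩
  · rintro ⟨h1, Q, h2, rfl⟩
    rw [pow_zero, one_mul] at h1 ⊢
    exact ⟨h2, isHomogeneous_iff_eulerP.mp h1⟩

theorem TraceFree.isHomogeneous {k : ℕ} {P : Symbol (p + q)} (hP : TraceFree p q k P) :
    P.IsHomogeneous k := isHomogeneous_iff_eulerP.mpr hP.2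

theorem TraceFree.eulerP_opD {κ : ℝ} {P : Symbol (p + q)} (hP : TraceFree p q κ P) :
    TraceFree p q (κ - 1) (opD p q P) := by
  refine ⟨by rw [opT_opD, hP.1, map_zero], ?_⟩
  rw [opD_apply, map_sum, Finset.smul_sum]
  exact Finset.sum_congr rfl fun i _ => by rw [eulerP_dx, hP.eulerP_dp, map_smul]

theorem opT_dx (a : Fin (p + q)) (P : Symbol (p + q)) : opT p q (dx a P) = dx a (opT p q P) := by
  simp only [opT_apply, map_sum, map_smul, dp_dx_comm]

theorem opT_smul (g : Smooth (p + q)) (P : Symbol (p + q)) : opT p q (g • P) = g • opT p q P := by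
  simp only [opT_apply, dp_smul, Finset.smul_sum, smul_comm g]

theorem TraceFree.opL {κ : ℝ} {P : Symbol (p + q)} (hP : TraceFree p q κ P) :
    TraceFree p q κ (opL p q P) := by
  refine ⟨?_, ?_⟩
  · rw [opL_apply, map_sum]
    exact Finset.sum_eq_zero fun i _ => by
      rw [map_smul, opT_dx, opT_dx, hP.1, map_zero, map_zero, smul_zero]
  · rw [opL_apply, map_sum, Finset.smul_sum]
    exact Finset.sum_congr rfl fun i _ => by
      rw [map_smul, eulerP_dx, eulerP_dx, hP.2, map_smul, map_smul, smul_comm]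

theorem TraceFree.opL_pow {κ : ℝ} {P : Symbol (p + q)} (hP : TraceFree p q κ P) (b : ℕ) :
    TraceFree p q κ ((ConfSymbols.opL p q ^ b) P) := by
  induction b with
  | zero => exact hP
  | succ b ih => rw [pow_succ']; exact ih.opL

theorem TraceFree.opD_pow {κ : ℝ} {P : Symbol (p + q)} (hP : TraceFree p q κ P) (d : ℕ) :
    TraceFree p q (κ - d) ((opD p q ^ d) P) := by
  induction d with
  | zero => simpa using hP
  | succ d ih =>
    rw [pow_succ']
    have := ih.eulerP_opD
    rwa [sub_sub, ← Nat.cast_succ] at this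

theorem opG_isHomogeneous {k : ℕ} {P : Symbol (p + q)} (hP : TraceFree p q k P) :
    eulerP (opG p q P) = ((k : ℝ) + 1) • opG p q P := by
  rw [opG_apply, map_sum, Finset.smul_sum]
  refine Finset.sum_congr rfl fun i _ => ?_
  rw [map_smul, eulerP_mul, eulerP_X, eulerP_dx, hP.2, map_smul, mul_smul_comm]
  module

theorem TraceFree.opG₀ (hn : 3 ≤ p + q) {k : ℕ} {P : Symbol (p + q)} (hP : TraceFree p q k P) :
    TraceFree p q (k + 1 : ℕ) (opG₀ p q k P) := by
  refine ⟨opT_opG₀ hn hP.isHomogeneous hP.1, ?_⟩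
  have e : ConfSymbols.opG₀ p q k P = opG p q P
      - ((p : ℝ) + q + 2 * k - 2)⁻¹ • opR p q (opD p q P) := rfl
  rw [e, map_sub, opG_isHomogeneous hP, map_smul, opR_apply, eulerP_mul, eulerP_metricR,
    hP.eulerP_opD.2, mul_smul_comm, smul_mul_assoc, Nat.cast_succ]
  module

theorem TraceFree.opG₀pow (hn : 3 ≤ p + q) {k : ℕ} {P : Symbol (p + q)} (hP : TraceFree p q k P)
    (g : ℕ) : TraceFree p q (k + g : ℕ) (opG₀pow p q k g P) := by
  induction g with
  | zero => exact hP
  | succ g ih => exact ih.opG₀ hn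

/-- Multiplication by the gradient of `f`, followed by the trace-free projection. -/
def gradSym₀ (p q : ℕ) (f : Smooth (p + q)) (k : ℕ) : Module.End ℝ (Symbol (p + q)) :=
  LinearMap.mulLeft ℝ (gradSym p q f) -
    ((p : ℝ) + q + 2 * k - 2)⁻¹ • (opR p q * gradP f)

theorem gradSym₀_apply (k : ℕ) (P : Symbol (p + q)) : gradSym₀ p q f k P =
    gradSym p q f * P - ((p : ℝ) + q + 2 * k - 2)⁻¹ • (metricR p q * gradP f P) := rfl

theorem opG₀_apply (k : ℕ) (P : Symbol (p + q)) : opG₀ p q k P =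
    opG p q P - ((p : ℝ) + q + 2 * k - 2)⁻¹ • (metricR p q * opD p q P) := rfl

theorem denom_pos (hn : 3 ≤ p + q) (k : ℕ) : 0 < (p : ℝ) + q + 2 * k - 2 := by
  have hn' : (3 : ℝ) ≤ p + q := by exact_mod_cast hn
  have : (0 : ℝ) ≤ k := k.cast_nonneg
  linarith

/-- The commutators of `G` and of `R D` both contain `R gradP f P`. With the factor `1/(n + 2k - 2)`
their sum is exactly what completes `gradSym` to its trace-free part. -/
theorem KillingEq.opG₀_lieDer (hV : KillingEq p q V f) (hn : 3 ≤ p + q) (δ : ℝ) {k : ℕ}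
    {P : Symbol (p + q)} (hP : TraceFree p q k P) :
    opG₀ p q k (lieDer δ V P) = lieDer (δ + 2 / ((p + q : ℕ) : ℝ)) V (opG₀ p q k P) +
      (((p + q : ℕ) : ℝ) / 2 * δ) • gradSym₀ p q f k P := by
  have h1 := hV.opR_lieDer hn δ (opD p q P)
  rw [opR_apply, opR_apply] at h1
  rw [opG₀_apply, hV.opG_lieDer δ hP, hV.opD_lieDer δ hP, mul_add, h1, mul_smul_comm, opG₀_apply,
    map_sub, map_smul, gradSym₀_apply, hV.lieDer_add_two_div hn δ (opG p q P)]
  have hne := (denom_pos hn k).ne'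
  generalize f • opG p q P = W
  generalize metricR p q * gradP f P = Z
  match_scalars <;> field_simp <;> ring

theorem gradP_mul {n : ℕ} (f : Smooth n) (P Q : Symbol n) :
    gradP f (P * Q) = P * gradP f Q + gradP f P * Q := by
  simp only [gradP_apply, dp_mul, smul_add, Finset.sum_add_distrib, Finset.mul_sum, Finset.sum_mul,
    mul_smul_comm, smul_mul_assoc]

theorem gradP_metricR : gradP f (metricR p q) = (2 : ℝ) • gradSym p q f := by
  simp only [gradP_apply, dp_metricR, gradSym, Finset.smul_sum]
  refine Finset.sum_congr rfl fun i _ => ?_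
  rw [smul_comm (partialX i f) (sgn p q i), smul_comm (partialX i f) (2 : ℝ), smul_comm]

theorem dx_metricR (i : Fin (p + q)) : dx i (metricR p q) = 0 := by
  simp [metricR, pow_two, dx_mul, dx_X]

theorem opD_metricR_mul (P : Symbol (p + q)) :
    opD p q (metricR p q * P) = metricR p q * opD p q P + (2 : ℝ) • opG p q P := by
  simp only [opD_apply, opG_apply, dp_mul, dp_metricR, map_add, dx_mul, dx_metricR, zero_mul,
    add_zero, Finset.sum_add_distrib, Finset.mul_sum, Finset.smul_sum, smul_mul_assoc, map_smul,
    dx_X]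
  congr 1
  exact Finset.sum_congr rfl fun i _ => smul_comm _ _ _

theorem opG_metricR_mul (P : Symbol (p + q)) :
    opG p q (metricR p q * P) = metricR p q * opG p q P := by
  simp only [opG_apply, dx_mul, dx_metricR, zero_mul, add_zero, Finset.mul_sum, mul_smul_comm]
  exact Finset.sum_congr rfl fun i _ => by rw [mul_left_comm]

theorem dx_gradSym (hc : ∀ i j, partialX i (partialX j f) = 0)
    (a : Fin (p + q)) : dx a (gradSym p q f) = 0 := by
  simp [gradSym, dx_smul, dx_X, hc]

theorem dx_gradP (hc : ∀ i j, partialX i (partialX j f) = 0)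
    (a : Fin (p + q)) (P : Symbol (p + q)) :
    dx a (gradP f P) = gradP f (dx a P) := by
  simp [gradP_apply, dx_smul, hc, dp_dx_comm]

theorem gradP_opD (hc : ∀ i j, partialX i (partialX j f) = 0)
    (P : Symbol (p + q)) : gradP f (opD p q P) = opD p q (gradP f P) := by
  simp only [opD_apply, map_sum, gradP_apply, dp_smul, dx_smul, hc, zero_smul, add_zero,
    dp_dx_comm]
  rw [Finset.sum_comm]
  exact Finset.sum_congr rfl fun i _ => Finset.sum_congr rfl fun a _ => by rw [dp_dp_comm]

theorem gradP_opL (hc : ∀ i j, partialX i (partialX j f) = 0)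
    (P : Symbol (p + q)) : gradP f (opL p q P) = opL p q (gradP f P) := by
  simp only [opL_apply, map_sum, map_smul, dx_gradP hc]

theorem gradP_opG (hc : ∀ i j, partialX i (partialX j f) = 0)
    (P : Symbol (p + q)) :
    gradP f (opG p q P) = opG p q (gradP f P) + gradX p q f P := by
  have h : ∀ i, gradP f (X i) = partialX i f • (1 : Symbol (p + q)) := fun i => by
    simp [gradP_apply, dp_X]
  simp only [opG_apply, map_sum, map_smul, dx_gradP hc, gradP_mul, h, gradX_apply, smul_add,
    Finset.sum_add_distrib, smul_mul_assoc, one_mul]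

theorem opD_gradSym_mul (hc : ∀ i j, partialX i (partialX j f) = 0)
    (P : Symbol (p + q)) :
    opD p q (gradSym p q f * P) = gradSym p q f * opD p q P + gradX p q f P := by
  have h : ∀ i, dp i (gradSym p q f) = sgn p q i • partialX i f • 1 := fun i => by
    simp [gradSym, dp_smul, dp_X]
  simp only [opD_apply, dp_mul, map_add, dx_mul, dx_gradSym hc, zero_mul, add_zero, h,
    Finset.sum_add_distrib, Finset.mul_sum, gradX_apply, smul_mul_assoc, one_mul, map_smul,
    dx_smul, hc, zero_smul]

theorem opG_gradSym_mul (hc : ∀ i j, partialX i (partialX j f) = 0)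
    (P : Symbol (p + q)) :
    opG p q (gradSym p q f * P) = gradSym p q f * opG p q P := by
  simp only [opG_apply, dx_mul, dx_gradSym hc, zero_mul, add_zero, Finset.mul_sum, mul_smul_comm]
  exact Finset.sum_congr rfl fun i _ => by rw [mul_left_comm]

theorem opL_gradSym_mul (hc : ∀ i j, partialX i (partialX j f) = 0)
    (P : Symbol (p + q)) :
    opL p q (gradSym p q f * P) = gradSym p q f * opL p q P := by
  simp only [opL_apply, dx_mul, dx_gradSym hc, zero_mul, add_zero, Finset.mul_sum, mul_smul_comm]

theorem opL_gradX (hc : ∀ i j, partialX i (partialX j f) = 0)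
    (P : Symbol (p + q)) :
    opL p q (gradX p q f P) = gradX p q f (opL p q P) := by
  simp only [opL_apply, gradX_apply, map_sum, map_smul, dx_smul, hc, zero_smul, add_zero,
    Finset.smul_sum]
  rw [Finset.sum_comm]
  refine Finset.sum_congr rfl fun i _ => Finset.sum_congr rfl fun a _ => ?_
  rw [dx_comm a i, dx_comm a i, smul_comm (sgn p q i) (sgn p q a)]

/-- `G` commutes with multiplication by the constant covector `gradSym`; the corrections by
multiples of `R` on the two sides agree once denominators are cleared. Hence the errors of
successive factors `G₀` are proportional. -/
theorem opG₀_gradSym₀ (hc : ∀ i j, partialX i (partialX j f) = 0)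
    (hn : 3 ≤ p + q) (k : ℕ) (P : Symbol (p + q)) :
    opG₀ p q (k + 1) (gradSym₀ p q f k P) = gradSym₀ p q f (k + 1) (opG₀ p q k P) := by
  have hne := (denom_pos hn k).ne'
  have hne' := (denom_pos hn (k + 1)).ne'
  simp only [opG₀_apply, gradSym₀_apply, map_sub, map_smul, opG_gradSym_mul hc,
    opD_gradSym_mul hc, opG_metricR_mul, opD_metricR_mul, gradP_mul, gradP_metricR, gradP_opG hc,
    gradP_opD hc, mul_add, mul_smul_comm, smul_mul_assoc, smul_sub, smul_add]
  rw [mul_left_comm (gradSym p q f) (metricR p q)]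
  push_cast at hne' ⊢
  match_scalars <;> field_simp <;> ring

theorem opL_opG (P : Symbol (p + q)) : opL p q (opG p q P) = opG p q (opL p q P) := by
  simp only [opL_apply, opG_apply, map_sum, map_smul, dx_mul, dx_X, zero_mul, add_zero,
    Finset.smul_sum]
  rw [Finset.sum_comm]
  refine Finset.sum_congr rfl fun i _ => Finset.sum_congr rfl fun a _ => ?_
  rw [dx_comm a i, dx_comm a i, smul_comm (sgn p q i) (sgn p q a)]

end Commutators

/-! ### Invariance of `D^d`, `G₀^g` and `𝓛_ℓ` -/

section Powers

variable {p q : ℕ} {V : Fin (p + q) → Smooth (p + q)} {f : Smooth (p + q)}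

theorem end_apply_pow {M : Type*} [AddCommGroup M] [Module ℝ M] (B : Module.End ℝ M) (d : ℕ)
    (P : M) : B ((B ^ d) P) = (B ^ (d + 1)) P := by rw [pow_succ', Module.End.mul_apply]

/-- `gradP f` commutes with `D`, so the errors of the single factors are multiples of one operator.
The degree falls by one at each step, which makes the coefficient the sum of an arithmetic
progression. -/
theorem KillingEq.opD_pow_lieDer (hV : KillingEq p q V f) (hn : 3 ≤ p + q) (δ : ℝ) {κ : ℝ}
    {P : Symbol (p + q)} (hP : TraceFree p q κ P) (d : ℕ) :
    (opD p q ^ (d + 1)) (lieDer δ V P) = lieDer δ V ((opD p q ^ (d + 1)) P) +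
      ((d + 1) * (((p + q : ℕ) : ℝ) / 2 * (δ - 1) - κ + (d + 2) / 2)) •
        gradP f ((opD p q ^ d) P) := by
  have hc := hV.hessian_eq_zero hn
  induction d with
  | zero =>
    simp only [zero_add, pow_one, pow_zero, Module.End.one_apply, hV.opD_lieDer δ hP]
    congr 2
    push_cast; ring
  | succ d ih =>
    rw [← end_apply_pow, ih, map_add, map_smul,
      hV.opD_lieDer δ (hP.opD_pow (d + 1)), ← gradP_opD hc, end_apply_pow, end_apply_pow,
      add_assoc, ← add_smul]
    congr 2
    push_cast; ring

theorem opG₀pow_gradSym₀ (hc : ∀ i j, partialX i (partialX j f) = 0) (hn : 3 ≤ p + q) (k g : ℕ)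
    (P : Symbol (p + q)) :
    opG₀pow p q (k + 1) g (gradSym₀ p q f k P) = gradSym₀ p q f (k + g) (opG₀pow p q k g P) := by
  induction g with
  | zero => rfl
  | succ g ih =>
    rw [opG₀pow, opG₀pow, Module.End.mul_apply, Module.End.mul_apply, ih, add_right_comm,
      opG₀_gradSym₀ hc hn]
    rfl

theorem opG₀pow_succ' (k g : ℕ) :
    opG₀pow p q k (g + 1) = opG₀pow p q (k + 1) g * opG₀ p q k := by
  induction g with
  | zero => simp [opG₀pow]
  | succ g ih =>
    rw [opG₀pow, ih, opG₀pow, ← mul_assoc, add_right_comm k 1 g]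
    rfl

/-- Each factor `G₀` raises the weight by `2/n`, so the coefficients `nδ/2 + i` for `0 ≤ i ≤ g` are
added. -/
theorem KillingEq.opG₀pow_lieDer (hV : KillingEq p q V f) (hn : 3 ≤ p + q) (δ : ℝ) {k : ℕ}
    {P : Symbol (p + q)} (hP : TraceFree p q k P) (g : ℕ) :
    opG₀pow p q k (g + 1) (lieDer δ V P) =
      lieDer (δ + 2 * (g + 1 : ℕ) / ((p + q : ℕ) : ℝ)) V (opG₀pow p q k (g + 1) P) +
      ((g + 1) * (((p + q : ℕ) : ℝ) / 2 * δ + g / 2)) •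
        gradSym₀ p q f (k + g) (opG₀pow p q k g P) := by
  have hc := hV.hessian_eq_zero hn
  have h0 : ((p + q : ℕ) : ℝ) ≠ 0 := by
    have : 0 < p + q := by omega
    positivity
  induction g with
  | zero =>
    have h := hV.opG₀_lieDer hn δ hP
    simp only [opG₀pow, add_zero, mul_one, zero_add, Nat.cast_one, Nat.cast_zero, one_mul,
      zero_div, Module.End.one_apply, h]
  | succ g ih =>
    rw [opG₀pow, Module.End.mul_apply, ih, map_add, map_smul,
      hV.opG₀_lieDer hn _ (hP.opG₀pow hn (g + 1)), ← add_assoc k g 1, opG₀_gradSym₀ hc hn,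
      Module.End.mul_apply, add_assoc, ← Module.End.mul_apply (opG₀ p q (k + g)),
      show opG₀ p q (k + g) * opG₀pow p q k g = opG₀pow p q k (g + 1) from rfl, ← add_smul]
    congr 2
    · congr 1; push_cast; ring
    · generalize ((p + q : ℕ) : ℝ) = N at h0
      push_cast; field_simp; ring

/-- The first order term in the commutator of `L` with a conformal Killing vector field. -/
def lapErr (p q : ℕ) (f : Smooth (p + q)) (c : ℝ) : Module.End ℝ (Symbol (p + q)) :=
  c • gradX p q f - opG p q * gradP f + LinearMap.mulLeft ℝ (gradSym p q f) * opD p q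

theorem lapErr_apply (c : ℝ) (P : Symbol (p + q)) : lapErr p q f c P =
    c • gradX p q f P - opG p q (gradP f P) + gradSym p q f * opD p q P := rfl

theorem opL_opD (P : Symbol (p + q)) : opL p q (opD p q P) = opD p q (opL p q P) := by
  simp only [opL_apply, opD_apply, map_sum, map_smul, Finset.smul_sum, dp_dx_comm]
  rw [Finset.sum_comm]
  refine Finset.sum_congr rfl fun i _ => Finset.sum_congr rfl fun a _ => ?_
  rw [dx_comm a i, dx_comm a i]

theorem opL_lapErr (hc : ∀ i j, partialX i (partialX j f) = 0) (c : ℝ) (P : Symbol (p + q)) :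
    opL p q (lapErr p q f c P) = lapErr p q f c (opL p q P) := by
  rw [lapErr_apply, lapErr_apply, map_add, map_sub, map_smul, opL_gradX hc, opL_opG,
    opL_gradSym_mul hc, gradP_opL hc, opL_opD]

/-- `lapErr` commutes with `L` and is affine in its parameter, which grows by `2` with each factor;
`b + 1` errors therefore amount to `b + 1` times the one with the mean parameter. -/
theorem KillingEq.opL_pow_lieDer (hV : KillingEq p q V f) (hn : 3 ≤ p + q) (δ : ℝ) {κ : ℝ}
    {P : Symbol (p + q)} (hP : TraceFree p q κ P) (b : ℕ) :
    (opL p q ^ (b + 1)) (lieDer δ V P) =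
      lieDer (δ + 2 * (b + 1 : ℕ) / ((p + q : ℕ) : ℝ)) V ((opL p q ^ (b + 1)) P) +
      ((b : ℝ) + 1) • lapErr p q f (((p + q : ℕ) : ℝ) * δ - κ + 1 - ((p + q : ℕ) : ℝ) / 2 + b)
        ((opL p q ^ b) P) := by
  have hc := hV.hessian_eq_zero hn
  have h0 : ((p + q : ℕ) : ℝ) ≠ 0 := by
    have : 0 < p + q := by omega
    positivity
  have h1 : ∀ (δ : ℝ) {P : Symbol (p + q)}, TraceFree p q κ P → opL p q (lieDer δ V P) =
      lieDer (δ + 2 / ((p + q : ℕ) : ℝ)) V (opL p q P) +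
      lapErr p q f (((p + q : ℕ) : ℝ) * δ - κ + 1 - ((p + q : ℕ) : ℝ) / 2) P := by
    intro δ P hP
    rw [hV.opL_lieDer hn δ hP, hV.lieDer_add_two_div hn, lapErr_apply]
    abel
  induction b with
  | zero => simp [h1 δ hP]
  | succ b ih =>
    rw [← end_apply_pow, ih, map_add, map_smul, h1 _ (hP.opL_pow (b + 1)),
      opL_lapErr hc, end_apply_pow, end_apply_pow, add_assoc]
    congr 1
    · congr 2; push_cast; ring
    · have h2 : ((p + q : ℕ) : ℝ) * (δ + 2 * (b + 1 : ℕ) / ((p + q : ℕ) : ℝ)) =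
          ((p + q : ℕ) : ℝ) * δ + 2 * (b + 1) := by
        generalize ((p + q : ℕ) : ℝ) = N at h0
        push_cast; field_simp
      rw [h2]
      simp only [lapErr_apply]
      match_scalars <;> ring

/-- Replacing `gradSym` and `G` by their trace-free versions changes the difference by multiples of
`R` times `gradP f (D P)` and `D (gradP f P)`, which cancel because the two operators commute. -/
theorem lapErr_zero_eq (hc : ∀ i j, partialX i (partialX j f) = 0) (k : ℕ) (P : Symbol (p + q)) :
    lapErr p q f 0 P = gradSym₀ p q f k (opD p q P) - opG₀ p q k (gradP f P) := by
  rw [lapErr_apply, gradSym₀_apply, opG₀_apply, gradP_opD hc]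
  module

theorem TraceFree.dp_eq_zero {P : Symbol (p + q)} (hP : TraceFree p q (0 : ℕ) P)
    (a : Fin (p + q)) : dp a P = 0 := by
  rw [totalDegree_eq_zero_iff_eq_C.mp (Nat.le_zero.mp hP.isHomogeneous.totalDegree_le)]
  simp [dp]

theorem TraceFree.opD_pow_nat {m : ℕ} {P : Symbol (p + q)} (hP : TraceFree p q m P) {i : ℕ}
    (hi : i ≤ m) : TraceFree p q (m - i : ℕ) ((opD p q ^ i) P) := by
  rw [Nat.cast_sub hi]; exact hP.opD_pow i

theorem TraceFree.opD_pow_eq_zero {m : ℕ} {P : Symbol (p + q)} (hP : TraceFree p q m P) {i : ℕ}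
    (hi : m < i) : (opD p q ^ i) P = 0 := by
  have h := hP.opD_pow_nat le_rfl
  rw [Nat.sub_self] at h
  obtain ⟨c, rfl⟩ := Nat.exists_eq_add_of_lt hi
  rw [show m + c + 1 = c + (m + 1) by ring, pow_add, Module.End.mul_apply, ← end_apply_pow,
    opD_apply ((opD p q ^ m) P)]
  simp only [h.dp_eq_zero, map_zero, Finset.sum_const_zero]

theorem TraceFree.gradP_opD_pow_eq_zero {m : ℕ} {P : Symbol (p + q)} (hP : TraceFree p q m P) {i : ℕ}
    (hi : m ≤ i) : ConfSymbols.gradP f ((opD p q ^ i) P) = 0 := by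
  rcases hi.eq_or_lt with rfl | hi
  · have h := hP.opD_pow_nat le_rfl
    rw [Nat.sub_self] at h
    simp only [gradP_apply, h.dp_eq_zero, smul_zero, Finset.sum_const_zero]
  · rw [hP.opD_pow_eq_zero hi, map_zero]

/-- The two families of error terms in the commutator of `𝓛_ℓ` with a conformal Killing field. -/
def errA (p q : ℕ) (f : Smooth (p + q)) (m l i : ℕ) : Module.End ℝ (Symbol (p + q)) :=
  gradSym₀ p q f (m - 1) * opG₀pow p q (m - (i + 1)) i * opL p q ^ (l - (i + 1)) *
    opD p q ^ (i + 1)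

/-- See `errA`. -/
def errB (p q : ℕ) (f : Smooth (p + q)) (m l i : ℕ) : Module.End ℝ (Symbol (p + q)) :=
  opG₀pow p q (m - (i + 1)) (i + 1) * gradP f * opL p q ^ (l - (i + 1)) * opD p q ^ i

theorem errA_eq_zero {m l i : ℕ} {P : Symbol (p + q)} (hP : TraceFree p q m P) (hi : m ≤ i) :
    errA p q f m l i P = 0 := by
  simp only [errA, Module.End.mul_apply, hP.opD_pow_eq_zero (Nat.lt_succ_of_le hi), map_zero]

theorem gradP_opL_pow (hc : ∀ i j, partialX i (partialX j f) = 0) (b : ℕ) (P : Symbol (p + q)) :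
    gradP f ((opL p q ^ b) P) = (opL p q ^ b) (gradP f P) := by
  induction b with
  | zero => rfl
  | succ b ih => rw [← end_apply_pow, gradP_opL hc, ih, end_apply_pow]

theorem errB_eq_zero (hc : ∀ i j, partialX i (partialX j f) = 0) {m l i : ℕ}
    {P : Symbol (p + q)} (hP : TraceFree p q m P) (hi : m ≤ i) :
    errB p q f m l i P = 0 := by
  rw [errB, Module.End.mul_apply, Module.End.mul_apply, Module.End.mul_apply, gradP_opL_pow hc,
    hP.gradP_opD_pow_eq_zero hi, map_zero, map_zero]

theorem TraceFree.lieDer (hV : KillingEq p q V f) {m : ℕ} {P : Symbol (p + q)}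
    (hP : TraceFree p q m P) (δ : ℝ) : TraceFree p q m (lieDer δ V P) :=
  traceFree_iff.mpr (lieDer_mem_sym ⟨f, hV⟩ δ (traceFree_iff.mp hP))

/-- The error of the power of `L` is rewritten in terms of the operators by which the errors of
`D^{i+1}` and `G₀^{i+1}` are expressed, so that they can be compared. For `i = m` both sides vanish,
since `D` cannot be applied to functions of degree zero in `p`. -/
theorem KillingEq.opG₀pow_lapErr (hV : KillingEq p q V f) (hn : 3 ≤ p + q)
    {m l i : ℕ} {P : Symbol (p + q)} (hP : TraceFree p q m P) (hi : i ≤ m) :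
    opG₀pow p q (m - i) i (lapErr p q f 0 ((opL p q ^ (l - (i + 1))) ((opD p q ^ i) P))) =
      errA p q f m l i P - errB p q f m l i P := by
  have hc := hV.hessian_eq_zero hn
  have hD : ∀ (b : ℕ) (P : Symbol (p + q)),
      opD p q ((opL p q ^ b) P) = (opL p q ^ b) (opD p q P) := by
    intro b P
    induction b with
    | zero => rfl
    | succ b ih => rw [← end_apply_pow, ← opL_opD, ih, end_apply_pow]
  rcases hi.eq_or_lt with rfl | hi
  · rw [errA_eq_zero hP le_rfl, errB_eq_zero hc hP le_rfl, lapErr_zero_eq hc 0, hD, end_apply_pow,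
      hP.opD_pow_eq_zero (Nat.lt_succ_self _), gradP_opL_pow hc, hP.gradP_opD_pow_eq_zero le_rfl]
    simp
  · obtain ⟨c, rfl⟩ := Nat.exists_eq_add_of_lt hi
    rw [show i + c + 1 - i = c + 1 by omega, lapErr_zero_eq hc c, hD, end_apply_pow, map_sub,
      opG₀pow_gradSym₀ hc hn, ← Module.End.mul_apply (opG₀pow p q (c + 1) i), ← opG₀pow_succ']
    simp only [errA, errB, Module.End.mul_apply, show i + c + 1 - 1 = c + i by omega,
      show i + c + 1 - (i + 1) = c by omega]

/-- The weight has two effects: the parameter of `lapErr` is zero for every `i`, and the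
coefficients of the errors of `D^i` and of `G₀^i` are opposite. Hence only the differences `errA -
errB` with indices `i - 1` and `i` occur. -/
theorem KillingEq.calL_term_lieDer (hV : KillingEq p q V f) (hn : 3 ≤ p + q) {δ : ℝ} {m l : ℕ}
    (hδ : ((p + q : ℕ) : ℝ) * δ = ((p + q : ℕ) : ℝ) / 2 + m - l)
    {P : Symbol (p + q)} (hP : TraceFree p q m P) {i : ℕ} (hi : i ≤ l) :
    opG₀pow p q (m - i) i ((opL p q ^ (l - i)) ((opD p q ^ i) (lieDer δ V P))) =
      lieDer (δ + 2 * l / ((p + q : ℕ) : ℝ)) V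
        (opG₀pow p q (m - i) i ((opL p q ^ (l - i)) ((opD p q ^ i) P))) +
      (i * (((p + q : ℕ) : ℝ) / 2 + m + l - 1 - i) / 2) •
        (errA p q f m l (i - 1) P - errB p q f m l (i - 1) P) +
      ((l : ℝ) - i) • (errA p q f m l i P - errB p q f m l i P) := by
  have hc := hV.hessian_eq_zero hn
  have h0 : ((p + q : ℕ) : ℝ) ≠ 0 := by
    have : 0 < p + q := by omega
    positivity
  rcases lt_or_ge m i with hmi | hmi
  · rw [(hP.lieDer hV δ).opD_pow_eq_zero hmi, hP.opD_pow_eq_zero hmi,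
      errA_eq_zero hP (by omega : m ≤ i - 1), errB_eq_zero hc hP (by omega : m ≤ i - 1),
      errA_eq_zero hP hmi.le, errB_eq_zero hc hP hmi.le]
    simp
  set Q := (opD p q ^ i) P with hQ
  have hQt : TraceFree p q (m - i : ℕ) Q := hP.opD_pow_nat hmi
  have hQt' : TraceFree p q ((m : ℝ) - i) Q := hP.opD_pow i
  -- The error of `D^i` is of type `errB` with index `i - 1`; for `i = 0` its coefficient is zero.
  have hD : opG₀pow p q (m - i) i ((opL p q ^ (l - i)) ((opD p q ^ i) (lieDer δ V P))) =
      opG₀pow p q (m - i) i ((opL p q ^ (l - i)) (lieDer δ V Q)) -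
      (i * (((p + q : ℕ) : ℝ) / 2 + m + l - 1 - i) / 2) • errB p q f m l (i - 1) P := by
    rcases i with _ | i
    · simp [hQ]
    · have e : ((i : ℝ) + 1) * (((p + q : ℕ) : ℝ) / 2 * (δ - 1) - m + (i + 2) / 2) =
          -((i + 1 : ℕ) * (((p + q : ℕ) : ℝ) / 2 + m + l - 1 - (i + 1 : ℕ)) / 2) := by
        generalize ((p + q : ℕ) : ℝ) = N at *
        push_cast
        linear_combination ((i : ℝ) + 1) / 2 * hδ
      rw [hV.opD_pow_lieDer hn δ hP, map_add, map_add, map_smul, map_smul, e, neg_smul,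
        ← sub_eq_add_neg, ← gradP_opL_pow hc, Nat.add_sub_cancel, ← hQ]
      rfl
  -- With degree `m - i` and exponent `l - i`, the terms in `i` cancel in the parameter of `lapErr`,
  -- and the condition on `δ` makes the rest zero.
  have hL : opG₀pow p q (m - i) i ((opL p q ^ (l - i)) (lieDer δ V Q)) =
      opG₀pow p q (m - i) i (lieDer (δ + 2 * (l - i : ℕ) / ((p + q : ℕ) : ℝ)) V
        ((opL p q ^ (l - i)) Q)) +
      ((l : ℝ) - i) • (errA p q f m l i P - errB p q f m l i P) := by
    rcases hi.eq_or_lt with rfl | hi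
    · simp
    · rw [← hV.opG₀pow_lapErr hn hP hmi]
      obtain ⟨b, rfl⟩ := Nat.exists_eq_add_of_lt hi
      rw [show i + b + 1 - i = b + 1 by omega, show i + b + 1 - (i + 1) = b by omega,
        hV.opL_pow_lieDer hn δ hQt', map_add, map_smul]
      congr 2
      · push_cast; ring
      · congr 3
        generalize ((p + q : ℕ) : ℝ) = N at *
        push_cast at hδ ⊢
        linear_combination hδ
  -- The error of `G₀^i`, in the weight already raised by `L^{l-i}`, is of type `errA` with index `i
  -- - 1`.
  have hG : opG₀pow p q (m - i) i (lieDer (δ + 2 * (l - i : ℕ) / ((p + q : ℕ) : ℝ)) V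
        ((opL p q ^ (l - i)) Q)) = lieDer (δ + 2 * l / ((p + q : ℕ) : ℝ)) V
        (opG₀pow p q (m - i) i ((opL p q ^ (l - i)) Q)) +
      (i * (((p + q : ℕ) : ℝ) / 2 + m + l - 1 - i) / 2) • errA p q f m l (i - 1) P := by
    rcases i with _ | i
    · simp [opG₀pow]
    · rw [hV.opG₀pow_lieDer hn _ (hQt.opL_pow _)]
      have hA : errA p q f m l i P = gradSym₀ p q f (m - (i + 1) + i)
          (opG₀pow p q (m - (i + 1)) i ((opL p q ^ (l - (i + 1))) Q)) := by
        simp only [errA, Module.End.mul_apply, show m - (i + 1) + i = m - 1 by omega, hQ]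
      rw [Nat.add_sub_cancel, hA, Nat.cast_sub hi]
      congr 2
      · congr 1
        field_simp; push_cast; ring
      · have h1 : ((p + q : ℕ) : ℝ) * (δ + 2 * ((l : ℝ) - (i + 1 : ℕ)) / ((p + q : ℕ) : ℝ)) =
          ((p + q : ℕ) : ℝ) * δ + 2 * ((l : ℝ) - (i + 1 : ℕ)) := by
          generalize ((p + q : ℕ) : ℝ) = N at *
          field_simp
        generalize ((p + q : ℕ) : ℝ) = N at *
        push_cast at h1 ⊢
        linear_combination ((i : ℝ) + 1) / 2 * h1 + ((i : ℝ) + 1) / 2 * hδ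
  rw [hD, hL, hG]
  module

/-- The coefficients of the operators `𝓛_ℓ`. -/
def calCoeff (n m l : ℕ) : ℕ → ℝ
  | 0 => 1
  | i + 1 => -(2 * ((l : ℝ) - i)) / ((i + 1) * ((n : ℝ) / 2 + m + l - 2 - i)) * calCoeff n m l i

/-- The condition that the `i`-th difference `errA - errB` cancels between the summands `i` and `i +
1`. It can be solved for the next coefficient because `n/2 + m + l - 2 - i ≥ 1/2` for `i < l`. -/
theorem calCoeff_succ (hn : 3 ≤ p + q) (m : ℕ) {l i : ℕ} (hi : i < l) :
    calCoeff (p + q) m l (i + 1) * ((i + 1 : ℕ) *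
      (((p + q : ℕ) : ℝ) / 2 + m + l - 1 - (i + 1 : ℕ)) / 2) +
      calCoeff (p + q) m l i * (l - i) = 0 := by
  have h1 : (3 : ℝ) ≤ ((p + q : ℕ) : ℝ) := by exact_mod_cast hn
  have h2 : (i : ℝ) + 1 ≤ l := by exact_mod_cast hi
  have h3 : (0 : ℝ) ≤ m := m.cast_nonneg
  have h4 : ((p + q : ℕ) : ℝ) / 2 + m + l - 2 - i ≠ 0 := by
    apply ne_of_gt; linarith
  have h5 : (i : ℝ) + 1 ≠ 0 := by positivity
  rw [calCoeff]
  generalize ((p + q : ℕ) : ℝ) = N at *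
  have h6 : N / 2 + m + l - 1 - (i + 1 : ℕ) = N / 2 + m + l - 2 - i := by push_cast; ring
  rw [h6]
  generalize N / 2 + m + l - 2 - (i : ℝ) = D at *
  push_cast
  field_simp
  ring

theorem KillingEq.calL_lieDer (hV : KillingEq p q V f) (hn : 3 ≤ p + q) {δ : ℝ} {m l : ℕ}
    (hδ : ((p + q : ℕ) : ℝ) * δ = ((p + q : ℕ) : ℝ) / 2 + m - l)
    {P : Symbol (p + q)} (hP : TraceFree p q m P) :
    opCalL p q (calCoeff (p + q) m l) m l (lieDer δ V P) =
      lieDer (δ + 2 * l / ((p + q : ℕ) : ℝ)) V (opCalL p q (calCoeff (p + q) m l) m l P) := by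
  simp only [opCalL, LinearMap.sum_apply, LinearMap.smul_apply, Module.End.mul_apply]
  rw [Finset.sum_congr rfl fun i hi => by
    rw [hV.calL_term_lieDer hn hδ hP (Nat.lt_succ_iff.mp (Finset.mem_range.mp hi))]]
  simp only [smul_add, Finset.sum_add_distrib, map_sum, map_smul]
  -- Shift of the index in the first error sum, whose term `i = 0` is zero; in the second sum the
  -- term `i = l` is zero.
  rw [add_assoc, add_eq_left, Finset.sum_range_succ', Finset.sum_range_succ]
  simp only [Nat.cast_zero, zero_mul, zero_div, zero_smul, smul_zero, add_zero, sub_self,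
    ← Finset.sum_add_distrib, Nat.add_sub_cancel]
  refine Finset.sum_eq_zero fun i hi => ?_
  rw [smul_smul, smul_smul, ← add_smul, calCoeff_succ hn m (Finset.mem_range.mp hi), zero_smul]

end Powers

/-! ### Harmonic polynomials in light-cone coordinates -/

section LightCone

variable {I : Type} [Fintype I] [DecidableEq I]

theorem pderiv_comm (i j : I) (P : MvPolynomial I ℂ) :
    pderiv i (pderiv j P) = pderiv j (pderiv i P) := by
  ext1 m
  simp only [coeff_pderiv, Finsupp.add_apply, add_right_comm m]
  by_cases h : i = j
  · subst h; rfl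
  · simp [Finsupp.single_apply, h, Ne.symm h]; ring

/-- The derivation `X_b ∂_c`. -/
def el (b c : I) : Derivation ℂ (MvPolynomial I ℂ) (MvPolynomial I ℂ) :=
  (X b : MvPolynomial I ℂ) • pderiv c

theorem el_apply (b c : I) (P : MvPolynomial I ℂ) : el b c P = X b * pderiv c P := rfl

/-- The Euler operator. -/
def eul : Derivation ℂ (MvPolynomial I ℂ) (MvPolynomial I ℂ) := ∑ b : I, el b b

theorem eul_apply (P : MvPolynomial I ℂ) : eul P = ∑ b, X b * pderiv b P := by
  simp only [eul, ← el_apply]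
  exact (congrFun (map_sum (Derivation.coeFnAddMonoidHom (R := ℂ) (A := MvPolynomial I ℂ)
    (M := MvPolynomial I ℂ)) (fun b => el b b) Finset.univ) P).trans (Finset.sum_apply _ _ _)

theorem eul_eq_of_isHomogeneous {d : ℕ} {P : MvPolynomial I ℂ} (h : P.IsHomogeneous d) :
    eul P = (d : ℂ) • P := by
  rw [eul_apply, Nat.cast_smul_eq_nsmul]; exact h.sum_X_mul_pderiv

/-- The quadratic form with `⟨e_u, e_v⟩ = 1` in light-cone coordinates. -/
def quad (u v : I) : MvPolynomial I ℂ := ∑ b, X b * X (Equiv.swap u v b)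

/-- The Laplacian in light-cone coordinates. -/
def lap (u v : I) : MvPolynomial I ℂ →ₗ[ℂ] MvPolynomial I ℂ :=
  ∑ b, (pderiv b).toLinearMap ∘ₗ (pderiv (Equiv.swap u v b)).toLinearMap

theorem lap_apply (u v : I) (P : MvPolynomial I ℂ) :
    lap u v P = ∑ b, pderiv b (pderiv (Equiv.swap u v b) P) := by
  simp [lap]

theorem pderiv_X' (i j : I) : pderiv i (X j : MvPolynomial I ℂ) = if j = i then 1 else 0 := by
  rw [pderiv_X, Pi.single_apply]

theorem pderiv_mul' (i : I) (P Q : MvPolynomial I ℂ) :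
    pderiv i (P * Q) = P * pderiv i Q + pderiv i P * Q := by
  rw [Derivation.leibniz, smul_eq_mul, smul_eq_mul, mul_comm Q]

theorem pderiv_quad (u v b : I) :
    pderiv b (quad u v) = (2 : ℂ) • X (Equiv.swap u v b) := by
  have h : ∀ a, (Equiv.swap u v a = b) ↔ (a = Equiv.swap u v b) := fun a =>
    ⟨fun h => by rw [← h, Equiv.swap_apply_self], fun h => by rw [h, Equiv.swap_apply_self]⟩
  simp only [quad, map_sum, pderiv_mul', pderiv_X', Finset.sum_add_distrib, h, mul_ite, mul_one,
    mul_zero, ite_mul, one_mul, zero_mul, Finset.sum_ite_eq', Finset.mem_univ, if_true]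
  rw [two_smul]

/-- The `sl₂` relation between the quadratic form, the Laplacian and the Euler operator. -/
theorem lap_quad_mul (u v : I) (P : MvPolynomial I ℂ) :
    lap u v (quad u v * P) = quad u v * lap u v P + (4 : ℂ) • eul P +
      (2 * (Fintype.card I : ℂ)) • P := by
  have h : ∀ b, pderiv b (pderiv (Equiv.swap u v b) (quad u v * P)) =
      quad u v * pderiv b (pderiv (Equiv.swap u v b) P) +
      (2 : ℂ) • (X b * pderiv b P) +
      (2 : ℂ) • (X (Equiv.swap u v b) * pderiv (Equiv.swap u v b) P) + (2 : ℂ) • P := by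
    intro b
    simp only [pderiv_mul', pderiv_quad, map_add, Derivation.map_smul, smul_mul_assoc,
      Equiv.swap_apply_self, pderiv_X', if_true, one_mul, smul_add]
    abel
  have h2 : ∑ b, X (Equiv.swap u v b) * pderiv (Equiv.swap u v b) P = eul P := by
    rw [eul_apply]
    exact Equiv.sum_comp (Equiv.swap u v) fun b => X b * pderiv b P
  rw [lap_apply, Finset.sum_congr rfl fun b _ => h b, Finset.sum_add_distrib,
    Finset.sum_add_distrib, Finset.sum_add_distrib, ← Finset.mul_sum, ← lap_apply,
    ← Finset.smul_sum, ← Finset.smul_sum, ← eul_apply, h2, Finset.sum_const, Finset.card_univ,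
    ← Nat.cast_smul_eq_nsmul ℂ]
  module

theorem eul_lap {u v : I} {c : ℂ} {P : MvPolynomial I ℂ} (h : eul P = c • P) :
    eul (lap u v P) = (c - 2) • lap u v P := by
  have h1 : ∀ (b : I) (c : ℂ) (P : MvPolynomial I ℂ), eul P = c • P →
      eul (pderiv b P) = (c - 1) • pderiv b P := by
    intro b c P h
    have h2 : pderiv b (eul P) = eul (pderiv b P) + pderiv b P := by
      simp only [eul_apply, map_sum, pderiv_mul', pderiv_X', ite_mul, one_mul, zero_mul,
        Finset.sum_add_distrib, Finset.sum_ite_eq', Finset.mem_univ, if_true, pderiv_comm b]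
    rw [h, Derivation.map_smul] at h2
    rw [sub_smul, one_smul, h2, add_sub_cancel_right]
  rw [lap_apply, map_sum, Finset.smul_sum]
  refine Finset.sum_congr rfl fun b _ => ?_
  rw [h1 b _ _ (h1 _ _ _ h)]
  congr 1; ring

theorem coeff_eul (P : MvPolynomial I ℂ) (d : I →₀ ℕ) :
    (eul P).coeff d = (d.degree : ℂ) * P.coeff d := by
  induction P using MvPolynomial.induction_on' with
  | add P Q hP hQ => rw [map_add, coeff_add, coeff_add, hP, hQ, mul_add]
  | monomial e g =>
    have h : (monomial e g : MvPolynomial I ℂ).IsHomogeneous e.degree := isHomogeneous_monomial g rfl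
    rw [eul_eq_of_isHomogeneous h, coeff_smul, coeff_monomial, smul_eq_mul]
    split_ifs with h
    · rw [h]
    · simp

theorem isHomogeneous_iff_eul {k : ℕ} {P : MvPolynomial I ℂ} :
    P.IsHomogeneous k ↔ eul P = (k : ℂ) • P := by
  refine ⟨eul_eq_of_isHomogeneous, fun h d hd => ?_⟩
  have h1 := coeff_eul P d
  rw [h, coeff_smul, smul_eq_mul] at h1
  have h4 := mul_right_cancel₀ hd h1
  have h5 : Finsupp.weight (1 : I → ℕ) d = d.degree := by
    rw [Finsupp.degree_eq_weight_one]; rfl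
  rw [h5]
  exact_mod_cast h4.symm

theorem eq_zero_of_eul_neg {c : ℝ} (hc : c < 0) {P : MvPolynomial I ℂ}
    (h : eul P = (c : ℂ) • P) : P = 0 := by
  ext1 d
  by_contra hd
  have h1 := coeff_eul P d
  rw [h, coeff_smul, smul_eq_mul] at h1
  have h2 := mul_right_cancel₀ hd h1
  have h3 : c = d.degree := by exact_mod_cast h2
  have : (0 : ℝ) ≤ d.degree := Nat.cast_nonneg _
  linarith

/-- The multiples of the quadratic form that are harmonic vanish. -/
theorem eq_zero_of_lap_quad_mul (u v : I) (hn : 3 ≤ Fintype.card I) {d : ℕ}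
    {s : MvPolynomial I ℂ} (hs : eul s = (d : ℂ) • s) (h : lap u v (quad u v * s) = 0) : s = 0 := by
  have hn' : (3 : ℝ) ≤ Fintype.card I := by exact_mod_cast hn
  have he : ∀ j : ℕ, eul ((lap u v ^ j) s) = (((d : ℝ) - 2 * j : ℝ) : ℂ) • (lap u v ^ j) s := by
    intro j
    induction j with
    | zero => simpa using hs
    | succ j ih =>
      rw [pow_succ', Module.End.mul_apply, eul_lap ih]
      congr 1; push_cast; ring
  -- Applying the Laplacian to the relation for `j` and using the `sl₂` relation gives the one for
  -- `j + 1`. The scalar to be inverted is at least `1` because `c` and the degree are non-negative;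
  -- once the degree is negative both sides are zero.
  have key : ∀ j : ℕ, ∃ c : ℝ, 0 ≤ c ∧
      (lap u v ^ j) s = -((c : ℂ) • (quad u v * (lap u v ^ (j + 1)) s)) := by
    intro j
    have step : ∀ (j : ℕ) (c : ℝ), 0 ≤ c → ∀ e : ℝ, e = (d : ℝ) - 2 * j → 0 ≤ e →
        ∀ A : ℝ, A = 1 + c * (4 * e + 2 * Fintype.card I) → 0 < A := by
      rintro j c hc e - he A rfl
      have : 0 ≤ c * (4 * e + 2 * Fintype.card I) := by positivity
      linarith
    induction j with
    | zero =>
      have h1 := lap_quad_mul u v s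
      rw [h, hs] at h1
      have hA : (0 : ℝ) < 4 * d + 2 * Fintype.card I := by positivity
      refine ⟨(4 * d + 2 * Fintype.card I)⁻¹, by positivity, ?_⟩
      have hA' : ((4 * d + 2 * Fintype.card I : ℝ) : ℂ) ≠ 0 := by exact_mod_cast hA.ne'
      rw [pow_zero, zero_add, pow_one, Module.End.one_apply, ← smul_right_inj hA', smul_neg,
        smul_smul, ← Complex.ofReal_mul, mul_inv_cancel₀ hA.ne', Complex.ofReal_one, one_smul,
        eq_neg_iff_add_eq_zero, h1]
      push_cast
      module
    | succ j ih =>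
      obtain ⟨c, hc, h1⟩ := ih
      by_cases hneg : (d : ℝ) - 2 * (j + 1 : ℕ) < 0
      · refine ⟨0, le_rfl, ?_⟩
        rw [eq_zero_of_eul_neg hneg (he (j + 1))]
        simp
      · have hA := step (j + 1) c hc _ rfl (not_lt.mp hneg) _ rfl
        set A : ℝ := 1 + c * (4 * ((d : ℝ) - 2 * (j + 1 : ℕ)) + 2 * Fintype.card I) with hAdef
        have hA' : (A : ℂ) ≠ 0 := by exact_mod_cast hA.ne'
        refine ⟨c / A, by positivity, ?_⟩
        have h2 := congrArg (lap u v) h1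
        rw [map_neg, map_smul, lap_quad_mul, ← Module.End.mul_apply, ← Module.End.mul_apply,
          ← pow_succ', ← pow_succ', he (j + 1)] at h2
        rw [← smul_right_inj hA', smul_neg, smul_smul, ← Complex.ofReal_mul,
          mul_div_cancel₀ _ hA.ne', hAdef]
        push_cast at h2 ⊢
        linear_combination (norm := module) h2
  -- `d + 1` Laplacians lower the degree below zero; from there the relations `key` are used
  -- downwards to `s` itself.
  have fin : ∀ i : ℕ, i ≤ d + 1 → (lap u v ^ (d + 1 - i)) s = 0 := by
    intro i hi
    induction i with
    | zero =>
      refine eq_zero_of_eul_neg ?_ (he (d + 1 - 0))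
      push_cast
      have : (0 : ℝ) ≤ d := Nat.cast_nonneg _
      linarith
    | succ i ih =>
      obtain ⟨c, -, h1⟩ := key (d + 1 - (i + 1))
      rw [h1, show d + 1 - (i + 1) + 1 = d + 1 - i by omega, ih (by omega), mul_zero, smul_zero,
        neg_zero]
  simpa using fin (d + 1) le_rfl

end LightCone

/-! ### Generation by the highest weight vector and the Fischer pairing -/

section LightCone

variable {I : Type} [Fintype I] [DecidableEq I]

theorem eul_mul {a b : ℂ} {P Q : MvPolynomial I ℂ} (hP : eul P = a • P) (hQ : eul Q = b • Q) :
    eul (P * Q) = (a + b) • (P * Q) := by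
  rw [Derivation.leibniz, hP, hQ, smul_eq_mul, smul_eq_mul, mul_smul_comm, mul_smul_comm,
    mul_comm Q]
  module

theorem eul_X (b : I) : eul (X b : MvPolynomial I ℂ) = (1 : ℂ) • X b := by
  rw [eul_apply, one_smul]
  simp only [pderiv_X', mul_ite, mul_one, mul_zero, Finset.sum_ite_eq, Finset.mem_univ, if_true]

theorem eul_X_pow (b : I) (k : ℕ) : eul (X b ^ k : MvPolynomial I ℂ) = (k : ℂ) • X b ^ k := by
  induction k with
  | zero => simp
  | succ k ih => rw [pow_succ, eul_mul ih (eul_X b)]; push_cast; rfl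

theorem eul_pderiv (b : I) {c : ℂ} {P : MvPolynomial I ℂ} (h : eul P = c • P) :
    eul (pderiv b P) = (c - 1) • pderiv b P := by
  have h2 : pderiv b (eul P) = eul (pderiv b P) + pderiv b P := by
    simp only [eul_apply, map_sum, pderiv_mul', pderiv_X', ite_mul, one_mul, zero_mul,
      Finset.sum_add_distrib, Finset.sum_ite_eq', Finset.mem_univ, if_true, pderiv_comm b]
  rw [h, Derivation.map_smul] at h2
  rw [sub_smul, one_smul, h2, add_sub_cancel_right]

theorem pderiv_pow' (b c : I) (k : ℕ) :
    pderiv b (X c ^ k : MvPolynomial I ℂ) = if c = b then (k : ℂ) • X c ^ (k - 1) else 0 := by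
  rw [Derivation.leibniz_pow, pderiv_X']
  split_ifs
  · rw [smul_eq_mul, mul_one, Nat.cast_smul_eq_nsmul]
  · simp

/-- The indices of the directions transversal to the light cone. -/
def trans (u v : I) : Finset I := Finset.univ.filter fun i => i ≠ u ∧ i ≠ v

theorem mem_trans {u v i : I} : i ∈ trans u v ↔ i ≠ u ∧ i ≠ v := by simp [trans]

theorem sum_eq_trans {M : Type*} [AddCommMonoid M] {u v : I} (huv : u ≠ v) (F : I → M) :
    ∑ i, F i = F u + F v + ∑ i ∈ trans u v, F i := by
  have h : (Finset.univ : Finset I) = insert u (insert v (trans u v)) := by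
    ext i
    simp only [Finset.mem_univ, Finset.mem_insert, mem_trans, true_iff]
    tauto
  rw [h, Finset.sum_insert (by simp [huv, mem_trans]), Finset.sum_insert (by simp [mem_trans]),
    add_assoc]

theorem card_trans {u v : I} (huv : u ≠ v) :
    ((trans u v).card : ℂ) = (Fintype.card I : ℂ) - 2 := by
  have h := sum_eq_trans huv (fun _ => (1 : ℂ))
  simp only [Finset.sum_const, Finset.card_univ, nsmul_eq_mul, mul_one] at h
  rw [h]; ring

/-- The transversal part of the quadratic form. -/
def quadT (u v : I) : MvPolynomial I ℂ := ∑ i ∈ trans u v, X i * X i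

theorem swap_trans {u v i : I} (hi : i ∈ trans u v) : Equiv.swap u v i = i :=
  Equiv.swap_apply_of_ne_of_ne (mem_trans.mp hi).1 (mem_trans.mp hi).2

theorem quad_eq {u v : I} (huv : u ≠ v) :
    quad u v = (2 : ℂ) • (X u * X v) + quadT u v := by
  rw [quad, sum_eq_trans huv, Equiv.swap_apply_left, Equiv.swap_apply_right, mul_comm (X v),
    ← two_smul ℂ, quadT]
  congr 1
  exact Finset.sum_congr rfl fun i hi => by rw [swap_trans hi]

/-- Polynomials in the transversal variables, homogeneous of degree `d`. -/
structure IsTrans (u v : I) (d : ℂ) (Y : MvPolynomial I ℂ) : Prop where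
  eul : eul Y = d • Y
  u : pderiv u Y = 0
  v : pderiv v Y = 0

theorem IsTrans.pderiv {u v : I} {d : ℂ} {Y : MvPolynomial I ℂ} (h : IsTrans u v d Y) (i : I) :
    IsTrans u v (d - 1) (pderiv i Y) :=
  ⟨eul_pderiv i h.eul, by rw [pderiv_comm, h.u, map_zero], by rw [pderiv_comm, h.v, map_zero]⟩

theorem IsTrans.X_mul {u v i : I} {d : ℂ} {Y : MvPolynomial I ℂ} (h : IsTrans u v d Y)
    (hi : i ∈ trans u v) : IsTrans u v (d + 1) (X i * Y) := by
  refine ⟨by rw [eul_mul (eul_X i) h.eul, add_comm], ?_, ?_⟩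
  · rw [pderiv_mul', h.u, pderiv_X', if_neg (mem_trans.mp hi).1]; simp
  · rw [pderiv_mul', h.v, pderiv_X', if_neg (mem_trans.mp hi).2]; simp

theorem IsTrans.sum {u v : I} {d : ℂ} {J : Finset I} {F : I → MvPolynomial I ℂ}
    (h : ∀ i ∈ J, IsTrans u v d (F i)) : IsTrans u v d (∑ i ∈ J, F i) := by
  refine ⟨?_, ?_, ?_⟩
  · rw [map_sum, Finset.smul_sum]; exact Finset.sum_congr rfl fun i hi => (h i hi).eul
  · rw [map_sum]; exact Finset.sum_eq_zero fun i hi => (h i hi).u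
  · rw [map_sum]; exact Finset.sum_eq_zero fun i hi => (h i hi).v

theorem IsTrans.sum_X_mul_pderiv {u v : I} (huv : u ≠ v) {d : ℂ} {Y : MvPolynomial I ℂ}
    (h : IsTrans u v d Y) : ∑ i ∈ trans u v, X i * MvPolynomial.pderiv i Y = d • Y := by
  have := h.eul
  rwa [eul_apply, sum_eq_trans huv, h.u, h.v, mul_zero, mul_zero, zero_add, zero_add] at this

theorem IsTrans.sum_pderiv_X_mul {u v : I} (huv : u ≠ v) {d : ℂ} {Y : MvPolynomial I ℂ}
    (h : IsTrans u v d Y) :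
    ∑ i ∈ trans u v, MvPolynomial.pderiv i (X i * Y) = ((Fintype.card I : ℂ) - 2 + d) • Y := by
  simp only [pderiv_mul', pderiv_X', if_true, one_mul, Finset.sum_add_distrib]
  rw [h.sum_X_mul_pderiv huv, Finset.sum_const, ← Nat.cast_smul_eq_nsmul ℂ, card_trans huv]
  module

theorem IsTrans.quadT_mul {u v : I} {d : ℂ} {Y : MvPolynomial I ℂ}
    (h : IsTrans u v d Y) : IsTrans u v (d + 2) (quadT u v * Y) := by
  rw [quadT, Finset.sum_mul]
  refine IsTrans.sum fun i hi => ?_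
  rw [mul_assoc, show d + 2 = d + 1 + 1 by ring]
  exact (h.X_mul hi).X_mul hi

/-- The infinitesimal rotation `X_i ∂_v - X_u ∂_i` fixing `X_u`. -/
def shear (u v i : I) : MvPolynomial I ℂ →ₗ[ℂ] MvPolynomial I ℂ :=
  (el i v).toLinearMap - (el u i).toLinearMap

theorem shear_apply (u v i : I) (P : MvPolynomial I ℂ) :
    shear u v i P = X i * pderiv v P - X u * pderiv i P := rfl

theorem shear_lightcone {u v i : I} (huv : u ≠ v) (hi : i ∈ trans u v) {d : ℂ}
    {Y : MvPolynomial I ℂ} (hY : IsTrans u v d Y) (a b : ℕ) :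
    shear u v i (X v ^ b * (X u ^ a * Y)) =
      (b : ℂ) • (X v ^ (b - 1) * (X u ^ a * (X i * Y))) -
        X v ^ b * (X u ^ (a + 1) * pderiv i Y) := by
  obtain ⟨h1, h2⟩ := mem_trans.mp hi
  simp only [shear_apply, pderiv_mul', pderiv_pow', hY.v, if_neg huv, if_neg h1.symm,
    if_neg h2.symm, if_true, mul_zero, zero_mul, add_zero, zero_add, smul_mul_assoc,
    mul_smul_comm, pow_succ]
  congr 1
  · congr 1; ring
  · ring

variable {u v : I} {m : ℕ} {S : Submodule ℂ (MvPolynomial I ℂ)}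

/-- The number `2a + d` is the distance from `X_v^m` when a shear replaces `X_v` by a transversal
variable, or a transversal variable by `X_u`. The outer induction is on this distance, the inner one
on `a`; the multiples of the quadratic form supply the missing relations. -/
theorem mem_of_shear_aux (huv : u ≠ v) (hn : 3 ≤ Fintype.card I) (h0 : X v ^ m ∈ S)
    (hR : ∀ P, eul P = ((m : ℂ) - 2) • P → quad u v * P ∈ S)
    (hS : ∀ i ∈ trans u v, ∀ P ∈ S, shear u v i P ∈ S) (w : ℕ) :
    ∀ (a b d : ℕ), 2 * a + d = w → b + a + d = m → ∀ Y, IsTrans u v d Y →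
      X v ^ b * (X u ^ a * Y) ∈ S := by
  induction w using Nat.strong_induction_on with
  | _ w ihw =>
    intro a
    -- Modulo the quadratic form, `2 X_u X_v` may be replaced by minus its transversal part.
    have both : ∀ (a b : ℕ) (e : ℂ) (Y : MvPolynomial I ℂ), (b : ℂ) + a + e = m - 2 →
        IsTrans u v e Y →
        (2 : ℂ) • (X v ^ (b + 1) * (X u ^ (a + 1) * Y)) + X v ^ b * (X u ^ a * (quadT u v * Y)) ∈ S := by
      intro a b e Y he hY
      have h1 := hR (X v ^ b * (X u ^ a * Y)) (by
        rw [eul_mul (eul_X_pow v b) (eul_mul (eul_X_pow u a) hY.eul), ← he, add_assoc])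
      convert h1 using 1
      rw [quad_eq huv, add_mul, smul_mul_assoc]
      congr 1
      · congr 1; ring
      · ring
    induction a with
    | succ a iha =>
      intro b d hw hm Y hY
      rcases b with _ | b
      -- Without a factor `X_v` the shear of `X_u^a X_i Y` has a single term. Summing over `i` gives
      -- the required polynomial times `n - 2 + d`, which is positive.
      · have key : ∀ i ∈ trans u v, X u ^ (a + 1) * pderiv i (X i * Y) ∈ S := by
          intro i hi
          have h1 := ihw (2 * a + (d + 1)) (by omega) a 0 (d + 1) rfl (by omega) (X i * Y)
            (by push_cast; exact hY.X_mul hi)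
          have h2 := hS i hi _ h1
          rw [shear_lightcone huv hi (hY.X_mul hi)] at h2
          simpa using h2
        have h3 := S.sum_mem key
        rw [← Finset.mul_sum, hY.sum_pderiv_X_mul huv, mul_smul_comm] at h3
        rw [pow_zero, one_mul]
        refine (S.smul_mem_iff ?_).mp h3
        have : (0 : ℝ) < (Fintype.card I : ℝ) - 2 + d := by
          have : (3 : ℝ) ≤ Fintype.card I := by exact_mod_cast hn
          have : (0 : ℝ) ≤ d := Nat.cast_nonneg _
          linarith
        exact_mod_cast this.ne'
      -- With both `X_u` and `X_v` present, one pair is traded for the transversal quadratic form: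
      -- the distance is unchanged and `a` decreases.
      · have h1 := both a b d Y (by rw [← hm]; push_cast; ring) hY
        have h2 := iha b (d + 2) (by omega) (by omega) (quadT u v * Y)
          (by push_cast; exact hY.quadT_mul)
        have h3 := (S.add_mem_iff_left h2).mp h1
        exact (S.smul_mem_iff two_ne_zero).mp h3
    | zero =>
      intro b d hw hm Y hY
      rcases Nat.eq_zero_or_pos d with rfl | hd
      · have : Y.IsHomogeneous 0 := isHomogeneous_iff_eul.mpr hY.eul
        rw [totalDegree_eq_zero_iff_eq_C.mp (Nat.le_zero.mp this.totalDegree_le)]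
        have hb : b = m := by omega
        rw [hb, pow_zero, one_mul, mul_comm, ← smul_eq_C_mul]
        exact S.smul_mem _ h0
      -- The shear of `X_v^{b+1} Y'`, with its unwanted term in `X_u X_v` replaced by means of
      -- `both`.
      · have step : ∀ i ∈ trans u v, ∀ Y', IsTrans u v ((d : ℂ) - 1) Y' →
            ((b : ℂ) + 1) • (X v ^ b * (X i * Y')) +
              (1 / 2 : ℂ) • (X v ^ b * (quadT u v * pderiv i Y')) ∈ S := by
          intro i hi Y' hY'
          have h1 := ihw (d - 1) (by omega) 0 (b + 1) (d - 1) (by omega) (by omega) Y'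
            (by rwa [Nat.cast_sub hd, Nat.cast_one])
          have h2 := hS i hi _ h1
          rw [shear_lightcone huv hi hY'] at h2
          have h3 := both 0 b ((d : ℂ) - 2) (pderiv i Y') (by rw [← hm]; push_cast; ring)
            (by convert hY'.pderiv i using 1; ring)
          have h4 := S.add_mem h2 (S.smul_mem (1 / 2 : ℂ) h3)
          convert h4 using 1
          push_cast
          simp only [pow_zero, one_mul, Nat.add_sub_cancel, smul_add, smul_smul]
          module
        -- Taking `Y' = X_i Z` and summing over `i`, both terms become the same polynomial, with a
        -- positive total factor.
        have hZ : ∀ Z, IsTrans u v ((d : ℂ) - 2) Z → X v ^ b * (quadT u v * Z) ∈ S := by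
          intro Z hZ
          have h1 := S.sum_mem fun i hi => step i hi (X i * Z)
            (by convert hZ.X_mul hi using 1; ring)
          rw [Finset.sum_add_distrib, ← Finset.smul_sum, ← Finset.smul_sum, ← Finset.mul_sum,
            ← Finset.mul_sum, ← Finset.mul_sum, hZ.sum_pderiv_X_mul huv] at h1
          simp only [← mul_assoc (X _) (X _) Z] at h1
          rw [← Finset.sum_mul, ← quadT, mul_smul_comm, mul_smul_comm, smul_smul, ← add_smul] at h1
          refine (S.smul_mem_iff ?_).mp h1
          have : (0 : ℝ) < b + 1 + 1 / 2 * ((Fintype.card I : ℝ) - 2 + (d - 2)) := by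
            have : (3 : ℝ) ≤ Fintype.card I := by exact_mod_cast hn
            have : (0 : ℝ) ≤ b := Nat.cast_nonneg _
            have : (1 : ℝ) ≤ d := by exact_mod_cast hd
            linarith
          have h5 := Complex.ofReal_ne_zero.mpr this.ne'
          push_cast at h5
          exact h5
        -- Now `Y' = ∂_i Y`: Euler's identity recovers `Y` with factor `(b + 1) d`, and the other
        -- term is covered by `hZ`.
        have h1 := S.sum_mem fun i hi => step i hi (pderiv i Y) (hY.pderiv i)
        rw [Finset.sum_add_distrib, ← Finset.smul_sum, ← Finset.smul_sum, ← Finset.mul_sum,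
            ← Finset.mul_sum, ← Finset.mul_sum, hY.sum_X_mul_pderiv huv] at h1
        have h2 := hZ (∑ i ∈ trans u v, pderiv i (pderiv i Y)) (IsTrans.sum fun i _ => by
          convert (hY.pderiv i).pderiv i using 1; ring)
        have h3 := (S.add_mem_iff_left (S.smul_mem _ h2)).mp h1
        rw [mul_smul_comm, smul_smul] at h3
        rw [pow_zero, one_mul]
        refine (S.smul_mem_iff ?_).mp h3
        have : ((b + 1) * d : ℕ) ≠ 0 := by positivity
        exact_mod_cast this

/-- A space of homogeneous polynomials that contains the highest weight vector and all multiples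
of the quadratic form and that is stable under the shears is everything. -/
theorem mem_of_shear (huv : u ≠ v) (hn : 3 ≤ Fintype.card I) (h0 : X v ^ m ∈ S)
    (hR : ∀ P, eul P = ((m : ℂ) - 2) • P → quad u v * P ∈ S)
    (hS : ∀ i ∈ trans u v, ∀ P ∈ S, shear u v i P ∈ S) {P : MvPolynomial I ℂ}
    (hP : eul P = (m : ℂ) • P) : P ∈ S := by
  have hP' : P.IsHomogeneous m := isHomogeneous_iff_eul.mpr hP
  rw [P.as_sum]
  refine S.sum_mem fun α hα => ?_
  have hdeg : α.degree = m := by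
    have := hP' (mem_support_iff.mp hα)
    rw [← this, Finsupp.degree_eq_weight_one]; rfl
  set β : I →₀ ℕ := (α.erase u).erase v with hβ
  have hαβ : α = Finsupp.single v (α v) + (Finsupp.single u (α u) + β) := by
    ext i
    rw [hβ]
    by_cases hiv : i = v
    · subst hiv; simp [huv.symm, huv]
    · by_cases hiu : i = u
      · subst hiu; simp [huv, huv.symm]
      · simp [hiv, hiu, Ne.symm hiv, Ne.symm hiu]
  have hmono : monomial α (P.coeff α) =
      (P.coeff α) • (X v ^ α v * (X u ^ α u * (monomial β 1 : MvPolynomial I ℂ))) := by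
    conv_lhs => rw [hαβ]
    rw [X_pow_eq_monomial, X_pow_eq_monomial, monomial_mul, monomial_mul, smul_monomial]
    simp [← hαβ]
  rw [hmono]
  refine S.smul_mem _ (mem_of_shear_aux huv hn h0 hR hS _ (α u) (α v) β.degree rfl ?_ _
    ⟨eul_eq_of_isHomogeneous (isHomogeneous_monomial _ rfl), ?_, ?_⟩)
  · rw [← hdeg]
    conv_rhs => rw [hαβ]
    simp only [map_add, Finsupp.degree_single]; ring
  · rw [pderiv_monomial]; simp [hβ, huv]
  · rw [pderiv_monomial]; simp [hβ]

/-- The bilinear form for which `X_b` and `∂_b` are adjoint. -/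
def fischer (Z : MvPolynomial I ℂ) : MvPolynomial I ℂ →ₗ[ℂ] ℂ :=
  (basisMonomials I ℂ).constr ℂ fun β => ((∏ i, (β i).factorial : ℕ) : ℂ) * Z.coeff β

theorem fischer_monomial (Z : MvPolynomial I ℂ) (β : I →₀ ℕ) :
    fischer Z (monomial β 1) = ((∏ i, (β i).factorial : ℕ) : ℂ) * Z.coeff β := by
  have := (basisMonomials I ℂ).constr_basis ℂ
    (fun β => ((∏ i, (β i).factorial : ℕ) : ℂ) * Z.coeff β) β
  rwa [coe_basisMonomials] at this

theorem fischer_ext {f g : MvPolynomial I ℂ →ₗ[ℂ] ℂ}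
    (h : ∀ β, f (monomial β 1) = g (monomial β 1)) : f = g :=
  (basisMonomials I ℂ).ext fun β => by simpa using h β

theorem fischer_add (Z W : MvPolynomial I ℂ) : fischer (Z + W) = fischer Z + fischer W :=
  fischer_ext fun β => by
    rw [LinearMap.add_apply, fischer_monomial, fischer_monomial, fischer_monomial, coeff_add,
      mul_add]

theorem fischer_smul (c : ℂ) (Z : MvPolynomial I ℂ) : fischer (c • Z) = c • fischer Z :=
  fischer_ext fun β => by
    rw [LinearMap.smul_apply, fischer_monomial, fischer_monomial, coeff_smul, smul_eq_mul,
      smul_eq_mul]; ring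

theorem prod_factorial_add_single (β : I →₀ ℕ) (b : I) :
    ∏ i, ((β + Finsupp.single b 1 : I →₀ ℕ) i).factorial = (β b + 1) * ∏ i, (β i).factorial := by
  rw [← Finset.mul_prod_erase _ _ (Finset.mem_univ b),
    ← Finset.mul_prod_erase _ (fun i => (β i).factorial) (Finset.mem_univ b), ← mul_assoc]
  congr 1
  · simp [Nat.factorial_succ]
  · refine Finset.prod_congr rfl fun i hi => ?_
    simp [Finsupp.single_apply, (Finset.ne_of_mem_erase hi).symm]

theorem fischer_X_mul (Z t : MvPolynomial I ℂ) (b : I) :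
    fischer Z (X b * t) = fischer (pderiv b Z) t := by
  have h : fischer Z ∘ₗ LinearMap.mulLeft ℂ (X b) = fischer (pderiv b Z) :=
    fischer_ext fun β => by
      have e : (X b : MvPolynomial I ℂ) * monomial β 1 = monomial (β + Finsupp.single b 1) 1 := by
        rw [X, monomial_mul, one_mul, add_comm]
      rw [LinearMap.comp_apply, LinearMap.mulLeft_apply, e, fischer_monomial, fischer_monomial,
        coeff_pderiv, prod_factorial_add_single]
      push_cast; ring
  exact congrArg (fun F => F t) h

theorem fischer_pderiv (Z t : MvPolynomial I ℂ) (b : I) :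
    fischer Z (pderiv b t) = fischer (X b * Z) t := by
  have h : fischer Z ∘ₗ (pderiv b).toLinearMap = fischer (X b * Z) :=
    fischer_ext fun β => by
      rw [LinearMap.comp_apply, Derivation.coeFn_coe, pderiv_monomial, fischer_monomial]
      by_cases hb : β b = 0
      · have h1 : b ∉ β.support := by simpa using hb
        rw [hb, Nat.cast_zero, mul_zero, monomial_zero, map_zero, mul_comm (X b), coeff_mul_X',
          if_neg h1, mul_zero]
      · obtain ⟨γ, rfl⟩ : ∃ γ, β = γ + Finsupp.single b 1 :=
          ⟨β - Finsupp.single b 1, by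
            rw [tsub_add_cancel_of_le]; simpa [Nat.one_le_iff_ne_zero] using hb⟩
        rw [mul_comm (X b), coeff_mul_X, prod_factorial_add_single, add_tsub_cancel_right,
          one_mul]
        have : (monomial γ) (((γ + Finsupp.single b 1 : I →₀ ℕ) b : ℕ) : ℂ) =
            (((γ b + 1 : ℕ) : ℂ)) • (monomial γ (1 : ℂ)) := by
          rw [smul_monomial]; simp
        rw [this, map_smul, fischer_monomial, smul_eq_mul]
        push_cast; ring
  exact congrArg (fun F => F t) h

/-- The pairing is diagonal on monomials with factorials on the diagonal, so it is non-degenerate in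
each degree. -/
theorem fischer_eq_zero {Z : MvPolynomial I ℂ} (hZ : eul Z = (m : ℂ) • Z)
    (h : ∀ t, eul t = (m : ℂ) • t → fischer Z t = 0) : Z = 0 := by
  ext1 β
  by_contra hβ
  have hd : β.degree = m := by
    have := isHomogeneous_iff_eul.mpr hZ hβ
    rw [← this, Finsupp.degree_eq_weight_one]; rfl
  have h1 := h (monomial β 1) (eul_eq_of_isHomogeneous (isHomogeneous_monomial _ hd))
  rw [fischer_monomial, mul_eq_zero] at h1
  rcases h1 with h1 | h1
  · rw [Nat.cast_eq_zero, Finset.prod_eq_zero_iff] at h1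
    obtain ⟨i, -, hi⟩ := h1
    exact Nat.factorial_ne_zero _ hi
  · exact hβ h1

end LightCone

/-! ### Intertwiners and their highest weight component -/

section LightCone

variable {I : Type} [Fintype I] [DecidableEq I]

/-- Infinitesimal rotations acting on the position variables. -/
def rotX (u v b c : I) (P : MvPolynomial I ℂ) : MvPolynomial I ℂ :=
  X b * pderiv (Equiv.swap u v c) P - X c * pderiv (Equiv.swap u v b) P

/-- Infinitesimal rotations acting on the momentum variables. -/
def rotP (u v b c : I) (P : MvPolynomial I ℂ) : MvPolynomial I ℂ :=
  X (Equiv.swap u v b) * pderiv c P - X (Equiv.swap u v c) * pderiv b P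

/-- The reflection `X_w ↦ -X_w`. -/
def flip (w : I) : MvPolynomial I ℂ →ₐ[ℂ] MvPolynomial I ℂ :=
  aeval fun b => if b = w then -X b else X b

/-- Harmonic polynomials, homogeneous of degree `m`. -/
structure IsHarm (u v : I) (m : ℕ) (h : MvPolynomial I ℂ) : Prop where
  eul : eul h = (m : ℂ) • h
  lap : lap u v h = 0

/-- Constant coefficient differential operators with polynomial symbols, evaluated at the origin
on polynomial arguments `g(x) h(p)`, and subject to the conditions imposed by invariance under
the linear conformal fields and under the special conformal fields. -/
structure Intertwiner (u v : I) (m m' : ℕ) (D N : ℂ)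
    (Φ : MvPolynomial I ℂ →ₗ[ℂ] MvPolynomial I ℂ →ₗ[ℂ] MvPolynomial I ℂ) : Prop where
  harm : ∀ g h, IsHarm u v m h → IsHarm u v m' (Φ g h)
  rot : ∀ b c g h, IsHarm u v m h →
    Φ (rotX u v b c g) h + Φ g (rotP u v b c h) = rotP u v b c (Φ g h)
  euler : ∀ g h, IsHarm u v m h → Φ (eul g) h = N • Φ g h
  conf : ∀ b g h, IsHarm u v m h →
    Φ ((2 : ℂ) • (X b * eul g) - quad u v * pderiv (Equiv.swap u v b) g) h
      + (2 * (D - m)) • Φ (X b * g) h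
      - (2 : ℂ) • ∑ e, Φ (X e * g) (X e * pderiv b h)
      + (2 : ℂ) • ∑ e, Φ (X (Equiv.swap u v e) * g) (X (Equiv.swap u v b) * pderiv e h) = 0
  refl : Fintype.card I = 3 → ∀ w ∈ trans u v, ∀ g h, IsHarm u v m h →
    Φ (flip w g) (flip w h) = flip w (Φ g h)

variable {u v : I} {m m' : ℕ} {D N : ℂ}
  {Φ : MvPolynomial I ℂ →ₗ[ℂ] MvPolynomial I ℂ →ₗ[ℂ] MvPolynomial I ℂ}

theorem eul_rotP {c : ℂ} (b e : I) {h : MvPolynomial I ℂ} (hh : eul h = c • h) :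
    eul (rotP u v b e h) = c • rotP u v b e h := by
  have := eul_mul (eul_X (Equiv.swap u v b)) (eul_pderiv e hh)
  have h2 := eul_mul (eul_X (Equiv.swap u v e)) (eul_pderiv b hh)
  rw [add_sub_cancel] at this h2
  rw [rotP, map_sub, this, h2, smul_sub]

/-- Moving the Laplacian past one half of the rotation produces `2 ∂_b ∂_c h`, which is symmetric
and cancels against the other half. -/
theorem lap_rotP (b c : I) (h : MvPolynomial I ℂ) :
    lap u v (rotP u v b c h) = rotP u v b c (lap u v h) := by
  have key : ∀ e c, lap u v (X (Equiv.swap u v e) * pderiv c h) =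
      X (Equiv.swap u v e) * pderiv c (lap u v h) + (2 : ℂ) • pderiv e (pderiv c h) := by
    intro e c
    have h1 : ∀ a, (Equiv.swap u v e = Equiv.swap u v a) ↔ (e = a) := fun a =>
      (Equiv.swap u v).injective.eq_iff
    have h2 : ∀ a, (Equiv.swap u v e = a) ↔ (Equiv.swap u v a = e) := fun a =>
      ⟨fun h => by rw [← h, Equiv.swap_apply_self], fun h => by rw [← h, Equiv.swap_apply_self]⟩
    have h3 : ∀ a, pderiv a (pderiv (Equiv.swap u v a) (X (Equiv.swap u v e) * pderiv c h)) =
        X (Equiv.swap u v e) * pderiv c (pderiv a (pderiv (Equiv.swap u v a) h)) +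
        ((if e = a then pderiv a (pderiv c h) else 0) + if Equiv.swap u v e = a then
          pderiv (Equiv.swap u v a) (pderiv c h) else 0) := by
      intro a
      simp only [pderiv_mul', map_add, pderiv_X', h1, pderiv_comm c]
      split_ifs <;> simp
      all_goals ring
    rw [lap_apply, Finset.sum_congr rfl fun a _ => h3 a, Finset.sum_add_distrib,
      Finset.sum_add_distrib, Finset.sum_ite_eq, Finset.sum_ite_eq, if_pos (Finset.mem_univ _),
      if_pos (Finset.mem_univ _), ← Finset.mul_sum, ← map_sum, ← lap_apply,
      Equiv.swap_apply_self, two_smul]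
  rw [rotP, rotP, map_sub, key, key, pderiv_comm b c]
  abel

theorem IsHarm.rotP (b c : I) {h : MvPolynomial I ℂ} (hh : IsHarm u v m h) :
    IsHarm u v m (rotP u v b c h) :=
  ⟨eul_rotP b c hh.eul, by rw [lap_rotP, hh.lap]; simp [ConfSymbols.rotP]⟩

theorem rotP_quad_mul (b c : I) (P : MvPolynomial I ℂ) :
    rotP u v b c (quad u v * P) = quad u v * rotP u v b c P := by
  simp only [rotP, pderiv_mul', pderiv_quad, smul_mul_assoc, mul_add, mul_smul_comm, mul_sub]
  have : X (Equiv.swap u v b) * (X (Equiv.swap u v c) * P) =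
    X (Equiv.swap u v c) * (X (Equiv.swap u v b) * P) := by ring
  rw [this]
  ring

theorem isHarm_X_pow (huv : u ≠ v) (m : ℕ) : IsHarm u v m (X v ^ m) := by
  refine ⟨eul_X_pow v m, ?_⟩
  rw [lap_apply]
  refine Finset.sum_eq_zero fun b _ => ?_
  rw [pderiv_pow']
  split_ifs with h
  · have hb : b = u := by
      rw [← Equiv.swap_apply_self u v b, ← h, Equiv.swap_apply_right]
    rw [Derivation.map_smul, pderiv_pow', if_neg (by rw [hb]; exact huv.symm), smul_zero]
  · rw [map_zero]

theorem shear_eq_rotP {i : I} (hi : i ∈ trans u v) (P : MvPolynomial I ℂ) :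
    shear u v i P = rotP u v i v P := by
  rw [shear_apply, rotP, swap_trans hi, Equiv.swap_apply_right]

/-- The coefficient of a power of `X_v` ignores everything divisible by another variable. This is
what makes it a highest weight functional. -/
theorem coeff_X_mul_single {i v : I} (hi : i ≠ v) (k : ℕ) (P : MvPolynomial I ℂ) :
    coeff (Finsupp.single v k) (X i * P) = 0 := by
  rw [mul_comm, coeff_mul_X', if_neg]
  simp [Finsupp.single_apply, hi.symm]

namespace Intertwiner

theorem linComb {Ψ : MvPolynomial I ℂ →ₗ[ℂ] MvPolynomial I ℂ →ₗ[ℂ] MvPolynomial I ℂ}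
    (hΦ : Intertwiner u v m m' D N Φ) (hΨ : Intertwiner u v m m' D N Ψ) (x y : ℂ) :
    Intertwiner u v m m' D N (x • Φ + y • Ψ) where
  harm g h hh := by
    have h1 := hΦ.harm g h hh
    have h2 := hΨ.harm g h hh
    constructor
    · simp only [LinearMap.add_apply, LinearMap.smul_apply, map_add, Derivation.map_smul, h1.eul,
        h2.eul]
      module
    · simp only [LinearMap.add_apply, LinearMap.smul_apply, map_add, map_smul, h1.lap, h2.lap,
        smul_zero, add_zero]
  rot b c g h hh := by
    have h1 := hΦ.rot b c g h hh
    have h2 := hΨ.rot b c g h hh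
    have h3 : ConfSymbols.rotP u v b c (x • Φ g h + y • Ψ g h) =
        x • ConfSymbols.rotP u v b c (Φ g h) + y • ConfSymbols.rotP u v b c (Ψ g h) := by
      simp only [ConfSymbols.rotP, map_add, Derivation.map_smul, mul_add, mul_smul_comm, smul_sub]
      abel
    simp only [LinearMap.add_apply, LinearMap.smul_apply, h3, ← h1, ← h2]
    module
  euler g h hh := by
    simp only [LinearMap.add_apply, LinearMap.smul_apply, hΦ.euler g h hh, hΨ.euler g h hh]
    module
  conf b g h hh := by
    have h1 := hΦ.conf b g h hh
    have h2 := hΨ.conf b g h hh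
    simp only [LinearMap.add_apply, LinearMap.smul_apply, Finset.sum_add_distrib,
      ← Finset.smul_sum]
    linear_combination (norm := module) x • h1 + y • h2
  refl h3 w hw g h hh := by
    simp only [LinearMap.add_apply, LinearMap.smul_apply, hΦ.refl h3 w hw g h hh,
      hΨ.refl h3 w hw g h hh, map_add, map_smul]

/-- The highest weight component. -/
def top (v : I) (m m' : ℕ)
    (Φ : MvPolynomial I ℂ →ₗ[ℂ] MvPolynomial I ℂ →ₗ[ℂ] MvPolynomial I ℂ) :
    MvPolynomial I ℂ →ₗ[ℂ] ℂ :=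
  lcoeff ℂ (Finsupp.single v m') ∘ₗ Φ.flip (X v ^ m)

theorem top_apply (g : MvPolynomial I ℂ) :
    top v m m' Φ g = coeff (Finsupp.single v m') (Φ g (X v ^ m)) := rfl

theorem top_eul (huv : u ≠ v) (hΦ : Intertwiner u v m m' D N Φ) (g : MvPolynomial I ℂ) :
    top v m m' Φ (eul g) = N * top v m m' Φ g := by
  rw [top_apply, hΦ.euler _ _ (isHarm_X_pow huv m), coeff_smul, smul_eq_mul, ← top_apply]

/-- Transversal rotations annihilate `X_v^m`, and their image has no pure power of `X_v`. So `top`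
is invariant under them. -/
theorem top_rot (huv : u ≠ v) (hΦ : Intertwiner u v m m' D N Φ) {i j : I} (hi : i ∈ trans u v)
    (hj : j ∈ trans u v) (g : MvPolynomial I ℂ) :
    top v m m' Φ (X i * pderiv j g) = top v m m' Φ (X j * pderiv i g) := by
  have h1 := hΦ.rot i j g _ (isHarm_X_pow huv m)
  have hi' := (mem_trans.mp hi).2
  have hj' := (mem_trans.mp hj).2
  have h2 : rotP u v i j (X v ^ m : MvPolynomial I ℂ) = 0 := by
    simp [rotP, pderiv_pow', hi'.symm, hj'.symm]
  have h3 := congrArg (coeff (Finsupp.single v m')) h1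
  rw [h2, map_zero, add_zero, rotP, swap_trans hi, swap_trans hj, coeff_sub,
    coeff_X_mul_single hi', coeff_X_mul_single hj', sub_zero, rotX, swap_trans hi,
    swap_trans hj, map_sub, LinearMap.sub_apply, coeff_sub] at h3
  exact sub_eq_zero.mp h3

/-- The rotation in the plane of `u` and `v` is diagonal: `X_v^m` has weight `m`, and taking the
coefficient of `X_v^{m'}` contributes `m'`. -/
theorem top_torus (huv : u ≠ v) (hΦ : Intertwiner u v m m' D N Φ) (g : MvPolynomial I ℂ) :
    top v m m' Φ (X u * pderiv u g) - top v m m' Φ (X v * pderiv v g) =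
      ((m' : ℂ) - m) * top v m m' Φ g := by
  have h1 := hΦ.rot u v g _ (isHarm_X_pow huv m)
  have h2 : rotP u v u v (X v ^ m : MvPolynomial I ℂ) = (m : ℂ) • X v ^ m := by
    rw [rotP, Equiv.swap_apply_left, Equiv.swap_apply_right, pderiv_pow', pderiv_pow', if_pos rfl,
      if_neg huv.symm, mul_zero, sub_zero]
    rcases m with _ | k
    · simp
    · rw [Nat.add_sub_cancel, mul_smul_comm, pow_succ']
  have h4 : ∀ Z : MvPolynomial I ℂ, coeff (Finsupp.single v m') (rotP u v u v Z) =
      m' * coeff (Finsupp.single v m') Z := by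
    intro Z
    rw [rotP, Equiv.swap_apply_left, Equiv.swap_apply_right, coeff_sub, coeff_X_mul_single huv,
      sub_zero, mul_comm, coeff_mul_X']
    rcases m' with _ | k
    · simp
    · have : v ∈ (Finsupp.single v (k + 1)).support := by simp
      rw [if_pos this, coeff_pderiv, ← Finsupp.single_tsub, ← Finsupp.single_add]
      simp [mul_comm]
  have h3 := congrArg (coeff (Finsupp.single v m')) h1
  rw [h2, map_smul, coeff_add, coeff_smul, h4, rotX, Equiv.swap_apply_left,
    Equiv.swap_apply_right, map_sub, LinearMap.sub_apply, coeff_sub, smul_eq_mul] at h3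
  simp only [← top_apply] at h3
  linear_combination h3

/-- A shear of the value `Φ g h` is divisible term by term by `X_i` or `X_u` and is invisible to the
coefficient, so equivariance moves the shear from `h` to `g`. -/
theorem coeff_shear (huv : u ≠ v) (hΦ : Intertwiner u v m m' D N Φ) {i : I}
    (hi : i ∈ trans u v) (g : MvPolynomial I ℂ) {h : MvPolynomial I ℂ} (hh : IsHarm u v m h) :
    coeff (Finsupp.single v m') (Φ g (shear u v i h)) =
      -coeff (Finsupp.single v m') (Φ (X i * pderiv u g - X v * pderiv i g) h) := by
  have h1 := congrArg (coeff (Finsupp.single v m')) (hΦ.rot i v g h hh)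
  rw [← shear_eq_rotP hi, ← shear_eq_rotP hi, shear_apply u v i (Φ g h), coeff_sub,
    coeff_X_mul_single (mem_trans.mp hi).2, coeff_X_mul_single huv, sub_zero, rotX,
    swap_trans hi, Equiv.swap_apply_right, coeff_add] at h1
  linear_combination h1

/-- `X_i X_v^{m-1}` is, up to the factor `m`, a shear of the highest weight vector. This brings the
other momenta in the conformal identities back to `top`. -/
theorem coeff_X_mul (huv : u ≠ v) (hΦ : Intertwiner u v m m' D N Φ) {i : I}
    (hi : i ∈ trans u v) (g : MvPolynomial I ℂ) :
    (m : ℂ) * coeff (Finsupp.single v m') (Φ g (X i * X v ^ (m - 1))) =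
      top v m m' Φ (X v * pderiv i g) - top v m m' Φ (X i * pderiv u g) := by
  have h1 := coeff_shear huv hΦ hi g (isHarm_X_pow huv m)
  have h2 : shear u v i (X v ^ m) = (m : ℂ) • (X i * X v ^ (m - 1)) := by
    rw [shear_apply, pderiv_pow', pderiv_pow', if_pos rfl, if_neg (mem_trans.mp hi).2.symm,
      mul_zero, sub_zero, mul_smul_comm]
  rw [h2, map_smul, coeff_smul, map_sub, LinearMap.sub_apply, coeff_sub, smul_eq_mul] at h1
  rw [h1, top_apply, top_apply]; ring

theorem pderiv_top (b : I) : pderiv b (X v ^ m : MvPolynomial I ℂ) =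
    if v = b then (m : ℂ) • X v ^ (m - 1) else 0 := pderiv_pow' b v m

theorem X_mul_top (m : ℕ) :
    (m : ℂ) • (X v * X v ^ (m - 1) : MvPolynomial I ℂ) = (m : ℂ) • X v ^ m := by
  rcases m with _ | k
  · simp
  · rw [Nat.add_sub_cancel, pow_succ']

/-- In the direction `u` the derivative of `X_v^m` vanishes and the last sum reduces to the highest
weight vector, so the identity closes on `top` at once. -/
theorem top_conf_u (huv : u ≠ v) (hΦ : Intertwiner u v m m' D N Φ) (g : MvPolynomial I ℂ) :
    2 * top v m m' Φ (X u * eul g) - top v m m' Φ (quad u v * pderiv v g) +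
      2 * D * top v m m' Φ (X u * g) = 0 := by
  have h1 := hΦ.conf u g _ (isHarm_X_pow huv m)
  simp only [pderiv_top, if_neg huv.symm, mul_zero, map_zero, Finset.sum_const_zero, smul_zero,
    sub_zero, Equiv.swap_apply_left, mul_ite, apply_ite (Φ _)] at h1
  rw [Finset.sum_ite_eq, if_pos (Finset.mem_univ _), mul_smul_comm, X_mul_top,
    Equiv.swap_apply_right, map_smul] at h1
  have h2 := congrArg (coeff (Finsupp.single v m')) h1
  simp only [coeff_add, coeff_smul, map_sub, map_smul, LinearMap.sub_apply, LinearMap.smul_apply,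
    coeff_sub, ← top_apply, smul_eq_mul, coeff_zero] at h2
  linear_combination h2

/-- In the direction `v` the momenta `X_i X_v^{m-1}` occur for all transversal `i`; `coeff_X_mul`
turns them into the sum over `trans u v`. The terms in `X_u` cancel. -/
theorem top_conf_v (huv : u ≠ v) (hΦ : Intertwiner u v m m' D N Φ) (g : MvPolynomial I ℂ) :
    2 * top v m m' Φ (X v * eul g) - top v m m' Φ (quad u v * pderiv u g) +
      2 * (D - 2 * m) * top v m m' Φ (X v * g) +
      2 * ∑ i ∈ trans u v, (top v m m' Φ (X i * pderiv u (X i * g)) -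
        top v m m' Φ (X v * pderiv i (X i * g))) = 0 := by
  have h1 := hΦ.conf v g _ (isHarm_X_pow huv m)
  simp only [pderiv_top, if_true, Equiv.swap_apply_right, mul_ite, mul_zero, map_zero,
    apply_ite (Φ _)] at h1
  rw [Finset.sum_ite_eq, if_pos (Finset.mem_univ _), Equiv.swap_apply_right,
    sum_eq_trans huv] at h1
  have h2 := congrArg (coeff (Finsupp.single v m')) h1
  have h3 : ∀ i ∈ trans u v, coeff (Finsupp.single v m') (Φ (X i * g) (X i * (m : ℂ) • X v ^ (m - 1)))
      = top v m m' Φ (X v * pderiv i (X i * g)) - top v m m' Φ (X i * pderiv u (X i * g)) := by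
    intro i hi
    rw [mul_smul_comm, map_smul, coeff_smul, smul_eq_mul, coeff_X_mul huv hΦ hi]
  simp only [coeff_add, coeff_smul, coeff_sub, coeff_sum, Finset.sum_congr rfl h3, coeff_zero] at h2
  rw [mul_smul_comm (m : ℂ) (X v), X_mul_top] at h2
  simp only [coeff_add, coeff_smul, map_sub, map_smul, LinearMap.sub_apply, LinearMap.smul_apply,
    coeff_sub, ← top_apply, smul_eq_mul, coeff_zero] at h2
  rw [Finset.sum_sub_distrib] at h2 ⊢
  linear_combination h2

theorem top_conf_i (huv : u ≠ v) (hΦ : Intertwiner u v m m' D N Φ) {i : I}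
    (hi : i ∈ trans u v) (g : MvPolynomial I ℂ) :
    2 * top v m m' Φ (X i * eul g) - top v m m' Φ (quad u v * pderiv i g) +
      2 * (D - m) * top v m m' Φ (X i * g) -
      2 * (top v m m' Φ (X i * pderiv u (X u * g)) -
        top v m m' Φ (X v * pderiv i (X u * g))) = 0 := by
  have h1 := hΦ.conf i g _ (isHarm_X_pow huv m)
  simp only [pderiv_top, if_neg (mem_trans.mp hi).2.symm, mul_zero, map_zero,
    Finset.sum_const_zero, smul_zero, sub_zero, swap_trans hi, mul_ite, apply_ite (Φ _)] at h1
  rw [Finset.sum_ite_eq, if_pos (Finset.mem_univ _), mul_smul_comm,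
    Equiv.swap_apply_right, map_smul] at h1
  have h2 := congrArg (coeff (Finsupp.single v m')) h1
  simp only [coeff_add, coeff_smul, map_sub, map_smul, LinearMap.sub_apply, LinearMap.smul_apply,
    coeff_sub, smul_eq_mul, coeff_zero, coeff_X_mul huv hΦ hi] at h2
  simp only [← top_apply] at h2
  linear_combination h2

/-- If the highest weight component vanishes, then so does the operator. -/
theorem eq_zero_of_top (huv : u ≠ v) (hn : 3 ≤ Fintype.card I)
    (hΦ : Intertwiner u v m m' D N Φ) (h0 : top v m m' Φ = 0) (g : MvPolynomial I ℂ)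
    {h : MvPolynomial I ℂ} (hh : IsHarm u v m h) : Φ g h = 0 := by
  -- From `X_v^m` to every harmonic `h`: the harmonic polynomials on which the coefficient vanishes
  -- for all `g`, together with the multiples of the quadratic form, are stable under shears and
  -- hence contain all polynomials of degree `m`.
  have lowest : ∀ (g h : MvPolynomial I ℂ), IsHarm u v m h →
      coeff (Finsupp.single v m') (Φ g h) = 0 := by
    intro g h hh
    let U : Submodule ℂ (MvPolynomial I ℂ) :=
      { carrier := {h | IsHarm u v m h ∧ ∀ g, coeff (Finsupp.single v m') (Φ g h) = 0}
        zero_mem' := ⟨⟨by simp, by simp⟩, by simp⟩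
        add_mem' := by
          rintro a b ⟨⟨ha, ha'⟩, ha''⟩ ⟨⟨hb, hb'⟩, hb''⟩
          exact ⟨⟨by rw [map_add, ha, hb, smul_add], by rw [map_add, ha', hb', add_zero]⟩,
            fun g => by rw [map_add, coeff_add, ha'', hb'', add_zero]⟩
        smul_mem' := by
          rintro c a ⟨⟨ha, ha'⟩, ha''⟩
          exact ⟨⟨by rw [Derivation.map_smul, ha, smul_comm], by rw [map_smul, ha', smul_zero]⟩,
            fun g => by rw [map_smul, coeff_smul, ha'', smul_zero]⟩ }
    let W : Submodule ℂ (MvPolynomial I ℂ) :=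
      { carrier := {h | ∃ s, eul s = ((m : ℂ) - 2) • s ∧ h = quad u v * s}
        zero_mem' := ⟨0, by simp, by simp⟩
        add_mem' := by
          rintro _ _ ⟨a, ha, rfl⟩ ⟨b, hb, rfl⟩
          exact ⟨a + b, by rw [map_add, ha, hb, smul_add], by rw [mul_add]⟩
        smul_mem' := by
          rintro c _ ⟨a, ha, rfl⟩
          exact ⟨c • a, by rw [Derivation.map_smul, ha, smul_comm], by rw [mul_smul_comm]⟩ }
    have hmem : h ∈ U ⊔ W := by
      refine mem_of_shear huv hn ?_ ?_ ?_ hh.eul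
      · exact Submodule.mem_sup_left ⟨isHarm_X_pow huv m, fun g => by
          rw [← top_apply, h0, LinearMap.zero_apply]⟩
      · exact fun P hP => Submodule.mem_sup_right ⟨P, hP, rfl⟩
      · intro i hi P hP
        obtain ⟨a, ⟨ha, ha'⟩, b, ⟨s, hs, rfl⟩, rfl⟩ := Submodule.mem_sup.mp hP
        rw [map_add]
        refine Submodule.add_mem_sup ⟨?_, fun g => ?_⟩ ⟨rotP u v i v s, eul_rotP i v hs, ?_⟩
        · rw [shear_eq_rotP hi]; exact ha.rotP i v
        · rw [coeff_shear huv hΦ hi g ha, ha', neg_zero]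
        · rw [shear_eq_rotP hi, rotP_quad_mul]
    obtain ⟨a, ⟨ha, ha'⟩, b, ⟨s, hs, rfl⟩, rfl⟩ := Submodule.mem_sup.mp hmem
    -- The part of `h` in the multiples of the quadratic form is a difference of harmonic
    -- polynomials, so it is itself harmonic and therefore zero.
    have hlap : lap u v (quad u v * s) = 0 := by
      have := hh.lap
      rwa [map_add, ha.lap, zero_add] at this
    have hs0 : s = 0 := by
      rcases lt_or_ge m 2 with h2 | h2
      · refine eq_zero_of_eul_neg (c := (m : ℝ) - 2) ?_ (by rw [hs]; push_cast; rfl)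
        have : (m : ℝ) < 2 := by exact_mod_cast h2
        linarith
      · exact eq_zero_of_lap_quad_mul u v hn (d := m - 2)
          (by rw [hs, Nat.cast_sub h2]; push_cast; rfl) hlap
    rw [hs0, mul_zero, add_zero]
    exact ha' g
  -- The other coefficients of the value, by the dual argument: the polynomials `t` orthogonal to
  -- all values contain `X_v^{m'}` by `lowest`, contain the multiples of the quadratic form because
  -- the values are harmonic, and are stable under shears.
  refine fischer_eq_zero (hΦ.harm g h hh).eul fun t ht => ?_
  let S : Submodule ℂ (MvPolynomial I ℂ) :=
    { carrier := {t | ∀ g h, IsHarm u v m h → fischer (Φ g h) t = 0}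
      zero_mem' := fun g h _ => map_zero _
      add_mem' := fun {a b} ha hb g h hh => by rw [map_add, ha g h hh, hb g h hh, add_zero]
      smul_mem' := fun c a ha g h hh => by rw [map_smul, ha g h hh, smul_zero] }
  have hmem : t ∈ S := by
    refine mem_of_shear huv hn ?_ ?_ ?_ ht
    · intro g h hh
      rw [X_pow_eq_monomial, fischer_monomial, lowest g h hh, mul_zero]
    · intro P _ g h hh
      have h1 := (hΦ.harm g h hh).lap
      have h2 : ∀ b, fischer (Φ g h) (X b * X (Equiv.swap u v b) * P) =
          fischer (pderiv (Equiv.swap u v b) (pderiv b (Φ g h))) P := fun b => by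
        rw [mul_assoc, fischer_X_mul, fischer_X_mul]
      have h3 : ∀ (F : I → MvPolynomial I ℂ), fischer (∑ b, F b) P = ∑ b, fischer (F b) P :=
        fun F => map_sum ({ toFun := fun Z => fischer Z P
                            map_zero' := by
                              have := fischer_smul (0 : ℂ) (0 : MvPolynomial I ℂ)
                              rw [zero_smul, zero_smul] at this
                              rw [this]; rfl
                            map_add' := fun a b => by rw [fischer_add]; rfl } :
                            MvPolynomial I ℂ →+ ℂ) F Finset.univ
      have h0' : fischer (0 : MvPolynomial I ℂ) P = 0 := by
        have := h3 (fun _ => 0)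
        have h4 := fischer_smul (0 : ℂ) (0 : MvPolynomial I ℂ)
        rw [zero_smul, zero_smul] at h4
        rw [h4]; rfl
      rw [quad, Finset.sum_mul, map_sum, Finset.sum_congr rfl fun b _ => h2 b, ← h3]
      simp only [pderiv_comm (Equiv.swap u v _)]
      rw [← lap_apply, h1, h0']
    · intro i hi P hP g h hh
      -- The adjoint of a shear is minus the opposite shear, also a rotation, which equivariance
      -- distributes over `g` and `h`.
      have h1 : fischer (Φ g h) (shear u v i P) = -fischer (rotP u v i u (Φ g h)) P := by
        rw [shear_apply, map_sub, fischer_X_mul, fischer_pderiv, fischer_X_mul, fischer_pderiv,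
          rotP, swap_trans hi, Equiv.swap_apply_left, sub_eq_add_neg (X i * _), fischer_add,
          ← neg_one_smul ℂ (X v * _), fischer_smul]
        simp
        ring
      rw [h1, ← hΦ.rot i u g h hh, fischer_add, LinearMap.add_apply, hP _ _ hh,
        hP _ _ (hh.rotP i u), add_zero, neg_zero]
  exact hmem g h hh

end Intertwiner

end LightCone

/-! ### Recurrences on monomials and the classification of intertwiners -/

section LightCone

variable {I : Type} [Fintype I] [DecidableEq I]
variable {u v w : I} {m m' : ℕ} {D N : ℂ}
  {Φ : MvPolynomial I ℂ →ₗ[ℂ] MvPolynomial I ℂ →ₗ[ℂ] MvPolynomial I ℂ}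

/-- The monomial `X_u^a X_v^b X_w^r`. -/
def mon (u v w : I) (a b r : ℕ) : MvPolynomial I ℂ := X u ^ a * (X v ^ b * X w ^ r)

theorem X_u_mon (a b r : ℕ) : X u * mon u v w a b r = mon u v w (a + 1) b r := by
  rw [mon, mon, pow_succ']; ring

theorem X_v_mon (a b r : ℕ) : X v * mon u v w a b r = mon u v w a (b + 1) r := by
  rw [mon, mon, pow_succ' (X v)]; ring

theorem X_w_mon (a b r : ℕ) : X w * mon u v w a b r = mon u v w a b (r + 1) := by
  rw [mon, mon, pow_succ' (X w)]; ring

theorem eul_mon (a b r : ℕ) : eul (mon u v w a b r) = ((a : ℂ) + b + r) • mon u v w a b r := by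
  rw [mon, eul_mul (eul_X_pow u a) (eul_mul (eul_X_pow v b) (eul_X_pow w r)), add_assoc]

theorem pderiv_u_mon (huv : u ≠ v) (hw : w ∈ trans u v) (a b r : ℕ) :
    pderiv u (mon u v w a b r) = (a : ℂ) • mon u v w (a - 1) b r := by
  have h1 := (mem_trans.mp hw).1
  rw [mon, mon, pderiv_mul', pderiv_mul', pderiv_pow', pderiv_pow', pderiv_pow', if_pos rfl,
    if_neg huv.symm, if_neg h1]
  simp

theorem pderiv_v_mon (huv : u ≠ v) (hw : w ∈ trans u v) (a b r : ℕ) :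
    pderiv v (mon u v w a b r) = (b : ℂ) • mon u v w a (b - 1) r := by
  have h1 := (mem_trans.mp hw).2
  rw [mon, mon, pderiv_mul', pderiv_mul', pderiv_pow', pderiv_pow', pderiv_pow', if_pos rfl,
    if_neg huv, if_neg h1]
  simp

theorem pderiv_w_mon (hw : w ∈ trans u v) (a b r : ℕ) :
    pderiv w (mon u v w a b r) = (r : ℂ) • mon u v w a b (r - 1) := by
  obtain ⟨h1, h2⟩ := mem_trans.mp hw
  rw [mon, mon, pderiv_mul', pderiv_mul', pderiv_pow', pderiv_pow', pderiv_pow', if_pos rfl,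
    if_neg h1.symm, if_neg h2.symm]
  simp

theorem pderiv_j_mon {j : I} (hj : j ∈ trans u v) (hjw : j ≠ w) (a b r : ℕ) :
    pderiv j (mon u v w a b r) = 0 := by
  obtain ⟨h1, h2⟩ := mem_trans.mp hj
  rw [mon, pderiv_mul', pderiv_mul', pderiv_pow', pderiv_pow', pderiv_pow', if_neg hjw.symm,
    if_neg h1.symm, if_neg h2.symm]
  simp

namespace Intertwiner

/-- `top` on the multiples of the transversal quadratic form. -/
theorem top_quadT_mon (huv : u ≠ v) (hw : w ∈ trans u v) (hΦ : Intertwiner u v m m' D N Φ)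
    (a b r : ℕ) :
    (r + 1) * top v m m' Φ (quadT u v * mon u v w a b r) =
      ((r : ℂ) + Fintype.card I - 2) * top v m m' Φ (mon u v w a b (r + 2)) := by
  -- Invariance under the rotation of `j` into `w`, applied to `X_j X_w^{r+1}`, trades `X_j²` for
  -- `X_w²`.
  have h : ∀ j ∈ trans u v, j ≠ w → (r + 1) * top v m m' Φ (X j * X j * mon u v w a b r) =
      top v m m' Φ (mon u v w a b (r + 2)) := by
    intro j hj hjw
    have h1 := top_rot huv hΦ hj hw (X j * mon u v w a b (r + 1))
    simp only [pderiv_mul', pderiv_w_mon hw, pderiv_j_mon hj hjw, pderiv_X', if_neg hjw,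
      if_true, zero_mul, add_zero, mul_zero, zero_add, one_mul, Nat.add_sub_cancel,
      mul_smul_comm, map_smul, smul_eq_mul, X_w_mon, ← mul_assoc] at h1
    rw [← h1]; push_cast; ring
  rw [quadT, Finset.sum_mul, map_sum, ← Finset.add_sum_erase _ _ hw, mul_add, Finset.mul_sum,
    Finset.sum_congr rfl fun j hj => h j (Finset.mem_of_mem_erase hj) (Finset.ne_of_mem_erase hj),
    mul_assoc, X_w_mon, X_w_mon, Finset.sum_const, Finset.card_erase_of_mem hw, nsmul_eq_mul,
    Nat.cast_sub (Finset.card_pos.mpr ⟨w, hw⟩), card_trans huv]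
  push_cast; ring

theorem top_quad_mon (huv : u ≠ v) (hw : w ∈ trans u v) (hΦ : Intertwiner u v m m' D N Φ)
    (a b r : ℕ) :
    (r + 1) * top v m m' Φ (quad u v * mon u v w a b r) =
      2 * (r + 1) * top v m m' Φ (mon u v w (a + 1) (b + 1) r) +
      ((r : ℂ) + Fintype.card I - 2) * top v m m' Φ (mon u v w a b (r + 2)) := by
  have h : quad u v * mon u v w a b r =
      (2 : ℂ) • mon u v w (a + 1) (b + 1) r + quadT u v * mon u v w a b r := by
    rw [quad_eq huv, add_mul, smul_mul_assoc, mul_assoc (X u), X_v_mon, X_u_mon]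
  rw [← top_quadT_mon huv hw hΦ, h, map_add, map_smul, smul_eq_mul]
  ring

/-- The special conformal identity in the direction `w` on `X_u^a X_v^b X_w^{r+1}`. The values on
`X_u^{a+1} X_v^{b+1} X_w^r` drop out, which leaves a scalar times one value. -/
theorem rec_w (huv : u ≠ v) (hw : w ∈ trans u v) (hΦ : Intertwiner u v m m' D N Φ) (a b r : ℕ) :
    (2 * b + r + 2 + 2 * D - 2 * m - Fintype.card I) * top v m m' Φ (mon u v w a b (r + 2)) = 0 := by
  have h1 := top_conf_i huv hΦ hw (mon u v w a b (r + 1))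
  simp only [eul_mon, X_u_mon, pderiv_w_mon hw, pderiv_u_mon huv hw, mul_smul_comm, map_smul,
    X_w_mon, X_v_mon, smul_eq_mul, Nat.add_sub_cancel] at h1
  have h2 := top_quad_mon huv hw hΦ a b r
  push_cast at h1
  linear_combination h1 + h2

/-- The direction `u` links a monomial to the one with a factor `X_u X_v` replaced by `X_w²`; the
direction `v`, in `rec_v`, links the same two with another coefficient. -/
theorem rec_u (huv : u ≠ v) (hw : w ∈ trans u v) (hΦ : Intertwiner u v m m' D N Φ) (a b r : ℕ) :
    2 * (r + 1) * (a + r + D) * top v m m' Φ (mon u v w (a + 1) (b + 1) r) =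
      (b + 1) * (r + Fintype.card I - 2) * top v m m' Φ (mon u v w a b (r + 2)) := by
  have h1 := top_conf_u huv hΦ (mon u v w a (b + 1) r)
  simp only [eul_mon, X_u_mon, pderiv_v_mon huv hw, mul_smul_comm, map_smul,
    X_v_mon, smul_eq_mul, Nat.add_sub_cancel] at h1
  have h2 := top_quad_mon huv hw hΦ a b r
  push_cast at h1
  linear_combination (r + 1) * h1 + (b + 1) * h2

/-- Boundary case without `X_v`: there is no neighbouring monomial, and the recurrence becomes a
condition on `D`. It is the source of the weight of `G₀^g`; in the same way `rec_v_zero` is the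
source of that of `D^d`. -/
theorem rec_u_zero (huv : u ≠ v) (hw : w ∈ trans u v) (hΦ : Intertwiner u v m m' D N Φ)
    (a r : ℕ) : (a + r + D) * top v m m' Φ (mon u v w (a + 1) 0 r) = 0 := by
  have h1 := top_conf_u huv hΦ (mon u v w a 0 r)
  simp only [eul_mon, X_u_mon, pderiv_v_mon huv hw, mul_smul_comm, map_smul,
    X_v_mon, smul_eq_mul, Nat.cast_zero, zero_mul] at h1
  linear_combination h1 / 2

theorem sum_shear_mon (huv : u ≠ v) (hw : w ∈ trans u v) (a b r : ℕ) :
    ∑ i ∈ trans u v, (top v m m' Φ (X i * pderiv u (X i * mon u v w a b r)) -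
        top v m m' Φ (X v * pderiv i (X i * mon u v w a b r))) =
      a * top v m m' Φ (quadT u v * mon u v w (a - 1) b r) -
        ((r : ℂ) + Fintype.card I - 2) * top v m m' Φ (mon u v w a (b + 1) r) := by
  have h1 : ∀ i ∈ trans u v, top v m m' Φ (X i * pderiv u (X i * mon u v w a b r)) =
      a * top v m m' Φ (X i * X i * mon u v w (a - 1) b r) := by
    intro i hi
    rw [pderiv_mul', pderiv_X', if_neg (mem_trans.mp hi).1, zero_mul, add_zero,
      pderiv_u_mon huv hw, mul_smul_comm, mul_smul_comm, map_smul, smul_eq_mul, mul_assoc]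
  have h2 : ∀ i ∈ trans u v, top v m m' Φ (X v * pderiv i (X i * mon u v w a b r)) =
      (1 + if i = w then (r : ℂ) else 0) * top v m m' Φ (mon u v w a (b + 1) r) := by
    intro i hi
    rw [pderiv_mul', pderiv_X', if_pos rfl, one_mul]
    split_ifs with h
    · subst h
      rw [pderiv_w_mon hw, mul_smul_comm, X_w_mon, mul_add, mul_smul_comm, X_v_mon, X_v_mon]
      rcases r with _ | r
      · simp
      · rw [Nat.add_sub_cancel, map_add, map_smul, smul_eq_mul]; ring
    · rw [pderiv_j_mon hi h, mul_zero, zero_add, X_v_mon, add_zero, one_mul]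
  rw [Finset.sum_sub_distrib, Finset.sum_congr rfl h1, Finset.sum_congr rfl h2, ← Finset.mul_sum,
    ← Finset.sum_mul, ← map_sum, ← Finset.sum_mul, ← quadT, Finset.sum_add_distrib,
    Finset.sum_ite_eq', if_pos hw, Finset.sum_const, nsmul_eq_mul, card_trans huv]
  ring

theorem rec_v (huv : u ≠ v) (hw : w ∈ trans u v) (hΦ : Intertwiner u v m m' D N Φ) (a b r : ℕ) :
    2 * (r + 1) * (b - 2 * m + D - Fintype.card I + 2) *
        top v m m' Φ (mon u v w (a + 1) (b + 1) r) =
      -((a + 1) * (r + Fintype.card I - 2) * top v m m' Φ (mon u v w a b (r + 2))) := by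
  have h1 := top_conf_v huv hΦ (mon u v w (a + 1) b r)
  rw [sum_shear_mon huv hw] at h1
  simp only [eul_mon, X_u_mon, pderiv_u_mon huv hw, mul_smul_comm, map_smul,
    X_v_mon, smul_eq_mul, Nat.add_sub_cancel] at h1
  have h2 := top_quad_mon huv hw hΦ a b r
  have h3 := top_quadT_mon huv hw hΦ a b r
  push_cast at h1
  linear_combination (r + 1) * h1 + (a + 1) * h2 - 2 * (a + 1) * h3

theorem rec_v_zero (huv : u ≠ v) (hw : w ∈ trans u v) (hΦ : Intertwiner u v m m' D N Φ)
    (b r : ℕ) :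
    (b - 2 * m + D - Fintype.card I + 2) * top v m m' Φ (mon u v w 0 (b + 1) r) = 0 := by
  have h1 := top_conf_v huv hΦ (mon u v w 0 b r)
  rw [sum_shear_mon huv hw] at h1
  simp only [eul_mon, X_u_mon, pderiv_u_mon huv hw, mul_smul_comm, map_smul,
    X_v_mon, smul_eq_mul, Nat.cast_zero, zero_mul] at h1
  linear_combination h1 / 2

/-- A monomial is an eigenvector of the torus and of the Euler operator, and a non-zero value forces
the eigenvalues. -/
theorem weights (huv : u ≠ v) (hw : w ∈ trans u v) (hΦ : Intertwiner u v m m' D N Φ)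
    {a b r : ℕ} (h : top v m m' Φ (mon u v w a b r) ≠ 0) :
    a + m = b + m' ∧ N = a + b + r := by
  constructor
  · have h1 := top_torus huv hΦ (mon u v w a b r)
    have h2 : top v m m' Φ (X u * pderiv u (mon u v w a b r)) =
        a * top v m m' Φ (mon u v w a b r) := by
      rw [pderiv_u_mon huv hw, mul_smul_comm, X_u_mon]
      rcases a with _ | a
      · simp
      · rw [Nat.add_sub_cancel, map_smul, smul_eq_mul]
    have h3 : top v m m' Φ (X v * pderiv v (mon u v w a b r)) =
        b * top v m m' Φ (mon u v w a b r) := by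
      rw [pderiv_v_mon huv hw, mul_smul_comm, X_v_mon]
      rcases b with _ | b
      · simp
      · rw [Nat.add_sub_cancel, map_smul, smul_eq_mul]
    rw [h2, h3] at h1
    have h4 : ((a : ℂ) - b) = m' - m := mul_right_cancel₀ h (by linear_combination h1)
    have h5 : ((a + m : ℕ) : ℂ) = ((b + m' : ℕ) : ℂ) := by push_cast; linear_combination h4
    exact_mod_cast h5
  · have h1 := top_eul huv hΦ (mon u v w a b r)
    rw [eul_mon, map_smul, smul_eq_mul] at h1
    exact (mul_right_cancel₀ h h1).symm

/-- Otherwise `rec_u` and `rec_v` would both have a vanishing scalar on their left side. Subtracting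
the two conditions and using `a + m = b + m'` gives `m + m' + r + n = 2`, which is impossible. -/
theorem lower (huv : u ≠ v) (hn : 3 ≤ Fintype.card I) (hw : w ∈ trans u v)
    (hΦ : Intertwiner u v m m' D N Φ) {a b r : ℕ}
    (h : top v m m' Φ (mon u v w (a + 1) (b + 1) r) ≠ 0) :
    top v m m' Φ (mon u v w a b (r + 2)) ≠ 0 := by
  intro h0
  have h1 := rec_u huv hw hΦ a b r
  have h2 := rec_v huv hw hΦ a b r
  rw [h0, mul_zero] at h1 h2
  have hr : (2 * ((r : ℂ) + 1)) ≠ 0 := by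
    have : (2 * (r + 1) : ℕ) ≠ 0 := by positivity
    exact_mod_cast this
  have h3 := (mul_eq_zero.mp ((mul_eq_zero.mp h1).resolve_right h)).resolve_left hr
  have h4 := (mul_eq_zero.mp ((mul_eq_zero.mp (h2.trans neg_zero)).resolve_right h)).resolve_left hr
  obtain ⟨h5, -⟩ := weights huv hw hΦ h
  have h6 : ((a : ℂ) + 1 + m) = b + 1 + m' := by exact_mod_cast h5
  have h7 : ((m' + m + r + Fintype.card I : ℕ) : ℂ) = (2 : ℕ) := by
    push_cast; linear_combination h3 - h4 - h6
  have h8 : m' + m + r + Fintype.card I = 2 := by exact_mod_cast h7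
  omega

theorem lower_min (huv : u ≠ v) (hn : 3 ≤ Fintype.card I) (hw : w ∈ trans u v)
    (hΦ : Intertwiner u v m m' D N Φ) (t : ℕ) {a b r : ℕ}
    (h : top v m m' Φ (mon u v w (a + t) (b + t) r) ≠ 0) :
    top v m m' Φ (mon u v w a b (r + 2 * t)) ≠ 0 := by
  induction t generalizing r with
  | zero => exact h
  | succ t ih =>
    have := ih (lower huv hn hw hΦ h)
    rwa [show r + 2 + 2 * t = r + 2 * (t + 1) by ring] at this

/-- The critical monomial: if `top` is non-zero on a monomial, it is non-zero on the one where
one of the first two exponents vanishes. -/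
theorem critical (huv : u ≠ v) (hn : 3 ≤ Fintype.card I) (hw : w ∈ trans u v)
    (hΦ : Intertwiner u v m m' D N Φ) {a b r : ℕ} (h : top v m m' Φ (mon u v w a b r) ≠ 0) :
    ∃ r₀ : ℕ, N = (m' - m : ℕ) + (m - m' : ℕ) + r₀ ∧
      top v m m' Φ (mon u v w (m' - m) (m - m') r₀) ≠ 0 := by
  obtain ⟨h1, h2⟩ := weights huv hw hΦ h
  have ha : a = (m' - m) + min a b := by omega
  have hb : b = (m - m') + min a b := by omega
  refine ⟨r + 2 * min a b, ?_, ?_⟩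
  · rw [h2]
    have : a + b + r = (m' - m) + (m - m') + r + 2 * min a b := by omega
    have h3 : ((a + b + r : ℕ) : ℂ) = (((m' - m) + (m - m') + r + 2 * min a b : ℕ) : ℂ) := by
      rw [this]
    push_cast at h3 ⊢
    rw [h3]; ring
  · apply lower_min huv hn hw hΦ
    rw [← ha, ← hb]
    exact h

theorem flip_mon (hw : w ∈ trans u v) (a b r : ℕ) :
    flip w (mon u v w a b r) = (-1 : ℂ) ^ r • mon u v w a b r := by
  obtain ⟨h1, h2⟩ := mem_trans.mp hw
  simp only [flip, mon, map_mul, map_pow, aeval_X, if_neg h1.symm, if_neg h2.symm, if_true]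
  rw [neg_pow, smul_eq_C_mul, map_pow, map_neg, map_one]
  ring

theorem coeff_flip {k : ℕ} (hw : w ≠ v) (Z : MvPolynomial I ℂ) :
    coeff (Finsupp.single v k) (flip w Z) = coeff (Finsupp.single v k) Z := by
  induction Z using MvPolynomial.induction_on' with
  | add P Q hP hQ => rw [map_add, coeff_add, coeff_add, hP, hQ]
  | monomial β c =>
    have h1 : flip w (monomial β c) = monomial β ((-1) ^ β w * c) := by
      rw [flip, aeval_monomial, Finsupp.prod_fintype _ _ (fun i => pow_zero _), monomial_eq,
        Finsupp.prod_fintype _ _ (fun i => pow_zero _), map_mul, mul_comm (C ((-1) ^ β w)),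
        mul_assoc, algebraMap_eq]
      congr 1
      rw [← Finset.mul_prod_erase _ _ (Finset.mem_univ w),
        ← Finset.mul_prod_erase _ (fun i => (X i : MvPolynomial I ℂ) ^ β i) (Finset.mem_univ w),
        if_pos rfl, neg_pow, ← mul_assoc, map_pow, map_neg, map_one]
      congr 1
      exact Finset.prod_congr rfl fun i hi => by rw [if_neg (Finset.ne_of_mem_erase hi)]
    rw [h1, coeff_monomial, coeff_monomial]
    split_ifs with h
    · rw [h, Finsupp.single_apply, if_neg hw.symm, pow_zero, one_mul]
    · rfl

/-- For `n ≥ 4` there are two transversal directions, and rotation invariance leaves no odd powers.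
For `n = 3` there is only one and the rotations give nothing; the reflection `X_w ↦ -X_w` takes
their place. -/
theorem odd_eq_zero (huv : u ≠ v) (hn : 3 ≤ Fintype.card I) (hw : w ∈ trans u v)
    (hΦ : Intertwiner u v m m' D N Φ) (a b : ℕ) {r : ℕ} (hr : Odd r) :
    top v m m' Φ (mon u v w a b r) = 0 := by
  rcases hn.eq_or_lt with h3 | h4
  · have h1 := hΦ.refl h3.symm w hw (mon u v w a b r) _ (isHarm_X_pow huv m)
    have h2 : flip w (X v ^ m : MvPolynomial I ℂ) = X v ^ m := by
      simp [flip, (mem_trans.mp hw).2.symm]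
    have h5 := congrArg (coeff (Finsupp.single v m')) h1
    rw [h2, flip_mon hw, coeff_flip (mem_trans.mp hw).2, hr.neg_one_pow, map_smul,
      LinearMap.smul_apply, coeff_smul, smul_eq_mul, ← top_apply] at h5
    have h6 : (-2 : ℂ) * top v m m' Φ (mon u v w a b r) = 0 := by linear_combination h5
    exact (mul_eq_zero.mp h6).resolve_left (by norm_num)
  · obtain ⟨j, hj, hjw⟩ : ∃ j ∈ trans u v, j ≠ w := by
      have h1 := card_trans huv
      have h2 : (trans u v).card + 2 = Fintype.card I := by
        have : (((trans u v).card + 2 : ℕ) : ℂ) = Fintype.card I := by push_cast; rw [h1]; ring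
        exact_mod_cast this
      exact Finset.exists_mem_ne (by omega) w
    obtain ⟨k, rfl⟩ := hr
    -- Rotation invariance lowers the exponent of `X_w` by two while raising that of `X_j`, so the
    -- power `t` must be carried along. At exponent one the rotated term is a derivative with
    -- respect to an absent variable.
    have h1 : ∀ k t : ℕ, top v m m' Φ (X j ^ t * mon u v w a b (2 * k + 1)) = 0 := by
      intro k
      have hX : ∀ t : ℕ, pderiv w (X j ^ t : MvPolynomial I ℂ) = 0 := fun t => by
        rw [pderiv_pow', if_neg hjw]
      induction k with
      | zero =>
        intro t
        have h1 := top_rot huv hΦ hw hj (X j ^ (t + 1) * mon u v w a b 0)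
        simp only [pderiv_mul', pderiv_w_mon hw, pderiv_j_mon hj hjw, hX, pderiv_pow', if_true,
          Nat.cast_zero, zero_smul, mul_zero, zero_mul, add_zero, map_zero, zero_add,
          Nat.add_sub_cancel, smul_mul_assoc, mul_smul_comm, map_smul, smul_eq_mul] at h1
        rw [mul_left_comm, X_w_mon] at h1
        exact (mul_eq_zero.mp h1).resolve_left (by exact_mod_cast t.succ_ne_zero)
      | succ k ih =>
        intro t
        have h1 := top_rot huv hΦ hw hj (X j ^ (t + 1) * mon u v w a b (2 * k + 2))
        simp only [pderiv_mul', pderiv_w_mon hw, pderiv_j_mon hj hjw, hX, pderiv_pow', if_true,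
          mul_zero, zero_mul, add_zero, map_zero, zero_add,
          Nat.add_sub_cancel, smul_mul_assoc, mul_smul_comm, map_smul, smul_eq_mul] at h1
        rw [mul_left_comm, X_w_mon, ← mul_assoc, ← pow_succ',
          show 2 * k + 2 - 1 = 2 * k + 1 by omega, ih, mul_zero] at h1
        exact (mul_eq_zero.mp h1).resolve_left (by exact_mod_cast t.succ_ne_zero)
    simpa using h1 k 0

/-- `top` is determined by its values on the monomials `X_u^a X_v^b X_w^r`. -/
theorem top_eq_zero (huv : u ≠ v) (hw : w ∈ trans u v)
    (hΦ : Intertwiner u v m m' D N Φ) (h : ∀ a b r, top v m m' Φ (mon u v w a b r) = 0) :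
    top v m m' Φ = 0 := by
  have key : ∀ (k : ℕ) (α : I →₀ ℕ), ∑ i ∈ (trans u v).erase w, α i = k →
      top v m m' Φ (monomial α 1) = 0 := by
    intro k
    induction k using Nat.strong_induction_on with
    | _ k ih =>
      intro α hα
      by_cases hz : ∀ i ∈ (trans u v).erase w, α i = 0
      · convert h (α u) (α v) (α w) using 2
        rw [monomial_eq, Finsupp.prod_fintype _ _ (fun i => pow_zero _), map_one, one_mul, mon]
        have h1 : (Finset.univ : Finset I) =
            insert u (insert v (insert w ((trans u v).erase w))) := by
          ext i
          simp only [Finset.mem_univ, Finset.mem_insert, Finset.mem_erase, mem_trans, true_iff]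
          tauto
        obtain ⟨h2, h3⟩ := mem_trans.mp hw
        rw [h1, Finset.prod_insert (by simp [huv, mem_trans, h2.symm]),
          Finset.prod_insert (by simp [mem_trans, h3.symm]), Finset.prod_insert (by simp),
          Finset.prod_eq_one fun i hi => by rw [hz i hi, pow_zero], mul_one]
      · push Not at hz
        obtain ⟨j, hj, hαj⟩ := hz
        have hjt := Finset.mem_of_mem_erase hj
        have hjw := Finset.ne_of_mem_erase hj
        obtain ⟨β, rfl⟩ : ∃ β, α = β + Finsupp.single j 1 :=
          ⟨α - Finsupp.single j 1, by
            rw [tsub_add_cancel_of_le]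
            simpa [Nat.one_le_iff_ne_zero] using hαj⟩
        -- The rotation expresses `X_j X^β`, with factor `β w + 1`, by a monomial with fewer
        -- variables outside `u`, `v`, `w`.
        have h1 := top_rot huv hΦ hjt hw (monomial (β + Finsupp.single w 1) 1)
        rw [pderiv_monomial, pderiv_monomial, X, monomial_mul, X, monomial_mul,
          add_tsub_cancel_right, add_comm (Finsupp.single j 1) β] at h1
        have hmon : ∀ (γ : I →₀ ℕ) (c : ℂ), (monomial γ c : MvPolynomial I ℂ) =
            c • monomial γ 1 := fun γ c => by rw [smul_monomial, smul_eq_mul, mul_one]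
        rw [hmon _ (1 * _), hmon (Finsupp.single w 1 + _), map_smul, map_smul] at h1
        have hlow : (1 * (1 * (((β + Finsupp.single w 1 : I →₀ ℕ) j : ℕ) : ℂ))) •
            top v m m' Φ (monomial (Finsupp.single w 1 +
              (β + Finsupp.single w 1 - Finsupp.single j 1)) 1) = 0 := by
          by_cases hβj : β j = 0
          · simp [hβj, hjw.symm, hjw]
          · rw [ih _ ?_ _ rfl, smul_zero]
            rw [← hα]
            refine Finset.sum_lt_sum (fun i hi => ?_) ⟨j, hj, ?_⟩
            · have := Finset.ne_of_mem_erase hi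
              simp [Finsupp.single_apply, this.symm]; omega
            · simp [Finsupp.single_apply, hjw.symm]
        rw [hlow, smul_eq_zero] at h1
        refine h1.resolve_left ?_
        simp only [one_mul, Finsupp.add_apply, Finsupp.single_eq_same]
        exact Nat.cast_ne_zero.mpr (Nat.succ_ne_zero (β w))
  refine fischer_ext fun β => ?_
  rw [key _ β rfl, LinearMap.zero_apply]

/-- The operator vanishes if `top` vanishes on the critical monomial. -/
theorem eq_zero_of_critical (huv : u ≠ v) (hn : 3 ≤ Fintype.card I) (hw : w ∈ trans u v)
    (hΦ : Intertwiner u v m m' D N Φ)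
    (h0 : ∀ r₀ : ℕ, N = (m' - m : ℕ) + (m - m' : ℕ) + r₀ →
      top v m m' Φ (mon u v w (m' - m) (m - m') r₀) = 0) (g : MvPolynomial I ℂ)
    {h : MvPolynomial I ℂ} (hh : IsHarm u v m h) : Φ g h = 0 := by
  refine eq_zero_of_top huv hn hΦ (top_eq_zero huv hw hΦ fun a b r => ?_) g hh
  by_contra hne
  obtain ⟨r₀, h1, h2⟩ := critical huv hn hw hΦ hne
  exact h2 (h0 r₀ h1)

/-- Two operators with the same parameters are proportional. -/
theorem exists_linComb_eq_zero (huv : u ≠ v) (hn : 3 ≤ Fintype.card I) (hw : w ∈ trans u v)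
    {Ψ : MvPolynomial I ℂ →ₗ[ℂ] MvPolynomial I ℂ →ₗ[ℂ] MvPolynomial I ℂ}
    (hΦ : Intertwiner u v m m' D N Φ) (hΨ : Intertwiner u v m m' D N Ψ) :
    ∃ x y : ℂ, (x ≠ 0 ∨ y ≠ 0) ∧ ∀ g h, IsHarm u v m h → x • Φ g h + y • Ψ g h = 0 := by
  have inj : ∀ r₁ r₂ : ℕ, N = (m' - m : ℕ) + (m - m' : ℕ) + r₁ →
      N = (m' - m : ℕ) + (m - m' : ℕ) + r₂ → r₁ = r₂ := by
    intro r₁ r₂ h1 h2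
    have : (r₁ : ℂ) = r₂ := add_left_cancel (h1.symm.trans h2)
    exact_mod_cast this
  by_cases hex : ∃ r₀ : ℕ, N = (m' - m : ℕ) + (m - m' : ℕ) + r₀ ∧
      top v m m' Φ (mon u v w (m' - m) (m - m') r₀) ≠ 0
  · obtain ⟨r₀, h1, h2⟩ := hex
    -- The combination is chosen to vanish on the critical monomial, whose exponents depend only on
    -- `m`, `m'` and `N` and so are common to both operators.
    refine ⟨-top v m m' Ψ (mon u v w (m' - m) (m - m') r₀),
      top v m m' Φ (mon u v w (m' - m) (m - m') r₀), Or.inr h2, fun g h hh => ?_⟩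
    refine eq_zero_of_critical huv hn hw (hΦ.linComb hΨ _ _) (fun r h3 => ?_) g hh
    rw [inj r r₀ h3 h1]
    rw [top_apply, LinearMap.add_apply, LinearMap.add_apply, LinearMap.smul_apply,
      LinearMap.smul_apply, LinearMap.smul_apply, LinearMap.smul_apply, coeff_add, coeff_smul,
      coeff_smul, ← top_apply, ← top_apply, smul_eq_mul, smul_eq_mul]
    ring
  · push Not at hex
    refine ⟨1, 0, Or.inl one_ne_zero, fun g h hh => ?_⟩
    rw [eq_zero_of_critical huv hn hw hΦ hex g hh, smul_zero, zero_smul, add_zero]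

/-- The parameters of a non-zero operator. -/
theorem classification (huv : u ≠ v) (hn : 3 ≤ Fintype.card I) (hw : w ∈ trans u v)
    (hΦ : Intertwiner u v m m' D N Φ) {g h : MvPolynomial I ℂ} (hh : IsHarm u v m h)
    (hne : Φ g h ≠ 0) :
    (m = m' ∧ N = 0) ∨
    (∃ d : ℕ, 1 ≤ d ∧ m = m' + d ∧ N = d ∧ D = Fintype.card I + 2 * m - 1 - d) ∨
    (∃ k : ℕ, 1 ≤ k ∧ m' = m + k ∧ N = k ∧ D = 1 - k) ∨
    (∃ l : ℕ, 1 ≤ l ∧ m = m' ∧ N = 2 * l ∧ D = Fintype.card I / 2 + m - l) := by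
  obtain ⟨r₀, hN, hq⟩ : ∃ r₀ : ℕ, N = (m' - m : ℕ) + (m - m' : ℕ) + r₀ ∧
      top v m m' Φ (mon u v w (m' - m) (m - m') r₀) ≠ 0 := by
    by_contra hex
    push Not at hex
    exact hne (eq_zero_of_critical huv hn hw hΦ hex g hh)
  -- If `m' > m` the critical monomial has no `X_v` and a positive power of `X_u`, so `rec_u_zero`
  -- applies; symmetrically `rec_v_zero` applies if `m > m'`.
  have hG : ∀ k, m' = m + (k + 1) → (k + r₀ + D : ℂ) = 0 := by
    intro k hk
    rw [show m' - m = k + 1 by omega, show m - m' = 0 by omega] at hq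
    exact (mul_eq_zero.mp (rec_u_zero huv hw hΦ k r₀)).resolve_right hq
  have hD : ∀ k, m = m' + (k + 1) → (k - 2 * m + D - Fintype.card I + 2 : ℂ) = 0 := by
    intro k hk
    rw [show m' - m = 0 by omega, show m - m' = k + 1 by omega] at hq
    exact (mul_eq_zero.mp (rec_v_zero huv hw hΦ k r₀)).resolve_right hq
  have heven : Even r₀ := by
    rw [← Nat.not_odd_iff_even]
    exact fun ho => hq (odd_eq_zero huv hn hw hΦ _ _ ho)
  rcases Nat.eq_zero_or_pos r₀ with rfl | hr
  · rcases lt_trichotomy m m' with hlt | heq | hlt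
    · obtain ⟨k, rfl⟩ : ∃ k, m' = m + (k + 1) := ⟨m' - m - 1, by omega⟩
      refine Or.inr (Or.inr (Or.inl ⟨k + 1, by omega, rfl, ?_, ?_⟩))
      · rw [hN]; simp
      · have := hG k rfl
        push_cast at this ⊢
        linear_combination this
    · exact Or.inl ⟨heq, by rw [hN, heq]; simp⟩
    · obtain ⟨k, rfl⟩ : ∃ k, m = m' + (k + 1) := ⟨m - m' - 1, by omega⟩
      refine Or.inr (Or.inl ⟨k + 1, by omega, rfl, ?_, ?_⟩)
      · rw [hN]; simp
      · have := hD k rfl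
        push_cast at this ⊢
        linear_combination this
  · obtain ⟨l, rfl⟩ := heven
    obtain ⟨r, hr2⟩ : ∃ r, l + l = r + 2 := ⟨l + l - 2, by omega⟩
    have hr2' : (l : ℂ) + l = r + 2 := by exact_mod_cast hr2
    have h1 := rec_w huv hw hΦ (m' - m) (m - m') r
    rw [← hr2] at h1
    have h2 := (mul_eq_zero.mp h1).resolve_right hq
    rcases lt_trichotomy m m' with hlt | heq | hlt
    -- A power of `X_w` with `m ≠ m'` would impose two conditions on `D`, that of `rec_w` and that
    -- of the boundary. Their difference is a sum of natural numbers containing `n` that would be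
    -- zero; the same happens for `m > m'`.
    · exfalso
      obtain ⟨k, rfl⟩ : ∃ k, m' = m + (k + 1) := ⟨m' - m - 1, by omega⟩
      have h3 := hG k rfl
      rw [show m - (m + (k + 1)) = 0 by omega] at h2
      push_cast at h3 h2
      have h4 : ((2 * k + 2 * l + 2 * m + Fintype.card I : ℕ) : ℂ) = (0 : ℕ) := by
        push_cast; linear_combination 2 * h3 - h2 - hr2'
      have h5 : 2 * k + 2 * l + 2 * m + Fintype.card I = 0 := by exact_mod_cast h4
      omega
    · refine Or.inr (Or.inr (Or.inr ⟨l, by omega, heq, ?_, ?_⟩))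
      · rw [hN, heq]; push_cast; simp; ring
      · rw [heq, Nat.sub_self] at h2
        rw [heq]
        push_cast at h2
        linear_combination h2 / 2 + hr2' / 2
    · exfalso
      obtain ⟨k, rfl⟩ : ∃ k, m = m' + (k + 1) := ⟨m - m' - 1, by omega⟩
      have h3 := hD k rfl
      rw [show m' + (k + 1) - m' = k + 1 by omega] at h2
      push_cast at h3 h2
      have h4 : ((r + 2 * m' + 2 * k + Fintype.card I + 2 : ℕ) : ℂ) = (0 : ℕ) := by
        push_cast; linear_combination h2 - 2 * h3
      have h5 : r + 2 * m' + 2 * k + Fintype.card I + 2 = 0 := by exact_mod_cast h4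
      omega

end Intertwiner

end LightCone

/-! ### The jet of an invariant operator at the origin -/

section Jets

/-- Polynomials as smooth functions. -/
def polyFun {n : ℕ} : MvPolynomial (Fin n) ℝ →ₐ[ℝ] Smooth n := aeval coord

theorem partialX_polyFun {n : ℕ} (k : Fin n) (g : MvPolynomial (Fin n) ℝ) :
    partialX k (polyFun g) = polyFun (pderiv k g) := by
  induction g using MvPolynomial.induction_on with
  | C a =>
    have : polyFun (C a : MvPolynomial (Fin n) ℝ) = algebraMap ℝ (Smooth n) a := aeval_C _ _
    rw [this, Derivation.map_algebraMap, pderiv_C, map_zero]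
  | add P Q hP hQ => simp only [map_add, hP, hQ]
  | mul_X P a h =>
    have : polyFun (X a : MvPolynomial (Fin n) ℝ) = coord a := aeval_X _ _
    rw [map_mul, Derivation.leibniz, h, Derivation.leibniz, map_add, smul_eq_mul, smul_eq_mul,
      smul_eq_mul, smul_eq_mul, map_mul, map_mul, this, partialX_coord, pderiv_X, Pi.single_apply]
    congr 1
    split_ifs <;> simp

theorem evAt_polyFun {n : ℕ} (g : MvPolynomial (Fin n) ℝ) :
    evAt 0 (polyFun g) = constantCoeff g := by
  have : (evAt 0).comp polyFun = (aeval (fun _ => (0 : ℝ)) : MvPolynomial (Fin n) ℝ →ₐ[ℝ] ℝ) := by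
    refine MvPolynomial.algHom_ext fun i => ?_
    rw [AlgHom.comp_apply, polyFun, aeval_X, aeval_X]
    rfl
  have h2 := congrArg (fun F => F g) this
  simpa using h2

theorem monoFun_eq_polyFun {n : ℕ} (α : Fin n →₀ ℕ) :
    (monoFun α : Smooth n) = polyFun (monomial α 1) := by
  rw [polyFun, aeval_monomial, map_one, one_mul, Finsupp.prod_fintype _ _ (fun i => pow_zero _)]
  rfl

/-- The reflection `X_i ↦ -X_i` of real polynomials. -/
def flipR {n : ℕ} (i : Fin n) : MvPolynomial (Fin n) ℝ →ₐ[ℝ] MvPolynomial (Fin n) ℝ :=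
  aeval fun j => if j = i then -X j else X j

theorem reflFun_polyFun {n : ℕ} (i : Fin n) (g : MvPolynomial (Fin n) ℝ) :
    reflFun i (polyFun g) = polyFun (flipR i g) := by
  have : (reflFun i).comp polyFun = (polyFun (n := n)).comp (flipR i) := by
    refine MvPolynomial.algHom_ext fun j => ?_
    rw [AlgHom.comp_apply, AlgHom.comp_apply, polyFun, aeval_X, flipR, aeval_X]
    refine smooth_ext fun x => ?_
    change (if j = i then -x j else x j) = _
    split_ifs
    · rw [map_neg, aeval_X]; rfl
    · rw [aeval_X]; rfl
  exact congrArg (fun F => F g) this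

theorem refl_smul {n : ℕ} (i : Fin n) (f : Smooth n) (P : Symbol n) :
    refl i (f • P) = reflFun i f • refl i P := by
  rw [smul_eq_C_mul, refl_mul, smul_eq_C_mul]
  congr 1
  exact eval₂Hom_C _ _ _

theorem refl_constSym {n : ℕ} (i : Fin n) (h : MvPolynomial (Fin n) ℝ) :
    refl i (constSym h) = constSym (flipR i h) := by
  induction h using MvPolynomial.induction_on with
  | C a =>
    have h1 : constSym (C a : MvPolynomial (Fin n) ℝ) = algebraMap ℝ (Smooth n) a • 1 := by
      rw [← algebraMap_eq, AlgHom.commutes, algebraMap_smul, Algebra.algebraMap_eq_smul_one]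
    have h2 : refl i (1 : Symbol n) = 1 := map_one (eval₂Hom _ _)
    have h3 : flipR i (C a : MvPolynomial (Fin n) ℝ) = C a := aeval_C _ _
    rw [h3, h1, refl_smul, h2, AlgHom.commutes]
  | add P Q hP hQ => simp only [map_add, hP, hQ]
  | mul_X P a h =>
    have hX : ∀ j, constSym (X j : MvPolynomial (Fin n) ℝ) = X j := fun j => map_X _ j
    rw [map_mul, refl_mul, h, map_mul, map_mul, hX, refl_X, flipR, aeval_X]
    split_ifs
    · rw [map_neg, hX]
    · rw [hX]

theorem evSym_refl {n : ℕ} (i : Fin n) (P : Symbol n) :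
    evSym 0 (refl i P) = flipR i (evSym 0 P) := by
  induction P using MvPolynomial.induction_on with
  | C f =>
    have h1 : ∀ g : Smooth n, evSym 0 (C g : Symbol n) = C (evAt 0 g) := fun g => map_C _ _
    have h2 : refl i (C f : Symbol n) = C (reflFun i f) := eval₂Hom_C _ _ _
    have h3 : ∀ a, flipR i (C a : MvPolynomial (Fin n) ℝ) = C a := fun a => aeval_C _ _
    rw [h2, h1, h1, h3]
    congr 1
    change f.1 (reflPt i 0) = f.1 0
    exact congrArg f.1 (funext fun j => by simp [reflPt])
  | add P Q hP hQ => simp only [map_add, hP, hQ]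
  | mul_X P a h =>
    have hX : ∀ j, evSym 0 (X j : Symbol n) = X j := fun j => map_X _ j
    rw [refl_mul, map_mul, map_mul, map_mul, h, refl_X, hX, flipR, aeval_X]
    split_ifs
    · rw [map_neg, hX]
    · rw [hX]

theorem dp_constSym {n : ℕ} (i : Fin n) (h : MvPolynomial (Fin n) ℝ) :
    dp i (constSym h) = constSym (pderiv i h) := by
  ext1 d
  have : dp i (constSym h) = pderiv i (constSym h) := rfl
  rw [this, coeff_pderiv, coeff_constSym, coeff_constSym, coeff_pderiv, map_mul, map_add,
    map_natCast, map_one]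

theorem evSym_dp {n : ℕ} (c : Fin n → ℝ) (i : Fin n) (P : Symbol n) :
    evSym c (dp i P) = pderiv i (evSym c P) := by
  ext1 d
  have : dp i P = pderiv i P := rfl
  rw [this, coeff_pderiv, coeff_evSym, coeff_evSym, coeff_pderiv, map_mul, map_add,
    map_natCast, map_one]

variable {p q m m' : ℕ}

/-- Real harmonic polynomials for the diagonal metric. -/
def RealHarm (p q m : ℕ) (h : MvPolynomial (Fin (p + q)) ℝ) : Prop :=
  h.IsHomogeneous m ∧ ∑ i, sgn p q i • pderiv i (pderiv i h) = 0

theorem constSym_injective {n : ℕ} : Function.Injective (constSym (n := n)) := by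
  intro a b hab
  ext1 d
  have h1 := congrArg (fun P => evAt 0 (P.coeff d)) hab
  simp only [coeff_constSym, AlgHom.commutes] at h1
  exact h1

theorem realHarm_iff {h : MvPolynomial (Fin (p + q)) ℝ} :
    RealHarm p q m h ↔ constSym h ∈ sym p q m 0 := by
  have h1 : opT p q (constSym h) = constSym (∑ i, sgn p q i • pderiv i (pderiv i h)) := by
    simp only [opT_apply, map_sum, map_smul, dp_constSym]
  have h2 : (constSym h : Symbol (p + q)).IsHomogeneous m ↔ h.IsHomogeneous m :=
    ⟨fun hh d hd => hh (by
      rw [coeff_constSym]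
      exact fun h0 => hd (by
        have := congrArg (evAt 0) h0
        rwa [AlgHom.commutes, map_zero] at this)),
      fun hh d hd => hh fun h0 => hd (by rw [coeff_constSym, h0, map_zero])⟩
  constructor
  · rintro ⟨ha, hb⟩
    exact ⟨h2.mpr ha, constSym h, by rw [h1, hb, map_zero], by rw [pow_zero, one_mul]⟩
  · rintro ⟨ha, Q, hQ, hb⟩
    rw [pow_zero, one_mul] at hb
    refine ⟨h2.mp ha, constSym_injective ?_⟩
    rw [← h1, hb, hQ, map_zero]

theorem realHarm_evSym {P : Symbol (p + q)} (hP : P ∈ sym p q m 0) :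
    RealHarm p q m (evSym 0 P) := realHarm_iff.mpr (constSym_evSym_mem 0 hP)

/-- The jet at the origin of an operator on symbols, as a bilinear map on polynomials. -/
def jet {n : ℕ} (A : Module.End ℝ (Symbol n)) :
    MvPolynomial (Fin n) ℝ →ₗ[ℝ] MvPolynomial (Fin n) ℝ →ₗ[ℝ] MvPolynomial (Fin n) ℝ :=
  LinearMap.mk₂ ℝ (fun g h => evSym 0 (A (polyFun g • constSym h)))
    (fun _ _ _ => by simp only [map_add, add_smul])
    (fun _ _ _ => by simp only [map_smul, smul_assoc])
    (fun _ _ _ => by simp only [map_add, smul_add])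
    (fun c g _ => by simp only [map_smul, smul_comm (polyFun g) c])

theorem jet_apply {n : ℕ} (A : Module.End ℝ (Symbol n)) (g h : MvPolynomial (Fin n) ℝ) :
    jet A g h = evSym 0 (A (polyFun g • constSym h)) := rfl

theorem lieDer_polyFun {n : ℕ} (δ : ℝ) (ν : Fin n → MvPolynomial (Fin n) ℝ)
    (g h : MvPolynomial (Fin n) ℝ) :
    lieDer δ (fun k => polyFun (ν k)) (polyFun g • constSym h) =
      ∑ k, polyFun (ν k * pderiv k g) • constSym h
        - ∑ i, ∑ j, polyFun (pderiv i (ν j) * g) • constSym (X j * pderiv i h)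
        + δ • (polyFun ((∑ k, pderiv k (ν k)) * g) • constSym h) := by
  have hX : ∀ j, constSym (X j : MvPolynomial (Fin n) ℝ) = X j := fun j => map_X _ j
  simp only [lieDer_apply, dx_smul_constSym, dp_smul, dp_constSym, partialX_polyFun, smul_smul,
    map_mul, mul_smul_comm, divergence, map_sum, hX]

/-- The consequence of invariance under a conformal field vanishing at the origin. -/
theorem jet_killing {A : sym p q m 0 →ₗ[ℝ] sym p q m' 0} {δ δ' : ℝ}
    (hA : ∀ (V : Fin (p + q) → Smooth (p + q)) (hV : IsConformalKilling p q V),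
      A ∘ₗ lieSym m 0 δ hV = lieSym m' 0 δ' hV ∘ₗ A)
    {B : Module.End ℝ (Symbol (p + q))} (hB : ∀ P : sym p q m 0, B P = A P)
    {ν : Fin (p + q) → MvPolynomial (Fin (p + q)) ℝ} {φ : MvPolynomial (Fin (p + q)) ℝ}
    (hν : ∀ i j, sgn p q j • pderiv i (ν j) + sgn p q i • pderiv j (ν i) =
      if i = j then sgn p q i • φ else 0)
    (h0 : ∀ k, constantCoeff (ν k) = 0) (g : MvPolynomial (Fin (p + q)) ℝ)
    {h : MvPolynomial (Fin (p + q)) ℝ} (hh : RealHarm p q m h) :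
    ∑ k, jet B (ν k * pderiv k g) h - ∑ i, ∑ j, jet B (pderiv i (ν j) * g) (X j * pderiv i h)
      + δ • jet B ((∑ k, pderiv k (ν k)) * g) h =
    (δ' * constantCoeff (∑ k, pderiv k (ν k))) • jet B g h -
      ∑ i, ∑ j, constantCoeff (pderiv i (ν j)) • (X j * pderiv i (jet B g h)) := by
  have hV : IsConformalKilling p q fun k => polyFun (ν k) := ⟨polyFun φ, fun i j => by
    rw [partialX_polyFun, partialX_polyFun, ← map_smul polyFun, ← map_smul polyFun,
      ← map_add polyFun, hν]
    split_ifs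
    · rw [map_smul]
    · rw [map_zero]⟩
  set P : sym p q m 0 := ⟨polyFun g • constSym h, (sym p q m 0).smul_mem _ (realHarm_iff.mp hh)⟩
    with hP
  have h1 := congrArg (fun F => evSym 0 (F P : Symbol (p + q))) (hA _ hV)
  have h2 : evSym 0 ((A ∘ₗ lieSym m 0 δ hV) P : Symbol (p + q)) =
      evSym 0 (B (lieDer δ (fun k => polyFun (ν k)) (polyFun g • constSym h))) := by
    rw [LinearMap.comp_apply, ← hB]; rfl
  have h3 : ((lieSym m' 0 δ' hV ∘ₗ A) P : Symbol (p + q)) =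
      lieDer δ' (fun k => polyFun (ν k)) (B (polyFun g • constSym h)) := by
    change lieDer δ' _ (A P : Symbol (p + q)) = _
    rw [← hB]
  have hX : ∀ j, evSym 0 (X j : Symbol (p + q)) = X j := fun j => map_X _ j
  simp only [h2, h3] at h1
  -- The field vanishes at the origin. On the target only its divergence and Jacobian at the origin
  -- survive the evaluation, and they act on the value of the jet.
  rw [lieDer_polyFun, lieDer_apply] at h1
  simp only [map_add, map_sub, map_sum, map_smul, evSym_smul, evAt_polyFun, h0, zero_smul,
    Finset.sum_const_zero, partialX_polyFun, map_mul, evSym_dp, hX, divergence, zero_sub] at h1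
  simp only [jet_apply, map_sum, map_mul]
  simp only [smul_smul] at h1
  rw [h1]
  abel

theorem jet_realHarm {A : sym p q m 0 →ₗ[ℝ] sym p q m' 0}
    {B : Module.End ℝ (Symbol (p + q))} (hB : ∀ P : sym p q m 0, B P = A P)
    (g : MvPolynomial (Fin (p + q)) ℝ)
    {h : MvPolynomial (Fin (p + q)) ℝ} (hh : RealHarm p q m h) :
    RealHarm p q m' (jet B g h) := by
  have h1 := hB ⟨polyFun g • constSym h, (sym p q m 0).smul_mem _ (realHarm_iff.mp hh)⟩
  rw [jet_apply]
  have h2 : B (polyFun g • constSym h) ∈ sym p q m' 0 := by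
    rw [show B (polyFun g • constSym h) = _ from h1]; exact SetLike.coe_mem _
  exact realHarm_evSym h2

theorem jet_refl {A : sym p q m 0 →ₗ[ℝ] sym p q m' 0} (hA : A ∈ reflInv p q m 0 m' 0)
    {B : Module.End ℝ (Symbol (p + q))} (hB : ∀ P : sym p q m 0, B P = A P) (i : Fin (p + q))
    (g : MvPolynomial (Fin (p + q)) ℝ)
    {h : MvPolynomial (Fin (p + q)) ℝ} (hh : RealHarm p q m h) :
    jet B (flipR i g) (flipR i h) = flipR i (jet B g h) := by
  set P : sym p q m 0 := ⟨polyFun g • constSym h, (sym p q m 0).smul_mem _ (realHarm_iff.mp hh)⟩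
    with hP
  have h1 := congrArg (fun F => (F P : Symbol (p + q))) (hA i)
  have h2 : ((A ∘ₗ reflSym p q m 0 i) P : Symbol (p + q)) =
      B (refl i (polyFun g • constSym h)) := by
    rw [LinearMap.comp_apply, ← hB]; rfl
  have h3 : ((reflSym p q m' 0 i ∘ₗ A) P : Symbol (p + q)) =
      refl i (B (polyFun g • constSym h)) := by
    change refl i (A P : Symbol (p + q)) = _
    rw [← hB]
  simp only [h2, h3] at h1
  rw [refl_smul, reflFun_polyFun, refl_constSym] at h1
  rw [jet_apply, h1, evSym_refl, jet_apply]

/-- Allows the jet to be defined as a bilinear map on all polynomials. The arbitrary values off the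
trace-free symbols are harmless, as the conditions on intertwiners are only required for harmonic
arguments. -/
theorem exists_extension (A : sym p q m 0 →ₗ[ℝ] sym p q m' 0) :
    ∃ B : Module.End ℝ (Symbol (p + q)), ∀ P : sym p q m 0, B P = A P := by
  obtain ⟨B, hB⟩ := LinearMap.exists_extend (p := (sym p q m 0).restrictScalars ℝ)
    ((((sym p q m' 0).subtype).restrictScalars ℝ) ∘ₗ A)
  exact ⟨B, fun P => congrArg (fun F => F P) hB⟩

/-- Translations are conformal fields. -/
theorem dx_comm_of_invariant {A : sym p q m 0 →ₗ[ℝ] sym p q m' 0} {δ δ' : ℝ}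
    (hA : ∀ (V : Fin (p + q) → Smooth (p + q)) (hV : IsConformalKilling p q V),
      A ∘ₗ lieSym m 0 δ hV = lieSym m' 0 δ' hV ∘ₗ A) (i : Fin (p + q)) (P Q : sym p q m 0)
    (hQ : (Q : Symbol (p + q)) = dx i P) : (A Q : Symbol (p + q)) = dx i (A P) := by
  set V : Fin (p + q) → Smooth (p + q) := fun k => if k = i then 1 else 0 with hVdef
  have hp : ∀ a b, partialX a (V b) = 0 := fun a b => by
    simp only [hVdef]; split_ifs <;> simp
  have hV : IsConformalKilling p q V := ⟨0, fun a b => by simp [hp]⟩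
  have hL : ∀ (δ : ℝ) (Z : Symbol (p + q)), lieDer δ V Z = dx i Z := fun δ Z => by
    simp only [lieDer_apply, hp, divergence, zero_smul, Finset.sum_const_zero, sub_zero, smul_zero,
      add_zero]
    simp only [hVdef, ite_smul, one_smul, zero_smul]
    rw [Finset.sum_ite_eq', if_pos (Finset.mem_univ _)]
  have h1 := congrArg (fun F => (F P : Symbol (p + q))) (hA V hV)
  have h2 : lieSym m 0 δ hV P = Q := Subtype.ext ((hL δ P).trans hQ.symm)
  simp only [LinearMap.comp_apply, h2] at h1
  rw [h1]
  exact hL δ' _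

/-- A differential operator invariant under translations is determined by its jet. -/
theorem eq_zero_of_jet {A : sym p q m 0 →ₗ[ℝ] sym p q m' 0} {r : ℕ} (hr : IsDiffOp r A) {δ δ' : ℝ}
    (hA : ∀ (V : Fin (p + q) → Smooth (p + q)) (hV : IsConformalKilling p q V),
      A ∘ₗ lieSym m 0 δ hV = lieSym m' 0 δ' hV ∘ₗ A)
    {B : Module.End ℝ (Symbol (p + q))} (hB : ∀ P : sym p q m 0, B P = A P)
    (h0 : ∀ g h, RealHarm p q m h → jet B g h = 0) : A = 0 := by
  refine diffOp_eq_zero hr (dx_comm_of_invariant hA) fun α h Z hh hZ => ?_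
  have h1 := h0 (monomial (Finsupp.equivFunOnFinite.symm α) 1) h (realHarm_iff.mpr hh)
  have h2 := monoFun_eq_polyFun (Finsupp.equivFunOnFinite.symm α)
  rw [jet_apply, ← h2] at h1
  rw [← hB, hZ]
  exact h1

end Jets

/-! ### Complexification and linear changes of coordinates -/

section Frames

variable {I : Type} [Fintype I] [DecidableEq I]

/-- Complexification of real polynomials. -/
def cplx : MvPolynomial I ℝ →ₐ[ℝ] MvPolynomial I ℂ := mapAlgHom (Algebra.ofId ℝ ℂ)

/-- Linear substitution of variables. -/
def subst (M : I → I → ℂ) : MvPolynomial I ℂ →ₐ[ℂ] MvPolynomial I ℂ :=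
  aeval fun k => ∑ f, M k f • X f

theorem cplx_X (k : I) : cplx (X k : MvPolynomial I ℝ) = X k := map_X _ _

theorem coeff_cplx (P : MvPolynomial I ℝ) (d : I →₀ ℕ) :
    (cplx P).coeff d = ((P.coeff d : ℝ) : ℂ) := coeff_map _ _ _

theorem cplx_C (a : ℝ) : cplx (C a : MvPolynomial I ℝ) = C (a : ℂ) := map_C _ _

theorem exists_cplx (P : MvPolynomial I ℂ) :
    ∃ a b : MvPolynomial I ℝ, P = cplx a + Complex.I • cplx b := by
  induction P using MvPolynomial.induction_on with
  | C z =>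
    refine ⟨C z.re, C z.im, ?_⟩
    rw [cplx_C, cplx_C, ← C_mul', ← C_mul, ← C_add, mul_comm, Complex.re_add_im]
  | add P Q hP hQ =>
    obtain ⟨a, b, rfl⟩ := hP
    obtain ⟨a', b', rfl⟩ := hQ
    exact ⟨a + a', b + b', by rw [map_add, map_add]; module⟩
  | mul_X P k h =>
    obtain ⟨a, b, rfl⟩ := h
    exact ⟨a * X k, b * X k, by rw [map_mul, map_mul, cplx_X, add_mul, smul_mul_assoc]⟩

theorem cplx_eq_zero {a b : MvPolynomial I ℝ} (h : cplx a + Complex.I • cplx b = 0) :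
    a = 0 ∧ b = 0 := by
  have h1 : ∀ d, a.coeff d = 0 ∧ b.coeff d = 0 := by
    intro d
    have h2 := congrArg (coeff d) h
    rw [coeff_add, coeff_smul, coeff_cplx, coeff_cplx, coeff_zero, smul_eq_mul, mul_comm] at h2
    have h3 := congrArg Complex.re h2
    have h4 := congrArg Complex.im h2
    simp at h3 h4
    exact ⟨h3, h4⟩
  exact ⟨by ext1 d; exact (h1 d).1, by ext1 d; exact (h1 d).2⟩

theorem pderiv_cplx (e : I) (P : MvPolynomial I ℝ) : pderiv e (cplx P) = cplx (pderiv e P) :=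
  pderiv_map

theorem subst_X (M : I → I → ℂ) (k : I) : subst M (X k) = ∑ f, M k f • X f := aeval_X _ _

theorem subst_subst {M M' : I → I → ℂ}
    (h : ∀ k l, ∑ f, M k f * M' f l = if k = l then 1 else 0) (P : MvPolynomial I ℂ) :
    subst M' (subst M P) = P := by
  have : (subst M').comp (subst M) = AlgHom.id ℂ (MvPolynomial I ℂ) := by
    refine MvPolynomial.algHom_ext fun k => ?_
    rw [AlgHom.comp_apply, subst_X, map_sum, AlgHom.id_apply]
    simp only [map_smul, subst_X, Finset.smul_sum, smul_smul]
    rw [Finset.sum_comm]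
    simp only [← Finset.sum_smul, h, ite_smul, one_smul, zero_smul]
    rw [Finset.sum_ite_eq, if_pos (Finset.mem_univ _)]
  exact congrArg (fun F => F P) this

theorem pderiv_subst (M : I → I → ℂ) (e : I) (P : MvPolynomial I ℂ) :
    pderiv e (subst M P) = ∑ k, M k e • subst M (pderiv k P) := by
  induction P using MvPolynomial.induction_on with
  | C z =>
    have : subst M (C z) = C z := aeval_C _ _
    simp [this]
  | add P Q hP hQ => simp only [map_add, hP, hQ, smul_add, Finset.sum_add_distrib]
  | mul_X P a h =>
    have h1 : pderiv e (∑ f, M a f • X f : MvPolynomial I ℂ) = C (M a e) := by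
      simp only [map_sum, Derivation.map_smul, pderiv_X', smul_ite, smul_zero]
      rw [Finset.sum_ite_eq', if_pos (Finset.mem_univ _), ← C_mul', mul_one]
    have h2 : ∀ k, subst M (pderiv k (X a : MvPolynomial I ℂ)) = if a = k then 1 else 0 := by
      intro k
      rw [pderiv_X']
      split_ifs <;> simp
    simp only [map_mul, pderiv_mul', map_add, h, subst_X, h1, h2, mul_ite, mul_one, mul_zero,
      smul_add, smul_ite, smul_zero, Finset.sum_add_distrib, Finset.sum_mul, smul_mul_assoc]
    rw [Finset.sum_ite_eq, if_pos (Finset.mem_univ _), smul_eq_C_mul, mul_comm (C _)]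

/-- Substitution of complex linear forms into real polynomials. -/
def real (M : I → I → ℂ) : MvPolynomial I ℝ →ₐ[ℝ] MvPolynomial I ℂ :=
  ((subst M).restrictScalars ℝ).comp cplx

theorem real_apply (M : I → I → ℂ) (P : MvPolynomial I ℝ) : real M P = subst M (cplx P) := rfl

theorem real_X (M : I → I → ℂ) (k : I) : real M (X k) = ∑ f, M k f • X f := by
  rw [real_apply, cplx_X, subst_X]

theorem pderiv_real (M : I → I → ℂ) (e : I) (P : MvPolynomial I ℝ) :
    pderiv e (real M P) = ∑ k, M k e • real M (pderiv k P) := by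
  rw [real_apply, pderiv_subst]
  simp only [pderiv_cplx, real_apply]

theorem constantCoeff_real (M : I → I → ℂ) (P : MvPolynomial I ℝ) :
    constantCoeff (real M P) = ((constantCoeff P : ℝ) : ℂ) := by
  induction P using MvPolynomial.induction_on with
  | C a =>
    have : real M (C a) = C (a : ℂ) := by rw [real_apply, cplx_C]; exact aeval_C _ _
    rw [this, constantCoeff_C, constantCoeff_C]
  | add P Q hP hQ => simp only [map_add, hP, hQ, Complex.ofReal_add]
  | mul_X P a h =>
    have h0 : constantCoeff (∑ f, M a f • X f : MvPolynomial I ℂ) = 0 := by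
      rw [map_sum]
      exact Finset.sum_eq_zero fun f _ => by
        rw [← C_mul', map_mul, constantCoeff_X, mul_zero]
    rw [map_mul, map_mul, map_mul, real_X, h0, constantCoeff_X, mul_zero, mul_zero,
      Complex.ofReal_zero]

theorem exists_bilinear (F : (I →₀ ℕ) → (I →₀ ℕ) → MvPolynomial I ℂ) :
    ∃ Φ : MvPolynomial I ℂ →ₗ[ℂ] MvPolynomial I ℂ →ₗ[ℂ] MvPolynomial I ℂ,
      ∀ α β, Φ (monomial α 1) (monomial β 1) = F α β := by
  refine ⟨(basisMonomials I ℂ).constr ℂ fun α => (basisMonomials I ℂ).constr ℂ fun β => F α β,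
    fun α β => ?_⟩
  have hm : ∀ (α : I →₀ ℕ), (monomial α (1 : ℂ) : MvPolynomial I ℂ) = basisMonomials I ℂ α :=
    fun α => by simp
  rw [hm, hm, Module.Basis.constr_basis, Module.Basis.constr_basis]

theorem cplx_smul (r : ℝ) (P : MvPolynomial I ℝ) : cplx (r • P) = (r : ℂ) • cplx P := by
  rw [map_smul]; ext1 d; simp

theorem exists_bilinear_cplx
    (J : MvPolynomial I ℝ →ₗ[ℝ] MvPolynomial I ℝ →ₗ[ℝ] MvPolynomial I ℝ) :
    ∃ Φ : MvPolynomial I ℂ →ₗ[ℂ] MvPolynomial I ℂ →ₗ[ℂ] MvPolynomial I ℂ,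
      ∀ g h, Φ (cplx g) (cplx h) = cplx (J g h) := by
  obtain ⟨Φ, hΦ⟩ := exists_bilinear fun α β => cplx (J (monomial α 1) (monomial β 1))
  refine ⟨Φ, fun g h => ?_⟩
  have hmr : ∀ (α : I →₀ ℕ) (r : ℝ), (monomial α r : MvPolynomial I ℝ) = r • monomial α 1 :=
    fun α r => by rw [smul_monomial, smul_eq_mul, mul_one]
  have hmono : ∀ (α : I →₀ ℕ) (r : ℝ), cplx (monomial α r) = (r : ℂ) • monomial α 1 :=
    fun α r => by
      rw [smul_monomial, smul_eq_mul, mul_one]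
      exact map_monomial _ _ _
  induction g using MvPolynomial.induction_on' with
  | add P Q hP hQ => simp only [map_add, LinearMap.add_apply, hP, hQ]
  | monomial α r =>
    induction h using MvPolynomial.induction_on' with
    | add P Q hP hQ => simp only [map_add, hP, hQ]
    | monomial β t =>
      rw [hmono, hmono, map_smul, map_smul, LinearMap.smul_apply, hΦ, hmr α r, hmr β t, map_smul (J _),
        map_smul J, LinearMap.smul_apply, cplx_smul, cplx_smul]

/-- Two mutually inverse matrices. -/
structure Inverse (c c' : I → I → ℂ) : Prop where
  left : ∀ k l, ∑ f, c' k f * c f l = if k = l then 1 else 0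
  right : ∀ f g, ∑ k, c f k * c' k g = if f = g then 1 else 0

namespace Inverse

variable {c c' : I → I → ℂ} (hc : Inverse c c')

theorem dual (hc : Inverse c c') : Inverse (fun f k => c' k f) (fun k f => c f k) :=
  ⟨fun k l => by simpa only [mul_comm, eq_comm] using hc.left l k,
    fun k l => by simpa only [mul_comm, eq_comm] using hc.right l k⟩

theorem exists_real (hc : Inverse c c') (P : MvPolynomial I ℂ) :
    ∃ a b, P = real c' a + Complex.I • real c' b := by
  obtain ⟨a, b, h⟩ := exists_cplx (subst c P)
  refine ⟨a, b, ?_⟩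
  rw [real_apply, real_apply, ← map_smul, ← map_add, ← h, subst_subst hc.right]

theorem real_eq_zero (hc : Inverse c c') {a b : MvPolynomial I ℝ}
    (h : real c' a + Complex.I • real c' b = 0) : a = 0 ∧ b = 0 := by
  refine cplx_eq_zero ?_
  have h1 := congrArg (subst c) h
  rwa [map_add, map_smul, map_zero, real_apply, real_apply, subst_subst hc.left,
    subst_subst hc.left] at h1

/-- A contraction of dual frames. -/
theorem contract (hc : Inverse c c') {M N P : Type*} [AddCommGroup M] [AddCommGroup N]
    [AddCommGroup P] [Module ℂ M] [Module ℂ N] [Module ℂ P] (B : M →ₗ[ℂ] N →ₗ[ℂ] P) (a : I → M) (b : I → N) :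
    ∑ e, B (∑ k, c' k e • a k) (∑ l, c e l • b l) = ∑ k, B (a k) (b k) := by
  simp only [map_sum, map_smul, LinearMap.sum_apply, LinearMap.smul_apply, Finset.smul_sum,
    smul_smul]
  have h1 : ∀ e, ∑ l, ∑ k, (c e l * c' k e) • B (a k) (b l) =
      ∑ k, ∑ l, (c' k e * c e l) • B (a k) (b l) := fun e => by
    rw [Finset.sum_comm]; simp only [mul_comm]
  simp only [h1]
  rw [Finset.sum_comm]
  refine Finset.sum_congr rfl fun k _ => ?_
  rw [Finset.sum_comm]
  simp only [← Finset.sum_smul, hc.left, ite_smul, one_smul, zero_smul]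
  rw [Finset.sum_ite_eq, if_pos (Finset.mem_univ _)]

theorem X_eq (hc : Inverse c c') (f : I) :
    (X f : MvPolynomial I ℂ) = ∑ k, c f k • real c' (X k) := by
  simp only [real_X, Finset.smul_sum, smul_smul]
  rw [Finset.sum_comm]
  simp only [← Finset.sum_smul, hc.right, ite_smul, one_smul, zero_smul]
  rw [Finset.sum_ite_eq, if_pos (Finset.mem_univ _)]

/-- A real bilinear map extends to a complex bilinear map. -/
theorem exists_extension (hc : Inverse c c')
    (J : MvPolynomial I ℝ →ₗ[ℝ] MvPolynomial I ℝ →ₗ[ℝ] MvPolynomial I ℝ) :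
    ∃ Φ : MvPolynomial I ℂ →ₗ[ℂ] MvPolynomial I ℂ →ₗ[ℂ] MvPolynomial I ℂ,
      ∀ g h, Φ (real c' g) (real (fun k f => c f k) h) = real (fun k f => c f k) (J g h) := by
  obtain ⟨Φ₀, h0⟩ := exists_bilinear_cplx J
  -- Positions are substituted by one matrix and momenta by the contragredient one, as for a linear
  -- change of coordinates on the cotangent bundle.
  refine ⟨LinearMap.mk₂ ℂ (fun g h => subst (fun k f => c f k)
    (Φ₀ (subst c g) (subst (fun f k => c' k f) h)))
    (fun _ _ _ => by simp only [map_add, LinearMap.add_apply])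
    (fun _ _ _ => by simp only [map_smul, LinearMap.smul_apply])
    (fun _ _ _ => by simp only [map_add])
    (fun _ _ _ => by simp only [map_smul]), fun g h => ?_⟩
  have h1 : subst c (real c' g) = cplx g := subst_subst hc.left _
  have h2 : subst (fun f k => c' k f) (real (fun k f => c f k) h) = cplx h :=
    subst_subst hc.dual.left _
  rw [LinearMap.mk₂_apply, h1, h2, h0, real_apply]

end Inverse

/-- The failure of invariance under a polynomial vector field vanishing at the origin. -/
def defect (Φ : MvPolynomial I ℂ →ₗ[ℂ] MvPolynomial I ℂ →ₗ[ℂ] MvPolynomial I ℂ) (δ δ' : ℂ)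
    (μ : I → MvPolynomial I ℂ) (g h : MvPolynomial I ℂ) : MvPolynomial I ℂ :=
  ∑ e, Φ (μ e * pderiv e g) h - ∑ f, ∑ e, Φ (pderiv e (μ f) * g) (X f * pderiv e h)
    + δ • Φ ((∑ e, pderiv e (μ e)) * g) h
    - ((δ' * constantCoeff (∑ e, pderiv e (μ e))) • Φ g h
      - ∑ f, ∑ e, constantCoeff (pderiv e (μ f)) • (X f * pderiv e (Φ g h)))

variable {Φ : MvPolynomial I ℂ →ₗ[ℂ] MvPolynomial I ℂ →ₗ[ℂ] MvPolynomial I ℂ} {δ δ' : ℂ}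

theorem constantCoeff_smul (z : ℂ) (P : MvPolynomial I ℂ) :
    constantCoeff (z • P) = z * constantCoeff P := by
  rw [← C_mul', map_mul, constantCoeff_C]

/-- Linearity in the field, and below in the two arguments, reduces invariance under complex fields
to the real case. -/
theorem defect_field (μ μ' : I → MvPolynomial I ℂ) (z : ℂ) (g h : MvPolynomial I ℂ) :
    defect Φ δ δ' (fun e => μ e + z • μ' e) g h =
      defect Φ δ δ' μ g h + z • defect Φ δ δ' μ' g h := by
  simp only [defect, map_add, Derivation.map_smul, add_mul, smul_mul_assoc, map_smul,
    LinearMap.add_apply, LinearMap.smul_apply, Finset.sum_add_distrib, ← Finset.smul_sum,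
    constantCoeff_smul, add_smul, mul_smul]
  module

theorem defect_left (μ : I → MvPolynomial I ℂ) (z : ℂ) (g g' h : MvPolynomial I ℂ) :
    defect Φ δ δ' μ (g + z • g') h =
      defect Φ δ δ' μ g h + z • defect Φ δ δ' μ g' h := by
  simp only [defect, map_add, Derivation.map_smul, mul_add, mul_smul_comm, map_smul,
    LinearMap.add_apply, LinearMap.smul_apply, Finset.sum_add_distrib, ← Finset.smul_sum,
    smul_add, smul_comm _ z]
  module

theorem defect_right (μ : I → MvPolynomial I ℂ) (z : ℂ) (g h h' : MvPolynomial I ℂ) :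
    defect Φ δ δ' μ g (h + z • h') =
      defect Φ δ δ' μ g h + z • defect Φ δ δ' μ g h' := by
  simp only [defect, map_add, Derivation.map_smul, mul_add, mul_smul_comm, map_smul,
    LinearMap.add_apply, LinearMap.smul_apply, Finset.sum_add_distrib, ← Finset.smul_sum,
    smul_add, smul_comm _ z]
  module

end Frames

/-! ### Naturality of the defect and light-cone frames -/

section Frames

variable {I : Type} [Fintype I] [DecidableEq I] {c c' : I → I → ℂ}

namespace Inverse

theorem pderiv_field (e : I) (ν : I → MvPolynomial I ℝ) (f : I) :
    pderiv e (∑ l, c f l • real c' (ν l)) =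
      ∑ k, c' k e • ∑ l, c f l • real c' (pderiv k (ν l)) := by
  simp only [map_sum, Derivation.map_smul, pderiv_real, Finset.smul_sum, smul_smul]
  rw [Finset.sum_comm]
  simp only [mul_comm]

theorem sum_pderiv_field (hc : Inverse c c') (ν : I → MvPolynomial I ℝ) :
    ∑ e, pderiv e (∑ l, c e l • real c' (ν l)) = real c' (∑ k, pderiv k (ν k)) := by
  have h : ∀ e, ∑ k, c' k e • ∑ l, c e l • real c' (pderiv k (ν l)) =
      ∑ k, ∑ l, (c' k e * c e l) • real c' (pderiv k (ν l)) := fun e => by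
    simp only [Finset.smul_sum, smul_smul]
  simp only [pderiv_field, h]
  rw [Finset.sum_comm, map_sum]
  refine Finset.sum_congr rfl fun k _ => ?_
  rw [Finset.sum_comm]
  simp only [← Finset.sum_smul, hc.left, ite_smul, one_smul, zero_smul]
  rw [Finset.sum_ite_eq, if_pos (Finset.mem_univ _)]

/-- The contraction of the Jacobian of a field with `p_j ∂_{p_i}` does not depend on the frame. It
is stated for an arbitrary bilinear `F`, to serve both for the argument of `Φ` and for its value. -/
theorem sum_field (hc : Inverse c c')
    (F : MvPolynomial I ℂ →ₗ[ℂ] MvPolynomial I ℂ →ₗ[ℂ] MvPolynomial I ℂ)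
    (ν : I → MvPolynomial I ℝ) (h : MvPolynomial I ℝ) :
    ∑ f, ∑ e, F (pderiv e (∑ l, c f l • real c' (ν l)))
        (X f * pderiv e (real (fun k f => c f k) h)) =
      ∑ k, ∑ j, F (real c' (pderiv k (ν j))) (real (fun k f => c f k) (X j * pderiv k h)) := by
  have h1 : ∀ f, ∑ e, F (pderiv e (∑ l, c f l • real c' (ν l)))
        (X f * pderiv e (real (fun k f => c f k) h)) =
      ∑ k, F (∑ l, c f l • real c' (pderiv k (ν l)))
        (X f * real (fun k f => c f k) (pderiv k h)) := by
    intro f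
    simp only [pderiv_field, pderiv_real]
    exact hc.contract (LinearMap.mk₂ ℂ (fun a b => F a (X f * b))
      (fun _ _ _ => by simp only [map_add, LinearMap.add_apply])
      (fun _ _ _ => by simp only [map_smul, LinearMap.smul_apply])
      (fun _ _ _ => by simp only [map_add, mul_add])
      (fun _ _ _ => by simp only [map_smul, mul_smul_comm])) _ _
  simp only [h1]
  rw [Finset.sum_comm]
  refine Finset.sum_congr rfl fun k _ => ?_
  have h2 : ∀ f, (X f : MvPolynomial I ℂ) = ∑ j, c' j f • real (fun k f => c f k) (X j) :=
    fun f => hc.dual.X_eq f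
  have h3 := hc.contract (LinearMap.mk₂ ℂ
      (fun a b => F b (a * real (fun k f => c f k) (pderiv k h)))
      (fun _ _ _ => by simp only [map_add, add_mul])
      (fun _ _ _ => by simp only [map_smul, smul_mul_assoc])
      (fun _ _ _ => by simp only [map_add, LinearMap.add_apply])
      (fun _ _ _ => by simp only [map_smul, LinearMap.smul_apply]))
      (fun j => real (fun k f => c f k) (X j)) (fun l => real c' (pderiv k (ν l)))
  simp only [← h2, LinearMap.mk₂_apply] at h3
  rw [h3]
  simp only [map_mul]

theorem sum_mul_pderiv (hc : Inverse c c') (ν : I → MvPolynomial I ℝ) (g : MvPolynomial I ℝ) :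
    ∑ e, (∑ l, c e l • real c' (ν l)) * pderiv e (real c' g) =
      real c' (∑ k, ν k * pderiv k g) := by
  have h3 := hc.contract (LinearMap.mk₂ ℂ (fun a b : MvPolynomial I ℂ => b * a)
      (fun _ _ _ => by simp only [mul_add])
      (fun _ _ _ => by simp only [mul_smul_comm])
      (fun _ _ _ => by simp only [add_mul])
      (fun _ _ _ => by simp only [smul_mul_assoc]))
      (fun j => real c' (pderiv j g)) (fun l => real c' (ν l))
  simp only [← pderiv_real, LinearMap.mk₂_apply] at h3
  rw [h3]
  simp only [map_mul, map_sum]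

variable {J : MvPolynomial I ℝ →ₗ[ℝ] MvPolynomial I ℝ →ₗ[ℝ] MvPolynomial I ℝ}
  {Φ : MvPolynomial I ℂ →ₗ[ℂ] MvPolynomial I ℂ →ₗ[ℂ] MvPolynomial I ℂ}

theorem real_smul (r : ℝ) (M : I → I → ℂ) (P : MvPolynomial I ℝ) :
    real M (r • P) = (r : ℂ) • real M P := by
  rw [real_apply, cplx_smul, map_smul, real_apply]

/-- Each of the terms of the defect is a contraction of dual frames, so it transforms into the real
expression provided by `jet_killing`. -/
theorem defect_real (hc : Inverse c c')
    (hΦ : ∀ g h, Φ (real c' g) (real (fun k f => c f k) h) = real (fun k f => c f k) (J g h))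
    {δ δ' : ℝ} {ν : I → MvPolynomial I ℝ} {g h : MvPolynomial I ℝ}
    (hJ : ∑ k, J (ν k * pderiv k g) h - ∑ i, ∑ j, J (pderiv i (ν j) * g) (X j * pderiv i h)
      + δ • J ((∑ k, pderiv k (ν k)) * g) h =
      (δ' * constantCoeff (∑ k, pderiv k (ν k))) • J g h -
      ∑ i, ∑ j, constantCoeff (pderiv i (ν j)) • (X j * pderiv i (J g h))) :
    defect Φ δ δ' (fun f => ∑ l, c f l • real c' (ν l)) (real c' g)
      (real (fun k f => c f k) h) = 0 := by
  have h1 := congrArg (real fun k f => c f k) hJ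
  have e2 := hc.sum_field (LinearMap.mk₂ ℂ (fun a b => Φ (a * real c' g) b)
      (fun _ _ _ => by simp only [map_add, add_mul, LinearMap.add_apply])
      (fun _ _ _ => by simp only [map_smul, smul_mul_assoc, LinearMap.smul_apply])
      (fun _ _ _ => by simp only [map_add])
      (fun _ _ _ => by simp only [map_smul])) ν h
  have e4 := hc.sum_field (LinearMap.mk₂ ℂ (fun a b => constantCoeff a • b)
      (fun _ _ _ => by simp only [map_add, add_smul])
      (fun _ _ _ => by simp only [constantCoeff_smul, mul_smul])
      (fun _ _ _ => by simp only [smul_add])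
      (fun z _ _ => by simp only [smul_comm z])) ν (J g h)
  simp only [LinearMap.mk₂_apply] at e2 e4
  rw [defect, ← LinearMap.sum_apply, ← map_sum, hc.sum_mul_pderiv, hc.sum_pderiv_field, e2, hΦ _ h, hΦ g h, e4,
    ← map_mul, hΦ, constantCoeff_real]
  simp only [← map_mul, hΦ, constantCoeff_real]
  simp only [map_add, map_sub, map_sum, real_smul, LinearMap.sum_apply] at h1
  simp only [map_sum, LinearMap.sum_apply]
  rw [h1]
  push_cast
  simp only [sub_self]

end Inverse

/-- Frames adapted to the light cone of a diagonal metric. -/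
structure LightFrame (s : I → ℝ) (u v : I) (c c' : I → I → ℂ) : Prop where
  inv : Inverse c c'
  metric : ∀ k f, c' k f = s k * c (Equiv.swap u v f) k
  trans_left : ∀ i ∈ trans u v, ∀ k, k ≠ i → c i k = 0
  trans_right : ∀ i ∈ trans u v, ∀ k, k ≠ i → c k i = 0

namespace LightFrame

variable {s : I → ℝ} {u v : I}

/-- The frame carries the diagonal metric to the light-cone form. Because `metric` determines `c'`
from `c`, this is just the inverse relation multiplied by the sign. -/
theorem sum_c (hs : ∀ i, s i * s i = 1) (hc : LightFrame s u v c c') (i j : I) :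
    ∑ e, c e i * c (Equiv.swap u v e) j = if i = j then (s i : ℂ) else 0 := by
  have h1 := hc.inv.left j i
  simp only [hc.metric, mul_assoc, ← Finset.mul_sum] at h1
  have h2 : ((s j : ℂ)) * s j = 1 := by exact_mod_cast hs j
  have h3 := congrArg (fun z => (s j : ℂ) * z) h1
  simp only [← mul_assoc, h2, one_mul] at h3
  simp only [mul_comm (c _ i)]
  rw [h3]
  by_cases h : i = j
  · subst h; simp
  · simp [h, Ne.symm h]

/-- The Killing equation in light-cone coordinates. -/
def _root_.ConfSymbols.LightKilling (u v : I) (μ : I → MvPolynomial I ℂ) (φ : MvPolynomial I ℂ) : Prop :=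
  ∀ e f, pderiv e (μ (Equiv.swap u v f)) + pderiv f (μ (Equiv.swap u v e)) =
    if f = Equiv.swap u v e then φ else 0

theorem killing_std (hs : ∀ i, s i * s i = 1) (hc : LightFrame s u v c c')
    {μ : I → MvPolynomial I ℂ} {φ : MvPolynomial I ℂ} (hμ : LightKilling u v μ φ) (i j : I) :
    (s j : ℂ) • ∑ e, c e i • pderiv e (∑ f, c' j f • μ f) +
      (s i : ℂ) • ∑ e, c e j • pderiv e (∑ f, c' i f • μ f) =
      if i = j then (s i : ℂ) • φ else 0 := by
  have h1 : ∀ i j, (s j : ℂ) • ∑ e, c e i • pderiv e (∑ f, c' j f • μ f) =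
      ∑ e, ∑ f, (c e i * c f j) • pderiv e (μ (Equiv.swap u v f)) := by
    intro i j
    have h2 : ((s j : ℂ)) * s j = 1 := by exact_mod_cast hs j
    rw [Finset.smul_sum]
    refine Finset.sum_congr rfl fun e _ => ?_
    rw [← Equiv.sum_comp (Equiv.swap u v)]
    simp only [hc.metric, Equiv.swap_apply_self, map_sum, Derivation.map_smul, Finset.smul_sum,
      smul_smul]
    refine Finset.sum_congr rfl fun f _ => ?_
    congr 1
    linear_combination (c e i * c f j) * h2
  rw [h1, h1 j i, Finset.sum_comm (f := fun e f => (c e j * c f i) • _), ← Finset.sum_add_distrib]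
  have h3 : ∀ e, ∑ f, (c e i * c f j) • pderiv e (μ (Equiv.swap u v f)) +
      ∑ f, (c f j * c e i) • pderiv f (μ (Equiv.swap u v e)) =
      (c e i * c (Equiv.swap u v e) j) • φ := by
    intro e
    rw [← Finset.sum_add_distrib]
    simp only [mul_comm (c _ j), ← smul_add, hμ e _, smul_ite, smul_zero]
    rw [Finset.sum_ite_eq', if_pos (Finset.mem_univ _)]
  rw [Finset.sum_congr rfl fun e _ => h3 e, ← Finset.sum_smul, hc.sum_c hs]
  split_ifs <;> simp

/-- Complex conformal fields are combinations of real ones. -/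
theorem exists_fields (hs : ∀ i, s i * s i = 1) (hc : LightFrame s u v c c')
    {μ : I → MvPolynomial I ℂ} {φ : MvPolynomial I ℂ} (hμ : LightKilling u v μ φ)
    (h0 : ∀ e, constantCoeff (μ e) = 0) :
    ∃ ν₁ ν₂ : I → MvPolynomial I ℝ, ∃ φ₁ φ₂ : MvPolynomial I ℝ,
      (∀ f, μ f = ∑ l, c f l • real c' (ν₁ l) + Complex.I • ∑ l, c f l • real c' (ν₂ l)) ∧
      (∀ i j, s j • pderiv i (ν₁ j) + s i • pderiv j (ν₁ i) = if i = j then s i • φ₁ else 0) ∧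
      (∀ i j, s j • pderiv i (ν₂ j) + s i • pderiv j (ν₂ i) = if i = j then s i • φ₂ else 0) ∧
      (∀ k, constantCoeff (ν₁ k) = 0) ∧ ∀ k, constantCoeff (ν₂ k) = 0 := by
  -- Real and imaginary parts are taken after returning to the standard frame, where the Killing
  -- equation has real coefficients and so splits.
  choose ν₁ ν₂ hν using fun k => hc.inv.exists_real (∑ f, c' k f • μ f)
  obtain ⟨φ₁, φ₂, hφ⟩ := hc.inv.exists_real φ
  have hμν : ∀ f, μ f = ∑ l, c f l • ∑ f, c' l f • μ f := by
    intro f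
    simp only [Finset.smul_sum, smul_smul]
    rw [Finset.sum_comm]
    simp only [← Finset.sum_smul, hc.inv.right, ite_smul, one_smul, zero_smul]
    rw [Finset.sum_ite_eq, if_pos (Finset.mem_univ _)]
  have hd : ∀ (i : I) (P : MvPolynomial I ℝ),
      ∑ e, c e i • pderiv e (real c' P) = real c' (pderiv i P) := by
    intro i P
    simp only [pderiv_real, Finset.smul_sum, smul_smul]
    rw [Finset.sum_comm]
    simp only [← Finset.sum_smul, mul_comm (c _ i), hc.inv.left, ite_smul, one_smul, zero_smul]
    rw [Finset.sum_ite_eq', if_pos (Finset.mem_univ _)]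
  have hk : ∀ i j, (s j • pderiv i (ν₁ j) + s i • pderiv j (ν₁ i) -
        if i = j then s i • φ₁ else 0) = 0 ∧
      (s j • pderiv i (ν₂ j) + s i • pderiv j (ν₂ i) - if i = j then s i • φ₂ else 0) = 0 := by
    intro i j
    refine hc.inv.real_eq_zero ?_
    have h1 := hc.killing_std hs hμ i j
    simp only [hν, map_add, Derivation.map_smul, smul_add, Finset.sum_add_distrib,
      smul_comm _ Complex.I, ← Finset.smul_sum, hd] at h1
    rw [← sub_eq_zero] at h1
    simp only [map_sub, map_add, Inverse.real_smul]
    rw [← h1]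
    by_cases hij : i = j
    · simp only [hij, if_true, hφ, Inverse.real_smul]
      module
    · simp only [hij, if_false, map_zero]
      module
  have hz : ∀ k, constantCoeff (ν₁ k) = 0 ∧ constantCoeff (ν₂ k) = 0 := by
    intro k
    have h1 := congrArg constantCoeff (hν k)
    rw [map_add, constantCoeff_smul, constantCoeff_real, constantCoeff_real, map_sum,
      Finset.sum_eq_zero fun f _ => by rw [constantCoeff_smul, h0, mul_zero]] at h1
    have h3 := congrArg Complex.re h1
    have h4 := congrArg Complex.im h1
    simp at h3 h4
    exact ⟨h3.symm, h4.symm⟩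
  refine ⟨ν₁, ν₂, φ₁, φ₂, fun f => ?_, fun i j => sub_eq_zero.mp (hk i j).1,
    fun i j => sub_eq_zero.mp (hk i j).2, fun k => (hz k).1, fun k => (hz k).2⟩
  rw [hμν f]
  simp only [hν, smul_add, Finset.sum_add_distrib, smul_comm _ Complex.I, ← Finset.smul_sum]

/-- The Laplacian on real polynomials in light-cone coordinates. -/
theorem lap_real (hs : ∀ i, s i * s i = 1) (hc : LightFrame s u v c c') (h : MvPolynomial I ℝ) :
    lap u v (real (fun k f => c f k) h) =
      real (fun k f => c f k) (∑ i, s i • pderiv i (pderiv i h)) := by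
  have h1 : ∀ e, pderiv e (pderiv (Equiv.swap u v e) (real (fun k f => c f k) h)) =
      ∑ k, ∑ j, (c e j * c (Equiv.swap u v e) k) •
        real (fun k f => c f k) (pderiv j (pderiv k h)) := by
    intro e
    simp only [pderiv_real, map_sum, Derivation.map_smul, Finset.smul_sum, smul_smul]
    refine Finset.sum_congr rfl fun k _ => Finset.sum_congr rfl fun j _ => ?_
    rw [mul_comm]
  rw [lap_apply]
  simp only [h1]
  rw [Finset.sum_comm, map_sum]
  refine Finset.sum_congr rfl fun k _ => ?_
  rw [Finset.sum_comm]
  simp only [← Finset.sum_smul, hc.sum_c hs, ite_smul, zero_smul]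
  rw [Finset.sum_ite_eq', if_pos (Finset.mem_univ _), Inverse.real_smul]

theorem eul_real (hc : LightFrame s u v c c') (h : MvPolynomial I ℝ) :
    eul (real (fun k f => c f k) h) = real (fun k f => c f k) (∑ i, X i * pderiv i h) := by
  have h1 := hc.inv.dual.sum_mul_pderiv (fun l => X l) h
  have h2 : ∀ f, (X f : MvPolynomial I ℂ) = ∑ j, c' j f • real (fun k f => c f k) (X j) :=
    fun f => hc.inv.dual.X_eq f
  rw [← h1, eul_apply]
  simp only [← h2]

end LightFrame

end Frames

/-! ### The defect of dilations, rotations and special conformal fields -/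

section Specialization

variable {I : Type} [Fintype I] [DecidableEq I] {u v : I}
  {Φ : MvPolynomial I ℂ →ₗ[ℂ] MvPolynomial I ℂ →ₗ[ℂ] MvPolynomial I ℂ} {δ δ' : ℂ}

theorem swap_eq_iff (a b : I) : Equiv.swap u v a = b ↔ a = Equiv.swap u v b :=
  ⟨fun h => by rw [← h, Equiv.swap_apply_self], fun h => by rw [h, Equiv.swap_apply_self]⟩

theorem lightKilling_euler : LightKilling u v (fun e => X e) 2 := by
  intro e f
  rw [pderiv_X', pderiv_X']
  by_cases h : f = Equiv.swap u v e
  · rw [if_pos ((swap_eq_iff f e).mpr h), if_pos h.symm, if_pos h]; norm_num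
  · rw [if_neg (fun h' => h ((swap_eq_iff f e).mp h')), if_neg (Ne.symm h), if_neg h, add_zero]

/-- The dilation has divergence `n` and acts on momenta by minus the degree; on homogeneous
arguments its defect determines the order of the operator. -/
theorem defect_euler (g h : MvPolynomial I ℂ) :
    defect Φ δ δ' (fun e => X e) g h = Φ (eul g) h - Φ g (eul h) +
      (δ * Fintype.card I) • Φ g h - ((δ' * Fintype.card I) • Φ g h - eul (Φ g h)) := by
  have h1 : ∑ e : I, (1 : MvPolynomial I ℂ) = C (Fintype.card I : ℂ) := by
    rw [Finset.sum_const, Finset.card_univ, nsmul_eq_mul, mul_one, map_natCast]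
  have h2 : ∀ f, ∑ e, Φ ((if f = e then 1 else 0) * g) (X f * pderiv e h) =
      Φ g (X f * pderiv f h) := by
    intro f
    rw [Finset.sum_eq_single f (fun e _ hne => by
      rw [if_neg (Ne.symm hne), zero_mul, map_zero, LinearMap.zero_apply]) (by simp), if_pos rfl,
      one_mul]
  have h3 : ∀ f, ∑ e, constantCoeff (if f = e then (1 : MvPolynomial I ℂ) else 0) •
      (X f * pderiv e (Φ g h)) = X f * pderiv f (Φ g h) := by
    intro f
    rw [Finset.sum_eq_single f (fun e _ hne => by
      rw [if_neg (Ne.symm hne), map_zero, zero_smul]) (by simp), if_pos rfl,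
      map_one, one_smul]
  simp only [defect, pderiv_X', if_true, h1, h2, h3, constantCoeff_C]
  rw [← LinearMap.sum_apply, ← map_sum, ← map_sum, ← eul_apply, ← eul_apply, ← eul_apply,
    C_mul', map_smul, LinearMap.smul_apply, smul_smul]

/-- The light-cone components of an infinitesimal rotation. -/
def rotField (u v b c : I) (e : I) : MvPolynomial I ℂ :=
  (if e = Equiv.swap u v c then X b else 0) - if e = Equiv.swap u v b then X c else 0

theorem pderiv_rotField (b c e f : I) : pderiv e (rotField u v b c f) =
    (if f = Equiv.swap u v c then if e = b then 1 else 0 else 0) -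
      if f = Equiv.swap u v b then if e = c then 1 else 0 else 0 := by
  simp only [rotField, map_sub, apply_ite (pderiv e), pderiv_X', map_zero, eq_comm]

theorem lightKilling_rot (b c : I) : LightKilling u v (rotField u v b c) 0 := by
  intro e f
  simp only [pderiv_rotField, (Equiv.swap u v).injective.eq_iff, ite_self]
  split_ifs <;> simp_all

/-- Rotations are free of divergence, so the weights do not enter. -/
theorem defect_rot (b c : I) (g h : MvPolynomial I ℂ) :
    defect Φ δ δ' (rotField u v b c) g h = Φ (rotX u v b c g) h + Φ g (rotP u v b c h) -
      rotP u v b c (Φ g h) := by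
  have hdiv : ∑ e, pderiv e (rotField u v b c e) = 0 := by
    simp only [pderiv_rotField, Finset.sum_sub_distrib, Finset.sum_ite_eq', Finset.mem_univ, if_true]
    rw [sub_eq_zero]
    by_cases h : b = Equiv.swap u v c
    · rw [if_pos (by rw [h]), if_pos (by rw [h, Equiv.swap_apply_self])]
    · rw [if_neg (fun h' => h h'.symm), if_neg (fun h' => h (by rw [← h', Equiv.swap_apply_self]))]
  have h1 : ∑ e, rotField u v b c e * pderiv e g = rotX u v b c g := by
    simp only [rotField, sub_mul, ite_mul, zero_mul, Finset.sum_sub_distrib]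
    rw [Finset.sum_ite_eq', Finset.sum_ite_eq', if_pos (Finset.mem_univ _),
      if_pos (Finset.mem_univ _), rotX]
  have h2 : ∀ F : MvPolynomial I ℂ →ₗ[ℂ] MvPolynomial I ℂ →ₗ[ℂ] MvPolynomial I ℂ, ∀ Z,
      ∑ f, ∑ e, F (pderiv e (rotField u v b c f)) (X f * pderiv e Z) = -F 1 (rotP u v b c Z) := by
    intro F Z
    have h3 : ∀ f, ∑ e, F (pderiv e (rotField u v b c f)) (X f * pderiv e Z) =
        (if f = Equiv.swap u v c then F 1 (X f * pderiv b Z) else 0) -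
          if f = Equiv.swap u v b then F 1 (X f * pderiv c Z) else 0 := by
      intro f
      simp only [pderiv_rotField, map_sub, LinearMap.sub_apply, Finset.sum_sub_distrib]
      congr 1
      · split_ifs with hf
        · rw [Finset.sum_eq_single b (fun e _ hne => by
            rw [if_neg hne, map_zero, LinearMap.zero_apply]) (by simp), if_pos rfl]
        · simp
      · split_ifs with hf
        · rw [Finset.sum_eq_single c (fun e _ hne => by
            rw [if_neg hne, map_zero, LinearMap.zero_apply]) (by simp), if_pos rfl]
        · simp
    simp only [h3, Finset.sum_sub_distrib]
    rw [Finset.sum_ite_eq', Finset.sum_ite_eq', if_pos (Finset.mem_univ _),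
      if_pos (Finset.mem_univ _), rotP, map_sub]
    abel
  have e2 := h2 (LinearMap.mk₂ ℂ (fun a b => Φ (a * g) b)
      (fun _ _ _ => by simp only [map_add, add_mul, LinearMap.add_apply])
      (fun _ _ _ => by simp only [map_smul, smul_mul_assoc, LinearMap.smul_apply])
      (fun _ _ _ => by simp only [map_add])
      (fun _ _ _ => by simp only [map_smul])) h
  have e4 := h2 (LinearMap.mk₂ ℂ (fun a b => constantCoeff a • b)
      (fun _ _ _ => by simp only [map_add, add_smul])
      (fun _ _ _ => by simp only [constantCoeff_smul, mul_smul])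
      (fun _ _ _ => by simp only [smul_add])
      (fun z _ _ => by simp only [smul_comm z])) (Φ g h)
  simp only [LinearMap.mk₂_apply, one_mul, map_one, one_smul] at e2 e4
  rw [defect, e2, e4, hdiv, ← LinearMap.sum_apply, ← map_sum, h1]
  simp

/-- The light-cone components of a special conformal field. -/
def confField (u v b : I) (e : I) : MvPolynomial I ℂ :=
  (2 : ℂ) • (X b * X e) - if e = Equiv.swap u v b then quad u v else 0

theorem pderiv_confField (b e f : I) : pderiv e (confField u v b f) =
    (if e = b then (2 : ℂ) • X f else 0) + (if f = e then (2 : ℂ) • X b else 0) -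
      if f = Equiv.swap u v b then (2 : ℂ) • X (Equiv.swap u v e) else 0 := by
  simp only [confField, map_sub, apply_ite (pderiv e), pderiv_quad, Derivation.map_smul,
    pderiv_mul', pderiv_X', map_zero, smul_add, mul_ite, mul_one, mul_zero, ite_mul, one_mul,
    zero_mul, smul_ite, smul_zero]
  simp only [eq_comm (a := e)]
  abel

theorem lightKilling_conf (b : I) : LightKilling u v (confField u v b) ((4 : ℂ) • X b) := by
  intro e f
  have h1 : (f = Equiv.swap u v e) ↔ (Equiv.swap u v f = e) := by
    rw [swap_eq_iff]
  simp only [pderiv_confField, (Equiv.swap u v).injective.eq_iff, swap_eq_iff f, swap_eq_iff e, ← h1]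
  by_cases h : f = Equiv.swap u v e
  · have h' : e = Equiv.swap u v f := by rw [h, Equiv.swap_apply_self]
    rw [if_pos h, if_pos h', if_pos h]
    module
  · have h' : ¬ e = Equiv.swap u v f := fun h2 => h (by rw [h2, Equiv.swap_apply_self])
    rw [if_neg h, if_neg h', if_neg h]
    abel

/-- The field is quadratic: its Jacobian and divergence vanish at the origin, so nothing acts on the
value of `Φ` and `δ'` does not occur. -/
theorem defect_conf (b : I) (g : MvPolynomial I ℂ) {h : MvPolynomial I ℂ} {m : ℂ}
    (hh : eul h = m • h) :
    defect Φ δ δ' (confField u v b) g h =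
      Φ ((2 : ℂ) • (X b * eul g) - quad u v * pderiv (Equiv.swap u v b) g) h
      + (2 * (Fintype.card I * δ - m)) • Φ (X b * g) h
      - (2 : ℂ) • ∑ e, Φ (X e * g) (X e * pderiv b h)
      + (2 : ℂ) • ∑ e, Φ (X (Equiv.swap u v e) * g) (X (Equiv.swap u v b) * pderiv e h) := by
  have hdiv : ∑ e, pderiv e (confField u v b e) = (2 * (Fintype.card I : ℂ)) • X b := by
    simp only [pderiv_confField, Finset.sum_sub_distrib, Finset.sum_add_distrib, if_true,
      Finset.sum_ite_eq', Finset.mem_univ, Equiv.swap_apply_self, Finset.sum_const,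
      Finset.card_univ]
    rw [add_sub_cancel_left, ← Nat.cast_smul_eq_nsmul ℂ, smul_smul, mul_comm]
  have h1 : ∑ e, confField u v b e * pderiv e g =
      (2 : ℂ) • (X b * eul g) - quad u v * pderiv (Equiv.swap u v b) g := by
    simp only [confField, sub_mul, ite_mul, zero_mul, Finset.sum_sub_distrib, smul_mul_assoc,
      mul_assoc]
    rw [Finset.sum_ite_eq', if_pos (Finset.mem_univ _), ← Finset.smul_sum, ← Finset.mul_sum,
      ← eul_apply]
  have hc : ∀ e f, constantCoeff (pderiv e (confField u v b f)) = 0 := by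
    intro e f
    rw [pderiv_confField]
    simp only [map_sub, map_add, apply_ite constantCoeff, constantCoeff_smul, constantCoeff_X,
      mul_zero, map_zero, ite_self, add_zero, sub_zero]
  have h2 : ∑ f, ∑ e, Φ (pderiv e (confField u v b f) * g) (X f * pderiv e h) =
      (2 : ℂ) • ∑ e, Φ (X e * g) (X e * pderiv b h) + (2 * m) • Φ (X b * g) h -
      (2 : ℂ) • ∑ e, Φ (X (Equiv.swap u v e) * g) (X (Equiv.swap u v b) * pderiv e h) := by
    have h3 : ∀ f, ∑ e, Φ (pderiv e (confField u v b f) * g) (X f * pderiv e h) =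
        (2 : ℂ) • Φ (X f * g) (X f * pderiv b h) + (2 : ℂ) • Φ (X b * g) (X f * pderiv f h) -
        if f = Equiv.swap u v b then
          (2 : ℂ) • ∑ e, Φ (X (Equiv.swap u v e) * g) (X f * pderiv e h) else 0 := by
      intro f
      simp only [pderiv_confField, sub_mul, add_mul, map_sub, map_add, LinearMap.sub_apply,
        LinearMap.add_apply, Finset.sum_sub_distrib, Finset.sum_add_distrib]
      congr 1
      · congr 1
        · rw [Finset.sum_eq_single b (fun e _ hne => by
            rw [if_neg hne, zero_mul, map_zero, LinearMap.zero_apply]) (by simp), if_pos rfl,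
            smul_mul_assoc, map_smul, LinearMap.smul_apply]
        · rw [Finset.sum_eq_single f (fun e _ hne => by
            rw [if_neg (Ne.symm hne), zero_mul, map_zero, LinearMap.zero_apply]) (by simp),
            if_pos rfl, smul_mul_assoc, map_smul, LinearMap.smul_apply]
      · split_ifs with hf
        · simp only [smul_mul_assoc, map_smul, LinearMap.smul_apply, Finset.smul_sum]
        · simp
    simp only [h3, Finset.sum_sub_distrib, Finset.sum_add_distrib]
    rw [Finset.sum_ite_eq', if_pos (Finset.mem_univ _), ← Finset.smul_sum, ← Finset.smul_sum,
      ← map_sum, ← eul_apply, hh, map_smul, smul_smul]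
  rw [defect, h2, hdiv, ← LinearMap.sum_apply, ← map_sum, h1]
  simp only [hc, zero_smul, Finset.sum_const_zero, constantCoeff_smul, constantCoeff_X, mul_zero,
    smul_mul_assoc, map_smul, LinearMap.smul_apply]
  module

end Specialization

/-! ### From invariant operators to intertwiners -/

section Operators

variable {p q m m' : ℕ} {u v : Fin (p + q)} {c c' : Fin (p + q) → Fin (p + q) → ℂ}

theorem LightFrame.isHarm (hc : LightFrame (sgn p q) u v c c') {h : MvPolynomial (Fin (p + q)) ℝ}
    (hh : RealHarm p q m h) : IsHarm u v m (real (fun k f => c f k) h) := by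
  refine ⟨?_, ?_⟩
  · rw [hc.eul_real, hh.1.sum_X_mul_pderiv, ← Nat.cast_smul_eq_nsmul ℝ, Inverse.real_smul]
    simp
  · rw [hc.lap_real (sgn_mul_self p q), hh.2, map_zero]

theorem isHomogeneous_of_euler {n k : ℕ} {P : MvPolynomial (Fin n) ℝ}
    (h : ∑ i, X i * pderiv i P = (k : ℝ) • P) : P.IsHomogeneous k := by
  have h1 : (cplx P).IsHomogeneous k := by
    rw [isHomogeneous_iff_eul, eul_apply]
    simp only [pderiv_cplx, ← cplx_X, ← map_mul, ← map_sum]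
    rw [h, cplx_smul]; simp
  intro d hd
  refine h1 ?_
  rw [coeff_cplx]
  exact Complex.ofReal_ne_zero.mpr hd

/-- In the standard frame the Laplacian and the Euler operator are real, so the real and imaginary
parts of a solution are solutions. -/
theorem LightFrame.exists_realHarm (hc : LightFrame (sgn p q) u v c c')
    {h : MvPolynomial (Fin (p + q)) ℂ} (hh : IsHarm u v m h) :
    ∃ a b, RealHarm p q m a ∧ RealHarm p q m b ∧
      h = real (fun k f => c f k) a + Complex.I • real (fun k f => c f k) b := by
  obtain ⟨a, b, rfl⟩ := hc.inv.dual.exists_real h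
  have h1 := hh.lap
  have h2 := hh.eul
  rw [map_add, map_smul, hc.lap_real (sgn_mul_self p q), hc.lap_real (sgn_mul_self p q)] at h1
  obtain ⟨ha, hb⟩ := hc.inv.dual.real_eq_zero h1
  have h3 : real (fun k f => c f k) (∑ i, X i * pderiv i a - (m : ℝ) • a) +
      Complex.I • real (fun k f => c f k) (∑ i, X i * pderiv i b - (m : ℝ) • b) = 0 := by
    rw [map_add, Derivation.map_smul, hc.eul_real, hc.eul_real] at h2
    rw [← sub_eq_zero] at h2
    rw [← h2, map_sub, map_sub, Inverse.real_smul, Inverse.real_smul]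
    push_cast
    module
  obtain ⟨ha', hb'⟩ := hc.inv.dual.real_eq_zero h3
  exact ⟨a, b, ⟨isHomogeneous_of_euler (sub_eq_zero.mp ha'), ha⟩,
    ⟨isHomogeneous_of_euler (sub_eq_zero.mp hb'), hb⟩, rfl⟩

/-- The substitution does not mix the direction `w` with the others; this is the reason for the
transversality conditions on light-cone frames. -/
theorem flip_real {n : ℕ} (w : Fin n) (M : Fin n → Fin n → ℂ) (h1 : ∀ f, f ≠ w → M w f = 0)
    (h2 : ∀ k, k ≠ w → M k w = 0) (g : MvPolynomial (Fin n) ℝ) :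
    flip w (real M g) = real M (flipR w g) := by
  have key : ((flip w).restrictScalars ℝ).comp (real M) = (real M).comp (flipR w) := by
    refine MvPolynomial.algHom_ext fun k => ?_
    have e1 : (((flip w).restrictScalars ℝ).comp (real M)) (X k) = flip w (real M (X k)) := rfl
    rw [e1, AlgHom.comp_apply, flipR, aeval_X, real_X, map_sum]
    simp only [map_smul, flip, aeval_X]
    split_ifs with h
    · subst h
      rw [map_neg, real_X, ← Finset.sum_neg_distrib]
      refine Finset.sum_congr rfl fun f _ => ?_
      split_ifs with hf
      · rw [smul_neg]
      · rw [h1 f hf, zero_smul, neg_zero]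
    · rw [real_X]
      refine Finset.sum_congr rfl fun f _ => ?_
      split_ifs with hf
      · rw [hf, h2 k h, zero_smul, zero_smul]
      · rfl
  exact congrArg (fun F => F g) key

theorem IsHarm.add {a b : MvPolynomial (Fin (p + q)) ℂ} (ha : IsHarm u v m a)
    (hb : IsHarm u v m b) : IsHarm u v m (a + b) :=
  ⟨by rw [map_add, ha.eul, hb.eul, smul_add], by rw [map_add, ha.lap, hb.lap, add_zero]⟩

theorem IsHarm.smul (z : ℂ) {a : MvPolynomial (Fin (p + q)) ℂ} (ha : IsHarm u v m a) :
    IsHarm u v m (z • a) :=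
  ⟨by rw [Derivation.map_smul, ha.eul, smul_comm], by rw [map_smul, ha.lap, smul_zero]⟩

theorem LightFrame.flip_left (hc : LightFrame (sgn p q) u v c c') {w : Fin (p + q)}
    (hw : w ∈ trans u v) (g : MvPolynomial (Fin (p + q)) ℝ) :
    flip w (real c' g) = real c' (flipR w g) := by
  refine flip_real w c' (fun f hf => ?_) (fun k hk => ?_) g
  · rw [hc.metric, hc.trans_right w hw, mul_zero]
    exact fun h => hf (by rw [(swap_eq_iff f w).mp h, swap_trans hw])
  · rw [hc.metric, swap_trans hw, hc.trans_left w hw k hk, mul_zero]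

theorem LightFrame.flip_right (hc : LightFrame (sgn p q) u v c c') {w : Fin (p + q)}
    (hw : w ∈ trans u v) (g : MvPolynomial (Fin (p + q)) ℝ) :
    flip w (real (fun k f => c f k) g) = real (fun k f => c f k) (flipR w g) :=
  flip_real w _ (fun f hf => hc.trans_right w hw f hf) (fun k hk => hc.trans_left w hw k hk) g

/-- The complexified jet of an invariant operator at the origin. -/
theorem LightFrame.exists_intertwiner (hc : LightFrame (sgn p q) u v c c')
    {A : sym p q m 0 →ₗ[ℝ] sym p q m' 0} {δ δ' : ℝ}
    (hA : ∀ (V : Fin (p + q) → Smooth (p + q)) (hV : IsConformalKilling p q V),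
      A ∘ₗ lieSym m 0 δ hV = lieSym m' 0 δ' hV ∘ₗ A)
    (hr : p + q = 3 → A ∈ reflInv p q m 0 m' 0)
    {B : Module.End ℝ (Symbol (p + q))} (hB : ∀ P : sym p q m 0, B P = A P) :
    ∃ Φ, Intertwiner u v m m' (((p + q : ℕ) : ℂ) * δ)
        ((m : ℂ) - m' + ((p + q : ℕ) : ℂ) * (δ' - δ)) Φ ∧
      ∀ g h, Φ (real c' g) (real (fun k f => c f k) h) =
        real (fun k f => c f k) (jet B g h) := by
  obtain ⟨Φ, hΦ⟩ := hc.inv.exists_extension (jet B)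
  have hharm : ∀ g h, IsHarm u v m h → IsHarm u v m' (Φ g h) := by
    intro g h hh
    obtain ⟨a, b, ha, hb, rfl⟩ := hc.exists_realHarm hh
    obtain ⟨x, y, rfl⟩ := hc.inv.exists_real g
    have h1 : ∀ x a, RealHarm p q m a →
        IsHarm u v m' (Φ (real c' x) (real (fun k f => c f k) a)) := fun x a ha => by
      rw [hΦ]; exact hc.isHarm (jet_realHarm hB x ha)
    simp only [map_add, map_smul, LinearMap.add_apply, LinearMap.smul_apply]
    exact ((h1 x a ha).add ((h1 y a ha).smul _)).add
      (((h1 x b hb).add ((h1 y b hb).smul _)).smul _)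
  -- The field, the function and the harmonic polynomial are all split into real and imaginary
  -- parts; on each real triple the defect vanishes by `jet_killing`.
  have hdef : ∀ (μ : Fin (p + q) → MvPolynomial (Fin (p + q)) ℂ) (φ : MvPolynomial (Fin (p + q)) ℂ),
      LightKilling u v μ φ → (∀ e, constantCoeff (μ e) = 0) → ∀ g h, IsHarm u v m h →
      defect Φ δ δ' μ g h = 0 := by
    intro μ φ hμ h0 g h hh
    obtain ⟨ν₁, ν₂, φ₁, φ₂, hμν, hk₁, hk₂, hz₁, hz₂⟩ := hc.exists_fields (sgn_mul_self p q) hμ h0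
    obtain ⟨a, b, ha, hb, rfl⟩ := hc.exists_realHarm hh
    obtain ⟨x, y, rfl⟩ := hc.inv.exists_real g
    rw [funext hμν, defect_field, defect_left, defect_left, defect_right, defect_right,
      defect_right, defect_right]
    simp only [hc.inv.defect_real hΦ (jet_killing hA hB hk₁ hz₁ _ ha),
      hc.inv.defect_real hΦ (jet_killing hA hB hk₁ hz₁ _ hb),
      hc.inv.defect_real hΦ (jet_killing hA hB hk₂ hz₂ _ ha),
      hc.inv.defect_real hΦ (jet_killing hA hB hk₂ hz₂ _ hb), smul_zero, add_zero]
  refine ⟨Φ, ⟨hharm, ?_, ?_, ?_, ?_⟩, hΦ⟩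
  · intro b e g h hh
    have h1 := hdef _ _ (lightKilling_rot b e) (fun f => by
      simp only [rotField, map_sub, apply_ite constantCoeff, constantCoeff_X, map_zero, ite_self,
        sub_zero]) g h hh
    rw [defect_rot] at h1
    exact sub_eq_zero.mp h1
  · intro g h hh
    -- Comparing the degrees `m`, `m'` and the weights under the dilation gives the value of `N`.
    have h1 := hdef _ _ lightKilling_euler (fun f => constantCoeff_X ℂ f) g h hh
    rw [defect_euler, hh.eul, (hharm g h hh).eul, map_smul, Fintype.card_fin] at h1
    rw [← sub_eq_zero, ← h1]
    module
  · intro b g h hh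
    have h1 := hdef _ _ (lightKilling_conf b) (fun f => by
      simp only [confField, quad, map_sub, apply_ite constantCoeff, constantCoeff_smul, map_mul,
        constantCoeff_X, map_sum, mul_zero, map_zero, Finset.sum_const_zero, ite_self,
        sub_zero]) g h hh
    rwa [defect_conf b g hh.eul, Fintype.card_fin] at h1
  · intro h3 w hw g h hh
    rw [Fintype.card_fin] at h3
    obtain ⟨a, b, ha, hb, rfl⟩ := hc.exists_realHarm hh
    obtain ⟨x, y, rfl⟩ := hc.inv.exists_real g
    have h1 : ∀ x a, RealHarm p q m a →
        jet B (flipR w x) (flipR w a) = flipR w (jet B x a) := fun x a ha =>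
      jet_refl (hr h3) hB w x ha
    simp only [map_add, map_smul, LinearMap.add_apply, LinearMap.smul_apply, hc.flip_left hw,
      hc.flip_right hw, hΦ, h1 _ _ ha, h1 _ _ hb]

end Operators

/-! ### Existence of light-cone frames -/

section LightFrames

variable {I : Type} [Fintype I] [DecidableEq I]

/-- Over `ℂ` every sign is a square, so the metric is a sum of squares in any signature, and two of
the squares combine into a hyperbolic plane. -/
theorem exists_lightFrame {u v : I} (huv : u ≠ v) (s : I → ℝ) (hs : ∀ i, s i * s i = 1) :
    ∃ c c', LightFrame s u v c c' := by
  have hroot : ∀ i, ∃ z : ℂ, z * z = s i := fun i => by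
    obtain ⟨z, hz⟩ := IsAlgClosed.exists_pow_nat_eq (s i : ℂ) (n := 2) (by norm_num)
    exact ⟨z, by rw [← pow_two, hz]⟩
  choose σ hσ using hroot
  have hss : ∀ i, ((s i : ℂ)) * s i = 1 := fun i => by exact_mod_cast hs i
  -- With `σ_i² = s_i`, the rows `u` and `v` are the null forms `σ_u x_u + i σ_v x_v` and half of
  -- `σ_u x_u - i σ_v x_v`; the half normalizes their product to `1`.
  let c : I → I → ℂ := fun b i =>
    if b = u then (if i = u then σ u else if i = v then Complex.I * σ v else 0)
    else if b = v then (if i = u then σ u / 2 else if i = v then -(Complex.I * σ v) / 2 else 0)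
    else if i = b then σ b else 0
  have cuu : c u u = σ u := by simp [c]
  have cuv : c u v = Complex.I * σ v := by simp [c, huv.symm]
  have cvu : c v u = σ u / 2 := by simp [c, huv.symm]
  have cvv : c v v = -(Complex.I * σ v) / 2 := by simp [c, huv.symm]
  have cut : ∀ i ∈ trans u v, c u i = 0 := fun i hi => by
    simp [c, (mem_trans.mp hi).1, (mem_trans.mp hi).2]
  have cvt : ∀ i ∈ trans u v, c v i = 0 := fun i hi => by
    simp [c, (mem_trans.mp hi).1, (mem_trans.mp hi).2]
  have ctt : ∀ i ∈ trans u v, ∀ k, c i k = if k = i then σ i else 0 := fun i hi k => by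
    simp [c, (mem_trans.mp hi).1, (mem_trans.mp hi).2]
  have hI := Complex.I_mul_I
  have hright : ∀ f g, ∑ k, c f k * (s k * c (Equiv.swap u v g) k) = if f = g then 1 else 0 := by
    have hcases : ∀ f, f = u ∨ f = v ∨ f ∈ trans u v := fun f => by rw [mem_trans]; tauto
    intro f g
    have hu : Equiv.swap u v u = v := Equiv.swap_apply_left u v
    have hv : Equiv.swap u v v = u := Equiv.swap_apply_right u v
    rw [sum_eq_trans huv]
    rcases hcases f with rfl | rfl | hf
    · rw [Finset.sum_eq_zero (fun i hi => by rw [cut i hi, zero_mul]), add_zero, cuu, cuv]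
      rcases hcases g with rfl | rfl | hg
      · rw [if_pos rfl, hu, cvu, cvv]
        linear_combination (s g / 2 : ℂ) * hσ g - (s v / 2 * σ v * σ v : ℂ) * hI
          + (s v / 2 : ℂ) * hσ v + hss g / 2 + hss v / 2
      · rw [if_neg huv, hv, cuu, cuv]
        linear_combination (s f : ℂ) * hσ f + (s g * σ g * σ g : ℂ) * hI
          - (s g : ℂ) * hσ g + hss f - hss g
      · rw [swap_trans hg, ctt g hg, ctt g hg, if_neg (mem_trans.mp hg).1.symm,
          if_neg (mem_trans.mp hg).2.symm, if_neg (mem_trans.mp hg).1.symm]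
        ring
    · rw [Finset.sum_eq_zero (fun i hi => by rw [cvt i hi, zero_mul]), add_zero, cvu, cvv]
      rcases hcases g with rfl | rfl | hg
      · rw [if_neg huv.symm, hu, cvu, cvv]
        linear_combination (s g / 4 : ℂ) * hσ g + (s f / 4 * σ f * σ f : ℂ) * hI
          - (s f / 4 : ℂ) * hσ f + hss g / 4 - hss f / 4
      · rw [if_pos rfl, hv, cuu, cuv]
        linear_combination (s u / 2 : ℂ) * hσ u - (s g / 2 * σ g * σ g : ℂ) * hI
          + (s g / 2 : ℂ) * hσ g + hss u / 2 + hss g / 2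
      · rw [swap_trans hg, ctt g hg, ctt g hg, if_neg (mem_trans.mp hg).1.symm,
          if_neg (mem_trans.mp hg).2.symm, if_neg (mem_trans.mp hg).2.symm]
        ring
    · rw [ctt f hf, ctt f hf, if_neg (mem_trans.mp hf).1.symm, if_neg (mem_trans.mp hf).2.symm,
        zero_mul, zero_mul, zero_add, zero_add, Finset.sum_eq_single f (fun i hi hne => by
          rw [ctt f hf, if_neg hne, zero_mul]) (fun h => absurd hf h), ctt f hf, if_pos rfl]
      rcases hcases g with rfl | rfl | hg
      · rw [hu, cvt f hf, if_neg (mem_trans.mp hf).1]; ring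
      · rw [hv, cut f hf, if_neg (mem_trans.mp hf).2]; ring
      · rw [swap_trans hg, ctt g hg]
        split_ifs with h
        · rw [← h]
          linear_combination (s f : ℂ) * hσ f + hss f
        · ring
  refine ⟨c, fun k f => s k * c (Equiv.swap u v f) k, ⟨⟨?_, hright⟩, fun k f => rfl, ?_, ?_⟩⟩
  -- A one-sided inverse of a square matrix is two-sided.
  · have h1 : (Matrix.of c) * (Matrix.of fun k f => s k * c (Equiv.swap u v f) k) = 1 := by
      ext f g
      rw [Matrix.mul_apply, Matrix.one_apply]
      exact hright f g
    have h2 := mul_eq_one_comm.mp h1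
    intro k l
    have h3 := congrFun (congrFun h2 k) l
    rwa [Matrix.mul_apply, Matrix.one_apply] at h3
  · intro i hi k hk
    rw [ctt i hi, if_neg hk]
  · intro i hi k hk
    by_cases hku : k = u
    · rw [hku, cut i hi]
    · by_cases hkv : k = v
      · rw [hkv, cvt i hi]
      · rw [ctt k (mem_trans.mpr ⟨hku, hkv⟩), if_neg (Ne.symm hk)]

end LightFrames

/-! ### Uniqueness and the possible parameters on trace-free symbols -/

section Uniqueness

variable {p q m m' : ℕ}

/-- The invariant operators on trace-free symbols, with reflections included in dimension 3. -/
structure IsInvariant (p q m m' : ℕ) (δ δ' : ℝ) (A : sym p q m 0 →ₗ[ℝ] sym p q m' 0) : Prop where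
  mem : A ∈ confInv p q m 0 m' 0 δ δ'
  refl : p + q = 3 → A ∈ reflInv p q m 0 m' 0

theorem exists_indices (hn : 3 ≤ p + q) : ∃ u v w : Fin (p + q), u ≠ v ∧ w ∈ trans u v :=
  ⟨⟨0, by omega⟩, ⟨1, by omega⟩, ⟨2, by omega⟩, by simp, by simp [mem_trans]⟩

/-- Two invariant operators with the same parameters are proportional. -/
theorem exists_smul_add_smul_eq_zero (hn : 3 ≤ p + q) {δ δ' : ℝ}
    {A₁ A₂ : sym p q m 0 →ₗ[ℝ] sym p q m' 0} (h₁ : IsInvariant p q m m' δ δ' A₁)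
    (h₂ : IsInvariant p q m m' δ δ' A₂) :
    ∃ x y : ℝ, (x ≠ 0 ∨ y ≠ 0) ∧ x • A₁ + y • A₂ = 0 := by
  obtain ⟨u, v, w, huv, hw⟩ := exists_indices hn
  obtain ⟨c, c', hc⟩ := exists_lightFrame huv (sgn p q) (sgn_mul_self p q)
  obtain ⟨B₁, hB₁⟩ := exists_extension A₁
  obtain ⟨B₂, hB₂⟩ := exists_extension A₂
  obtain ⟨⟨r₁, hr₁⟩, hA₁⟩ := h₁.mem
  obtain ⟨⟨r₂, hr₂⟩, hA₂⟩ := h₂.mem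
  obtain ⟨Φ₁, hΦ₁, hJ₁⟩ := hc.exists_intertwiner hA₁ h₁.refl hB₁
  obtain ⟨Φ₂, hΦ₂, hJ₂⟩ := hc.exists_intertwiner hA₂ h₂.refl hB₂
  obtain ⟨x, y, hxy, hz⟩ := Intertwiner.exists_linComb_eq_zero huv
    (by rw [Fintype.card_fin]; exact hn) hw hΦ₁ hΦ₂
  -- The complex relation between the intertwiners becomes two real relations between the jets, at
  -- least one of which is non-trivial.
  have hsplit : ∀ g h, RealHarm p q m h →
      x.re • jet B₁ g h + y.re • jet B₂ g h = 0 ∧ x.im • jet B₁ g h + y.im • jet B₂ g h = 0 := by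
    intro g h hh
    have h1 := hz (real c' g) _ (hc.isHarm hh)
    rw [hJ₁, hJ₂] at h1
    refine hc.inv.dual.real_eq_zero ?_
    rw [map_add, map_add, Inverse.real_smul, Inverse.real_smul, Inverse.real_smul,
      Inverse.real_smul, ← h1]
    conv_rhs => rw [← Complex.re_add_im x, ← Complex.re_add_im y]
    module
  have hzero : ∀ a b : ℝ, (∀ g h, RealHarm p q m h → a • jet B₁ g h + b • jet B₂ g h = 0) →
      a • A₁ + b • A₂ = 0 := by
    intro a b hab
    have hmem := (confInv p q m 0 m' 0 δ δ').add_mem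
      ((confInv p q m 0 m' 0 δ δ').smul_mem a h₁.mem)
      ((confInv p q m 0 m' 0 δ δ').smul_mem b h₂.mem)
    obtain ⟨⟨r, hr⟩, hA⟩ := hmem
    refine eq_zero_of_jet hr hA (B := a • B₁ + b • B₂) (fun P => ?_) fun g h hh => ?_
    · simp [hB₁, hB₂]
    · rw [← hab g h hh]
      simp [jet_apply]
  by_cases hre : x.re ≠ 0 ∨ y.re ≠ 0
  · exact ⟨x.re, y.re, hre, hzero _ _ fun g h hh => (hsplit g h hh).1⟩
  · push Not at hre
    refine ⟨x.im, y.im, ?_, hzero _ _ fun g h hh => (hsplit g h hh).2⟩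
    by_contra! him
    rcases hxy with hx | hy
    · exact hx (Complex.ext hre.1 him.1)
    · exact hy (Complex.ext hre.2 him.2)

/-- The parameters of a non-zero invariant operator. -/
theorem IsInvariant.classification (hn : 3 ≤ p + q) {δ δ' : ℝ}
    {A : sym p q m 0 →ₗ[ℝ] sym p q m' 0} (h : IsInvariant p q m m' δ δ' A) (hne : A ≠ 0) :
    (m = m' ∧ ((p + q : ℕ) : ℝ) * (δ' - δ) = 0) ∨
    (∃ d : ℕ, 1 ≤ d ∧ m = m' + d ∧ ((p + q : ℕ) : ℝ) * (δ' - δ) = 0 ∧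
      ((p + q : ℕ) : ℝ) * δ = (p + q : ℕ) + 2 * m - 1 - d) ∨
    (∃ g : ℕ, 1 ≤ g ∧ m' = m + g ∧ ((p + q : ℕ) : ℝ) * (δ' - δ) = 2 * g ∧
      ((p + q : ℕ) : ℝ) * δ = 1 - g) ∨
    (∃ l : ℕ, 1 ≤ l ∧ m = m' ∧ ((p + q : ℕ) : ℝ) * (δ' - δ) = 2 * l ∧
      ((p + q : ℕ) : ℝ) * δ = (p + q : ℕ) / 2 + m - l) := by
  obtain ⟨u, v, w, huv, hw⟩ := exists_indices hn
  obtain ⟨c, c', hc⟩ := exists_lightFrame huv (sgn p q) (sgn_mul_self p q)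
  obtain ⟨B, hB⟩ := exists_extension A
  obtain ⟨⟨r, hr⟩, hA⟩ := h.mem
  obtain ⟨Φ, hΦ, hJ⟩ := hc.exists_intertwiner hA h.refl hB
  obtain ⟨x, a, ha, hxa⟩ : ∃ x a, RealHarm p q m a ∧ jet B x a ≠ 0 := by
    by_contra! hcon
    exact hne (eq_zero_of_jet hr hA hB hcon)
  have hne' : Φ (real c' x) (real (fun k f => c f k) a) ≠ 0 := by
    rw [hJ]
    intro h0
    refine hxa (hc.inv.dual.real_eq_zero (a := jet B x a) (b := 0) ?_).1
    rw [h0, map_zero, smul_zero, add_zero]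
  have h1 := hΦ.classification huv (by rw [Fintype.card_fin]; exact hn) hw (hc.isHarm ha) hne'
  rw [Fintype.card_fin] at h1
  rcases h1 with ⟨h1, h2⟩ | ⟨d, h0, h1, h2, h3⟩ | ⟨d, h0, h1, h2, h3⟩ | ⟨d, h0, h1, h2, h3⟩
  · refine Or.inl ⟨h1, ?_⟩
    rw [h1] at h2
    have h4 : (((p + q : ℕ) : ℂ)) * (δ' - δ) = 0 := by linear_combination h2
    exact_mod_cast h4
  · refine Or.inr (Or.inl ⟨d, h0, h1, ?_, by exact_mod_cast h3⟩)
    rw [h1] at h2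
    have h4 : (((p + q : ℕ) : ℂ)) * (δ' - δ) = 0 := by push_cast at h2 ⊢; linear_combination h2
    exact_mod_cast h4
  · refine Or.inr (Or.inr (Or.inl ⟨d, h0, h1, ?_, by exact_mod_cast h3⟩))
    rw [h1] at h2
    have h4 : (((p + q : ℕ) : ℂ)) * (δ' - δ) = 2 * d := by push_cast at h2 ⊢; linear_combination h2
    exact_mod_cast h4
  · refine Or.inr (Or.inr (Or.inr ⟨d, h0, h1, ?_, Complex.ofReal_injective ?_⟩))
    · rw [h1] at h2
      have h4 : (((p + q : ℕ) : ℂ)) * (δ' - δ) = 2 * d := by push_cast at h2 ⊢; linear_combination h2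
      exact_mod_cast h4
    · push_cast at h3 ⊢
      linear_combination h3

end Uniqueness

/-! ### The algebra of differential operators on symbols -/

section DifferentialOperators

variable {n : ℕ}

/-- The commutator of an endomorphism with the multiplication by a function. -/
def fnComm (f : Smooth n) : Module.End ℝ (Symbol n) →ₗ[ℝ] Module.End ℝ (Symbol n) :=
  LinearMap.mulRight ℝ (Algebra.lsmul ℝ ℝ (Symbol n) f) -
    LinearMap.mulLeft ℝ (Algebra.lsmul ℝ ℝ (Symbol n) f)

theorem fnComm_apply (f : Smooth n) (B : Module.End ℝ (Symbol n)) (P : Symbol n) :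
    fnComm f B P = B (f • P) - f • B P := rfl

theorem fnComm_mul (f : Smooth n) (B C : Module.End ℝ (Symbol n)) :
    fnComm f (B * C) = fnComm f B * C + B * fnComm f C := by
  refine LinearMap.ext fun P => ?_
  simp only [fnComm_apply, LinearMap.add_apply, Module.End.mul_apply, map_sub]
  abel

/-- All the `r`-fold commutators with functions vanish. -/
def DiffOrder : ℕ → Module.End ℝ (Symbol n) → Prop
  | 0, B => B = 0
  | r + 1, B => ∀ f, DiffOrder r (fnComm f B)

theorem DiffOrder.zero (r : ℕ) : DiffOrder r (0 : Module.End ℝ (Symbol n)) := by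
  induction r with
  | zero => rfl
  | succ r ih => intro f; rw [map_zero]; exact ih

theorem DiffOrder.succ {r : ℕ} {B : Module.End ℝ (Symbol n)} (h : DiffOrder r B) :
    DiffOrder (r + 1) B := by
  induction r generalizing B with
  | zero => intro f; rw [show B = 0 from h, map_zero]; exact DiffOrder.zero 0
  | succ r ih => intro f; exact ih (h f)

theorem DiffOrder.mono {r t : ℕ} (hrt : r ≤ t) {B : Module.End ℝ (Symbol n)}
    (h : DiffOrder r B) : DiffOrder t B := by
  induction hrt with
  | refl => exact h
  | step _ ih => exact ih.succ

theorem DiffOrder.add {r : ℕ} {B C : Module.End ℝ (Symbol n)} (hB : DiffOrder r B)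
    (hC : DiffOrder r C) : DiffOrder r (B + C) := by
  induction r generalizing B C with
  | zero => rw [show B = 0 from hB, show C = 0 from hC, add_zero]; rfl
  | succ r ih => intro f; rw [map_add]; exact ih (hB f) (hC f)

/-- A commutator with a function is a derivation, so each commutator lowers one of the two numbers;
induction on their sum. -/
theorem DiffOrder.mul {r t : ℕ} {B C : Module.End ℝ (Symbol n)} (hB : DiffOrder r B)
    (hC : DiffOrder t C) : DiffOrder (r + t) (B * C) := by
  induction h : r + t generalizing r t B C with
  | zero =>
    obtain ⟨rfl, rfl⟩ : r = 0 ∧ t = 0 := by omega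
    rw [show B = 0 from hB, zero_mul]; rfl
  | succ N ih =>
    rcases r with _ | r
    · rw [show B = 0 from hB, zero_mul]; exact DiffOrder.zero _
    rcases t with _ | t
    · rw [show C = 0 from hC, mul_zero]; exact DiffOrder.zero _
    intro f
    rw [fnComm_mul]
    exact (ih (hB f) hC (by omega)).add (ih hB (hC f) (by omega))

theorem diffOrder_of_smul {B : Module.End ℝ (Symbol n)} (h : ∀ (f : Smooth n) P, B (f • P) = f • B P) :
    DiffOrder 1 B := fun f => LinearMap.ext fun P => by
  rw [fnComm_apply, h, sub_self]; rfl

/-- The algebra of the differential operators on symbols. -/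
def diffOps (n : ℕ) : Subalgebra ℝ (Module.End ℝ (Symbol n)) where
  carrier := {B | ∃ r, DiffOrder r B}
  mul_mem' := by
    rintro B C ⟨r, hB⟩ ⟨t, hC⟩
    exact ⟨r + t, hB.mul hC⟩
  add_mem' := by
    rintro B C ⟨r, hB⟩ ⟨t, hC⟩
    exact ⟨max r t, (hB.mono (le_max_left r t)).add (hC.mono (le_max_right r t))⟩
  algebraMap_mem' c := ⟨1, diffOrder_of_smul fun f P => by
    rw [Module.algebraMap_end_apply, Module.algebraMap_end_apply, smul_comm]⟩

theorem mulLeft_mem_diffOps (Q : Symbol n) : LinearMap.mulLeft ℝ Q ∈ diffOps n :=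
  ⟨1, diffOrder_of_smul fun f P => by simp⟩

theorem dp_mem_diffOps (i : Fin n) : dp i ∈ diffOps n :=
  ⟨1, diffOrder_of_smul fun f P => dp_smul i f P⟩

theorem dx_mem_diffOps (i : Fin n) : dx i ∈ diffOps n := by
  refine ⟨2, fun f => diffOrder_of_smul fun g P => ?_⟩
  simp only [fnComm_apply, dx_smul, smul_add, smul_comm f g]
  module

/-- `DiffOrder` counts vanishing commutators from zero, so it exceeds the order by one; the bound
obtained here is not sharp, but only finiteness is needed. -/
theorem IsDiffOp.of_diffOrder {M N : Submodule (Smooth n) (Symbol n)} {A : M →ₗ[ℝ] N}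
    {B : Module.End ℝ (Symbol n)} (hAB : ∀ P, (A P : Symbol n) = B P) {r : ℕ}
    (hB : DiffOrder r B) : IsDiffOp r A := by
  induction r generalizing A B with
  | zero =>
    have : A = 0 := LinearMap.ext fun P => Subtype.ext (by rw [hAB, show B = 0 from hB]; rfl)
    rw [this]
    exact isDiffOp_zero 0
  | succ r ih =>
    intro f
    refine ih (B := fnComm f B) (fun P => ?_) (hB f)
    rw [fnComm_apply, ← hAB]
    exact congrArg (fun Z => Z - f • (A P : Symbol n)) (hAB (f • P))

end DifferentialOperators

/-! ### Differential operators commuting with the reflections -/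

section NaturalOperators

variable {p q : ℕ}

theorem partialX_reflFun {n : ℕ} (a i : Fin n) (f : Smooth n) :
    partialX a (reflFun i f) = (if a = i then (-1 : ℝ) else 1) • reflFun i (partialX a f) := by
  refine smooth_ext fun x => ?_
  have hf := smooth_contDiff f
  let l : (Fin n → ℝ) →L[ℝ] (Fin n → ℝ) := ContinuousLinearMap.pi fun j =>
    (if j = i then (-1 : ℝ) else 1) • ContinuousLinearMap.proj j
  have hl : ∀ y, reflPt i y = l y := fun y => funext fun j => by
    simp only [reflPt, l, ContinuousLinearMap.pi_apply, smul_apply,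
      ContinuousLinearMap.proj_apply]
    split_ifs <;> simp
  have h1 : (reflFun i f).1 = f.1 ∘ l := funext fun y => by
    rw [Function.comp_apply, ← hl]; rfl
  have h2 : l (Pi.single a 1) = (if a = i then (-1 : ℝ) else 1) • Pi.single a 1 := by
    refine funext fun j => ?_
    simp only [l, ContinuousLinearMap.pi_apply, smul_apply,
      ContinuousLinearMap.proj_apply, Pi.smul_apply, smul_eq_mul, Pi.single_apply]
    by_cases hja : j = a
    · rw [hja]
    · simp [hja]
  rw [partialX_apply, h1, fderiv_comp _ (hf.differentiable (by simp) _) l.differentiableAt,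
    ContinuousLinearMap.fderiv, ContinuousLinearMap.comp_apply, h2, map_smul, ← hl]
  rfl

theorem dx_refl {n : ℕ} (a i : Fin n) (P : Symbol n) :
    dx a (refl i P) = (if a = i then (-1 : ℝ) else 1) • refl i (dx a P) := by
  induction P using MvPolynomial.induction_on with
  | C f =>
    have h1 : ∀ g, refl i (C g : Symbol n) = C (reflFun i g) := fun g => eval₂Hom_C _ _ _
    have h2 : ∀ g, dx a (C g : Symbol n) = C (partialX a g) := fun g => dx_monomial a 0 g
    rw [h1, h2, h2, h1, partialX_reflFun]
    split_ifs <;> simp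
  | add P Q hP hQ => simp only [map_add, hP, hQ, smul_add]
  | mul_X P b h =>
    have h0 : dx a (if b = i then -X b else X b : Symbol n) = 0 := by
      split_ifs <;> simp [dx_X]
    rw [refl_mul, dx_mul, h, refl_X, h0, dx_mul, dx_X, map_add, refl_mul, refl_mul, map_zero,
      refl_X, mul_zero, zero_add, zero_add, smul_mul_assoc]

/-- The differential operators that commute with the reflections. -/
def naturalOps (n : ℕ) : Subalgebra ℝ (Module.End ℝ (Symbol n)) :=
  diffOps n ⊓ Subalgebra.centralizer ℝ (Set.range refl)

theorem mem_naturalOps {n : ℕ} {B : Module.End ℝ (Symbol n)} :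
    B ∈ naturalOps n ↔ B ∈ diffOps n ∧ ∀ i P, refl i (B P) = B (refl i P) := by
  refine and_congr_right fun _ => ?_
  rw [SetLike.mem_coe, Subalgebra.mem_centralizer_iff]
  constructor
  · intro h i P
    exact LinearMap.congr_fun (h _ ⟨i, rfl⟩) P
  · rintro h _ ⟨i, rfl⟩
    exact LinearMap.ext (h i)

theorem refl_X_mul {n : ℕ} (a i : Fin n) (P : Symbol n) :
    X a * refl i P = (if a = i then (-1 : ℝ) else 1) • refl i (X a * P) := by
  rw [refl_mul, refl_X]
  split_ifs <;> simp

theorem opR_mem_naturalOps : opR p q ∈ naturalOps (p + q) :=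
  mem_naturalOps.mpr ⟨mulLeft_mem_diffOps _, fun i P => by
    have := refl_metricR p q i 1
    rw [pow_one] at this
    rw [opR_apply, opR_apply, refl_mul, this]⟩

theorem opG_mem_naturalOps : opG p q ∈ naturalOps (p + q) := by
  refine mem_naturalOps.mpr ⟨Subalgebra.sum_mem _ fun i _ => Subalgebra.smul_mem _
    (Subalgebra.mul_mem _ (mulLeft_mem_diffOps _) (dx_mem_diffOps i)) _, fun i P => ?_⟩
  rw [opG_apply, opG_apply, map_sum]
  refine Finset.sum_congr rfl fun a _ => ?_
  rw [map_smul, dx_refl, mul_smul_comm, refl_X_mul]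
  split_ifs <;> simp

theorem opD_mem_naturalOps : opD p q ∈ naturalOps (p + q) := by
  refine mem_naturalOps.mpr ⟨Subalgebra.sum_mem _ fun i _ =>
    Subalgebra.mul_mem _ (dx_mem_diffOps i) (dp_mem_diffOps i), fun i P => ?_⟩
  rw [opD_apply, opD_apply, map_sum]
  refine Finset.sum_congr rfl fun a _ => ?_
  rw [dp_refl, map_smul, dx_refl]
  split_ifs <;> simp

theorem opL_mem_naturalOps : opL p q ∈ naturalOps (p + q) := by
  refine mem_naturalOps.mpr ⟨Subalgebra.sum_mem _ fun i _ => Subalgebra.smul_mem _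
    (Subalgebra.mul_mem _ (dx_mem_diffOps i) (dx_mem_diffOps i)) _, fun i P => ?_⟩
  rw [opL_apply, opL_apply, map_sum]
  refine Finset.sum_congr rfl fun a _ => ?_
  rw [map_smul, dx_refl, map_smul, dx_refl]
  split_ifs <;> simp

theorem opG₀pow_mem_naturalOps (k g : ℕ) : opG₀pow p q k g ∈ naturalOps (p + q) := by
  induction g with
  | zero => exact one_mem _
  | succ g ih =>
    exact mul_mem (sub_mem opG_mem_naturalOps (Subalgebra.smul_mem _
      (mul_mem opR_mem_naturalOps opD_mem_naturalOps) _)) ih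

theorem opCalL_mem_naturalOps (a : ℕ → ℝ) (k l : ℕ) : opCalL p q a k l ∈ naturalOps (p + q) :=
  Subalgebra.sum_mem _ fun _ _ => Subalgebra.smul_mem _ (mul_mem (mul_mem
    (opG₀pow_mem_naturalOps _ _) (pow_mem opL_mem_naturalOps _)) (pow_mem opD_mem_naturalOps _)) _

/-- Natural operators that preserve trace-free symbols and intertwine the actions of the conformal
Killing fields restrict to invariant operators. -/
theorem exists_isInvariant {m m' : ℕ} {δ δ' : ℝ} {B : Module.End ℝ (Symbol (p + q))}
    (hB : B ∈ naturalOps (p + q)) (hmem : ∀ P, TraceFree p q m P → TraceFree p q m' (B P))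
    (hinv : ∀ V f, KillingEq p q V f → ∀ P, TraceFree p q m P →
      B (lieDer δ V P) = lieDer δ' V (B P))
    (hne : ∃ P, TraceFree p q m P ∧ B P ≠ 0) :
    ∃ A : sym p q m 0 →ₗ[ℝ] sym p q m' 0, IsInvariant p q m m' δ δ' A ∧ A ≠ 0 ∧
      ∀ P, (A P : Symbol (p + q)) = B P := by
  obtain ⟨⟨r, hr⟩, hrefl⟩ := mem_naturalOps.mp hB
  let A : sym p q m 0 →ₗ[ℝ] sym p q m' 0 :=
    { toFun := fun P => ⟨B P, traceFree_iff.mp (hmem P (traceFree_iff.mpr P.2))⟩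
      map_add' := fun P Q => Subtype.ext (map_add B (P : Symbol (p + q)) Q)
      map_smul' := fun c P => Subtype.ext (map_smul B c (P : Symbol (p + q))) }
  refine ⟨A, ⟨⟨⟨r, IsDiffOp.of_diffOrder (fun P => rfl) hr⟩, fun V hV => ?_⟩, fun _ i => ?_⟩,
    fun h => ?_, fun P => rfl⟩
  · obtain ⟨f, hf⟩ := hV
    exact LinearMap.ext fun P => Subtype.ext (hinv V f hf P (traceFree_iff.mpr P.2))
  · exact LinearMap.ext fun P => Subtype.ext (hrefl i P).symm
  · obtain ⟨P, hP, hne⟩ := hne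
    exact hne (congrArg Subtype.val (LinearMap.congr_fun h ⟨P, traceFree_iff.mp hP⟩))

end NaturalOperators

/-! ### Powers in a formal quadratic extension -/

section QuadraticPowers

variable {A : Type} [CommRing A] [Algebra ℝ A]

/-- The components of `(x + σ y)^j`, where `σ² = e`. -/
def quadPow (e : ℝ) (x y : A) : ℕ → A × A
  | 0 => (1, 0)
  | j + 1 => (x * (quadPow e x y j).1 + e • (y * (quadPow e x y j).2),
      x * (quadPow e x y j).2 + y * (quadPow e x y j).1)

variable {e : ℝ} {x y : A} {d : A →ₗ[ℝ] A}

/-- The rule for the derivative of a power of `x + σ y`, whose derivative is `ξ + σ ζ`, separated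
into components. It provides powers of null vectors with real coefficients in every signature. -/
theorem derivation_quadPow (hd : ∀ P Q, d (P * Q) = P * d Q + d P * Q) {ξ ζ : ℝ}
    (hx : d x = ξ • (1 : A)) (hy : d y = ζ • (1 : A)) (j : ℕ) :
    d (quadPow e x y (j + 1)).1 =
        ((j + 1 : ℕ) : ℝ) • (ξ • (quadPow e x y j).1 + (e * ζ) • (quadPow e x y j).2) ∧
      d (quadPow e x y (j + 1)).2 =
        ((j + 1 : ℕ) : ℝ) • (ξ • (quadPow e x y j).2 + ζ • (quadPow e x y j).1) := by
  have h1 : d 1 = 0 := by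
    have := hd 1 1
    rw [one_mul, mul_one, one_mul] at this
    exact left_eq_add.mp this
  induction j with
  | zero => simp [quadPow, hd, hx, hy, h1, smul_smul]
  | succ j ih =>
    constructor
    · rw [quadPow, map_add, map_smul, hd, hd, ih.1, ih.2, hx, hy, quadPow]
      push_cast
      simp only [smul_mul_assoc, mul_smul_comm, one_mul, mul_add, smul_add]
      module
    · rw [quadPow, map_add, hd, hd, ih.1, ih.2, hx, hy, quadPow]
      push_cast
      simp only [smul_mul_assoc, mul_smul_comm, one_mul, mul_add, smul_add]
      module

theorem derivation_quadPow_eq_zero (hd : ∀ P Q, d (P * Q) = P * d Q + d P * Q)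
    (hx : d x = 0) (hy : d y = 0) (j : ℕ) :
    d (quadPow e x y j).1 = 0 ∧ d (quadPow e x y j).2 = 0 := by
  rcases j with _ | j
  · have := hd 1 1
    rw [one_mul, mul_one, one_mul] at this
    exact ⟨left_eq_add.mp this, map_zero d⟩
  · have := derivation_quadPow (e := e) hd (ξ := 0) (ζ := 0) (hx.trans (zero_smul ℝ 1).symm)
      (hy.trans (zero_smul ℝ 1).symm) j
    simpa using this

end QuadraticPowers

/-! ### Symbols on which the operators do not vanish -/

section TestSymbols

variable {p q : ℕ} {w u : Fin (p + q)}

/-- The components of the powers of a null linear form in `p_w` and `p_u`. -/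
def nullP (w u : Fin (p + q)) (m : ℕ) : Symbol (p + q) × Symbol (p + q) :=
  quadPow (-(sgn p q w * sgn p q u)) (X w) (X u) m

/-- The components of the powers of the null coordinate in the direction of `nullP`. -/
def nullX (w u : Fin (p + q)) (j : ℕ) : Smooth (p + q) × Smooth (p + q) :=
  quadPow (-(sgn p q w * sgn p q u)) (coord w) ((sgn p q w * sgn p q u) • coord u) j

theorem dx_nullP (i : Fin (p + q)) (m : ℕ) :
    dx i (nullP w u m).1 = 0 ∧ dx i (nullP w u m).2 = 0 :=
  derivation_quadPow_eq_zero (dx_mul i) (dx_X i w) (dx_X i u) m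

theorem dp_nullP_fst (hwu : w ≠ u) (m : ℕ) :
    dp w (nullP w u (m + 1)).1 = ((m + 1 : ℕ) : ℝ) • (nullP w u m).1 ∧
      dp w (nullP w u (m + 1)).2 = ((m + 1 : ℕ) : ℝ) • (nullP w u m).2 := by
  have := derivation_quadPow (e := -(sgn p q w * sgn p q u)) (x := (X w : Symbol (p + q)))
    (y := X u) (dp_mul w) (ξ := 1) (ζ := 0) (by simp [dp_X]) (by simp [dp_X, hwu.symm]) m
  simpa [nullP] using this

theorem dp_nullP_snd (hwu : w ≠ u) (m : ℕ) :
    dp u (nullP w u (m + 1)).1 =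
        ((m + 1 : ℕ) : ℝ) • (-(sgn p q w * sgn p q u)) • (nullP w u m).2 ∧
      dp u (nullP w u (m + 1)).2 = ((m + 1 : ℕ) : ℝ) • (nullP w u m).1 := by
  have := derivation_quadPow (e := -(sgn p q w * sgn p q u)) (x := (X w : Symbol (p + q)))
    (y := X u) (dp_mul u) (ξ := 0) (ζ := 1) (by simp [dp_X, hwu]) (by simp [dp_X]) m
  simpa [nullP] using this

theorem dp_nullP_of_ne {i : Fin (p + q)} (hw : w ≠ i) (hu : u ≠ i) (m : ℕ) :
    dp i (nullP w u m).1 = 0 ∧ dp i (nullP w u m).2 = 0 :=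
  derivation_quadPow_eq_zero (dp_mul i) (by simp [dp_X, hw]) (by simp [dp_X, hu]) m

theorem dp_nullP_zero (i : Fin (p + q)) :
    dp i (nullP w u 0).1 = 0 ∧ dp i (nullP w u 0).2 = 0 :=
  ⟨show dp i (1 : Symbol (p + q)) = 0 by simp [dp], map_zero _⟩

theorem eulerP_nullP (m : ℕ) : eulerP (nullP w u m).1 = (m : ℝ) • (nullP w u m).1 ∧
    eulerP (nullP w u m).2 = (m : ℝ) • (nullP w u m).2 := by
  induction m with
  | zero =>
    have h1 : eulerP (1 : Symbol (p + q)) = 0 := by simp [eulerP_apply, dp]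
    exact ⟨by simp [nullP, quadPow, h1], by simp [nullP, quadPow]⟩
  | succ m ih =>
    have e1 : (nullP w u (m + 1)).1 = X w * (nullP w u m).1 +
      (-(sgn p q w * sgn p q u)) • (X u * (nullP w u m).2) := rfl
    have e2 : (nullP w u (m + 1)).2 = X w * (nullP w u m).2 + X u * (nullP w u m).1 := rfl
    rw [e1, e2]
    simp only [map_add, map_smul, eulerP_mul, eulerP_X, ih.1, ih.2, mul_smul_comm]
    push_cast
    constructor <;> module

/-- `T` applied to a power of a linear form gives its norm as a factor; for `p_w + σ p_u` the norm
is `s_w + s_u σ²`, which is zero for `σ² = -s_w s_u`. -/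
theorem opT_nullP (hwu : w ≠ u) (m : ℕ) :
    opT p q (nullP w u m).1 = 0 ∧ opT p q (nullP w u m).2 = 0 := by
  have hsum : ∀ P : Symbol (p + q), (∀ i, w ≠ i → u ≠ i → dp i P = 0) →
      opT p q P = sgn p q w • dp w (dp w P) + sgn p q u • dp u (dp u P) := fun P hP => by
    rw [opT_apply]
    refine Fintype.sum_eq_add w u hwu fun i hi => ?_
    rw [hP i hi.1.symm hi.2.symm, map_zero, smul_zero]
  rw [hsum _ fun i h1 h2 => (dp_nullP_of_ne h1 h2 m).1,
    hsum _ fun i h1 h2 => (dp_nullP_of_ne h1 h2 m).2]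
  rcases m with _ | _ | m
  · simp [dp_nullP_zero]
  · simp [dp_nullP_fst hwu, dp_nullP_snd hwu, dp_nullP_zero]
  · simp only [dp_nullP_fst hwu, dp_nullP_snd hwu, map_smul]
    have hw := sgn_mul_self p q w
    have hu := sgn_mul_self p q u
    have key : ∀ Z : Symbol (p + q), (((m + 1 + 1 : ℕ) : ℝ) * ((m + 1 : ℕ) : ℝ) * sgn p q w *
        (sgn p q u * sgn p q u)) • Z =
        (((m + 1 + 1 : ℕ) : ℝ) * ((m + 1 : ℕ) : ℝ) * sgn p q w) • Z := fun Z => by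
      rw [hu, mul_one]
    constructor
    · linear_combination (norm := module) -(key (nullP w u m).1)
    · linear_combination (norm := module) -(key (nullP w u m).2)

theorem traceFree_nullP (hwu : w ≠ u) (m : ℕ) :
    TraceFree p q m (nullP w u m).1 ∧ TraceFree p q m (nullP w u m).2 :=
  ⟨⟨(opT_nullP hwu m).1, (eulerP_nullP m).1⟩, ⟨(opT_nullP hwu m).2, (eulerP_nullP m).2⟩⟩

theorem symbol_one_ne_zero {n : ℕ} : (1 : Symbol n) ≠ 0 := fun h => by
  have := congrArg (evSym 0) h
  rw [map_one, map_zero] at this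
  exact one_ne_zero this

theorem nullP_ne_zero (hwu : w ≠ u) (m : ℕ) : (nullP w u m).1 ≠ 0 := by
  induction m with
  | zero => exact symbol_one_ne_zero
  | succ m ih =>
    intro h
    have h1 := (dp_nullP_fst hwu m).1
    rw [h, map_zero] at h1
    exact smul_ne_zero (Nat.cast_ne_zero.mpr m.succ_ne_zero) ih h1.symm

theorem TraceFree.smul {κ : ℝ} {P : Symbol (p + q)} (hP : TraceFree p q κ P)
    (g : Smooth (p + q)) : TraceFree p q κ (g • P) :=
  ⟨by rw [opT_smul, hP.1, smul_zero], by rw [eulerP_smul, hP.2, smul_comm]⟩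

theorem TraceFree.add {κ : ℝ} {P Q : Symbol (p + q)} (hP : TraceFree p q κ P)
    (hQ : TraceFree p q κ Q) : TraceFree p q κ (P + Q) :=
  ⟨by rw [map_add, hP.1, hQ.1, add_zero], by rw [map_add, hP.2, hQ.2, smul_add]⟩

theorem partialX_coord_pow {n : ℕ} (i t : Fin n) (j : ℕ) :
    partialX i (coord t ^ (j + 1) : Smooth n) =
      if t = i then ((j + 1 : ℕ) : ℝ) • coord t ^ j else 0 := by
  rw [Derivation.leibniz_pow, partialX_coord, Nat.add_sub_cancel, ← Nat.cast_smul_eq_nsmul ℝ]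
  split_ifs <;> simp

theorem opD_coord_pow_smul_nullP (hwu : w ≠ u) (j m : ℕ) :
    opD p q ((coord w ^ (j + 1) : Smooth (p + q)) • (nullP w u (m + 1)).1) =
      (((j + 1 : ℕ) : ℝ) * ((m + 1 : ℕ) : ℝ)) • (coord w ^ j : Smooth (p + q)) • (nullP w u m).1 := by
  rw [opD_apply, Finset.sum_eq_single w (fun i _ hi => ?_) (fun h => absurd (Finset.mem_univ w) h)]
  · rw [dp_smul, dx_smul, (dp_nullP_fst hwu m).1, map_smul, (dx_nullP w m).1, partialX_coord_pow,
      if_pos rfl, smul_zero, smul_zero, zero_add, smul_assoc, mul_smul,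
      smul_comm _ ((m + 1 : ℕ) : ℝ)]
  · rw [dp_smul, dx_smul, partialX_coord_pow, if_neg (Ne.symm hi), zero_smul, add_zero,
      ← dp_dx_comm, (dx_nullP i (m + 1)).1, map_zero, smul_zero]

/-- Test symbol: `x_w^d` times a power of the null form. Each `D` differentiates once in `x_w` and
once in `p_w` and reproduces a symbol of the same shape. -/
theorem exists_opD_pow_ne_zero (hwu : w ≠ u) (m' d : ℕ) :
    ∃ P, TraceFree p q (m' + d : ℕ) P ∧ (opD p q ^ d) P ≠ 0 := by
  refine ⟨_, (traceFree_nullP hwu (m' + d)).1.smul (coord w ^ d), ?_⟩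
  have h : ∃ c : ℝ, c ≠ 0 ∧ (opD p q ^ d) ((coord w ^ d : Smooth (p + q)) • (nullP w u (m' + d)).1) =
      c • (nullP w u m').1 := by
    induction d with
    | zero => exact ⟨1, one_ne_zero, by simp⟩
    | succ d ih =>
      obtain ⟨c, hc, ih⟩ := ih
      refine ⟨((d + 1 : ℕ) : ℝ) * ((m' + d + 1 : ℕ) : ℝ) * c, by positivity, ?_⟩
      rw [pow_succ (opD p q), Module.End.mul_apply, ← add_assoc m' d 1,
        opD_coord_pow_smul_nullP hwu, map_smul, ih, smul_smul]
  obtain ⟨c, hc, h⟩ := h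
  rw [h]
  exact smul_ne_zero hc (nullP_ne_zero hwu m')

theorem opL_coord_pow_smul_nullP (t : Fin (p + q)) (j m : ℕ) :
    opL p q ((coord t ^ (j + 2) : Smooth (p + q)) • (nullP w u m).1) =
      (sgn p q t * (((j + 2 : ℕ) : ℝ) * ((j + 1 : ℕ) : ℝ))) •
        (coord t ^ j : Smooth (p + q)) • (nullP w u m).1 := by
  have hdx : ∀ (i : Fin (p + q)) (g : Smooth (p + q)),
      dx i (g • (nullP w u m).1) = partialX i g • (nullP w u m).1 := fun i g => by
    rw [dx_smul, (dx_nullP i m).1, smul_zero, zero_add]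
  rw [opL_apply, Finset.sum_eq_single t (fun i _ hi => ?_) (fun h => absurd (Finset.mem_univ t) h)]
  · rw [hdx, hdx, partialX_coord_pow, if_pos rfl, Derivation.map_smul, partialX_coord_pow, if_pos rfl,
      smul_smul, smul_assoc, smul_smul]
  · rw [hdx, partialX_coord_pow, if_neg (Ne.symm hi), zero_smul, map_zero, smul_zero]

/-- The coefficient `x_t^{2l}` depends on a direction that the null form does not involve, so `D`
kills the test symbol and only the summand `L^l`, with coefficient `1`, contributes. -/
theorem exists_opCalL_ne_zero (hwu : w ≠ u) {t : Fin (p + q)} (hw : w ≠ t) (hu : u ≠ t)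
    {a : ℕ → ℝ} (ha : a 0 = 1) (m l : ℕ) :
    ∃ P, TraceFree p q m P ∧ opCalL p q a m l P ≠ 0 := by
  refine ⟨_, (traceFree_nullP hwu m).1.smul (coord t ^ (2 * l)), ?_⟩
  have hD : ∀ g : ℕ, opD p q ((coord t ^ g : Smooth (p + q)) • (nullP w u m).1) = 0 := fun g => by
    rw [opD_apply]
    refine Finset.sum_eq_zero fun i _ => ?_
    rw [dp_smul, dx_smul, ← dp_dx_comm, (dx_nullP i m).1, map_zero, smul_zero, zero_add]
    rcases g with _ | g
    · rw [pow_zero, Derivation.map_one_eq_zero, zero_smul]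
    · rw [partialX_coord_pow]
      split_ifs with h
      · rw [← h, (dp_nullP_of_ne hw hu m).1, smul_zero]
      · rw [zero_smul]
  have hL : ∃ c : ℝ, c ≠ 0 ∧
      (opL p q ^ l) ((coord t ^ (2 * l) : Smooth (p + q)) • (nullP w u m).1) =
        c • (nullP w u m).1 := by
    induction l with
    | zero => exact ⟨1, one_ne_zero, by simp⟩
    | succ l ih =>
      obtain ⟨c, hc, ih⟩ := ih
      have hs : sgn p q t ≠ 0 := fun h => by
        have := sgn_mul_self p q t
        rw [h, zero_mul] at this
        exact zero_ne_one this
      refine ⟨sgn p q t * (((2 * l + 2 : ℕ) : ℝ) * ((2 * l + 1 : ℕ) : ℝ)) * c,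
        mul_ne_zero (mul_ne_zero hs (by positivity)) hc, ?_⟩
      rw [pow_succ (opL p q), Module.End.mul_apply, mul_add, mul_one,
        opL_coord_pow_smul_nullP, map_smul, ih, smul_smul]
  obtain ⟨c, hc, hL⟩ := hL
  have : opCalL p q a m l ((coord t ^ (2 * l) : Smooth (p + q)) • (nullP w u m).1) =
      c • (nullP w u m).1 := by
    rw [opCalL, Finset.sum_range_succ', LinearMap.add_apply, LinearMap.sum_apply,
      Finset.sum_eq_zero fun i _ => ?_, zero_add, ha, one_smul, pow_zero, mul_one, Nat.sub_zero,
      Nat.sub_zero, show opG₀pow p q m 0 = 1 from rfl, one_mul, hL]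
    rw [LinearMap.smul_apply, Module.End.mul_apply, pow_succ, Module.End.mul_apply,
      Module.End.mul_apply, hD, map_zero, map_zero,
      map_zero, smul_zero]
  rw [this]
  exact smul_ne_zero hc (nullP_ne_zero hwu m)

theorem partialX_nullX_fst (hwu : w ≠ u) (j : ℕ) :
    partialX w (nullX w u (j + 1)).1 = ((j + 1 : ℕ) : ℝ) • (nullX w u j).1 ∧
      partialX w (nullX w u (j + 1)).2 = ((j + 1 : ℕ) : ℝ) • (nullX w u j).2 := by
  have := derivation_quadPow (e := -(sgn p q w * sgn p q u)) (x := (coord w : Smooth (p + q)))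
    (y := (sgn p q w * sgn p q u) • coord u) (d := (partialX w : Smooth (p + q) →ₗ[ℝ] _))
    (fun P Q => by simp [mul_comm Q]) (ξ := 1) (ζ := 0)
    (by simp [partialX_coord]) (by simp [partialX_coord, hwu.symm]) j
  simpa [nullX] using this

theorem partialX_nullX_snd (hwu : w ≠ u) (j : ℕ) :
    partialX u (nullX w u (j + 1)).1 = -(((j + 1 : ℕ) : ℝ) • (nullX w u j).2) ∧
      partialX u (nullX w u (j + 1)).2 =
        ((j + 1 : ℕ) : ℝ) • (sgn p q w * sgn p q u) • (nullX w u j).1 := by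
  have := derivation_quadPow (e := -(sgn p q w * sgn p q u)) (x := (coord w : Smooth (p + q)))
    (y := (sgn p q w * sgn p q u) • coord u) (d := (partialX u : Smooth (p + q) →ₗ[ℝ] _))
    (fun P Q => by simp [mul_comm Q]) (ξ := 0) (ζ := sgn p q w * sgn p q u)
    (by simp [partialX_coord, hwu]) (by simp [partialX_coord]) j
  have h1 : -(sgn p q w * sgn p q u) * (sgn p q w * sgn p q u) = -1 := by
    linear_combination (-sgn p q u * sgn p q u) * sgn_mul_self p q w - sgn_mul_self p q u
  rw [h1] at this
  simpa [nullX] using this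

theorem partialX_nullX_of_ne {i : Fin (p + q)} (hw : w ≠ i) (hu : u ≠ i) (j : ℕ) :
    partialX i (nullX w u j).1 = 0 ∧ partialX i (nullX w u j).2 = 0 :=
  derivation_quadPow_eq_zero (d := (partialX i : Smooth (p + q) →ₗ[ℝ] _))
    (fun P Q => by simp [mul_comm Q]) (by simp [partialX_coord, hw])
    (by simp [partialX_coord, hu]) j

/-- The first component of the product of the powers of the null coordinate and of the null
linear form. -/
def nullXP (w u : Fin (p + q)) (j m : ℕ) : Symbol (p + q) :=
  (nullX w u j).1 • (nullP w u m).1 +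
    (-(sgn p q w * sgn p q u)) • (nullX w u j).2 • (nullP w u m).2

theorem traceFree_nullXP (hwu : w ≠ u) (j m : ℕ) : TraceFree p q m (nullXP w u j m) := by
  have h2 := (traceFree_nullP hwu m).2.smul ((-(sgn p q w * sgn p q u)) • (nullX w u j).2)
  rw [smul_assoc] at h2
  exact ((traceFree_nullP hwu m).1.smul _).add h2

theorem dx_nullXP (i : Fin (p + q)) (j m : ℕ) : dx i (nullXP w u j m) =
    partialX i (nullX w u j).1 • (nullP w u m).1 +
      (-(sgn p q w * sgn p q u)) • partialX i (nullX w u j).2 • (nullP w u m).2 := by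
  rw [nullXP, map_add, LinearMap.map_smul (dx i), dx_smul, dx_smul, (dx_nullP i m).1, (dx_nullP i m).2, smul_zero,
    smul_zero, zero_add, zero_add]

/-- `D` contracts the differential of the null coordinate with the null form; the result is `1 + s_w
s_u σ² = 0`. -/
theorem opD_nullXP (hwu : w ≠ u) (j m : ℕ) : opD p q (nullXP w u (j + 1) m) = 0 := by
  have h : ∀ i, dx i (dp i (nullXP w u (j + 1) m)) =
      partialX i (nullX w u (j + 1)).1 • dp i (nullP w u m).1 +
        (-(sgn p q w * sgn p q u)) • partialX i (nullX w u (j + 1)).2 • dp i (nullP w u m).2 := by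
    intro i
    rw [← dp_dx_comm, dx_nullXP, map_add, LinearMap.map_smul (dp i), dp_smul, dp_smul]
  rw [opD_apply]
  simp only [h]
  rw [Fintype.sum_eq_add w u hwu fun i hi => by
    rw [(partialX_nullX_of_ne hi.1.symm hi.2.symm (j + 1)).1,
      (partialX_nullX_of_ne hi.1.symm hi.2.symm (j + 1)).2, zero_smul, zero_smul, smul_zero,
      add_zero]]
  rcases m with _ | m
  · simp [dp_nullP_zero]
  · rw [(partialX_nullX_fst hwu j).1, (partialX_nullX_fst hwu j).2, (partialX_nullX_snd hwu j).1,
      (partialX_nullX_snd hwu j).2, (dp_nullP_fst hwu m).1, (dp_nullP_fst hwu m).2,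
      (dp_nullP_snd hwu m).1, (dp_nullP_snd hwu m).2]
    have h1 : (sgn p q w * sgn p q u) * (sgn p q w * sgn p q u) = 1 := by
      linear_combination (sgn p q u * sgn p q u) * sgn_mul_self p q w + sgn_mul_self p q u
    generalize sgn p q w * sgn p q u = ε at h1 ⊢
    simp only [neg_smul, smul_neg, smul_assoc, smul_comm ((nullX w u j).1) (_ : ℝ),
      smul_comm ((nullX w u j).2) (_ : ℝ)]
    have key : ∀ Z : Symbol (p + q), (((j + 1 : ℕ) : ℝ) * ((m + 1 : ℕ) : ℝ) * (ε * ε)) • Z =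
        (((j + 1 : ℕ) : ℝ) * ((m + 1 : ℕ) : ℝ)) • Z := fun Z => by rw [h1, mul_one]
    linear_combination (norm := module) -(key ((nullX w u j).1 • (nullP w u m).1))

/-- `G` of the null coordinate is `s_w` times the null form, so `G` trades one power of the former
for one of the latter. -/
theorem opG_nullXP (hwu : w ≠ u) (j m : ℕ) : opG p q (nullXP w u (j + 1) m) =
    (((j + 1 : ℕ) : ℝ) * sgn p q w) • nullXP w u j (m + 1) := by
  rw [opG_apply]
  simp only [dx_nullXP]
  rw [Fintype.sum_eq_add w u hwu fun i hi => by
    rw [(partialX_nullX_of_ne hi.1.symm hi.2.symm (j + 1)).1,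
      (partialX_nullX_of_ne hi.1.symm hi.2.symm (j + 1)).2, zero_smul, zero_smul, smul_zero,
      add_zero, mul_zero, smul_zero]]
  rw [(partialX_nullX_fst hwu j).1, (partialX_nullX_fst hwu j).2, (partialX_nullX_snd hwu j).1,
      (partialX_nullX_snd hwu j).2, nullXP]
  have e1 : (nullP w u (m + 1)).1 = X w * (nullP w u m).1 +
    (-(sgn p q w * sgn p q u)) • (X u * (nullP w u m).2) := rfl
  have e2 : (nullP w u (m + 1)).2 = X w * (nullP w u m).2 + X u * (nullP w u m).1 := rfl
  rw [e1, e2]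
  have hw := sgn_mul_self p q w
  have hu := sgn_mul_self p q u
  simp only [neg_smul, smul_neg, smul_assoc, smul_add, mul_add, mul_smul_comm, mul_neg,
    smul_comm ((nullX w u j).1) (_ : ℝ), smul_comm ((nullX w u j).2) (_ : ℝ)]
  have key : ∀ (r c : ℝ), r * r = 1 → ∀ Z : Symbol (p + q), (c * (r * r)) • Z = c • Z :=
    fun r c hr Z => by rw [hr, mul_one]
  linear_combination (norm := module)
    key _ (((j + 1 : ℕ) : ℝ) * sgn p q u) hw ((nullX w u j).2 • (X u * (nullP w u m).1))
    - key _ (((j + 1 : ℕ) : ℝ) * sgn p q u * (sgn p q w * sgn p q w)) hu ((nullX w u j).1 • (X u * (nullP w u m).2))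

/-- On these symbols the divergence vanishes, so `G₀` acts as `G`, and `g` steps use up the power
`g` of the null coordinate. -/
theorem exists_opG₀pow_ne_zero (hwu : w ≠ u) (m g : ℕ) :
    ∃ P, TraceFree p q m P ∧ opG₀pow p q m g P ≠ 0 := by
  refine ⟨_, traceFree_nullXP hwu g m, ?_⟩
  have hs : sgn p q w ≠ 0 := fun h => by
    have := sgn_mul_self p q w
    rw [h, zero_mul] at this
    exact zero_ne_one this
  have h : ∀ j, ∃ c : ℝ, c ≠ 0 ∧ opG₀pow p q m g (nullXP w u (j + g) m) =
      c • nullXP w u j (m + g) := by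
    induction g with
    | zero => exact fun j => ⟨1, one_ne_zero, by rw [one_smul]; rfl⟩
    | succ g ih =>
      intro j
      obtain ⟨c, hc, h⟩ := ih (j + 1)
      refine ⟨c * (((j + 1 : ℕ) : ℝ) * sgn p q w),
        mul_ne_zero hc (mul_ne_zero (by positivity) hs), ?_⟩
      rw [opG₀pow, Module.End.mul_apply, show j + (g + 1) = j + 1 + g by omega, h, map_smul,
        opG₀_apply, opD_nullXP hwu, opG_nullXP hwu, mul_zero, smul_zero, sub_zero, smul_smul]
      rfl
  obtain ⟨c, hc, h⟩ := h 0
  rw [zero_add] at h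
  rw [h]
  refine smul_ne_zero hc ?_
  have : nullXP w u 0 (m + g) = (nullP w u (m + g)).1 := by simp [nullXP, nullX, quadPow]
  rw [this]
  exact nullP_ne_zero hwu _

end TestSymbols

/-! ### Existence of the invariant operators on trace-free symbols -/

section Existence

variable {p q m m' : ℕ} {δ δ' : ℝ}

theorem exists_isInvariant_one (hn : 3 ≤ p + q) (hm : m = m')
    (hδ : ((p + q : ℕ) : ℝ) * (δ' - δ) = 0) :
    ∃ A : sym p q m 0 →ₗ[ℝ] sym p q m' 0, IsInvariant p q m m' δ δ' A ∧ A ≠ 0 ∧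
      ∀ P, (A P : Symbol (p + q)) = (1 : Module.End ℝ (Symbol (p + q))) P := by
  have h0 : ((p + q : ℕ) : ℝ) ≠ 0 := Nat.cast_ne_zero.mpr (by omega)
  obtain rfl : δ' = δ := by linarith [(mul_eq_zero.mp hδ).resolve_left h0]
  subst hm
  obtain ⟨w, u, t, hwu, ht⟩ := exists_indices hn
  exact exists_isInvariant (one_mem _) (fun P hP => hP) (fun V f hV P hP => rfl)
    ⟨_, (traceFree_nullP hwu m).1, nullP_ne_zero hwu m⟩

theorem exists_isInvariant_opD_pow (hn : 3 ≤ p + q) {d : ℕ} (hd : 1 ≤ d) (hm : m = m' + d)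
    (hδ : ((p + q : ℕ) : ℝ) * (δ' - δ) = 0)
    (hδ₀ : ((p + q : ℕ) : ℝ) * δ = (p + q : ℕ) + 2 * m - 1 - d) :
    ∃ A : sym p q m 0 →ₗ[ℝ] sym p q m' 0, IsInvariant p q m m' δ δ' A ∧ A ≠ 0 ∧
      ∀ P, (A P : Symbol (p + q)) = (opD p q ^ d) P := by
  have h0 : ((p + q : ℕ) : ℝ) ≠ 0 := Nat.cast_ne_zero.mpr (by omega)
  obtain rfl : δ' = δ := by linarith [(mul_eq_zero.mp hδ).resolve_left h0]
  obtain ⟨w, u, t, hwu, ht⟩ := exists_indices hn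
  subst hm
  refine exists_isInvariant (pow_mem opD_mem_naturalOps d) (fun P hP => ?_)
    (fun V f hV P hP => ?_) (exists_opD_pow_ne_zero hwu m' d)
  · have := hP.opD_pow_nat (Nat.le_add_left d m')
    rwa [Nat.add_sub_cancel] at this
  · obtain ⟨d, rfl⟩ := Nat.exists_eq_add_of_le' hd
    rw [hV.opD_pow_lieDer hn _ hP d]
    -- The prescribed weight is the zero of the accumulated coefficient of the error.
    have : ((p + q : ℕ) : ℝ) / 2 * (δ' - 1) - ((m' + (d + 1) : ℕ) : ℝ) + (d + 2) / 2 = 0 := by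
      push_cast at hδ₀ ⊢
      linear_combination hδ₀ / 2
    rw [this, mul_zero, zero_smul, add_zero]

theorem exists_isInvariant_opG₀pow (hn : 3 ≤ p + q) {g : ℕ} (hg : 1 ≤ g) (hm : m' = m + g)
    (hδ : ((p + q : ℕ) : ℝ) * (δ' - δ) = 2 * g) (hδ₀ : ((p + q : ℕ) : ℝ) * δ = 1 - g) :
    ∃ A : sym p q m 0 →ₗ[ℝ] sym p q m' 0, IsInvariant p q m m' δ δ' A ∧ A ≠ 0 ∧
      ∀ P, (A P : Symbol (p + q)) = opG₀pow p q m g P := by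
  have h0 : ((p + q : ℕ) : ℝ) ≠ 0 := Nat.cast_ne_zero.mpr (by omega)
  obtain rfl : δ' = δ + 2 * g / ((p + q : ℕ) : ℝ) := by
    rw [← hδ, mul_div_cancel_left₀ _ h0]; ring
  obtain ⟨w, u, t, hwu, ht⟩ := exists_indices hn
  subst hm
  refine exists_isInvariant (opG₀pow_mem_naturalOps m g) (fun P hP => hP.opG₀pow hn g)
    (fun V f hV P hP => ?_) (exists_opG₀pow_ne_zero hwu m g)
  obtain ⟨g, rfl⟩ := Nat.exists_eq_add_of_le' hg
  rw [hV.opG₀pow_lieDer hn _ hP g]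
  have : ((p + q : ℕ) : ℝ) / 2 * δ + (g : ℝ) / 2 = 0 := by
    push_cast at hδ₀ ⊢
    linear_combination hδ₀ / 2
  rw [this, mul_zero, zero_smul, add_zero]

theorem TraceFree.opCalL (hn : 3 ≤ p + q) {P : Symbol (p + q)} (hP : TraceFree p q m P)
    (a : ℕ → ℝ) (l : ℕ) : TraceFree p q m (ConfSymbols.opCalL p q a m l P) := by
  rw [ConfSymbols.opCalL, LinearMap.sum_apply]
  refine Finset.sum_induction _ (TraceFree p q m) (fun _ _ h₁ h₂ => h₁.add h₂)
    ⟨map_zero _, by rw [map_zero, smul_zero]⟩ fun i _ => ?_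
  rw [LinearMap.smul_apply, Module.End.mul_apply, Module.End.mul_apply]
  by_cases hi : i ≤ m
  · have h1 := ((hP.opD_pow_nat hi).opL_pow (l - i)).opG₀pow hn i
    rw [Nat.sub_add_cancel hi] at h1
    have h2 := h1.smul (algebraMap ℝ (Smooth (p + q)) (a i))
    rwa [algebraMap_smul] at h2
  -- For `i > m` the truncated difference `m - i` is meaningless as a degree, but `D^i` already
  -- annihilates `P`.
  · rw [hP.opD_pow_eq_zero (not_le.mp hi), map_zero, map_zero, smul_zero]
    exact ⟨map_zero _, by rw [map_zero, smul_zero]⟩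

theorem exists_isInvariant_opCalL (hn : 3 ≤ p + q) {l : ℕ} (hm : m = m')
    (hδ : ((p + q : ℕ) : ℝ) * (δ' - δ) = 2 * l)
    (hδ₀ : ((p + q : ℕ) : ℝ) * δ = (p + q : ℕ) / 2 + m - l) :
    ∃ A : sym p q m 0 →ₗ[ℝ] sym p q m' 0, IsInvariant p q m m' δ δ' A ∧ A ≠ 0 ∧
      ∀ P, (A P : Symbol (p + q)) = opCalL p q (calCoeff (p + q) m l) m l P := by
  have h0 : ((p + q : ℕ) : ℝ) ≠ 0 := Nat.cast_ne_zero.mpr (by omega)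
  obtain rfl : δ' = δ + 2 * l / ((p + q : ℕ) : ℝ) := by
    rw [← hδ, mul_div_cancel_left₀ _ h0]; ring
  obtain ⟨w, u, t, hwu, ht⟩ := exists_indices hn
  subst hm
  exact exists_isInvariant (opCalL_mem_naturalOps _ m l) (fun P hP => hP.opCalL hn _ l)
    (fun V f hV P hP => hV.calL_lieDer hn hδ₀ hP)
    (exists_opCalL_ne_zero hwu (mem_trans.mp ht).1.symm (mem_trans.mp ht).2.symm rfl m l)

end Existence

/-! ### Multiplication by powers of `R` -/

section PowersOfTheMetric

variable {p q : ℕ}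

/-- Smooth functions have zero divisors, so the cancellation is done at each point, where the
symbols become polynomials over `ℝ` and `R` is a non-zero one. -/
theorem metricR_mul_eq_zero (hn : 0 < p + q) {P : Symbol (p + q)} (h : metricR p q * P = 0) :
    P = 0 := by
  refine symbol_eq_zero_of_evSym fun c => ?_
  have h1 := congrArg (evSym c) h
  rw [map_mul, map_zero] at h1
  refine (mul_eq_zero.mp h1).resolve_left fun h2 => ?_
  have hX : ∀ i, evSym c (X i : Symbol (p + q)) = X i := fun i => map_X _ i
  have h3 := congrArg (MvPolynomial.eval (Pi.single (⟨0, hn⟩ : Fin (p + q)) (1 : ℝ))) h2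
  simp only [metricR, map_sum, map_smul, map_pow, hX, smul_eval, eval_X, map_zero,
    Pi.single_apply] at h3
  rw [Finset.sum_eq_single ⟨0, hn⟩ (fun i _ hi => by simp [hi]) (by simp)] at h3
  have h4 := sgn_mul_self p q ⟨0, hn⟩
  simp at h3
  rw [h3, zero_mul] at h4
  exact zero_ne_one h4

theorem metricR_pow_mul_eq_zero (hn : 0 < p + q) {s : ℕ} {P : Symbol (p + q)}
    (h : metricR p q ^ s * P = 0) : P = 0 := by
  induction s with
  | zero => rwa [pow_zero, one_mul] at h
  | succ s ih => exact ih (metricR_mul_eq_zero hn (by rwa [pow_succ', mul_assoc] at h))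

theorem eulerP_metricR_pow_mul (s : ℕ) (P : Symbol (p + q)) :
    eulerP (metricR p q ^ s * P) = metricR p q ^ s * (eulerP P + ((2 * s : ℕ) : ℝ) • P) := by
  induction s with
  | zero => simp
  | succ s ih =>
    rw [pow_succ', mul_assoc, eulerP_mul, ih, eulerP_metricR, mul_assoc, smul_mul_assoc]
    push_cast
    simp only [mul_add, add_mul, mul_smul_comm]
    module

theorem opT_metricR_mul (P : Symbol (p + q)) : opT p q (metricR p q * P) =
    metricR p q * opT p q P + (4 : ℝ) • eulerP P + (2 * ((p + q : ℕ) : ℝ)) • P := by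
  have h1 : ∀ i, sgn p q i • dp i (dp i (metricR p q * P)) =
      metricR p q * (sgn p q i • dp i (dp i P)) + (4 : ℝ) • (X i * dp i P) + (2 : ℝ) • P := by
    intro i
    simp only [dp_mul, map_add, dp_metricR, smul_mul_assoc, map_smul, dp_X, if_true, one_mul,
      smul_add, smul_smul, ← mul_assoc, sgn_mul_self, mul_smul_comm]
    module
  rw [opT_apply, opT_apply, eulerP_apply]
  simp only [h1, Finset.sum_add_distrib, ← Finset.mul_sum, ← Finset.smul_sum]
  rw [Finset.sum_const, Finset.card_univ, Fintype.card_fin, ← Nat.cast_smul_eq_nsmul ℝ, smul_smul,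
    mul_comm]

/-- By the `sl₂` relation, `T` lowers the power of `R` with a factor that is a sum of non-negative
terms and of a positive multiple of `n`. -/
theorem TraceFree.exists_opT_pow (hn : 0 < p + q) (m s : ℕ) : ∃ c : ℝ, c ≠ 0 ∧
    ∀ Q, TraceFree p q m Q → (opT p q ^ s) (metricR p q ^ s * Q) = c • Q := by
  have hn' : (0 : ℝ) < ((p + q : ℕ) : ℝ) := by exact_mod_cast hn
  have h : ∀ j : ℕ, ∃ c : ℝ, 0 < c ∧ ∀ Q, TraceFree p q m Q →
      opT p q (metricR p q ^ (j + 1) * Q) = c • (metricR p q ^ j * Q) := by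
    intro j
    induction j with
    | zero =>
      refine ⟨4 * m + 2 * ((p + q : ℕ) : ℝ), by positivity, fun Q hQ => ?_⟩
      rw [zero_add, pow_one, opT_metricR_mul, hQ.1, hQ.2]
      simp only [mul_zero, pow_zero, one_mul]
      module
    | succ j ih =>
      obtain ⟨c, hc, h⟩ := ih
      refine ⟨c + 4 * (m + (2 * (j + 1) : ℕ)) + 2 * ((p + q : ℕ) : ℝ), by positivity,
        fun Q hQ => ?_⟩
      rw [pow_succ', mul_assoc, opT_metricR_mul, h Q hQ, eulerP_metricR_pow_mul, hQ.2,
        mul_smul_comm, ← mul_assoc, ← pow_succ', ← add_smul, mul_smul_comm]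
      module
  induction s with
  | zero => exact ⟨1, one_ne_zero, fun Q hQ => by simp⟩
  | succ s ih =>
    obtain ⟨c, hc, ih⟩ := ih
    obtain ⟨b, hb, h⟩ := h s
    refine ⟨b * c, mul_ne_zero hb.ne' hc, fun Q hQ => ?_⟩
    rw [pow_succ (opT p q), Module.End.mul_apply, h Q hQ, map_smul, ih Q hQ, smul_smul]

/-- In weight zero the field multiplies `R` by `-f`, which is compensated by a shift of the weight
by `2/n` for each factor. -/
theorem KillingEq.metricR_pow_lieDer (hn : 3 ≤ p + q) {V : Fin (p + q) → Smooth (p + q)}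
    {f : Smooth (p + q)} (hV : KillingEq p q V f) (s : ℕ) (δ : ℝ) (P : Symbol (p + q)) :
    metricR p q ^ s * lieDer δ V P =
      lieDer (δ + 2 * s / ((p + q : ℕ) : ℝ)) V (metricR p q ^ s * P) := by
  induction s with
  | zero => simp
  | succ s ih =>
    have h := hV.opR_lieDer hn (δ + 2 * s / ((p + q : ℕ) : ℝ)) (metricR p q ^ s * P)
    rw [opR_apply, opR_apply] at h
    rw [pow_succ', mul_assoc, ih, h, mul_assoc]
    congr 2
    push_cast
    ring

theorem metricR_pow_mul_mem {k s : ℕ} (hs : 2 * s ≤ k) {P : Symbol (p + q)}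
    (hP : P ∈ sym p q (k - 2 * s) 0) : metricR p q ^ s * P ∈ sym p q k s := by
  have hP := traceFree_iff.mpr hP
  refine ⟨isHomogeneous_iff_eulerP.mpr ?_, P, hP.1, rfl⟩
  rw [eulerP_metricR_pow_mul, hP.2, ← add_smul, mul_smul_comm, ← Nat.cast_add,
    Nat.sub_add_cancel hs]

/-- Multiplication by `R^s` on the trace-free symbols. -/
def symMul {k s : ℕ} (hs : 2 * s ≤ k) : sym p q (k - 2 * s) 0 →ₗ[Smooth (p + q)] sym p q k s :=
  LinearMap.restrict (LinearMap.mulLeft (Smooth (p + q)) (metricR p q ^ s))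
    fun _ => metricR_pow_mul_mem hs

theorem symMul_coe {k s : ℕ} (hs : 2 * s ≤ k) (P : sym p q (k - 2 * s) 0) :
    (symMul hs P : Symbol (p + q)) = metricR p q ^ s * P := rfl

/-- In the definition of `S_{k,s}` the trace-free factor is not assumed homogeneous; cancelling
`R^s` in Euler's identity shows that it is. -/
theorem symMul_bijective (hn : 0 < p + q) {k s : ℕ} (hs : 2 * s ≤ k) :
    Function.Bijective (symMul hs : sym p q (k - 2 * s) 0 →ₗ[Smooth (p + q)] sym p q k s) := by
  constructor
  · rw [injective_iff_map_eq_zero]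
    intro P hP
    have h := congrArg Subtype.val hP
    rw [symMul_coe] at h
    exact Subtype.ext (metricR_pow_mul_eq_zero hn h)
  · rintro ⟨_, hP, Q, hQ, rfl⟩
    have h := isHomogeneous_iff_eulerP.mp hP
    rw [eulerP_metricR_pow_mul, ← mul_smul_comm, ← sub_eq_zero, ← mul_sub] at h
    have h1 := metricR_pow_mul_eq_zero hn h
    refine ⟨⟨Q, traceFree_iff.mp ⟨hQ, ?_⟩⟩, rfl⟩
    rw [Nat.cast_sub hs]
    linear_combination (norm := module) h1

/-- Multiplication by `R^s`, as an isomorphism from the trace-free symbols. -/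
def symEquiv (hn : 0 < p + q) {k s : ℕ} (hs : 2 * s ≤ k) :
    sym p q (k - 2 * s) 0 ≃ₗ[Smooth (p + q)] sym p q k s :=
  LinearEquiv.ofBijective (symMul hs) (symMul_bijective hn hs)

theorem symEquiv_coe (hn : 0 < p + q) {k s : ℕ} (hs : 2 * s ≤ k) (P : sym p q (k - 2 * s) 0) :
    (symEquiv hn hs P : Symbol (p + q)) = metricR p q ^ s * P := rfl

theorem symEquiv_lieSym (hn : 3 ≤ p + q) (hn₀ : 0 < p + q) {k s : ℕ} (hs : 2 * s ≤ k) (δ : ℝ)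
    {V : Fin (p + q) → Smooth (p + q)} (hV : IsConformalKilling p q V)
    (P : sym p q (k - 2 * s) 0) :
    symEquiv hn₀ hs (lieSym (k - 2 * s) 0 (δ - 2 * s / ((p + q : ℕ) : ℝ)) hV P) =
      lieSym k s δ hV (symEquiv hn₀ hs P) := by
  obtain ⟨f, hf⟩ := hV
  refine Subtype.ext ((KillingEq.metricR_pow_lieDer hn hf s _ _).trans ?_)
  rw [sub_add_cancel]
  rfl

theorem symEquiv_reflSym (hn : 0 < p + q) {k s : ℕ} (hs : 2 * s ≤ k) (i : Fin (p + q))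
    (P : sym p q (k - 2 * s) 0) :
    symEquiv hn hs (reflSym p q (k - 2 * s) 0 i P) = reflSym p q k s i (symEquiv hn hs P) := by
  refine Subtype.ext ?_
  change metricR p q ^ s * refl i (P : Symbol (p + q)) = refl i (metricR p q ^ s * P)
  rw [refl_mul, refl_metricR]

end PowersOfTheMetric

/-! ### Transport of operators along isomorphisms -/

section Conjugation

variable {n : ℕ} {M N M₁ N₁ : Submodule (Smooth n) (Symbol n)}

/-- Transport of operators along isomorphisms of the spaces of symbols. -/
def conjEquiv (e : M ≃ₗ[Smooth n] M₁) (e' : N ≃ₗ[Smooth n] N₁) :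
    (M →ₗ[ℝ] N) ≃ₗ[ℝ] (M₁ →ₗ[ℝ] N₁) :=
  (e.restrictScalars ℝ).arrowCongr (e'.restrictScalars ℝ)

variable (e : M ≃ₗ[Smooth n] M₁) (e' : N ≃ₗ[Smooth n] N₁)

theorem conjEquiv_apply (A : M →ₗ[ℝ] N) (P : M) : conjEquiv e e' A (e P) = e' (A P) := by
  simp [conjEquiv, LinearEquiv.arrowCongr_apply]

theorem conjEquiv_ext {B C : M₁ →ₗ[ℝ] N₁} (h : ∀ P, B (e P) = C (e P)) : B = C :=
  LinearMap.ext fun P => by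
    obtain ⟨P, rfl⟩ := e.surjective P
    exact h P

theorem commFun_conjEquiv (A : M →ₗ[ℝ] N) (f : Smooth n) :
    commFun (conjEquiv e e' A) f = conjEquiv e e' (commFun A f) := by
  refine conjEquiv_ext e fun P => ?_
  rw [conjEquiv_apply]
  change conjEquiv e e' A (f • e P) - f • conjEquiv e e' A (e P) = e' (A (f • P) - f • A P)
  rw [← map_smul e, conjEquiv_apply, conjEquiv_apply, map_sub, map_smul e']

theorem isDiffOp_conjEquiv (A : M →ₗ[ℝ] N) (r : ℕ) :
    IsDiffOp r (conjEquiv e e' A) ↔ IsDiffOp r A := by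
  induction r generalizing A with
  | zero =>
    refine forall_congr' fun f => ?_
    rw [commFun_conjEquiv, LinearEquiv.map_eq_zero_iff]
  | succ r ih =>
    refine forall_congr' fun f => ?_
    rw [commFun_conjEquiv]
    exact ih _

theorem conjEquiv_comp_eq_iff {u : M →ₗ[ℝ] M} {u₁ : M₁ →ₗ[ℝ] M₁} {v : N →ₗ[ℝ] N}
    {v₁ : N₁ →ₗ[ℝ] N₁} (hu : ∀ P, e (u P) = u₁ (e P)) (hv : ∀ P, e' (v P) = v₁ (e' P))
    (A : M →ₗ[ℝ] N) :
    conjEquiv e e' A ∘ₗ u₁ = v₁ ∘ₗ conjEquiv e e' A ↔ A ∘ₗ u = v ∘ₗ A := by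
  constructor
  · intro h
    refine LinearMap.ext fun P => e'.injective ?_
    have := LinearMap.congr_fun h (e P)
    rwa [LinearMap.comp_apply, LinearMap.comp_apply, ← hu, conjEquiv_apply, conjEquiv_apply,
      ← hv] at this
  · intro h
    refine conjEquiv_ext e fun P => ?_
    rw [LinearMap.comp_apply, LinearMap.comp_apply, ← hu, conjEquiv_apply, conjEquiv_apply, ← hv]
    exact congrArg e' (LinearMap.congr_fun h P)

end Conjugation

section Lines

variable {E : Type} [AddCommMonoid E] [Module ℝ E]

theorem finrank_eq_one_of_eq_span {W : Submodule ℝ E} {x : E} (h : W = Submodule.span ℝ {x})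
    (hx : x ≠ 0) : Module.finrank ℝ W = 1 := by
  let _ := Module.addCommMonoidToAddCommGroup ℝ (M := E)
  rw [h]
  exact finrank_span_singleton hx

theorem neg_smul_eq_of_smul_add_smul_eq_zero {x y : ℝ} (hy : y ≠ 0) {A B : E}
    (h : x • A + y • B = 0) : (-(y⁻¹ * x)) • A = B := by
  let _ := Module.addCommMonoidToAddCommGroup ℝ (M := E)
  have h1 : y • B = -(x • A) := eq_neg_of_add_eq_zero_right h
  rw [neg_smul, mul_smul, ← smul_neg, ← h1, inv_smul_smul₀ hy]

end Lines

/-! ### Reduction to trace-free symbols -/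

section Reduction

variable {p q k s k' s' : ℕ} {δ δ' : ℝ} {W : Submodule ℝ (sym p q k s →ₗ[ℝ] sym p q k' s')}

/-- Multiplication by `R^s` is linear over functions, commutes with the reflections and intertwines
the Lie derivatives up to the shift of weight, so every condition transports. -/
theorem conjEquiv_mem_iff (hn : 3 ≤ p + q) (hn₀ : 0 < p + q) (hs : 2 * s ≤ k) (hs' : 2 * s' ≤ k')
    (hW : 4 ≤ p + q ∧ W = confInv p q k s k' s' δ δ' ∨
      p + q = 3 ∧ W = confInv p q k s k' s' δ δ' ⊓ reflInv p q k s k' s')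
    (A : sym p q (k - 2 * s) 0 →ₗ[ℝ] sym p q (k' - 2 * s') 0) :
    conjEquiv (symEquiv hn₀ hs) (symEquiv hn₀ hs') A ∈ W ↔
      IsInvariant p q (k - 2 * s) (k' - 2 * s') (δ - 2 * s / ((p + q : ℕ) : ℝ))
        (δ' - 2 * s' / ((p + q : ℕ) : ℝ)) A := by
  have h1 : conjEquiv (symEquiv hn₀ hs) (symEquiv hn₀ hs') A ∈ confInv p q k s k' s' δ δ' ↔
      A ∈ confInv p q (k - 2 * s) 0 (k' - 2 * s') 0 (δ - 2 * s / ((p + q : ℕ) : ℝ))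
        (δ' - 2 * s' / ((p + q : ℕ) : ℝ)) :=
    and_congr (exists_congr fun r => isDiffOp_conjEquiv _ _ A r)
      (forall_congr' fun V => forall_congr' fun hV => conjEquiv_comp_eq_iff _ _
        (symEquiv_lieSym hn hn₀ hs δ hV) (symEquiv_lieSym hn hn₀ hs' δ' hV) A)
  have h2 : conjEquiv (symEquiv hn₀ hs) (symEquiv hn₀ hs') A ∈ reflInv p q k s k' s' ↔
      A ∈ reflInv p q (k - 2 * s) 0 (k' - 2 * s') 0 :=
    forall_congr' fun i => conjEquiv_comp_eq_iff _ _ (symEquiv_reflSym hn₀ hs i)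
      (symEquiv_reflSym hn₀ hs' i) A
  rcases hW with ⟨h4, rfl⟩ | ⟨h3, rfl⟩
  · rw [h1]
    exact ⟨fun h => ⟨h, fun h3 => by omega⟩, fun h => h.mem⟩
  · rw [Submodule.mem_inf, h1, h2]
    exact ⟨fun h => ⟨h.1, fun _ => h.2⟩, fun h => ⟨h.mem, h.refl h3⟩⟩

/-- In a non-trivial relation between `A` and `B` the coefficient of `B` cannot vanish, because `A`
is non-zero. -/
theorem eq_span_of_mem (hn : 3 ≤ p + q) (hs : 2 * s ≤ k) (hs' : 2 * s' ≤ k')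
    (hW : 4 ≤ p + q ∧ W = confInv p q k s k' s' δ δ' ∨
      p + q = 3 ∧ W = confInv p q k s k' s' δ δ' ⊓ reflInv p q k s k' s')
    {A : sym p q k s →ₗ[ℝ] sym p q k' s'} (hA : A ∈ W) (hne : A ≠ 0) :
    W = Submodule.span ℝ {A} := by
  have hn₀ : 0 < p + q := by omega
  refine le_antisymm (fun B hB => ?_) ((Submodule.span_singleton_le_iff_mem A W).mpr hA)
  obtain ⟨A₀, rfl⟩ := (conjEquiv (symEquiv hn₀ hs) (symEquiv hn₀ hs')).surjective A
  obtain ⟨B₀, rfl⟩ := (conjEquiv (symEquiv hn₀ hs) (symEquiv hn₀ hs')).surjective B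
  obtain ⟨x, y, hxy, h⟩ := exists_smul_add_smul_eq_zero hn
    ((conjEquiv_mem_iff hn hn₀ hs hs' hW A₀).mp hA) ((conjEquiv_mem_iff hn hn₀ hs hs' hW B₀).mp hB)
  have hy : y ≠ 0 := by
    rintro rfl
    rw [zero_smul, add_zero] at h
    rcases smul_eq_zero.mp h with h0 | h0
    · simp [h0] at hxy
    · exact hne (by rw [h0, map_zero])
  refine Submodule.mem_span_singleton.mpr ⟨-(y⁻¹ * x), ?_⟩
  rw [← map_smul]
  congr 1
  exact neg_smul_eq_of_smul_add_smul_eq_zero hy h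

/-- `T^s` inverts `R^s` up to a non-zero scalar `c`, so `R^{s'} B T^s` is `c` times the transported
operator. -/
theorem isSpannedBy_of_isInvariant (hn : 3 ≤ p + q) (hs : 2 * s ≤ k) (hs' : 2 * s' ≤ k')
    (hW : 4 ≤ p + q ∧ W = confInv p q k s k' s' δ δ' ∨
      p + q = 3 ∧ W = confInv p q k s k' s' δ δ' ⊓ reflInv p q k s k' s')
    {B : Module.End ℝ (Symbol (p + q))}
    (h : ∃ A : sym p q (k - 2 * s) 0 →ₗ[ℝ] sym p q (k' - 2 * s') 0,
      IsInvariant p q (k - 2 * s) (k' - 2 * s') (δ - 2 * s / ((p + q : ℕ) : ℝ))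
        (δ' - 2 * s' / ((p + q : ℕ) : ℝ)) A ∧ A ≠ 0 ∧ ∀ P, (A P : Symbol (p + q)) = B P) :
    IsSpannedBy W B := by
  have hn₀ : 0 < p + q := by omega
  obtain ⟨A, hA, hne, hAB⟩ := h
  obtain ⟨c, hc, hT⟩ := TraceFree.exists_opT_pow hn₀ (k - 2 * s) s
  have hne' : c • conjEquiv (symEquiv hn₀ hs) (symEquiv hn₀ hs') A ≠ 0 :=
    smul_ne_zero hc ((LinearEquiv.map_ne_zero_iff _).mpr hne)
  have hmem : c • conjEquiv (symEquiv hn₀ hs) (symEquiv hn₀ hs') A ∈ W :=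
    W.smul_mem c ((conjEquiv_mem_iff hn hn₀ hs hs' hW A).mpr hA)
  refine ⟨_, hne', fun P => ?_, eq_span_of_mem hn hs hs' hW hmem hne'⟩
  obtain ⟨Q, rfl⟩ := (symEquiv hn₀ hs).surjective P
  have hR : ∀ Z, (opR p q ^ s') Z = metricR p q ^ s' * Z := fun Z => by
    rw [opR, LinearMap.pow_mulLeft, LinearMap.mulLeft_apply]
  rw [LinearMap.smul_apply, conjEquiv_apply, Module.End.mul_apply, Module.End.mul_apply,
    symEquiv_coe, hT Q (traceFree_iff.mpr Q.2), map_smul, map_smul, ← hAB, hR]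
  rfl

end Reduction

end

end ConfSymbols

/-! ### The classification theorem -/

open ConfSymbols in
theorem theorem4p3 (p q : ℕ) (hn : 3 ≤ p + q) :
    ∃ a : ℕ → ℕ → ℕ → ℝ, (∀ m l, a m l 0 = 1) ∧
      ∀ (k s k' s' : ℕ), 2 * s ≤ k → 2 * s' ≤ k' → ∀ (δ δ' : ℝ)
        (W : Submodule ℝ (sym p q k s →ₗ[ℝ] sym p q k' s')),
        (4 ≤ p + q ∧ W = confInv p q k s k' s' δ δ' ∨
          p + q = 3 ∧ W = confInv p q k s k' s' δ δ' ⊓ reflInv p q k s k' s') →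
        (W = ⊥ ∨ Module.finrank ℝ W = 1) ∧
        (W ≠ ⊥ → ∃ j : ℤ, (j : ℝ) = ((p + q : ℕ) : ℝ) / 2 * (δ' - δ) ∧
          (CaseId k s k' s' j ∨ (∃ d, CaseD (p + q) k s k' s' δ j d) ∨
            (∃ g, CaseG (p + q) k s k' s' δ j g) ∨ ∃ l, CaseL (p + q) k s k' s' δ j l)) ∧
        (∀ j : ℤ, (j : ℝ) = ((p + q : ℕ) : ℝ) / 2 * (δ' - δ) →
          (CaseId k s k' s' j → IsSpannedBy W 1) ∧
          (∀ d, CaseD (p + q) k s k' s' δ j d → IsSpannedBy W (opD p q ^ d)) ∧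
          (∀ g, CaseG (p + q) k s k' s' δ j g → IsSpannedBy W (opG₀pow p q (k - 2 * s) g)) ∧
          (∀ l, CaseL (p + q) k s k' s' δ j l →
            IsSpannedBy W (opCalL p q (a (k - 2 * s) l) (k - 2 * s) l))) := by
  refine ⟨calCoeff (p + q), fun m l => rfl, fun k s k' s' hs hs' δ δ' W hW => ?_⟩
  have hn₀ : 0 < p + q := by omega
  have h0 : ((p + q : ℕ) : ℝ) ≠ 0 := Nat.cast_ne_zero.mpr hn₀.ne'
  -- The shift of weight in the reduction changes `nδ` by `2s` and `nδ'` by `2s'`. With `m = k - 2s`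
  -- and `m' = k' - 2s'` this translates the four cases for trace-free symbols into the stated ones.
  have hδ : ∀ (δ : ℝ) (t : ℕ), ((p + q : ℕ) : ℝ) * (δ - 2 * t / ((p + q : ℕ) : ℝ)) =
      ((p + q : ℕ) : ℝ) * δ - 2 * t := fun δ t => by field_simp
  have hm : ((k - 2 * s : ℕ) : ℝ) = k - 2 * s := by rw [Nat.cast_sub hs]; push_cast; ring
  have hm' : ((k' - 2 * s' : ℕ) : ℝ) = k' - 2 * s' := by rw [Nat.cast_sub hs']; push_cast; ring
  refine ⟨?_, fun hW₀ => ?_, fun j hj => ⟨fun h => ?_, fun d h => ?_, fun g h => ?_, fun l h => ?_⟩⟩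
  · rw [or_iff_not_imp_left]
    intro hW₀
    obtain ⟨A, hA, hne⟩ := W.ne_bot_iff.mp hW₀
    exact finrank_eq_one_of_eq_span (eq_span_of_mem hn hs hs' hW hA hne) hne
  · obtain ⟨A, hA, hne⟩ := W.ne_bot_iff.mp hW₀
    obtain ⟨A, rfl⟩ := (conjEquiv (symEquiv hn₀ hs) (symEquiv hn₀ hs')).surjective A
    rcases ((conjEquiv_mem_iff hn hn₀ hs hs' hW A).mp hA).classification hn
        ((LinearEquiv.map_ne_zero_iff _).mp hne) with
      ⟨h1, h2⟩ | ⟨d, hd, h1, h2, h3⟩ | ⟨g, hg, h1, h2, h3⟩ | ⟨l, hl, h1, h2, h3⟩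
    · rw [mul_sub, hδ, hδ] at h2
      refine ⟨s' - s, ?_, Or.inl ⟨rfl, by omega⟩⟩
      push_cast at h2 ⊢
      linarith
    · rw [mul_sub, hδ, hδ] at h2
      rw [hδ, hm] at h3
      refine ⟨s' - s, ?_, Or.inr (Or.inl ⟨d, hd, rfl, by omega, ?_⟩)⟩
      · push_cast at h2 ⊢
        linarith
      · rw [← sub_eq_iff_eq_add', eq_div_iff h0]
        linarith
    · rw [mul_sub, hδ, hδ] at h2
      rw [hδ] at h3
      refine ⟨g + s' - s, ?_, Or.inr (Or.inr (Or.inl ⟨g, hg, rfl, by omega, ?_⟩))⟩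
      · push_cast at h2 ⊢
        linarith
      · rw [eq_div_iff h0]
        linarith
    · rw [mul_sub, hδ, hδ] at h2
      rw [hδ, hm] at h3
      refine ⟨l + s' - s, ?_, Or.inr (Or.inr (Or.inr ⟨l, hl, rfl, by omega, ?_⟩))⟩
      · push_cast at h2 ⊢
        linarith
      · rw [← sub_eq_iff_eq_add', eq_div_iff h0]
        linarith
  · obtain ⟨h1, h2⟩ := h
    have h1' : (s' : ℝ) - s = j := by exact_mod_cast h1
    refine isSpannedBy_of_isInvariant hn hs hs' hW (exists_isInvariant_one hn (by omega) ?_)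
    rw [mul_sub, hδ, hδ]
    linarith
  · obtain ⟨hd, h1, h2, h3⟩ := h
    have h1' : (s' : ℝ) - s = j := by exact_mod_cast h1
    rw [← sub_eq_iff_eq_add', eq_div_iff h0] at h3
    refine isSpannedBy_of_isInvariant hn hs hs' hW
      (exists_isInvariant_opD_pow hn hd (by omega) ?_ ?_)
    · rw [mul_sub, hδ, hδ]
      linarith
    · rw [hδ, hm]
      linarith
  · obtain ⟨hg, h1, h2, h3⟩ := h
    have h1' : (g : ℝ) + s' - s = j := by exact_mod_cast h1
    rw [eq_div_iff h0] at h3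
    refine isSpannedBy_of_isInvariant hn hs hs' hW
      (exists_isInvariant_opG₀pow hn hg (by omega) ?_ ?_)
    · rw [mul_sub, hδ, hδ]
      linarith
    · rw [hδ]
      linarith
  · obtain ⟨hl, h1, h2, h3⟩ := h
    have h1' : (l : ℝ) + s' - s = j := by exact_mod_cast h1
    rw [← sub_eq_iff_eq_add', eq_div_iff h0] at h3
    refine isSpannedBy_of_isInvariant hn hs hs' hW
      (exists_isInvariant_opCalL hn (by omega) ?_ ?_)
    · rw [mul_sub, hδ, hδ]
      linarith
    · rw [hδ, hm]
      linarith
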